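/- Let $Y$ be a compact connected five-manifold, $X=\mathbb{R}_+\times Y$ with coordinate $r$ on $\mathbb{R}_+$ and Euler field $r\partial_r$. All data below are smooth. **Conventions.** A generalized vector $V=v+\nu\in TX\oplus T^*X$ acts on polyforms by $V\cdot\Phi=v\lrcorner\Phi+\nu\wedge\Phi$, and $\mathcal L_V\Phi=d(V\cdot\Phi)+V\cdot d\Phi$, $\mathcal L_{v+\nu}(w+\mu)=[v,w]+\mathcal L_v\mu-w\lrcorner d\nu$. The Mukai pairing is $\langle\Phi,\Psi\rangle=[\Phi\wedge\lambda(\Psi)]_{\rm top}$ with $\lambda(\Psi_p)=(-1)^{[p/2]}\Psi_p$. A non-degenerate pure spinor $\Omega$ (maximal annihilator, $\langle\Omega,\bar\Omega\rangle\neq0$ everywhere) defines an almost complex structure $\mathcal J$ on $TX\oplus T^*X$ whose $+i$-eigenspace is the annihilator of $\Omega$; $\mathcal J$ acts on polyforms through the Lie algebra $\mathfrak o(6,6)$, and $d^{\mathcal J}=[\mathcal J\cdot,d]$. **Hypotheses.** Let $\Omega_-$ (odd) and $\Omega_+=\alpha_+e^{-b_++i\omega_+}$ ($\alpha_+$ a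 nowhere vanishing complex function, $b_+,\omega_+$ real two-forms: type zero) be non-degenerate pure spinors on $X$ with structures $\mathcal J_\mp$, let $A,\hat\Delta$ be real functions and $f_5$ a real constant, such that: 1. $d\Omega_-=0$, $\mathcal L_{r\partial_r}\Omega_-=3\Omega_-$, $\mathcal L_{r\partial_r}\Omega_+=3\Omega_+$, $\mathcal L_{r\partial_r}e^A=e^A$, $\mathcal L_{r\partial_r}\hat\Delta=0$. 2. (Compatibility) $\mathcal J_-$ and $\mathcal J_+$ commute and $G=-\mathcal J_-\mathcal J_+$ is positive definite for the pairing on $TX\oplus T^*X$. Let $g_X,B$ be the Riemannian metric and real two-form with $G=\begin{pmatrix}1&0\\-B&1\end{pmatrix}\begin{pmatrix}0&g_X^{-1}\\g_X&0\end{pmatrix}\begin{pmatrix}1&0\\B&1\end{pmatrix}$, where the block $B$ maps $v\mapsto -v\lrcorner B$. 3. $\mathcal L_{r\partial_r}G=0$ and $G(r\partial_r)=e^{2\hat\Delta}d\log r$. 4. $d(e^{-A}\,\mathrm{Re}\,\Omega_+)=0$ and $d\,d^{\mathcal J_-}(e^{-3A}\,\mathrm{Im}\,\Omega_+)=0$.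 5. The RR fluxes $F=F_1+F_3+F_5$, defined by $e^{-B}F=8\,d^{\mathcal J_-}(e^{-3A}\,\mathrm{Im}\,\Omega_+)$, satisfy $\mathcal L_{r\partial_r}F=0$, $r\partial_r\lrcorner F=0$ and $F_5=f_5\,\mathrm{vol}_Y$, where $\mathrm{vol}_X=-e^{6\hat\Delta}d\log r\wedge\mathrm{vol}_Y$ and $\mathrm{vol}_X$ is the Riemannian volume form of $g_X$ oriented so that $i\langle\Omega_+,\bar\Omega_+\rangle/\mathrm{vol}_X>0$. Put $\xi=\xi_{\rm v}+\xi_{\rm f}=\mathcal J_-(r\partial_r)$ and $\eta=\eta_{\rm v}+\eta_{\rm f}=\mathcal J_-(d\log r)$ (vector and one-form parts). **Conclusion.** There is a constant $c$ such that after replacing $A$ by $A+c$ (this preserves all the hypotheses and multiplies $F$ and $f_5$ by $e^{-3c}$) the following hold. (a) $e^A=r\,e^{\hat\Delta}$. (b) $\mathcal L_\xi G=0$ and $\mathcal L_\xi(e^{-B}F)=0$. (c) There is a closed real two-form $b_2$ on $X$ such that, with $\sigma=\eta_{\rm f}-\eta_{\rm v}\lrcorner b_2$, the two-form $\omega=\tfrac12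 d(r^2\sigma)$ is symplectic on $X$, and $\sigma$ is the pull-back of a contact form on $Y$ whose Reeb vector field is $\xi_{\rm v}$ ($\xi_{\rm v}$ being tangent to $Y$ and independent of $r$). (d) $f_5\neq0$, and, with the same $b_2$, $$\alpha_+=-i\frac{f_5}{32}r^3e^{-\hat\Delta},\qquad \omega_+=\frac{e^{2\hat\Delta}}{r^2}\,\omega,\qquad b_+=e^{2\hat\Delta}d\log r\wedge(\eta_{\rm v}\lrcorner\omega_+)+b_2 .$$ Moreover, let $U\subset X$ be an open set with generalized Darboux coordinates for $\Omega_-$: functions $z$ (complex) and $x_1,y_1,x_2,y_2$ (real) and a closed real two-form $b_0$ on $U$ with $\Omega_-=d\bar z\wedge e^{-b_0+i\omega_0}$, $\omega_0=dx_1\wedge dy_1+dx_2\wedge dy_2$, and $z=r^3e^{3h}e^{3i\psi}$ with real functions $h,\psi$ where $h$ depends only on $x_1,y_1,x_2,y_2$ (that is, $dh$ is a combination of the $dx_a,dy_a$). Let $\mathcal H_h$ be the vector field with $dz(\mathcal H_h)=0$, $\mathcal H_h\lrcorner\omega_0=-dh$, and let $\omega_T=\tfrac12d\sigma$. Then on $U$,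 writing $b_2'=b_2-b_0$ and $b_+'=b_+-b_0$ for the forms after the closed $B$-transform by $b_0$ which brings $\Omega_-$ to the form $d\bar z\wedge e^{i\omega_0}$, $$\sigma=d\psi+\mathcal H_h\lrcorner b_2',\qquad b_+'=-e^{4\hat\Delta}\,d\log r\wedge(\mathcal H_h\lrcorner\omega_T)+b_2' .$$ -/

import Mathlib

open scoped Manifold ContDiff Topology

noncomputable section

namespace GenGeom

/-! ### Linear algebra of `V ⊕ V*` acting on complex polyforms -/

section LinearAlgebra

variable {V : Type*} [NormedAddCommGroup V] [NormedSpace ℝ V]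

/-- `F`-valued alternating `k`-forms on `V`. -/
abbrev Form (V F : Type*) [NormedAddCommGroup V] [NormedSpace ℝ V] [NormedAddCommGroup F]
    [NormedSpace ℝ F] (k : ℕ) : Type _ :=
  V [⋀^Fin k]→L[ℝ] F

/-- Complex polyforms: formal sums of complex valued alternating forms, one for each degree. -/
abbrev Polyform (V : Type*) [NormedAddCommGroup V] [NormedSpace ℝ V] : Type _ :=
  (k : ℕ) → Form V ℂ k

/-- Generalized vectors `v + ν ∈ V ⊕ V*`. -/
abbrev GenVec (V : Type*) [NormedAddCommGroup V] [NormedSpace ℝ V] : Type _ :=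
  V × (V →L[ℝ] ℝ)

/-- A linear functional as a one-form. -/
def oneForm (ν : V →L[ℝ] ℝ) : Form V ℝ 1 :=
  ContinuousAlternatingMap.ofSubsingleton ℝ V ℝ (0 : Fin 1) ν

/-- A real form regarded as a complex valued form. -/
def cplx {k : ℕ} (φ : Form V ℝ k) : Form V ℂ k :=
  Complex.ofRealCLM.compContinuousAlternatingMap φ

/-- The contraction `v ⌟ β = β(v, ·)` of a real two-form. -/
def contract (v : V) (β : Form V ℝ 2) : V →L[ℝ] ℝ :=
  (ContinuousAlternatingMap.ofSubsingleton ℝ V ℝ (0 : Fin 1)).symm (β.curryLeft v)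

/-- `(μ ∧ ν)(v, w) = μ(v) ν(w) - μ(w) ν(v)` for real one-forms. -/
def wedgeReal (μ ν : V →L[ℝ] ℝ) : Form V ℝ 2 :=
  ContinuousAlternatingMap.alternatizeUncurryFin (μ.smulRight (oneForm ν))

/-- Interior product `v ⌟ Φ` of a polyform. -/
def intProd (v : V) (Φ : Polyform V) : Polyform V := fun k => (Φ (k + 1)).curryLeft v

/-- `ν ∧ Φ` for a complex one-form `ν`:
`(ν ∧ φ)(v₀, …, v_k) = ∑ᵢ (-1)ⁱ ν(vᵢ) φ(v₀, …, v̂ᵢ, …, v_k)`. -/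
def wedgeOne (ν : V →L[ℝ] ℂ) (Φ : Polyform V) : Polyform V
  | 0 => 0
  | k + 1 => ContinuousAlternatingMap.alternatizeUncurryFin
      (((ContinuousLinearMap.toSpanSingleton ℂ (Φ k)).restrictScalars ℝ).comp ν)

/-- The Clifford action `(v + ν) · Φ = v ⌟ Φ + ν ∧ Φ`. -/
def cliff (W : GenVec V) (Φ : Polyform V) : Polyform V :=
  intProd W.1 Φ + wedgeOne (Complex.ofRealCLM.comp W.2) Φ

theorem wedgeOne_add (μ ν : V →L[ℝ] ℂ) (Φ : Polyform V) :
    wedgeOne (μ + ν) Φ = wedgeOne μ Φ + wedgeOne ν Φ := by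
  funext k
  cases k with
  | zero => simp [wedgeOne]
  | succ k =>
    simp [wedgeOne, ContinuousLinearMap.comp_add,
      ContinuousAlternatingMap.alternatizeUncurryFin_add]

theorem wedgeOne_smul (c : ℝ) (ν : V →L[ℝ] ℂ) (Φ : Polyform V) :
    wedgeOne (c • ν) Φ = (c : ℂ) • wedgeOne ν Φ := by
  funext k
  cases k with
  | zero => simp [wedgeOne]
  | succ k =>
    ext v
    simp [wedgeOne, ContinuousAlternatingMap.alternatizeUncurryFin_apply, Finset.mul_sum,
      mul_left_comm]

theorem cliff_add (W Z : GenVec V) (Φ : Polyform V) :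
    cliff (W + Z) Φ = cliff W Φ + cliff Z Φ := by
  have h : intProd (W.1 + Z.1) Φ = intProd W.1 Φ + intProd Z.1 Φ := by
    funext k; simp [intProd]
  simp only [cliff, Prod.fst_add, Prod.snd_add, ContinuousLinearMap.comp_add, wedgeOne_add, h]
  abel

theorem cliff_smul (c : ℝ) (W : GenVec V) (Φ : Polyform V) :
    cliff (c • W) Φ = (c : ℂ) • cliff W Φ := by
  have h : intProd (c • W.1) Φ = (c : ℂ) • intProd W.1 Φ := by
    funext k; ext v; simp [intProd]
  simp only [cliff, Prod.smul_fst, Prod.smul_snd, ContinuousLinearMap.comp_smul, wedgeOne_smul, h,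
    smul_add]

/-- The annihilator `L_Ω ⊆ (V ⊕ V*) ⊗ ℂ` of a polyform, the complex generalized vector `W + i Z`
being written as the pair `(W, Z)` of its real and imaginary parts. -/
def annihilator (Ω : Polyform V) : Submodule ℝ (GenVec V × GenVec V) where
  carrier := {P | cliff P.1 Ω + Complex.I • cliff P.2 Ω = 0}
  zero_mem' := by
    have h : cliff (0 : GenVec V) Ω = 0 := by simpa using cliff_smul 0 (0 : GenVec V) Ω
    simp [h]
  add_mem' := by
    intro P Q hP hQ
    simp only [Set.mem_ofPred_eq, Prod.fst_add, Prod.snd_add, cliff_add, smul_add] at *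
    calc _ = (cliff P.1 Ω + Complex.I • cliff P.2 Ω)
          + (cliff Q.1 Ω + Complex.I • cliff Q.2 Ω) := by abel
      _ = 0 := by rw [hP, hQ, add_zero]
  smul_mem' := by
    intro c P hP
    simp only [Set.mem_ofPred_eq, Prod.smul_fst, Prod.smul_snd, cliff_smul] at *
    rw [smul_comm Complex.I (c : ℂ), ← smul_add, hP, smul_zero]

/-- Purity: the annihilator (which is always isotropic if `Ω ≠ 0`) has maximal dimension, that is
real dimension `2 dim V`. -/
def IsPure (Ω : Polyform V) : Prop :=
  Module.finrank ℝ (annihilator Ω) = 2 * Module.finrank ℝ V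

/-- `J` is a generalized almost complex structure whose `+i`-eigenspace is the annihilator of `Ω`:
`W + i Z` satisfies `J (W + i Z) = i (W + i Z)` iff `Z = - J W`, as `J² = -1`. -/
def IsAssociated (Ω : Polyform V) (J : GenVec V →ₗ[ℝ] GenVec V) : Prop :=
  (∀ W, J (J W) = -W) ∧ ∀ W Z, (W, Z) ∈ annihilator Ω ↔ Z = -J W

open Classical in
/-- The (unique) generalized almost complex structure of a non-degenerate pure spinor. -/
def genStruct (Ω : Polyform V) : GenVec V →ₗ[ℝ] GenVec V :=
  if h : ∃ J, IsAssociated Ω J then h.choose else 0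

/-- The pairing `⟨v + ν, w + μ⟩ = (ν(w) + μ(v)) / 2` on `V ⊕ V*`. -/
def pairing (W Z : GenVec V) : ℝ := (W.2 Z.1 + Z.2 W.1) / 2

/-- The generalized metric `G = - J₋ J₊`. -/
def genMetric (Ωm Ωp : Polyform V) : GenVec V →ₗ[ℝ] GenVec V :=
  -(genStruct Ωm ∘ₗ genStruct Ωp)

/-- Compatibility: `J₋` and `J₊` commute and `G = - J₋ J₊` is positive definite. -/
def IsCompatible (Ωm Ωp : Polyform V) : Prop :=
  (∀ W, genStruct Ωm (genStruct Ωp W) = genStruct Ωp (genStruct Ωm W)) ∧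
    ∀ W, W ≠ 0 → 0 < pairing (genMetric Ωm Ωp W) W

/-- Complex conjugation of polyforms. -/
def conjP (Φ : Polyform V) : Polyform V := fun k =>
  (Complex.conjCLE : ℂ →L[ℝ] ℂ).compContinuousAlternatingMap (Φ k)

/-- Real part of a polyform. -/
def reP (Φ : Polyform V) : Polyform V := fun k => cplx (Complex.reCLM.compContinuousAlternatingMap (Φ k))

/-- Imaginary part of a polyform. -/
def imP (Φ : Polyform V) : Polyform V := fun k => cplx (Complex.imCLM.compContinuousAlternatingMap (Φ k))

/-- `λ(Φ_p) = (-1)^[p/2] Φ_p`. -/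
def lam (Φ : Polyform V) : Polyform V := fun k => (-1 : ℂ) ^ (k / 2) • Φ k

variable [FiniteDimensional ℝ V]

/-- A fixed basis `e_a` of `V`; the definitions below do not depend on its choice. -/
def bas (V : Type*) [NormedAddCommGroup V] [NormedSpace ℝ V] [FiniteDimensional ℝ V] :
    Module.Basis (Fin (Module.finrank ℝ V)) ℝ V := Module.finBasis ℝ V

/-- The dual basis `e^a`. -/
def dualBas (a : Fin (Module.finrank ℝ V)) : V →L[ℝ] ℝ :=
  LinearMap.toContinuousLinearMap ((bas V).coord a)

/-- The wedge product `φ ∧ Ψ` of a `k`-form and a polyform, by recursion on `k` through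
`φ = k⁻¹ ∑ₐ eᵃ ∧ (eₐ ⌟ φ)`. -/
def wedgeForm : (k : ℕ) → (Form V ℂ k) → Polyform V → Polyform V
  | 0, φ, Ψ => φ ![] • Ψ
  | k + 1, φ, Ψ => ((k : ℂ) + 1)⁻¹ • ∑ a, wedgeOne (Complex.ofRealCLM.comp (dualBas a))
      (wedgeForm k (φ.curryLeft (bas V a)) Ψ)

/-- The wedge product of polyforms. -/
def wedge (Φ Ψ : Polyform V) : Polyform V := fun n =>
  ∑ k ∈ Finset.range (n + 1), wedgeForm k (Φ k) Ψ n

/-- The Mukai pairing `⟨Φ, Ψ⟩ = [Φ ∧ λ(Ψ)]_top` in dimension six. -/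
def mukai (Φ Ψ : Polyform V) : Form V ℂ 6 := wedge Φ (lam Ψ) 6

/-- `e^β ∧ Φ` for a complex two-form `β`, in dimension at most seven (where `β⁴ = 0`). -/
def expWedge (β : Form V ℂ 2) (Φ : Polyform V) : Polyform V :=
  ∑ n ∈ Finset.range 4, ((n.factorial : ℂ)⁻¹) • (wedgeForm 2 β)^[n] Φ

/-- The constant polyform `c` in degree zero. -/
def constP (c : ℂ) : Polyform V :=
  Pi.single 0 (ContinuousAlternatingMap.constOfIsEmpty ℝ V (Fin 0) c)

/-- The Lie algebra action `J · Φ` on polyforms of `J ∈ 𝔬(V ⊕ V*)`, characterised up to constants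
by `[J ·, W ·] = (J W) ·`; for `J` with blocks `(a, β; b, -a*)`, where `b` is the map
`v ↦ - v ⌟ b`, it is `(tr a)/2 - a* · + b ∧ + β ⌟`. -/
def algAct (J : GenVec V →ₗ[ℝ] GenVec V) (Φ : Polyform V) : Polyform V :=
  (1 / 2 : ℂ) • ∑ a, (cliff (J (bas V a, 0)) (cliff (0, dualBas a) Φ)
    + cliff (J (0, dualBas a)) (cliff (bas V a, 0) Φ))

/-! The metric `g` and the two-form `B` encoded by a generalized metric
`G = (g⁻¹ B, g⁻¹; g - B g⁻¹ B, - B g⁻¹)`, where the block `B` is the map `v ↦ - v ⌟ B`. -/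

/-- The block `g⁻¹ : V* → V` of `G`. -/
def metricInv (G : GenVec V →ₗ[ℝ] GenVec V) : (V →L[ℝ] ℝ) →L[ℝ] V :=
  LinearMap.toContinuousLinearMap
    (LinearMap.fst ℝ V (V →L[ℝ] ℝ) ∘ₗ G ∘ₗ LinearMap.inr ℝ V (V →L[ℝ] ℝ))

/-- The metric `g : V → V*`, `g(v, w) = metric G v w`. -/
def metric (G : GenVec V →ₗ[ℝ] GenVec V) : V →L[ℝ] V →L[ℝ] ℝ := (metricInv G).inverse

/-- The two-form `B(v, w) = - (g (g⁻¹ B) v)(w)`, with `g⁻¹ B` the first block of `G`. This bilinear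
form is skew for a generalized metric, and so equals its skew part, which is taken here. -/
def bField (G : GenVec V →ₗ[ℝ] GenVec V) : Form V ℝ 2 :=
  (-1 / 2 : ℝ) • ∑ a, wedgeReal (dualBas a) (metric G (G (bas V a, 0)).1)

/-- The Riemannian volume form of the metric of `G`, with the orientation for which the top-form
`m` is real and positive: `vol = √(det g(e_a, e_b)) m / |m(e_1, …, e_6)|`. -/
def volForm (hd : Module.finrank ℝ V = 6) (G : GenVec V →ₗ[ℝ] GenVec V)
    (m : Form V ℂ 6) : Form V ℂ 6 :=
  ((Real.sqrt (Matrix.det (Matrix.of fun a b => metric G (bas V a) (bas V b))) /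
    ‖m (fun i => bas V (Fin.cast hd.symm i))‖ : ℝ) : ℂ) • m

end LinearAlgebra

/-! ### Forms and generalized vector fields on a manifold

The tangent space `TangentSpace I x` is by definition the model vector space `E`, so a vector field
is a function `M → E` and a `k`-form is a function `M → Form E F k`; smoothness and
differentiation are taken in charts. Only manifolds without boundary are considered. -/

section Manifold

variable {E : Type*} [NormedAddCommGroup E] [NormedSpace ℝ E]
  {F : Type*} [NormedAddCommGroup F] [NormedSpace ℝ F]
  {H : Type*} [TopologicalSpace H] (I : ModelWithCorners ℝ E H)
  {M : Type*} [TopologicalSpace M] [ChartedSpace H M]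

/-- The pull-back of a form by the inverse of the preferred chart at `x₀`. -/
def chartForm {k : ℕ} (om : M → Form E F k) (x₀ : M) (y : E) : Form E F k :=
  (om ((extChartAt I x₀).symm y)).compContinuousLinearMap
    (mfderiv 𝓘(ℝ, E) I (extChartAt I x₀).symm y : E →L[ℝ] E)

/-- Smoothness of a form at a point. -/
def SmoothFormAt {k : ℕ} (om : M → Form E F k) (x : M) : Prop :=
  ContDiffAt ℝ ∞ (chartForm I om x) (extChartAt I x x)

/-- The exterior derivative of a form. -/
def extD {k : ℕ} (om : M → Form E F k) (x : M) : Form E F (k + 1) :=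
  (extDeriv (chartForm I om x) (extChartAt I x x)).compContinuousLinearMap
    (mfderiv I 𝓘(ℝ, E) (extChartAt I x) x : E →L[ℝ] E)

/-- Smoothness of a vector field at a point. -/
def SmoothVecAt [IsManifold I ∞ M] (v : M → E) (x : M) : Prop :=
  ContMDiffAt I I.tangent ∞ (fun y => (⟨y, v y⟩ : TangentBundle I M)) x

/-- The differential of a function. -/
def dFun (f : M → F) (x : M) : E →L[ℝ] F := mfderiv I 𝓘(ℝ, F) f x

/-- Smoothness of a polyform. -/
def SmoothPoly (Φ : M → Polyform E) : Prop := ∀ k x, SmoothFormAt I (fun y => Φ y k) x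

/-- The exterior derivative of a polyform. -/
def polyD (Φ : M → Polyform E) (x : M) : Polyform E
  | 0 => 0
  | k + 1 => extD I (fun y => Φ y k) x

/-- The generalized Lie derivative of a polyform, `L_W Φ = d(W · Φ) + W · dΦ`. -/
def lieP (W : M → GenVec E) (Φ : M → Polyform E) (x : M) : Polyform E :=
  polyD I (fun y => cliff (W y) (Φ y)) x + cliff (W x) (polyD I Φ x)

/-- The Lie derivative of a one-form, `L_v ν = d(v ⌟ ν) + v ⌟ dν`. -/
def lieOne (v : M → E) (ν : M → E →L[ℝ] ℝ) (x : M) : E →L[ℝ] ℝ :=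
  dFun I (fun y => ν y (v y)) x + contract (v x) (extD I (fun y => oneForm (ν y)) x)

/-- The Lie bracket of vector fields. -/
def bracket (v w : M → E) (x : M) : E := VectorField.mlieBracket I (M := M) v w x

/-- The generalized Lie derivative of a generalized vector field,
`L_{v + ν} (w + μ) = [v, w] + L_v μ - w ⌟ dν`. -/
def genLie (W Z : M → GenVec E) (x : M) : GenVec E :=
  (bracket I (fun y => (W y).1) (fun y => (Z y).1) x,
    lieOne I (fun y => (W y).1) (fun y => (Z y).2) x
      - contract (Z x).1 (extD I (fun y => oneForm (W y).2) x))

/-- `L_W K = 0` for a field `K` of endomorphisms of `TM ⊕ T*M`: the operator `[L_W, K]` vanishes on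
all locally defined smooth generalized vector fields. -/
def Preserves [IsManifold I ∞ M] (W : M → GenVec E) (K : M → GenVec E →ₗ[ℝ] GenVec E) : Prop :=
  ∀ (x : M) (Z : M → GenVec E), SmoothVecAt I (fun y => (Z y).1) x →
    SmoothFormAt I (fun y => oneForm (Z y).2) x →
    genLie I W (fun y => K y (Z y)) x = K x (genLie I W Z x)

/-- `d^J Φ = [J, d] Φ = J · dΦ - d(J · Φ)`. -/
def dJ [FiniteDimensional ℝ E] (J : M → GenVec E →ₗ[ℝ] GenVec E) (Φ : M → Polyform E) (x : M) :
    Polyform E :=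
  algAct (J x) (polyD I Φ x) - polyD I (fun y => algAct (J y) (Φ y)) x

end Manifold

/-! ### The cone `X = ℝ₊ × Y` over a five-manifold -/

section Cone

/-- The open half line `ℝ₊`, as an open submanifold of `ℝ`. -/
def posReals : TopologicalSpace.Opens ℝ := ⟨Set.Ioi 0, isOpen_Ioi⟩

/-- The model vector space of `Y`. -/
abbrev E₅ : Type := EuclideanSpace ℝ (Fin 5)

/-- The model vector space of `X`, which is `T_{(r, y)} X = ℝ × T_y Y`. -/
abbrev E₆ : Type := ℝ × EuclideanSpace ℝ (Fin 5)

theorem finrank_E₆ : Module.finrank ℝ E₆ = 6 := by simp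

/-- The cone `X = ℝ₊ × Y`. -/
abbrev Cone (Y : Type*) : Type _ := posReals × Y

/-- The model of the cone. -/
abbrev coneI : ModelWithCorners ℝ E₆ (ModelProd ℝ (EuclideanSpace ℝ (Fin 5))) :=
  𝓘(ℝ, ℝ).prod (𝓡 5)

variable {Y : Type*} [TopologicalSpace Y] [ChartedSpace (EuclideanSpace ℝ (Fin 5)) Y]

/-- The radial function. -/
def rad (x : Cone Y) : ℝ := (x.1 : ℝ)

/-- The Euler vector field `r∂_r`, as a generalized vector field. -/
def euler (x : Cone Y) : GenVec E₆ := ((rad x, 0), 0)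

/-- The one-form `d log r = dr / r`. -/
def dlogr (x : Cone Y) : E₆ →L[ℝ] ℝ := (rad x)⁻¹ • ContinuousLinearMap.fst ℝ ℝ E₅

/-- The generalized Reeb vector `ξ = J₋(r∂_r)`. -/
def xi (Ωm : Cone Y → Polyform E₆) (x : Cone Y) : GenVec E₆ := genStruct (Ωm x) (euler x)

/-- The generalized contact form `η = J₋(d log r)`. -/
def eta (Ωm : Cone Y → Polyform E₆) (x : Cone Y) : GenVec E₆ := genStruct (Ωm x) (0, dlogr x)

/-- The field `G` of generalized metrics. -/
def metricG (Ωm Ωp : Cone Y → Polyform E₆) (x : Cone Y) : GenVec E₆ →ₗ[ℝ] GenVec E₆ :=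
  genMetric (Ωm x) (Ωp x)

/-- The polyform `e^{-3A} Im Ω₊`. -/
def scaledIm (Ωp : Cone Y → Polyform E₆) (A : Cone Y → ℝ) (x : Cone Y) : Polyform E₆ :=
  (Real.exp (-3 * A x) : ℂ) • imP (Ωp x)

/-- The polyform `e^{-B} F = 8 d^{J₋}(e^{-3A} Im Ω₊)`. -/
def twistedFlux (Ωm Ωp : Cone Y → Polyform E₆) (A : Cone Y → ℝ) (x : Cone Y) : Polyform E₆ :=
  (8 : ℂ) • dJ coneI (fun y => genStruct (Ωm y)) (scaledIm Ωp A) x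

/-- The Ramond–Ramond fluxes `F`. -/
def flux (Ωm Ωp : Cone Y → Polyform E₆) (A : Cone Y → ℝ) (x : Cone Y) : Polyform E₆ :=
  expWedge (cplx (bField (metricG Ωm Ωp x))) (twistedFlux Ωm Ωp A x)

/-- The Riemannian volume form of `g_X`, in the orientation for which the Mukai norm
`i ⟨Ω₊, Ω̄₊⟩ / vol_X` is positive. -/
def volX (Ωm Ωp : Cone Y → Polyform E₆) (x : Cone Y) : Form E₆ ℂ 6 :=
  volForm finrank_E₆ (metricG Ωm Ωp x) (Complex.I • mukai (Ωp x) (conjP (Ωp x)))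

/-- The volume form of `g_Y`, determined by `vol_X = - e^{6Δ} d log r ∧ vol_Y` (pulled back to `X`),
that is `vol_Y = - e^{-6Δ} r∂_r ⌟ vol_X`. -/
def volY (Ωm Ωp : Cone Y → Polyform E₆) (Δ : Cone Y → ℝ) (x : Cone Y) : Form E₆ ℂ 5 :=
  (-Real.exp (-6 * Δ x) : ℂ) • (volX Ωm Ωp x).curryLeft (euler x).1

/-- The differential and algebraic conditions on the pair `Ω₋`, `Ω₊ = α exp(-b + i ω)` on
`X = ℝ₊ × Y`, on the function `A`, the conformal factor `Δ` and the constant `f₅`. -/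
structure IsConeStructure [IsManifold (𝓡 5) ∞ Y] (Ωm Ωp : Cone Y → Polyform E₆) (α : Cone Y → ℂ)
    (b om : Cone Y → Form E₆ ℝ 2) (A Δ : Cone Y → ℝ) (f₅ : ℝ) : Prop where
  smooth_minus : SmoothPoly coneI Ωm
  smooth_plus : SmoothPoly coneI Ωp
  smooth_A : ContMDiff coneI 𝓘(ℝ, ℝ) ∞ A
  smooth_Δ : ContMDiff coneI 𝓘(ℝ, ℝ) ∞ Δ
  /-- `Ω₋` is a non-degenerate pure spinor of odd degree. -/
  odd_minus : ∀ x k, Even k → Ωm x k = 0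
  pure_minus : ∀ x, IsPure (Ωm x)
  nondeg_minus : ∀ x, mukai (Ωm x) (conjP (Ωm x)) ≠ 0
  /-- `dΩ₋ = 0` and `L_{r∂_r} Ω₋ = 3 Ω₋`. -/
  closed_minus : ∀ x, polyD coneI Ωm x = 0
  homog_minus : ∀ x, lieP coneI euler Ωm x = (3 : ℂ) • Ωm x
  /-- `Ω₊` is a non-degenerate pure spinor that is everywhere of type zero. -/
  pure_plus : ∀ x, IsPure (Ωp x)
  nondeg_plus : ∀ x, mukai (Ωp x) (conjP (Ωp x)) ≠ 0
  type_zero : ∀ x, α x ≠ 0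
  plus_eq : ∀ x, Ωp x = α x • expWedge (-cplx (b x) + Complex.I • cplx (om x)) (constP 1)
  compatible : ∀ x, IsCompatible (Ωm x) (Ωp x)
  /-- `L_{r∂_r} G = 0` and `G(r∂_r) = e^{2Δ} d log r`, with `L_{r∂_r} Δ = 0`. -/
  homog_metric : Preserves coneI euler (metricG Ωm Ωp)
  metric_euler : ∀ x, metricG Ωm Ωp x (euler x) = (0, Real.exp (2 * Δ x) • dlogr x)
  homog_Δ : ∀ x, dFun coneI Δ x (euler x).1 = 0
  /-- `L_{r∂_r} Ω₊ = 3 Ω₊` and `L_{r∂_r} e^A = e^A`. -/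
  homog_plus : ∀ x, lieP coneI euler Ωp x = (3 : ℂ) • Ωp x
  homog_A : ∀ x, dFun coneI (fun y => Real.exp (A y)) x (euler x).1 = Real.exp (A x)
  /-- `d(e^{-A} Re Ω₊) = 0`. -/
  closed_re : ∀ x, polyD coneI (fun y => (Real.exp (-A y) : ℂ) • reP (Ωp y)) x = 0
  /-- The Bianchi identity `d d^{J₋}(e^{-3A} Im Ω₊) = 0`. -/
  bianchi : ∀ x, polyD coneI (dJ coneI (fun y => genStruct (Ωm y)) (scaledIm Ωp A)) x = 0
  /-- The fluxes are basic: `L_{r∂_r} F = 0`, `r∂_r ⌟ F = 0`. -/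
  flux_homog : ∀ x, lieP coneI euler (flux Ωm Ωp A) x = 0
  flux_horizontal : ∀ x, intProd (euler x).1 (flux Ωm Ωp A x) = 0
  /-- `F₅ = f₅ vol_Y` with `f₅` constant. -/
  flux_five : ∀ x, flux Ωm Ωp A x 5 = (f₅ : ℂ) • volY Ωm Ωp Δ x

/-- `σ` is a contact form on the five-manifold `Y` with Reeb vector field `R`: `dσ` is
non-degenerate on the hyperplane field `ker σ`, and `σ(R) = 1`, `R ⌟ dσ = 0`. -/
structure IsContactWithReeb [IsManifold (𝓡 5) ∞ Y] (σ : Y → E₅ →L[ℝ] ℝ) (R : Y → E₅) : Prop where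
  smooth_form : ∀ y, SmoothFormAt (𝓡 5) (fun y => oneForm (σ y)) y
  smooth_reeb : ∀ y, SmoothVecAt (𝓡 5) R y
  nondeg : ∀ y v, σ y v = 0 →
    (∀ w, σ y w = 0 → extD (𝓡 5) (fun y => oneForm (σ y)) y ![v, w] = 0) → v = 0
  reeb_one : ∀ y, σ y (R y) = 1
  reeb_kernel : ∀ y, contract (R y) (extD (𝓡 5) (fun y => oneForm (σ y)) y) = 0

/-- Symplectic forms: closed and non-degenerate. -/
structure IsSymplectic (om : Cone Y → Form E₆ ℝ 2) : Prop where
  smooth : ∀ x, SmoothFormAt coneI om x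
  closed : ∀ x, extD coneI om x = 0
  nondeg : ∀ x v, contract v (om x) = 0 → v = 0

/-- The two-form `dx₁ ∧ dy₁ + dx₂ ∧ dy₂`. -/
def omegaZero (p q : Fin 2 → Cone Y → ℝ) (x : Cone Y) : Form E₆ ℝ 2 :=
  ∑ a, wedgeReal (dFun coneI (p a) x) (dFun coneI (q a) x)

/-- Generalized Darboux coordinates for `Ω₋` on an open set `U` where it has type one:
`Ω₋ = dz̄ ∧ exp(-b₀ + i ω₀)` with `b₀` a closed real two-form, `ω₀ = dx₁ ∧ dy₁ + dx₂ ∧ dy₂` (the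
coordinates `x_a`, `y_a` are `p a`, `q a`), and `z = r³ e^{3h} e^{3iψ}` where `h` is a function of
the symplectic coordinates; `Hh` is the Hamiltonian vector field of `h`, tangent to the symplectic
leaves (where `z` is constant), with `Hh ⌟ ω₀ = - dh`. -/
structure IsDarbouxFrame (Ωm : Cone Y → Polyform E₆) (U : Set (Cone Y)) (z : Cone Y → ℂ)
    (p q : Fin 2 → Cone Y → ℝ) (b₀ : Cone Y → Form E₆ ℝ 2) (h ψ : Cone Y → ℝ)
    (Hh : Cone Y → E₆) : Prop where
  isOpen : IsOpen U
  smooth_z : ContMDiffOn coneI 𝓘(ℝ, ℂ) ∞ z U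
  smooth_p : ∀ a, ContMDiffOn coneI 𝓘(ℝ, ℝ) ∞ (p a) U
  smooth_q : ∀ a, ContMDiffOn coneI 𝓘(ℝ, ℝ) ∞ (q a) U
  smooth_h : ContMDiffOn coneI 𝓘(ℝ, ℝ) ∞ h U
  smooth_ψ : ContMDiffOn coneI 𝓘(ℝ, ℝ) ∞ ψ U
  smooth_b₀ : ∀ x ∈ U, SmoothFormAt coneI b₀ x
  closed_b₀ : ∀ x ∈ U, extD coneI b₀ x = 0
  minus_eq : ∀ x ∈ U, Ωm x =
    wedgeOne ((Complex.conjCLE : ℂ →L[ℝ] ℂ).comp (dFun coneI z x))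
      (expWedge (-cplx (b₀ x) + Complex.I • cplx (omegaZero p q x)) (constP 1))
  z_eq : ∀ x ∈ U, z x = (rad x : ℂ) ^ 3 * (Real.exp (3 * h x) : ℂ)
    * Complex.exp (3 * Complex.I * ψ x)
  /-- `dh` is a combination of the `dx_a` and `dy_a`. -/
  h_leaf : ∀ x ∈ U, ∀ v : E₆, (∀ a, dFun coneI (p a) x v = 0) → (∀ a, dFun coneI (q a) x v = 0) →
    dFun coneI h x v = 0
  ham_tangent : ∀ x ∈ U, dFun coneI z x (Hh x) = 0
  ham_eq : ∀ x ∈ U, contract (Hh x) (omegaZero p q x) = -dFun coneI h x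

/-- The one-form `σ = η_f - η_v ⌟ b₂`. -/
def sigma (Ωm : Cone Y → Polyform E₆) (b₂ : Cone Y → Form E₆ ℝ 2) (x : Cone Y) :
    E₆ →L[ℝ] ℝ :=
  (eta Ωm x).2 - contract (eta Ωm x).1 (b₂ x)

/-- The two-form `½ d(r² σ)`. -/
def coneOmega (σ : Cone Y → E₆ →L[ℝ] ℝ) (x : Cone Y) : Form E₆ ℝ 2 :=
  (1 / 2 : ℝ) • extD coneI (fun y => oneForm (rad y ^ 2 • σ y)) x

/-- The transverse two-form `ω_T = ½ dσ`. -/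
def omegaT (σ : Cone Y → E₆ →L[ℝ] ℝ) (x : Cone Y) : Form E₆ ℝ 2 :=
  (1 / 2 : ℝ) • extD coneI (fun y => oneForm (σ y)) x

end Cone

end GenGeom

end

open GenGeom

/-!
Write `J₋`, `J₊` for the structures of `Ω₋`, `Ω₊`, `ρ = e^{-A} Ω₊` and `φ = e^{-A} Im α₊`. Since
`Re ρ` is closed and homogeneous, `Re α₊ = 0` (`re_α`), so `ρ = i φ e^{-b₊ + i ω₊}`, and `φ ω₊` is
closed. The unknown is the real polyform `κ = d (Im ρ) = -i dρ`.

The core of the argument is a duality for the flux. For a unitary frame `c₁, J c₁, …, c₃, J c₃` of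
the `+1`-eigenspace of `G`, on which `J₋` and `J₊` agree, let `S` be the Clifford product
`c₁ (J c₁) c₂ (J c₂) c₃ (J c₃)`, a generalized Hodge operator. It satisfies `S (W · Φ) = -(G W) · S Φ`.
As the derivative of a pure spinor, `κ` arises from `ρ` by at most three raising operators, and
because it is real the same holds for the conjugate spinor (`kappa_lower`). Hence it has charge zero
for `J₊`, and its charges for `J₋` are `±1` and `±3`. The components of charge `±3` vanish because
`Ω₋` is closed: the tensor which measures them is determined by the annihilator bundle, and it can
be evaluated on `Ω₋` in place of `Ω₊` (`exists_torsion`, `kappa_torsion`). On what remains `S`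
inverts the action of `J₋` (`hodge_algOp_eq`, `hodge_kappa`), and therefore
`S (e^{-B} F) = 8 e^{-2A} (κ + 2 dA ∧ Im ρ)` (`hodge_flux`). The condition `r∂_r ⌟ F = 0` becomes
`d log r ∧ (κ + 2 dA ∧ Im ρ) = 0` (`dlogr_dualFlux`), since `S` exchanges the actions of `r∂_r` and of
`G(r∂_r) = e^{2Δ} d log r` up to sign.

This equation contains the theorem. In degree one it gives `dφ + 2 φ dA = 4 φ d log r` (`dphi`), so
that `e^A Im α₊ = C r⁴` on the connected cone (`exists_constant`). Applying `S` once more, the top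
component of the flux is `f₅ = -32 Im α₊ e^{4Δ - 3A}` (`flux_constant`). Together they show that
`A - log r - Δ` is constant and that `f₅ ≠ 0`, and a shift of `A` makes the constant zero
(`exists_shift`, `shift`). In degree three it gives `d log r ∧ db₊ = 0` (`dlogr_db`). Paired with the
annihilator of `ρ` it determines the component of `dρ` along `d log r`, whence `ξ_v(A) = 0`
(`dA_xi`).

The field `ξ = J₋(r∂_r) = J₊(e^{2Δ} d log r)` then satisfies `L_ξ Ω₋ = -3i Ω₋` and `L_ξ Ω₊ = 0`
(`lie_xi_minus`, `lie_xi_plus`), so it preserves both structures, `G`, and the twisted flux. The form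
`b₂ = b₊ - d log r ∧ (r∂_r ⌟ b₊)` is closed because `L_{r∂_r} b₊ = 0` and `d log r ∧ db₊ = 0`. The
explicit form of `J₊`, which is of type zero, gives `σ = e^{-2Δ} r∂_r ⌟ ω₊`, and `d(φ ω₊) = 0` with
the homogeneity of `φ ω₊` gives `½ d(r² σ) = r² e^{-2Δ} ω₊` (`coneOmega_eq`). Thus `ω` is symplectic
and homogeneous of degree two, and `σ` descends to a contact form on `Y` with Reeb field `ξ_v`
(`radial_const`, `exists_contact`).

In Darboux coordinates `Ω₋` is annihilated by `dz̄`, which is a multiple of `d log r + dh - i dψ`, and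
by the complex combination of `dh` and `H + H ⌟ b₀` for the Hamiltonian field `H` of `h`. Hence
`J₋(d log r + dh) = dψ`, and `η = J₋(d log r) = dψ - H - H ⌟ b₀` (`eta_darboux`).
-/

noncomputable section

set_option linter.unusedSectionVars false
set_option linter.unusedSimpArgs false

namespace GenGeom

/-! ### Clifford operators on polyforms -/

section Clifford

variable {V : Type*} [NormedAddCommGroup V] [NormedSpace ℝ V]

/-- The interior product as a complex linear operator. -/
def intOp (v : V) : Module.End ℂ (Polyform V) where
  toFun := intProd v
  map_add' Φ Ψ := by funext k; ext; simp [intProd]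
  map_smul' c Φ := by funext k; ext; simp [intProd]

/-- The exterior product with a complex one-form as a complex linear operator. -/
def wedOp : (V →L[ℝ] ℂ) →ₗ[ℂ] Module.End ℂ (Polyform V) where
  toFun ν :=
    { toFun := wedgeOne ν
      map_add' := fun Φ Ψ => by
        funext k
        cases k with
        | zero => simp [wedgeOne]
        | succ k =>
          ext v
          simp [wedgeOne, ContinuousAlternatingMap.alternatizeUncurryFin_apply, mul_add,
            Finset.sum_add_distrib]
      map_smul' := fun c Φ => by
        funext k
        cases k with
        | zero => simp [wedgeOne]
        | succ k =>
          ext v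
          simp [wedgeOne, ContinuousAlternatingMap.alternatizeUncurryFin_apply, Finset.mul_sum,
            mul_left_comm] }
  map_add' μ ν := by
    ext1 Φ
    exact wedgeOne_add μ ν Φ
  map_smul' c ν := by
    ext1 Φ
    funext k
    cases k with
    | zero => simp [wedgeOne]
    | succ k =>
      ext v
      simp [wedgeOne, ContinuousAlternatingMap.alternatizeUncurryFin_apply, Finset.mul_sum,
        mul_left_comm, mul_assoc]

theorem intOp_apply (v : V) (Φ : Polyform V) : intOp v Φ = intProd v Φ := rfl

theorem wedOp_apply (ν : V →L[ℝ] ℂ) (Φ : Polyform V) : wedOp ν Φ = wedgeOne ν Φ := rfl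

theorem intOp_apply_apply (v : V) (Φ : Polyform V) (k : ℕ) (w : Fin k → V) :
    intOp v Φ k w = Φ (k + 1) (Matrix.vecCons v w) := rfl

theorem wedOp_apply_zero (ν : V →L[ℝ] ℂ) (Φ : Polyform V) : wedOp ν Φ 0 = 0 := rfl

theorem wedOp_apply_succ (ν : V →L[ℝ] ℂ) (Φ : Polyform V) (k : ℕ) (w : Fin (k + 1) → V) :
    wedOp ν Φ (k + 1) w = ∑ i : Fin (k + 1), (-1) ^ (i : ℕ) * (ν (w i) * Φ k (i.removeNth w)) := by
  simp [wedOp_apply, wedgeOne, ContinuousAlternatingMap.alternatizeUncurryFin_apply, mul_comm]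

theorem intOp_add (v w : V) : intOp (v + w) = intOp v + intOp w := by
  ext Φ k; simp [intOp_apply, intProd]

theorem intOp_smul (c : ℝ) (v : V) : intOp (c • v) = (c : ℂ) • intOp v := by
  ext Φ k; simp [intOp_apply, intProd]

/-- The interior product as an additive map. -/
def intHom : V →+ Module.End ℂ (Polyform V) where
  toFun := intOp
  map_zero' := by simpa using intOp_smul (0 : ℝ) (0 : V)
  map_add' := intOp_add

/-- A polyform vanishes if its degree zero part and all its contractions do. -/
theorem polyform_eq_zero {Φ : Polyform V} (h0 : Φ 0 = 0) (h : ∀ v, intOp v Φ = 0) : Φ = 0 := by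
  funext k
  cases k with
  | zero => exact h0
  | succ k =>
    ext w
    have := congrFun (h (w 0)) k
    have h2 : intOp (w 0) Φ k (Matrix.vecTail w) = 0 := by rw [this]; rfl
    rw [intOp_apply_apply] at h2
    exact (congrArg (Φ (k + 1)) (Matrix.cons_head_tail w)).symm.trans h2

theorem component_eq_zero {Φ : Polyform V} {k : ℕ} (h : ∀ v, intOp v Φ k = 0) : Φ (k + 1) = 0 := by
  ext w
  have h2 : intOp (w 0) Φ k (Matrix.vecTail w) = 0 := by rw [h]; rfl
  rw [intOp_apply_apply] at h2
  exact (congrArg (Φ (k + 1)) (Matrix.cons_head_tail w)).symm.trans h2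

theorem int_wed (v : V) (ν : V →L[ℝ] ℂ) :
    intOp v * wedOp ν + wedOp ν * intOp v = ν v • (1 : Module.End ℂ (Polyform V)) := by
  ext Φ k w
  simp only [LinearMap.add_apply, Module.End.mul_apply, LinearMap.smul_apply, Module.End.one_apply,
    Pi.add_apply, Pi.smul_apply, ContinuousAlternatingMap.add_apply,
    ContinuousAlternatingMap.smul_apply, smul_eq_mul]
  rw [intOp_apply_apply, wedOp_apply_succ, Fin.sum_univ_succ]
  cases k with
  | zero =>
    rw [wedOp_apply_zero]
    simp [Fin.removeNth, Fin.tail_cons, Matrix.vecCons]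
  | succ k =>
    rw [wedOp_apply_succ]
    simp only [intOp_apply_apply, Fin.val_zero, pow_zero, one_mul, Fin.val_succ, pow_succ,
      mul_neg, mul_one, neg_mul, Finset.sum_neg_distrib]
    have h1 : ∀ i : Fin (k + 1), (i.succ).removeNth (Matrix.vecCons v w)
        = Matrix.vecCons v (i.removeNth w) := by
      intro i
      funext j
      refine Fin.cases ?_ (fun j => ?_) j
      · simp [Fin.removeNth, Matrix.vecCons]
      · simp [Fin.removeNth, Matrix.vecCons, Fin.succ_succAbove_succ]
    simp [h1]

theorem int_wed' (v : V) (ν : V →L[ℝ] ℂ) (Φ : Polyform V) :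
    intOp v (wedOp ν Φ) = ν v • Φ - wedOp ν (intOp v Φ) := by
  have := congrArg (fun f => f Φ) (int_wed v ν)
  simp only [LinearMap.add_apply, Module.End.mul_apply, LinearMap.smul_apply,
    Module.End.one_apply] at this
  rw [← this]; abel

theorem int_int (v : V) : intOp v * intOp v = 0 := by
  ext Φ k w
  simp only [Module.End.mul_apply, intOp_apply_apply]
  exact (Φ (k + 2)).map_eq_zero_of_eq _ (i := 0) (j := 1) rfl (by simp)

theorem wed_wed (ν : V →L[ℝ] ℂ) : wedOp ν * wedOp ν = 0 := by
  have h : ∀ k (Φ : Polyform V), wedOp ν (wedOp ν Φ) k = 0 := by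
    intro k
    induction k with
    | zero => intro Φ; rfl
    | succ k ih =>
      intro Φ
      refine component_eq_zero (Φ := wedOp ν (wedOp ν Φ)) fun v => ?_
      rw [int_wed', int_wed', map_sub, map_smul, sub_sub_cancel]
      exact ih _
  ext Φ k
  rw [Module.End.mul_apply, h]
  rfl

/-- The Clifford action of a generalized vector as an operator. -/
def cl : GenVec V →+ Module.End ℂ (Polyform V) where
  toFun W := intOp W.1 + wedOp (Complex.ofRealCLM.comp W.2)
  map_zero' := by
    have h := (intHom (V := V)).map_zero
    simp only [Prod.fst_zero, Prod.snd_zero, ContinuousLinearMap.comp_zero, map_zero, add_zero]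
    exact h
  map_add' W Z := by
    simp only [Prod.fst_add, Prod.snd_add, ContinuousLinearMap.comp_add, map_add, intOp_add]
    abel

theorem cl_apply (W : GenVec V) (Φ : Polyform V) : cl W Φ = cliff W Φ := rfl

theorem cl_eq (W : GenVec V) : cl W = intOp W.1 + wedOp (Complex.ofRealCLM.comp W.2) := rfl

theorem cl_vec (v : V) : cl ((v, 0) : GenVec V) = intOp v := by simp [cl_eq]

theorem cl_form (ν : V →L[ℝ] ℝ) :
    cl ((0, ν) : GenVec V) = wedOp (Complex.ofRealCLM.comp ν) := by
  have h : intOp (0 : V) = 0 := (intHom (V := V)).map_zero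
  simp [cl_eq, h]

theorem cl_smul (c : ℝ) (W : GenVec V) : cl (c • W) = (c : ℂ) • cl W := by
  ext1 Φ; exact cliff_smul c W Φ

theorem cl_sq (W : GenVec V) : cl W * cl W = ((W.2 W.1 : ℝ) : ℂ) • (1 : Module.End ℂ (Polyform V)) := by
  have := int_wed W.1 (Complex.ofRealCLM.comp W.2)
  rw [cl_eq, add_mul, mul_add, mul_add, int_int, wed_wed, zero_add, add_zero, this]
  simp

/-- The Clifford relation. -/
theorem cl_cl (W Z : GenVec V) :
    cl W * cl Z + cl Z * cl W = ((2 * pairing W Z : ℝ) : ℂ) • (1 : Module.End ℂ (Polyform V)) := by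
  have h1 := cl_sq (W + Z)
  have h2 := cl_sq W
  have h3 := cl_sq Z
  rw [map_add, add_mul, mul_add, mul_add, h2, h3] at h1
  have h4 : cl W * cl Z + cl Z * cl W = (((W + Z).2 (W + Z).1 : ℝ) : ℂ) • (1 : Module.End ℂ (Polyform V))
      - ((W.2 W.1 : ℝ) : ℂ) • (1 : Module.End ℂ (Polyform V)) - ((Z.2 Z.1 : ℝ) : ℂ) • 1 := by
    rw [← h1]; abel
  have h5 : 2 * pairing W Z = (W + Z).2 (W + Z).1 - W.2 W.1 - Z.2 Z.1 := by
    simp only [pairing, Prod.fst_add, Prod.snd_add, add_apply, map_add]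
    ring
  rw [h4, h5]
  push_cast
  module

theorem pairing_comm (W Z : GenVec V) : pairing W Z = pairing Z W := by
  simp only [pairing]; ring

theorem pairing_add_left (W Z U : GenVec V) : pairing (W + Z) U = pairing W U + pairing Z U := by
  simp only [pairing, Prod.fst_add, Prod.snd_add, add_apply, map_add]; ring

theorem pairing_smul_left (c : ℝ) (W U : GenVec V) : pairing (c • W) U = c * pairing W U := by
  simp only [pairing, Prod.smul_fst, Prod.smul_snd, smul_apply, map_smul,
    smul_eq_mul]; ring

/-- The pairing as a bilinear map. -/
def pairB : GenVec V →ₗ[ℝ] GenVec V →ₗ[ℝ] ℝ :=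
  LinearMap.mk₂ ℝ pairing pairing_add_left pairing_smul_left
    (fun W Z U => by rw [pairing_comm, pairing_add_left, pairing_comm Z, pairing_comm U])
    (fun c W U => by rw [pairing_comm, pairing_smul_left, pairing_comm U, smul_eq_mul])

theorem pairing_smul_right (c : ℝ) (W U : GenVec V) : pairing U (c • W) = c * pairing U W :=
  map_smul (pairB U) c W

theorem pairing_neg_left (W U : GenVec V) : pairing (-W) U = -pairing W U := by
  simp only [pairing, Prod.fst_neg, Prod.snd_neg, neg_apply, map_neg]; ring

theorem pairing_neg_right (W U : GenVec V) : pairing U (-W) = -pairing U W :=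
  map_neg (pairB U) W

/-! ### Degrees -/

/-- Polyforms all of whose components in degree less than `m` vanish. -/
def degGE (m : ℕ) : Submodule ℂ (Polyform V) where
  carrier := {Φ | ∀ k < m, Φ k = 0}
  zero_mem' := fun _ _ => rfl
  add_mem' := fun {Φ Ψ} h h' k hk => by rw [Pi.add_apply, h k hk, h' k hk, add_zero]
  smul_mem' := fun c Φ h k hk => by rw [Pi.smul_apply, h k hk, smul_zero]

/-- Polyforms all of whose components in degree greater than `m` vanish. -/
def degLE (m : ℕ) : Submodule ℂ (Polyform V) where
  carrier := {Φ | ∀ k, m < k → Φ k = 0}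
  zero_mem' := fun _ _ => rfl
  add_mem' := fun {Φ Ψ} h h' k hk => by rw [Pi.add_apply, h k hk, h' k hk, add_zero]
  smul_mem' := fun c Φ h k hk => by rw [Pi.smul_apply, h k hk, smul_zero]

theorem wedOp_component {ν : V →L[ℝ] ℂ} {Φ : Polyform V} {k : ℕ} (h : Φ k = 0) :
    wedOp ν Φ (k + 1) = 0 := by
  ext w
  rw [wedOp_apply_succ, h]
  simp

theorem intOp_component {v : V} {Φ : Polyform V} {k : ℕ} (h : Φ (k + 1) = 0) :
    intOp v Φ k = 0 := by
  ext w
  rw [intOp_apply_apply, h]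
  simp

theorem wedOp_mem_degGE {ν : V →L[ℝ] ℂ} {Φ : Polyform V} {m : ℕ} (h : Φ ∈ degGE m) :
    wedOp ν Φ ∈ degGE (m + 1) := by
  intro k hk
  cases k with
  | zero => rfl
  | succ k => exact wedOp_component (h k (by omega))

theorem wedOp_mem_degLE {ν : V →L[ℝ] ℂ} {Φ : Polyform V} {m : ℕ} (h : Φ ∈ degLE m) :
    wedOp ν Φ ∈ degLE (m + 1) := by
  intro k hk
  cases k with
  | zero => rfl
  | succ k => exact wedOp_component (h k (by omega))

theorem intOp_mem_degLE {v : V} {Φ : Polyform V} {m : ℕ} (h : Φ ∈ degLE m) :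
    intOp v Φ ∈ degLE m :=
  fun k hk => intOp_component (h (k + 1) (by omega))

theorem intOp_mem_degLE_pred {v : V} {Φ : Polyform V} {m : ℕ} (h : Φ ∈ degLE (m + 1)) :
    intOp v Φ ∈ degLE m :=
  fun k hk => intOp_component (h (k + 1) (by omega))

theorem intOp_of_degLE_zero {v : V} {Φ : Polyform V} (h : Φ ∈ degLE 0) : intOp v Φ = 0 := by
  funext k
  exact intOp_component (h (k + 1) (by omega))

theorem degLE_mono {m n : ℕ} (h : m ≤ n) : (degLE m : Submodule ℂ (Polyform V)) ≤ degLE n :=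
  fun _ hΦ k hk => hΦ k (by omega)

theorem contract_apply (v w : V) (β : Form V ℝ 2) : contract v β w = β ![v, w] := by
  simp only [contract]
  change β (Matrix.vecCons v fun _ => w) = _
  congr 1
  funext i
  fin_cases i <;> rfl

theorem twoForm_skew {F : Type*} [NormedAddCommGroup F] [NormedSpace ℝ F] (β : Form V F 2)
    (v w : V) : β ![v, w] = -β ![w, v] := by
  have := β.toAlternatingMap.map_swap ![w, v] (i := 0) (j := 1) (by simp)
  rw [show (β.toAlternatingMap ![w, v]) = β ![w, v] from rfl] at this
  rw [← this]
  change _ = β _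
  congr 1
  funext i
  fin_cases i <;> rfl

variable [FiniteDimensional ℝ V]

theorem form_eq_zero_of_finrank_lt {k : ℕ} (h : Module.finrank ℝ V < k) (φ : Form V ℂ k) :
    φ = 0 := by
  ext w
  have : ¬ LinearIndependent ℝ w := fun hw => by
    have := hw.fintype_card_le_finrank
    simp at this
    omega
  exact φ.toAlternatingMap.map_linearDependent w this

theorem eq_zero_of_mem_degGE {m : ℕ} {Φ : Polyform V} (hm : Module.finrank ℝ V < m)
    (h : Φ ∈ degGE m) : Φ = 0 := by
  funext k
  rcases lt_or_ge k m with hk | hk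
  · exact h k hk
  · exact form_eq_zero_of_finrank_lt (by omega) _

theorem mem_degLE_finrank (Φ : Polyform V) : Φ ∈ degLE (Module.finrank ℝ V) :=
  fun _ hk => form_eq_zero_of_finrank_lt hk _

/-! ### Bases -/

theorem sum_dualBas (φ : V →L[ℝ] ℂ) :
    ∑ a, φ (bas V a) • Complex.ofRealCLM.comp (dualBas (V := V) a) = φ := by
  ext v
  conv_rhs => rw [← (bas V).sum_repr v, map_sum]
  simp only [sum_apply, map_smul, smul_apply,
    ContinuousLinearMap.comp_apply, dualBas, LinearMap.coe_toContinuousLinearMap',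
    Module.Basis.coord_apply, Complex.ofRealCLM_apply, smul_eq_mul, Complex.real_smul]
  exact Finset.sum_congr rfl fun a _ => mul_comm _ _

theorem dualBas_apply_bas (a c : Fin (Module.finrank ℝ V)) :
    dualBas (V := V) a (bas V c) = if a = c then 1 else 0 := by
  simp [dualBas, Finsupp.single_apply, eq_comm]

theorem sum_dualBas_smul (v : V) : ∑ a, dualBas (V := V) a v • bas V a = v := by
  conv_rhs => rw [← (bas V).sum_repr v]
  simp [dualBas]

theorem sum_dualBas_real (φ : V →L[ℝ] ℝ) : ∑ a, φ (bas V a) • dualBas (V := V) a = φ := by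
  ext v
  conv_rhs => rw [← sum_dualBas_smul v, map_sum]
  simp [mul_comm]

/-- The exterior product with a complex two-form. -/
def twoOp (β : Form V ℂ 2) : Module.End ℂ (Polyform V) :=
  (1 / 2 : ℂ) • ∑ a, wedOp (Complex.ofRealCLM.comp (dualBas a)) *
    wedOp ((ContinuousAlternatingMap.ofSubsingleton ℝ V ℂ (0 : Fin 1)).symm
      (β.curryLeft (bas V a)))

/-- The contraction of a complex two-form with a vector, as a complex one-form. -/
def contractC (v : V) (β : Form V ℂ 2) : V →L[ℝ] ℂ :=
  (ContinuousAlternatingMap.ofSubsingleton ℝ V ℂ (0 : Fin 1)).symm (β.curryLeft v)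

theorem contractC_apply (v w : V) (β : Form V ℂ 2) : contractC v β w = β ![v, w] := by
  simp only [contractC]
  change β (Matrix.vecCons v fun _ => w) = _
  congr 1
  funext i
  fin_cases i <;> rfl

theorem wedgeForm_two (β : Form V ℂ 2) (Φ : Polyform V) : wedgeForm 2 β Φ = twoOp β Φ := by
  have h1 : ∀ φ : Form V ℂ 1, wedgeForm 1 φ Φ
      = wedOp ((ContinuousAlternatingMap.ofSubsingleton ℝ V ℂ (0 : Fin 1)).symm φ) Φ := by
    intro φ
    rw [← sum_dualBas ((ContinuousAlternatingMap.ofSubsingleton ℝ V ℂ (0 : Fin 1)).symm φ)]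
    simp only [wedgeForm, map_sum, map_smul, LinearMap.sum_apply, LinearMap.smul_apply]
    simp only [Nat.cast_zero, zero_add, inv_one, one_smul]
    refine Finset.sum_congr rfl fun a _ => ?_
    rw [← wedOp_apply, map_smul]
    congr 1
    change φ (Matrix.vecCons _ _) = φ _
    congr 1
    funext i
    fin_cases i
    rfl
  rw [wedgeForm, twoOp]
  simp only [h1, LinearMap.smul_apply, LinearMap.sum_apply, Module.End.mul_apply]
  norm_num
  rfl

theorem int_two (v : V) (β : Form V ℂ 2) (Φ : Polyform V) :
    intOp v (twoOp β Φ) = twoOp β (intOp v Φ) + wedOp (contractC v β) Φ := by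
  have key : ∑ a, (((dualBas (V := V) a v : ℝ) : ℂ) • wedOp (contractC (bas V a) β) Φ
      - (contractC (bas V a) β v) • wedOp (Complex.ofRealCLM.comp (dualBas a)) Φ)
      = (2 : ℂ) • wedOp (contractC v β) Φ := by
    have e1 : contractC v β = ∑ a, ((dualBas (V := V) a v : ℝ) : ℂ) • contractC (bas V a) β := by
      ext w
      conv_lhs => rw [← sum_dualBas_smul v]
      simp only [contractC, map_sum, map_smul, sum_apply,
        smul_apply]
      simp [Complex.real_smul, ContinuousAlternatingMap.sum_apply, ContinuousAlternatingMap.ofSubsingleton]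
      rfl
    have e2 : contractC v β = ∑ a, (-(contractC (bas V a) β v)) •
        Complex.ofRealCLM.comp (dualBas (V := V) a) := by
      rw [← sum_dualBas (contractC v β)]
      refine Finset.sum_congr rfl fun a _ => ?_
      rw [contractC_apply, contractC_apply, twoForm_skew]
    rw [two_smul, Finset.sum_sub_distrib]
    conv_rhs => 
      congr
      · rw [e1]
      · rw [e2]
    simp only [map_sum, map_smul, LinearMap.sum_apply, LinearMap.smul_apply, map_neg, neg_smul,
      LinearMap.neg_apply, Finset.sum_neg_distrib]
    abel
  have h2 : wedOp (contractC v β) Φ = (1 / 2 : ℂ) • ((2 : ℂ) • wedOp (contractC v β) Φ) := by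
    rw [smul_smul]; norm_num
  rw [h2, ← key, twoOp]
  simp only [LinearMap.smul_apply, LinearMap.sum_apply, Module.End.mul_apply, map_smul, map_sum,
    ← smul_add, ← Finset.sum_add_distrib]
  congr 1
  refine Finset.sum_congr rfl fun a _ => ?_
  change intOp v (wedOp _ (wedOp (contractC (bas V a) β) Φ)) =
    wedOp _ (wedOp (contractC (bas V a) β) (intOp v Φ)) + _
  rw [int_wed', int_wed', map_sub, map_smul]
  simp only [ContinuousLinearMap.comp_apply, Complex.ofRealCLM_apply]
  abel

end Clifford

/-! ### Exponentials of two-forms -/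

section Exponential

variable {V : Type*} [NormedAddCommGroup V] [NormedSpace ℝ V]

theorem wed_anticomm (μ ν : V →L[ℝ] ℂ) : wedOp μ * wedOp ν = (-1 : ℂ) • (wedOp ν * wedOp μ) := by
  have h := wed_wed (μ + ν)
  rw [map_add, add_mul, mul_add, mul_add, wed_wed, wed_wed, zero_add, add_zero] at h
  linear_combination (norm := module) (1 : ℂ) • h

theorem int_anticomm (v w : V) : intOp v * intOp w = (-1 : ℂ) • (intOp w * intOp v) := by
  have h := int_int (v + w)
  rw [intOp_add, add_mul, mul_add, mul_add, int_int, int_int, zero_add, add_zero] at h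
  linear_combination (norm := module) (1 : ℂ) • h

variable [FiniteDimensional ℝ V]

theorem contractC_add (v : V) (β γ : Form V ℂ 2) :
    contractC v (β + γ) = contractC v β + contractC v γ := by
  ext w; simp [contractC_apply]

theorem contractC_smul (v : V) (c : ℂ) (β : Form V ℂ 2) :
    contractC v (c • β) = c • contractC v β := by
  ext w; simp [contractC_apply]

theorem twoOp_eq (β : Form V ℂ 2) : twoOp β = (1 / 2 : ℂ) •
    ∑ a, wedOp (Complex.ofRealCLM.comp (dualBas a)) * wedOp (contractC (bas V a) β) := rfl

/-- The exterior product with a complex two-form, as a complex linear map in the two-form. -/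
def twoHom : Form V ℂ 2 →ₗ[ℂ] Module.End ℂ (Polyform V) where
  toFun := twoOp
  map_add' β γ := by
    simp only [twoOp_eq, contractC_add, map_add, mul_add, Finset.sum_add_distrib, smul_add]
  map_smul' c β := by
    simp only [twoOp_eq, contractC_smul, map_smul, mul_smul_comm, ← Finset.smul_sum,
      RingHom.id_apply]
    rw [smul_comm]

theorem twoOp_add (β γ : Form V ℂ 2) : twoOp (β + γ) = twoOp β + twoOp γ := map_add twoHom β γ

theorem twoOp_neg (β : Form V ℂ 2) : twoOp (-β) = -twoOp β := map_neg twoHom β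

theorem twoOp_zero : twoOp (0 : Form V ℂ 2) = 0 := map_zero twoHom

theorem int_two_mul (v : V) (β : Form V ℂ 2) :
    intOp v * twoOp β = twoOp β * intOp v + wedOp (contractC v β) := by
  ext1 Φ; exact int_two v β Φ

theorem two_wed (β : Form V ℂ 2) (ν : V →L[ℝ] ℂ) : Commute (twoOp β) (wedOp ν) := by
  have h : ∀ μ ρ : V →L[ℝ] ℂ, Commute (wedOp μ * wedOp ρ) (wedOp ν) := by
    intro μ ρ
    unfold Commute SemiconjBy
    rw [mul_assoc, wed_anticomm ρ ν, mul_smul_comm, ← mul_assoc, wed_anticomm μ ν, smul_mul_assoc,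
      smul_smul, mul_assoc]
    norm_num
  rw [twoOp_eq]
  exact (Commute.sum_left _ _ _ fun a _ => h _ _).smul_left _

theorem two_two (β γ : Form V ℂ 2) : Commute (twoOp β) (twoOp γ) := by
  rw [twoOp_eq γ]
  exact (Commute.sum_right _ _ _ fun a _ => (two_wed β _).mul_right (two_wed β _)).smul_right _

theorem twoOp_mem_degGE {β : Form V ℂ 2} {Φ : Polyform V} {m : ℕ} (h : Φ ∈ degGE m) :
    twoOp β Φ ∈ degGE (m + 2) := by
  rw [twoOp_eq, LinearMap.smul_apply, LinearMap.sum_apply]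
  exact Submodule.smul_mem _ _ (Submodule.sum_mem _ fun a _ =>
    wedOp_mem_degGE (wedOp_mem_degGE h))

theorem mem_degGE_zero (Φ : Polyform V) : Φ ∈ degGE 0 := fun _ hk => absurd hk (by omega)

variable [hd : Fact (Module.finrank ℝ V = 6)]

theorem eq_zero_of_degGE_seven {Φ : Polyform V} (h : Φ ∈ degGE 7) : Φ = 0 :=
  eq_zero_of_mem_degGE (by rw [hd.out]; norm_num) h

theorem mem_degLE_six (Φ : Polyform V) : Φ ∈ degLE 6 := hd.out ▸ mem_degLE_finrank Φ

theorem twoOp_pow_three_wed (β : Form V ℂ 2) (ν : V →L[ℝ] ℂ) : twoOp β ^ 3 * wedOp ν = 0 := by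
  ext1 Φ
  simp only [pow_succ, pow_zero, one_mul, Module.End.mul_apply]
  exact eq_zero_of_degGE_seven (twoOp_mem_degGE (twoOp_mem_degGE (twoOp_mem_degGE
    (wedOp_mem_degGE (mem_degGE_zero Φ)))))

theorem twoOp_pow_four (β : Form V ℂ 2) : twoOp β ^ 4 = 0 := by
  ext1 Φ
  simp only [pow_succ, pow_zero, one_mul, Module.End.mul_apply]
  refine eq_zero_of_degGE_seven fun k hk => ?_
  exact twoOp_mem_degGE (twoOp_mem_degGE (twoOp_mem_degGE (twoOp_mem_degGE
    (mem_degGE_zero Φ)))) k (by omega)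

/-- The operator `e^β ∧`. -/
def eOp (β : Form V ℂ 2) : Module.End ℂ (Polyform V) := IsNilpotent.exp (twoOp β)

theorem eOp_eq_sum (β : Form V ℂ 2) :
    eOp β = ∑ n ∈ Finset.range 4, ((n.factorial : ℂ)⁻¹) • twoOp β ^ n := by
  rw [eOp, IsNilpotent.exp_eq_sum (twoOp_pow_four β)]
  refine Finset.sum_congr rfl fun n _ => ?_
  rw [← Rat.cast_smul_eq_qsmul ℂ]
  norm_num

theorem expWedge_eq (β : Form V ℂ 2) (Φ : Polyform V) : expWedge β Φ = eOp β Φ := by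
  have h : wedgeForm 2 β = fun Φ => twoOp β Φ := funext (wedgeForm_two β)
  rw [eOp_eq_sum, expWedge, LinearMap.sum_apply]
  refine Finset.sum_congr rfl fun n _ => ?_
  rw [LinearMap.smul_apply, Module.End.pow_apply, h]

theorem eOp_add (β γ : Form V ℂ 2) : eOp (β + γ) = eOp β * eOp γ := by
  rw [eOp, twoOp_add]
  exact IsNilpotent.exp_add_of_commute (two_two β γ) ⟨4, twoOp_pow_four β⟩ ⟨4, twoOp_pow_four γ⟩

theorem eOp_zero : eOp (0 : Form V ℂ 2) = 1 := by
  rw [eOp, twoOp_zero, IsNilpotent.exp_zero]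

theorem eOp_neg_mul (β : Form V ℂ 2) : eOp (-β) * eOp β = 1 := by
  rw [← eOp_add, neg_add_cancel, eOp_zero]

theorem eOp_comm_of_commute (β : Form V ℂ 2) {X : Module.End ℂ (Polyform V)}
    (h : Commute (twoOp β) X) : Commute (eOp β) X := by
  rw [eOp_eq_sum]
  exact Commute.sum_left _ _ _ fun n _ => (h.pow_left n).smul_left _

theorem eOp_wed (β : Form V ℂ 2) (ν : V →L[ℝ] ℂ) : Commute (eOp β) (wedOp ν) :=
  eOp_comm_of_commute β (two_wed β ν)

theorem int_eOp (v : V) (β : Form V ℂ 2) :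
    intOp v * eOp β = eOp β * (intOp v + wedOp (contractC v β)) := by
  set X := twoOp β with hX
  set ν := wedOp (contractC v β) with hν
  set i := intOp v with hi
  have hc : X * ν = ν * X := two_wed β _
  have h1 : i * X = X * i + ν := int_two_mul v β
  have h3 : X ^ 3 * ν = 0 := twoOp_pow_three_wed β _
  have h2 : i * (X * X) = X * X * i + (2 : ℂ) • (X * ν) := by
    rw [← mul_assoc, h1, add_mul, mul_assoc, h1, mul_add, ← hc, two_smul, ← mul_assoc, add_assoc]
  have h4 : i * (X * X * X) = X * X * X * i + (3 : ℂ) • (X * X * ν) := by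
    rw [← mul_assoc, h2, add_mul, mul_assoc _ i X, h1, mul_add, smul_mul_assoc, mul_assoc X ν X,
      ← hc, ← mul_assoc, ← mul_assoc, add_assoc, ← one_smul ℂ (X * X * ν), smul_smul, ← add_smul]
    norm_num
  rw [eOp_eq_sum, ← hX]
  simp only [Finset.sum_range_succ, Finset.sum_range_zero, pow_succ, pow_zero, one_mul, zero_add]
  simp only [pow_succ, pow_zero, one_mul] at h3
  simp only [Nat.factorial]
  simp only [mul_add, add_mul, mul_smul_comm, smul_mul_assoc, h1, h2, h4, mul_one, one_mul, h3]
  push_cast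
  module

theorem int_eOp_apply (v : V) (β : Form V ℂ 2) (Φ : Polyform V) :
    intOp v (eOp β Φ) = eOp β (intOp v Φ + wedOp (contractC v β) Φ) := by
  have := congrArg (fun f => f Φ) (int_eOp v β)
  simpa only [Module.End.mul_apply, LinearMap.add_apply] using this

theorem eOp_mem_degGE {β : Form V ℂ 2} {Φ : Polyform V} {m : ℕ} (h : Φ ∈ degGE m) :
    eOp β Φ ∈ degGE m := by
  have h1 : ∀ n, (twoOp β ^ n) Φ ∈ degGE m := by
    intro n
    induction n with
    | zero => simpa using h
    | succ n ih =>
      rw [pow_succ', Module.End.mul_apply]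
      exact fun k hk => twoOp_mem_degGE ih k (by omega)
  rw [eOp_eq_sum, LinearMap.sum_apply]
  exact Submodule.sum_mem _ fun n _ => Submodule.smul_mem _ _ (h1 n)

theorem eOp_apply_zero (β : Form V ℂ 2) (Φ : Polyform V) : eOp β Φ 0 = Φ 0 := by
  have h : ∀ Ψ : Polyform V, twoOp β Ψ 0 = 0 := fun Ψ =>
    twoOp_mem_degGE (mem_degGE_zero Ψ) 0 (by omega)
  rw [eOp_eq_sum]
  simp [Finset.sum_range_succ, pow_succ, h]

/-! ### The top degree functional -/

/-- The value of the top degree component on a basis. -/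
def topAt (u : Module.Basis (Fin 6) ℝ V) : Polyform V →ₗ[ℂ] ℂ where
  toFun Φ := Φ 6 u
  map_add' _ _ := rfl
  map_smul' _ _ := rfl

theorem topAt_apply (u : Module.Basis (Fin 6) ℝ V) (Φ : Polyform V) : topAt u Φ = Φ 6 u := rfl

theorem form_eq_zero_of_basis {F : Type*} [NormedAddCommGroup F] [NormedSpace ℝ F]
    (u : Module.Basis (Fin 6) ℝ V) (φ : Form V F 6) (h : φ u = 0) : φ = 0 := by
  have := Module.Basis.ext_alternating (f := φ.toAlternatingMap) (g := 0) u fun v hv => by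
    have hb : Function.Bijective v := Finite.injective_iff_bijective.mp hv
    have h1 := φ.toAlternatingMap.map_perm u (Equiv.ofBijective v hb)
    have h2 : φ.toAlternatingMap u = 0 := h
    rw [h2, smul_zero] at h1
    exact h1
  ext w
  exact congrArg (fun f => f w) this

theorem topAt_int (u : Module.Basis (Fin 6) ℝ V) (v : V) (Φ : Polyform V) :
    topAt u (intOp v Φ) = 0 := by
  rw [topAt_apply, intOp_component (form_eq_zero_of_finrank_lt (by rw [hd.out]; norm_num) (Φ 7))]
  rfl

theorem eq_zero_of_wed {Φ : Polyform V} {k : ℕ} (hk : k < 6)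
    (h : ∀ ν : V →L[ℝ] ℝ, wedOp (Complex.ofRealCLM.comp ν) Φ (k + 1) = 0) : Φ k = 0 := by
  have hN : ∀ (k : ℕ) (Φ : Polyform V), (∑ a, wedOp (Complex.ofRealCLM.comp (dualBas a))
      (intOp (bas V a) Φ)) k = (k : ℂ) • Φ k := by
    intro k
    induction k with
    | zero => intro Φ; simp [wedOp_apply_zero]
    | succ k ih =>
      intro Φ
      rw [← sub_eq_zero]
      refine component_eq_zero (Φ := (∑ a, wedOp (Complex.ofRealCLM.comp (dualBas a))
        (intOp (bas V a) Φ)) - ((k + 1 : ℕ) : ℂ) • Φ) fun v => ?_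
      rw [map_sub, map_sum, map_smul]
      have h1 : ∀ a, intOp v (wedOp (Complex.ofRealCLM.comp (dualBas a)) (intOp (bas V a) Φ))
          = ((dualBas (V := V) a v : ℝ) : ℂ) • intOp (bas V a) Φ
            + wedOp (Complex.ofRealCLM.comp (dualBas a)) (intOp (bas V a) (intOp v Φ)) := by
        intro a
        rw [int_wed']
        have : intOp v (intOp (bas V a) Φ) = -intOp (bas V a) (intOp v Φ) := by
          have := congrArg (fun f => f Φ) (int_anticomm v (bas V a))
          simpa using this
        rw [this, map_neg, sub_neg_eq_add]
        rfl
      have h2 : ∑ a, ((dualBas (V := V) a v : ℝ) : ℂ) • intOp (bas V a) Φ = intOp v Φ := by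
        conv_rhs => rw [← sum_dualBas_smul v]
        have := map_sum (intHom (V := V)) (fun a => dualBas (V := V) a v • bas V a) Finset.univ
        change intOp _ = ∑ a, intOp _ at this
        rw [this, LinearMap.sum_apply]
        exact Finset.sum_congr rfl fun a _ => by rw [intOp_smul]; rfl
      simp only [h1, Finset.sum_add_distrib, h2]
      rw [Pi.sub_apply, Pi.add_apply, ih, Pi.smul_apply]
      push_cast
      module
  have h2 : (∑ a, intOp (bas V a) (wedOp (Complex.ofRealCLM.comp (dualBas a)) Φ)) k
      = ((6 : ℂ) - k) • Φ k := by
    have : ∀ a, intOp (bas V a) (wedOp (Complex.ofRealCLM.comp (dualBas a)) Φ)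
        = Φ - wedOp (Complex.ofRealCLM.comp (dualBas a)) (intOp (bas V a) Φ) := by
      intro a
      rw [int_wed']
      simp [dualBas_apply_bas]
    simp only [this, Finset.sum_sub_distrib]
    rw [Pi.sub_apply, hN]
    simp [hd.out]
    module
  have h3 : (∑ a, intOp (bas V a) (wedOp (Complex.ofRealCLM.comp (dualBas a)) Φ)) k = 0 := by
    rw [Finset.sum_apply]
    exact Finset.sum_eq_zero fun a _ => intOp_component (h _)
  rw [h3] at h2
  have h4 : ((6 : ℂ) - k) ≠ 0 := by
    intro h0
    have : (k : ℂ) = 6 := by linear_combination -h0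
    have : k = 6 := by exact_mod_cast this
    omega
  exact (smul_eq_zero.mp h2.symm).resolve_left h4

/-- The functional `Φ ↦ [e^β ∧ Φ]₆`, evaluated on a basis. -/
def tau (u : Module.Basis (Fin 6) ℝ V) (β : Form V ℂ 2) : Polyform V →ₗ[ℂ] ℂ :=
  topAt u ∘ₗ eOp β

theorem tau_apply (u : Module.Basis (Fin 6) ℝ V) (β : Form V ℂ 2) (Φ : Polyform V) :
    tau u β Φ = eOp β Φ 6 u := rfl

theorem tau_int (u : Module.Basis (Fin 6) ℝ V) (β : Form V ℂ 2) (v : V) (Φ : Polyform V) :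
    tau u β (intOp v Φ + wedOp (contractC v β) Φ) = 0 := by
  rw [tau, LinearMap.comp_apply, ← int_eOp_apply, topAt_int]

/-- A polyform `Φ` vanishes if the functional `[e^β ∧ ·]₆` vanishes on all the polyforms obtained
from `Φ` by the Clifford action of a complement of its left kernel. -/
theorem eq_zero_of_words (u : Module.Basis (Fin 6) ℝ V) (β : Form V ℂ 2)
    (l lb : GenVec V → Module.End ℂ (Polyform V))
    (h1 : ∀ W Φ, tau u β (l W Φ) = 0)
    (h2 : ∀ W Z, ∃ s : ℂ, ∀ Φ, lb Z (l W Φ) = s • Φ - l W (lb Z Φ))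
    (h3 : ∀ W, (2 : ℂ) • cl W = l W + lb W) (Φ : Polyform V)
    (h : ∀ L : List (GenVec V), tau u β ((L.map lb).prod Φ) = 0) : Φ = 0 := by
  let N : Set (Polyform V) := {Φ | ∀ L : List (GenVec V), tau u β ((L.map lb).prod Φ) = 0}
  have hlb : ∀ Φ ∈ N, ∀ W, lb W Φ ∈ N := by
    intro Φ hΦ W L
    have := hΦ (L ++ [W])
    simpa using this
  have hl : ∀ (L : List (GenVec V)) (Φ : Polyform V), Φ ∈ N → ∀ W,
      tau u β ((L.map lb).prod (l W Φ)) = 0 := by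
    intro L
    induction L using List.reverseRecOn with
    | nil => intro Φ _ W; simpa using h1 W Φ
    | append_singleton L Z ih =>
      intro Φ hΦ W
      obtain ⟨s, hs⟩ := h2 W Z
      have hΦL : tau u β ((L.map lb).prod Φ) = 0 := hΦ L
      simp [hs, hΦL, ih _ (hlb Φ hΦ Z) W]
  -- `N` is stable under the Clifford action, so its elements can be tested degree by degree
  have hcl : ∀ Φ ∈ N, ∀ W, cl W Φ ∈ N := by
    intro Φ hΦ W L
    have e : cl W Φ = (1 / 2 : ℂ) • (l W Φ + lb W Φ) := by
      rw [← LinearMap.add_apply, ← h3, LinearMap.smul_apply, smul_smul]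
      norm_num
    have h5 : tau u β ((L.map lb).prod (lb W Φ)) = 0 := hlb Φ hΦ W L
    rw [e, map_smul, map_add, map_smul, map_add, hl L Φ hΦ W, h5]
    simp
  have hdeg : ∀ j ≤ 6, ∀ Φ ∈ N, eOp β Φ (6 - j) = 0 := by
    intro j
    induction j with
    | zero =>
      intro _ Φ hΦ
      exact form_eq_zero_of_basis u _ (hΦ [])
    | succ j ih =>
      intro hj Φ hΦ
      refine eq_zero_of_wed (by omega) fun ν => ?_
      have := ih (by omega) _ (hcl Φ hΦ (0, ν))
      rw [cl_form, ← Module.End.mul_apply, (eOp_wed β _).eq, Module.End.mul_apply] at this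
      rwa [show 6 - (j + 1) + 1 = 6 - j by omega]
  have hz : eOp β Φ = 0 := by
    funext k
    rcases Nat.lt_or_ge 6 k with hk | hk
    · exact mem_degLE_six _ k hk
    · have := hdeg (6 - k) (by omega) Φ h
      rwa [show 6 - (6 - k) = k by omega] at this
  have := congrArg (fun f => f Φ) (eOp_neg_mul β)
  simp only [Module.End.mul_apply, Module.End.one_apply, hz, map_zero] at this
  exact this.symm

end Exponential

/-! ### The Lie algebra action and unitary frames -/

section Frames

variable {V : Type*} [NormedAddCommGroup V] [NormedSpace ℝ V] [FiniteDimensional ℝ V]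

/-- The operator `algAct J`. -/
def algOp (J : GenVec V →ₗ[ℝ] GenVec V) : Module.End ℂ (Polyform V) :=
  (1 / 2 : ℂ) • ∑ a, (cl (J (bas V a, 0)) * cl (0, dualBas a)
    + cl (J (0, dualBas a)) * cl (bas V a, 0))

theorem algAct_eq (J : GenVec V →ₗ[ℝ] GenVec V) (Φ : Polyform V) : algAct J Φ = algOp J Φ := by
  simp only [algAct, algOp, LinearMap.smul_apply, LinearMap.sum_apply, LinearMap.add_apply,
    Module.End.mul_apply, cl_apply]

theorem pair_vec (v : V) (W : GenVec V) : 2 * pairing ((v, 0) : GenVec V) W = W.2 v := by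
  simp [pairing]; ring

theorem pair_form (ν : V →L[ℝ] ℝ) (W : GenVec V) : 2 * pairing ((0, ν) : GenVec V) W = ν W.1 := by
  simp [pairing]; ring

/-- The expansion of a generalized vector in the basis `e_a`, `e^a`. -/
theorem genVec_expand (W : GenVec V) :
    W = ∑ a, ((dualBas (V := V) a W.1) • ((bas V a, 0) : GenVec V)
      + (W.2 (bas V a)) • ((0, dualBas a) : GenVec V)) := by
  refine Prod.ext ?_ ?_
  · rw [Prod.fst_sum]
    simp [sum_dualBas_smul]
  · rw [Prod.snd_sum]
    simp [sum_dualBas_real]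

/-- The sum defining the Lie algebra action does not depend on the choice of dual bases of
`V ⊕ V*`. -/
theorem algOp_eq_sum {ι : Type*} [Fintype ι] (f g : ι → GenVec V)
    (hfg : ∀ W, W = ∑ k, (2 * pairing W (f k)) • g k) (J : GenVec V →ₗ[ℝ] GenVec V) :
    algOp J = (1 / 2 : ℂ) • ∑ k, cl (J (f k)) * cl (g k) := by
  have hcl : ∀ (c : ι → ℝ) (h : ι → GenVec V), cl (∑ k, c k • h k) = ∑ k, (c k : ℂ) • cl (h k) := by
    intro c h
    rw [map_sum]
    exact Finset.sum_congr rfl fun k _ => cl_smul _ _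
  have e : ∀ k, cl (J (f k)) = ∑ a, (((dualBas (V := V) a (f k).1 : ℝ) : ℂ) • cl (J (bas V a, 0))
      + (((f k).2 (bas V a) : ℝ) : ℂ) • cl (J (0, dualBas a))) := by
    intro k
    conv_lhs => rw [genVec_expand (f k)]
    rw [map_sum, map_sum]
    refine Finset.sum_congr rfl fun a _ => ?_
    rw [map_add, map_smul, map_smul, map_add, cl_smul, cl_smul]
  rw [algOp]
  congr 1
  simp only [e, Finset.sum_mul]
  rw [Finset.sum_comm]
  refine Finset.sum_congr rfl fun a _ => ?_
  have e1 : cl (0, dualBas (V := V) a) = ∑ k, ((2 * pairing (0, dualBas a) (f k) : ℝ) : ℂ) •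
      cl (g k) := by
    rw [← hcl, ← hfg]
  have e2 : cl (bas V a, 0) = ∑ k, ((2 * pairing (bas V a, 0) (f k) : ℝ) : ℂ) • cl (g k) := by
    rw [← hcl, ← hfg]
  rw [e1, e2]
  simp only [pair_vec, pair_form, Finset.mul_sum, add_mul, Finset.sum_add_distrib, smul_mul_assoc,
    mul_smul_comm]

theorem cl_cl_apply (W Z : GenVec V) (Φ : Polyform V) :
    cl W (cl Z Φ) = ((2 * pairing W Z : ℝ) : ℂ) • Φ - cl Z (cl W Φ) := by
  have := congrArg (fun f => f Φ) (cl_cl W Z)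
  simp only [LinearMap.add_apply, Module.End.mul_apply, LinearMap.smul_apply,
    Module.End.one_apply] at this
  rw [← this]; abel

/-- The Lie algebra action is characterised by `[J ·, W ·] = (J W) ·`. -/
theorem algOp_cl (J : GenVec V →ₗ[ℝ] GenVec V)
    (hJ : ∀ W Z, pairing (J W) Z = -pairing W (J Z)) (W : GenVec V) (Φ : Polyform V) :
    algOp J (cl W Φ) = cl W (algOp J Φ) + cl (J W) Φ := by
  have h2 : ∀ W Z, 2 * pairing (J W) Z = -(2 * pairing W (J Z)) := fun W Z => by rw [hJ]; ring
  have key : ∀ X Y : GenVec V, cl (J X) (cl Y (cl W Φ)) = cl W (cl (J X) (cl Y Φ))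
      + ((2 * pairing Y W : ℝ) : ℂ) • cl (J X) Φ + ((2 * pairing X (J W) : ℝ) : ℂ) • cl Y Φ := by
    intro X Y
    rw [cl_cl_apply Y W, map_sub, map_smul, cl_cl_apply (J X) W, h2]
    push_cast
    module
  simp only [algOp, LinearMap.smul_apply, LinearMap.sum_apply, LinearMap.add_apply,
    Module.End.mul_apply, key, pair_vec, pair_form, map_smul, map_sum, map_add]
  have e1 : cl (J W) Φ = ∑ a, (((dualBas (V := V) a W.1 : ℝ) : ℂ) • cl (J (bas V a, 0)) Φ
      + ((W.2 (bas V a) : ℝ) : ℂ) • cl (J (0, dualBas a)) Φ) := by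
    conv_lhs => rw [genVec_expand W]
    rw [map_sum, map_sum, LinearMap.sum_apply]
    refine Finset.sum_congr rfl fun a _ => ?_
    rw [map_add, map_smul, map_smul, map_add, cl_smul, cl_smul]
    rfl
  have e2 : cl (J W) Φ = ∑ a, (((dualBas (V := V) a (J W).1 : ℝ) : ℂ) • cl (bas V a, 0) Φ
      + (((J W).2 (bas V a) : ℝ) : ℂ) • cl (0, dualBas a) Φ) := by
    conv_lhs => rw [genVec_expand (J W)]
    rw [map_sum, LinearMap.sum_apply]
    refine Finset.sum_congr rfl fun a _ => ?_
    rw [map_add, cl_smul, cl_smul]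
    rfl
  have e3 : cl (J W) Φ = (1 / 2 : ℂ) • (cl (J W) Φ + cl (J W) Φ) := by module
  rw [e3]
  conv_rhs =>
    congr
    · skip
    · congr
      · skip
      · congr
        · rw [e1]
        · rw [e2]
  rw [← smul_add, ← Finset.sum_add_distrib, ← Finset.sum_add_distrib]
  congr 1
  refine Finset.sum_congr rfl fun a _ => ?_
  abel

/-- A pair of commuting generalized almost complex structures, compatible with the pairing, such
that `-J₋ J₊` is positive definite. -/
structure IsGenKahler (Jm Jp : GenVec V →ₗ[ℝ] GenVec V) : Prop where
  sq_m : ∀ W, Jm (Jm W) = -W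
  sq_p : ∀ W, Jp (Jp W) = -W
  comm : ∀ W, Jm (Jp W) = Jp (Jm W)
  skew_m : ∀ W Z, pairing (Jm W) Z = -pairing W (Jm Z)
  skew_p : ∀ W Z, pairing (Jp W) Z = -pairing W (Jp Z)
  pos : ∀ W, W ≠ 0 → 0 < pairing (-(Jm (Jp W))) W

variable {Jm Jp : GenVec V →ₗ[ℝ] GenVec V}

/-- The generalized metric of a pair of structures. -/
def gOf (Jm Jp : GenVec V →ₗ[ℝ] GenVec V) : GenVec V →ₗ[ℝ] GenVec V := -(Jm ∘ₗ Jp)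

theorem gOf_apply (W : GenVec V) : gOf Jm Jp W = -(Jm (Jp W)) := rfl

namespace IsGenKahler

variable (h : IsGenKahler Jm Jp)
include h

theorem g_g (W : GenVec V) : gOf Jm Jp (gOf Jm Jp W) = W := by
  simp only [gOf_apply, map_neg, h.comm, neg_neg, h.sq_p, h.sq_m]

theorem g_m (W : GenVec V) : gOf Jm Jp (Jm W) = Jm (gOf Jm Jp W) := by
  simp only [gOf_apply, map_neg, ← h.comm]

theorem g_p (W : GenVec V) : gOf Jm Jp (Jp W) = Jp (gOf Jm Jp W) := by
  simp only [gOf_apply, map_neg, h.comm]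

theorem g_symm (W Z : GenVec V) : pairing (gOf Jm Jp W) Z = pairing W (gOf Jm Jp Z) := by
  simp only [gOf_apply, pairing_neg_left, pairing_neg_right, h.skew_m, h.skew_p, h.comm, neg_neg]

theorem m_m (W Z : GenVec V) : pairing (Jm W) (Jm Z) = pairing W Z := by
  rw [h.skew_m, h.sq_m, pairing_neg_right, neg_neg]

theorem p_p (W Z : GenVec V) : pairing (Jp W) (Jp Z) = pairing W Z := by
  rw [h.skew_p, h.sq_p, pairing_neg_right, neg_neg]

theorem m_of_g {W : GenVec V} {s : ℝ} (hW : gOf Jm Jp W = s • W) : Jp W = s • Jm W := by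
  have := congrArg Jm hW
  rwa [gOf_apply, map_neg, h.sq_m, neg_neg, map_smul] at this

end IsGenKahler

/-- A frame of `V ⊕ V*` that is adapted to the pair `Jm`, `Jp`: the vectors `c i`, `Jm (c i)` form an
orthonormal basis of the positive definite eigenspace of the generalized metric, and `d i`,
`Jm (d i)` one of the negative definite eigenspace. -/
structure IsAdapted (Jm Jp : GenVec V →ₗ[ℝ] GenVec V) (c d : Fin 3 → GenVec V) : Prop where
  p_c : ∀ i, Jp (c i) = Jm (c i)
  p_d : ∀ i, Jp (d i) = -Jm (d i)
  cc : ∀ i j, pairing (c i) (c j) = if i = j then 1 else 0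
  cmc : ∀ i j, pairing (c i) (Jm (c j)) = 0
  dd : ∀ i j, pairing (d i) (d j) = if i = j then -1 else 0
  dmd : ∀ i j, pairing (d i) (Jm (d j)) = 0
  expand : ∀ W, W = (∑ i, (pairing W (c i) • c i + pairing W (Jm (c i)) • Jm (c i)))
    - ∑ i, (pairing W (d i) • d i + pairing W (Jm (d i)) • Jm (d i))

/-- The operator `c₁ (J c₁) c₂ (J c₂) c₃ (J c₃)`, a generalized Hodge operator. -/
def hodge (Jm : GenVec V →ₗ[ℝ] GenVec V) (c : Fin 3 → GenVec V) : Module.End ℂ (Polyform V) :=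
  cl (c 0) * cl (Jm (c 0)) * (cl (c 1) * cl (Jm (c 1))) * (cl (c 2) * cl (Jm (c 2)))

theorem hodge_apply (c : Fin 3 → GenVec V) (Φ : Polyform V) :
    hodge Jm c Φ = cl (c 0) (cl (Jm (c 0)) (cl (c 1) (cl (Jm (c 1)) (cl (c 2)
      (cl (Jm (c 2)) Φ))))) := rfl

section Adapted

variable (h : IsGenKahler Jm Jp) {c d : Fin 3 → GenVec V} (ha : IsAdapted Jm Jp c d)
include h ha

theorem algOp_m_apply (Φ : Polyform V) : algOp Jm Φ =
    (1 / 2 : ℂ) • (∑ i, cl (d i) (cl (Jm (d i)) Φ) - ∑ i, cl (c i) (cl (Jm (c i)) Φ)) := by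
  rw [algOp_eq_sum (ι := (Fin 3 ⊕ Fin 3) ⊕ (Fin 3 ⊕ Fin 3))
    (Sum.elim (Sum.elim c fun i => Jm (c i)) (Sum.elim d fun i => Jm (d i)))
    (Sum.elim (Sum.elim (fun i => (1 / 2 : ℝ) • c i) fun i => (1 / 2 : ℝ) • Jm (c i))
      (Sum.elim (fun i => (-1 / 2 : ℝ) • d i) fun i => (-1 / 2 : ℝ) • Jm (d i)))]
  · simp only [Fintype.sum_sum_type, Sum.elim_inl, Sum.elim_inr, cl_smul, h.sq_m, map_neg,
      LinearMap.smul_apply, LinearMap.add_apply, LinearMap.sum_apply, Module.End.mul_apply,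
      LinearMap.neg_apply, mul_smul_comm]
    have hc : ∀ i, cl (Jm (c i)) (cl (c i) Φ) = -cl (c i) (cl (Jm (c i)) Φ) := by
      intro i
      rw [cl_cl_apply, pairing_comm, ha.cmc]; simp
    have hd : ∀ i, cl (Jm (d i)) (cl (d i) Φ) = -cl (d i) (cl (Jm (d i)) Φ) := by
      intro i
      rw [cl_cl_apply, pairing_comm, ha.dmd]; simp
    simp only [hc, hd, Fin.sum_univ_three]
    push_cast
    module
  · intro W
    conv_lhs => rw [ha.expand W]
    simp only [Fintype.sum_sum_type, Sum.elim_inl, Sum.elim_inr, Fin.sum_univ_three]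
    module

omit h ha in
theorem cl_sq_apply (W : GenVec V) (Φ : Polyform V) :
    cl W (cl W Φ) = ((pairing W W : ℝ) : ℂ) • Φ := by
  have := congrArg (fun f => f Φ) (cl_sq W)
  simp only [Module.End.mul_apply, LinearMap.smul_apply, Module.End.one_apply] at this
  rw [this, pairing, add_self_div_two]

theorem cl_c_sq (i : Fin 3) (Φ : Polyform V) : cl (c i) (cl (c i) Φ) = Φ := by
  rw [cl_sq_apply, ha.cc, if_pos rfl]; simp

theorem cl_mc_sq (i : Fin 3) (Φ : Polyform V) : cl (Jm (c i)) (cl (Jm (c i)) Φ) = Φ := by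
  rw [cl_sq_apply, h.m_m, ha.cc, if_pos rfl]; simp

theorem cl_d_sq (i : Fin 3) (Φ : Polyform V) : cl (d i) (cl (d i) Φ) = -Φ := by
  rw [cl_sq_apply, ha.dd, if_pos rfl]; simp

theorem cl_md_sq (i : Fin 3) (Φ : Polyform V) : cl (Jm (d i)) (cl (Jm (d i)) Φ) = -Φ := by
  rw [cl_sq_apply, h.m_m, ha.dd, if_pos rfl]; simp

omit h ha in
theorem cl_anti {W Z : GenVec V} (hWZ : pairing W Z = 0) (Φ : Polyform V) :
    cl W (cl Z Φ) = -cl Z (cl W Φ) := by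
  rw [cl_cl_apply, hWZ]; simp

theorem hodge_of_orth {W : GenVec V} (h1 : ∀ i, pairing W (c i) = 0)
    (h2 : ∀ i, pairing W (Jm (c i)) = 0) (Φ : Polyform V) :
    hodge Jm c (cl W Φ) = cl W (hodge Jm c Φ) := by
  simp only [hodge_apply]
  have a1 : ∀ i Ψ, cl (c i) (cl W Ψ) = -cl W (cl (c i) Ψ) := fun i Ψ =>
    cl_anti (by rw [pairing_comm]; exact h1 i) Ψ
  have a2 : ∀ i Ψ, cl (Jm (c i)) (cl W Ψ) = -cl W (cl (Jm (c i)) Ψ) := fun i Ψ =>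
    cl_anti (by rw [pairing_comm]; exact h2 i) Ψ
  simp only [a1, a2, map_neg, neg_neg]

theorem pair_cl_c (i j : Fin 3) (Φ : Polyform V) :
    cl (c j) (cl (Jm (c j)) (cl (c i) Φ))
      = (if i = j then -1 else 1 : ℂ) • cl (c i) (cl (c j) (cl (Jm (c j)) Φ)) := by
  rw [cl_anti (W := Jm (c j)) (Z := c i) (by rw [pairing_comm, ha.cmc]), map_neg]
  split_ifs with hij
  · rw [hij, neg_one_smul]
  · rw [cl_anti (W := c j) (Z := c i) (by rw [ha.cc, if_neg (Ne.symm hij)]), neg_neg, one_smul]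

theorem pair_cl_mc (i j : Fin 3) (Φ : Polyform V) :
    cl (c j) (cl (Jm (c j)) (cl (Jm (c i)) Φ))
      = (if i = j then -1 else 1 : ℂ) • cl (Jm (c i)) (cl (c j) (cl (Jm (c j)) Φ)) := by
  split_ifs with hij
  · rw [hij, cl_anti (W := c j) (Z := Jm (c j)) (by rw [ha.cmc]), neg_one_smul]
  · rw [cl_anti (W := Jm (c j)) (Z := Jm (c i)) (by rw [h.m_m, ha.cc, if_neg (Ne.symm hij)]),
      map_neg, cl_anti (W := c j) (Z := Jm (c i)) (by rw [ha.cmc]), neg_neg, one_smul]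

theorem hodge_c (i : Fin 3) (Φ : Polyform V) :
    hodge Jm c (cl (c i) Φ) = -cl (c i) (hodge Jm c Φ) := by
  simp only [hodge_apply, pair_cl_c h ha, map_smul, smul_smul]
  fin_cases i <;> simp

theorem hodge_mc (i : Fin 3) (Φ : Polyform V) :
    hodge Jm c (cl (Jm (c i)) Φ) = -cl (Jm (c i)) (hodge Jm c Φ) := by
  simp only [hodge_apply, pair_cl_mc h ha, map_smul, smul_smul]
  fin_cases i <;> simp

theorem c_orth_d (i j : Fin 3) : pairing (d i) (c j) = 0 := by
  have h1 : gOf Jm Jp (d i) = -d i := by rw [gOf_apply, ha.p_d, map_neg, h.sq_m, neg_neg]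
  have h2 : gOf Jm Jp (c j) = c j := by rw [gOf_apply, ha.p_c, h.sq_m, neg_neg]
  have := h.g_symm (d i) (c j)
  rw [h1, h2, pairing_neg_left] at this
  linarith

theorem c_orth_md (i j : Fin 3) : pairing (Jm (d i)) (c j) = 0 := by
  have h1 : gOf Jm Jp (Jm (d i)) = -Jm (d i) := by
    rw [h.g_m, gOf_apply, ha.p_d, map_neg, h.sq_m, neg_neg]
  have h2 : gOf Jm Jp (c j) = c j := by rw [gOf_apply, ha.p_c, h.sq_m, neg_neg]
  have := h.g_symm (Jm (d i)) (c j)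
  rw [h1, h2, pairing_neg_left] at this
  linarith

/-- The generalized Hodge operator intertwines the Clifford action with `-G`. -/
theorem hodge_cl (W : GenVec V) (Φ : Polyform V) :
    hodge Jm c (cl W Φ) = -cl (gOf Jm Jp W) (hodge Jm c Φ) := by
  have g_c : ∀ i, gOf Jm Jp (c i) = c i := fun i => by rw [gOf_apply, ha.p_c, h.sq_m, neg_neg]
  have g_d : ∀ i, gOf Jm Jp (d i) = -d i := fun i => by
    rw [gOf_apply, ha.p_d, map_neg, h.sq_m, neg_neg]
  have e1 : ∀ i, hodge Jm c (cl (d i) Φ) = cl (d i) (hodge Jm c Φ) := fun i =>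
    hodge_of_orth h ha (fun j => c_orth_d h ha i j)
      (fun j => by rw [← neg_eq_zero, ← h.skew_m]; exact c_orth_md h ha i j) Φ
  have e2 : ∀ i, hodge Jm c (cl (Jm (d i)) Φ) = cl (Jm (d i)) (hodge Jm c Φ) := fun i =>
    hodge_of_orth h ha (fun j => c_orth_md h ha i j)
      (fun j => by rw [h.m_m]; exact c_orth_d h ha i j) Φ
  rw [ha.expand W]
  simp only [map_sub, map_sum, map_add, map_smul, h.g_m, g_c, g_d, cl_smul, LinearMap.sub_apply,
    LinearMap.sum_apply, LinearMap.add_apply, LinearMap.smul_apply, e1, e2, hodge_c h ha,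
    hodge_mc h ha, map_neg, LinearMap.neg_apply, smul_neg, Fin.sum_univ_three]
  abel

theorem hodge_hodge (Φ : Polyform V) : hodge Jm c (hodge Jm c Φ) = -Φ := by
  have e : ∀ i Ψ, hodge Jm c (cl (c i) (cl (Jm (c i)) Ψ))
      = cl (c i) (cl (Jm (c i)) (hodge Jm c Ψ)) := by
    intro i Ψ
    rw [hodge_c h ha, hodge_mc h ha, map_neg, neg_neg]
  have e1 : ∀ i Ψ, cl (c i) (cl (Jm (c i)) (cl (c i) (cl (Jm (c i)) Ψ))) = -Ψ := by
    intro i Ψ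
    rw [pair_cl_c h ha, if_pos rfl, cl_mc_sq h ha, cl_c_sq h ha, neg_one_smul]
  have e2 : ∀ i j Ψ, i ≠ j → cl (c i) (cl (Jm (c i)) (cl (c j) (cl (Jm (c j)) Ψ)))
      = cl (c j) (cl (Jm (c j)) (cl (c i) (cl (Jm (c i)) Ψ))) := by
    intro i j Ψ hij
    rw [pair_cl_c h ha, pair_cl_mc h ha, if_neg hij.symm, one_smul, one_smul]
  conv_lhs => rw [hodge_apply (Φ := Φ)]
  rw [e, e, e, hodge_apply, e2 2 0 _ (by decide), e2 2 1 _ (by decide), e1 2, map_neg, map_neg,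
    e2 1 0 _ (by decide), map_neg, map_neg, e1 1]
  simp only [map_neg, neg_neg, e1]

/-- On the vacuum of `Jp` the operator `Jm ·` vanishes. -/
theorem algOp_m_vacuum {Ω : Polyform V} (hΩ : ∀ W, cl W Ω = Complex.I • cl (Jp W) Ω) :
    algOp Jm Ω = 0 := by
  have e1 : ∀ i, cl (c i) (cl (Jm (c i)) Ω) = -Complex.I • Ω := by
    intro i
    have := hΩ (Jm (c i))
    rw [← h.comm, ha.p_c, h.sq_m, map_neg, LinearMap.neg_apply] at this
    rw [this, map_smul, map_neg, cl_c_sq h ha]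
    module
  have e2 : ∀ i, cl (d i) (cl (Jm (d i)) Ω) = -Complex.I • Ω := by
    intro i
    have := hΩ (Jm (d i))
    rw [← h.comm, ha.p_d, map_neg, h.sq_m, neg_neg] at this
    rw [this, map_smul, cl_d_sq h ha]
    module
  rw [algOp_m_apply h ha]
  simp only [e1, e2, sub_self, smul_zero]

/-- On the vacuum of `Jp` each factor `c (J c)` of the generalized Hodge operator acts as a scalar,
because `Jp` and `Jm` agree on `c`. -/
theorem hodge_vacuum {Ω : Polyform V} (hΩ : ∀ W, cl W Ω = Complex.I • cl (Jp W) Ω) :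
    hodge Jm c Ω = Complex.I • Ω := by
  have e1 : ∀ i, cl (c i) (cl (Jm (c i)) Ω) = -Complex.I • Ω := by
    intro i
    have := hΩ (Jm (c i))
    rw [← h.comm, ha.p_c, h.sq_m, map_neg, LinearMap.neg_apply] at this
    rw [this, map_smul, map_neg, cl_c_sq h ha]
    module
  rw [hodge_apply, e1, map_smul, map_smul, e1, map_smul, map_smul, map_smul, map_smul, e1,
    smul_smul, smul_smul]
  congr 1
  linear_combination -Complex.I * Complex.I_sq

/-- A functional with left kernel containing the annihilator of `Jp` vanishes on the image of
`Jm ·`. -/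
theorem functional_algOp_m {t : Polyform V →ₗ[ℂ] ℂ}
    (ht : ∀ W Φ, t (cl W Φ) = Complex.I * t (cl (Jp W) Φ)) (Φ : Polyform V) :
    t (algOp Jm Φ) = 0 := by
  have e1 : ∀ i, t (cl (c i) (cl (Jm (c i)) Φ)) = Complex.I * t Φ := by
    intro i
    rw [ht, ha.p_c, cl_mc_sq h ha]
  have e2 : ∀ i, t (cl (d i) (cl (Jm (d i)) Φ)) = Complex.I * t Φ := by
    intro i
    rw [ht, ha.p_d, map_neg, LinearMap.neg_apply, cl_md_sq h ha, neg_neg]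
  rw [algOp_m_apply h ha, map_smul, map_sub, map_sum, map_sum]
  simp only [e1, e2, sub_self, smul_zero]

/-- The statement dual to the action of the generalized Hodge operator on the vacuum. -/
theorem functional_hodge {t : Polyform V →ₗ[ℂ] ℂ}
    (ht : ∀ W Φ, t (cl W Φ) = Complex.I * t (cl (Jp W) Φ)) (Φ : Polyform V) :
    t (hodge Jm c Φ) = -Complex.I * t Φ := by
  have e1 : ∀ i Φ, t (cl (c i) (cl (Jm (c i)) Φ)) = Complex.I * t Φ := by
    intro i Φ
    rw [ht, ha.p_c, cl_mc_sq h ha]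
  rw [hodge_apply, e1, e1, e1]
  linear_combination Complex.I * t Φ * Complex.I_sq

end Adapted

end Frames

/-! ### The pure spinor of type zero -/

section TypeZero

variable {V : Type*} [NormedAddCommGroup V] [NormedSpace ℝ V]

theorem contract_sub (v : V) (β γ : Form V ℝ 2) :
    contract v (β - γ) = contract v β - contract v γ := by
  ext w; rw [sub_apply]; rfl

theorem contract_smul (v : V) (c : ℝ) (β : Form V ℝ 2) :
    contract v (c • β) = c • contract v β := by
  ext w; rw [smul_apply]; rfl

/-- The contraction of a real two-form as a linear map in the vector. -/
def contractHom (β : Form V ℝ 2) : V →ₗ[ℝ] V →L[ℝ] ℝ where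
  toFun v := contract v β
  map_add' v w := by ext u; simp only [contract, map_add]; rfl
  map_smul' c v := by ext u; simp only [contract, map_smul]; rfl

theorem contractHom_apply (β : Form V ℝ 2) (v : V) : contractHom β v = contract v β := rfl

theorem contract_skew (β : Form V ℝ 2) (v w : V) : contract v β w = -contract w β v := by
  rw [contract_apply, contract_apply, twoForm_skew]

theorem contract_self (β : Form V ℝ 2) (v : V) : contract v β v = 0 := by
  have := contract_skew β v v
  linarith

theorem contractC_cplx [FiniteDimensional ℝ V] (v : V) (β : Form V ℝ 2) :
    contractC v (cplx β) = Complex.ofRealCLM.comp (contract v β) := by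
  ext w
  rw [contractC_apply, ContinuousLinearMap.comp_apply, contract_apply]
  rfl

/-- The structure `Jp` of the pure spinor `e^{-b + iω}`: `X + X ⌟ b` is mapped to `X ⌟ ω`. -/
structure IsTypeZero (Jp : GenVec V →ₗ[ℝ] GenVec V) (b om : Form V ℝ 2) : Prop where
  sq : ∀ W, Jp (Jp W) = -W
  vec : ∀ X, Jp (X, contract X b) = (0, contract X om)

variable [FiniteDimensional ℝ V]

namespace IsTypeZero

variable {Jp : GenVec V →ₗ[ℝ] GenVec V} {b om : Form V ℝ 2} (h : IsTypeZero Jp b om)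
include h

theorem form (X : V) : Jp (0, contract X om) = -(X, contract X b) := by
  rw [← h.vec, h.sq]

theorem injective : Function.Injective (contractHom om) := by
  rw [← LinearMap.ker_eq_bot, LinearMap.ker_eq_bot']
  intro X hX
  have h1 := h.form X
  rw [← contractHom_apply, hX] at h1
  have h2 : Jp ((0 : V), (0 : V →L[ℝ] ℝ)) = 0 := map_zero Jp
  rw [h2] at h1
  have := congrArg Prod.fst h1
  simpa using this.symm

theorem surjective : Function.Surjective (contractHom om) := by
  refine (LinearMap.injective_iff_surjective_of_finrank_eq_finrank ?_).mp h.injective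
  rw [← LinearMap.toContinuousLinearMap.finrank_eq, Subspace.dual_finrank_eq]

/-- Every generalized vector is of the form `X + X ⌟ b + Y ⌟ ω`. -/
theorem exists_rep (W : GenVec V) :
    ∃ X Y : V, W = (X, contract X b) + (0, contract Y om) := by
  obtain ⟨Y, hY⟩ := h.surjective (W.2 - contract W.1 b)
  refine ⟨W.1, Y, Prod.ext (by simp) ?_⟩
  rw [contractHom_apply] at hY
  simp [hY]

/-- The operators `W + i J W`, `W - i J W` in terms of `X`, `Y` with `W = X + X ⌟ b + Y ⌟ ω`. -/
theorem bar_rep (X Y : V) (Φ : Polyform V) :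
    cl ((X, contract X b) + (0, contract Y om)) Φ
      + Complex.I • cl (Jp ((X, contract X b) + (0, contract Y om))) Φ
    = (intOp X Φ + wedOp (contractC X (cplx b + Complex.I • cplx om)) Φ)
      - Complex.I • (intOp Y Φ + wedOp (contractC Y (cplx b + Complex.I • cplx om)) Φ) := by
  rw [map_add, map_add Jp, h.vec, h.form]
  have e : ((X, contract X b) : GenVec V) = (X, 0) + (0, contract X b) := by simp
  have e' : ((Y, contract Y b) : GenVec V) = (Y, 0) + (0, contract Y b) := by simp
  rw [map_add, map_neg, e, e', map_add, map_add]
  simp only [cl_vec, cl_form, contractC_add, contractC_smul, contractC_cplx, map_add, map_smul,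
    LinearMap.add_apply, LinearMap.neg_apply, LinearMap.smul_apply, smul_add, smul_neg, smul_smul,
    Complex.I_mul_I]
  module

theorem hol_rep (X Y : V) (Φ : Polyform V) :
    cl ((X, contract X b) + (0, contract Y om)) Φ
      - Complex.I • cl (Jp ((X, contract X b) + (0, contract Y om))) Φ
    = (intOp X Φ + wedOp (contractC X (cplx b - Complex.I • cplx om)) Φ)
      + Complex.I • (intOp Y Φ + wedOp (contractC Y (cplx b - Complex.I • cplx om)) Φ) := by
  rw [map_add, map_add Jp, h.vec, h.form]
  have e : ((X, contract X b) : GenVec V) = (X, 0) + (0, contract X b) := by simp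
  have e' : ((Y, contract Y b) : GenVec V) = (Y, 0) + (0, contract Y b) := by simp
  rw [map_add, map_neg, e, e', map_add, map_add, sub_eq_add_neg (cplx b), ← neg_smul]
  simp only [cl_vec, cl_form, contractC_add, contractC_smul, contractC_cplx, map_add, map_smul,
    LinearMap.add_apply, LinearMap.neg_apply, LinearMap.smul_apply, smul_add, smul_neg, smul_smul,
    Complex.I_mul_I, mul_neg]
  module

end IsTypeZero

variable [hd : Fact (Module.finrank ℝ V = 6)]
variable {Jm Jp : GenVec V →ₗ[ℝ] GenVec V} {b om : Form V ℝ 2}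

/-- The operator of `W + i J₊ W`. -/
def barOp (Jp : GenVec V →ₗ[ℝ] GenVec V) (W : GenVec V) : Module.End ℂ (Polyform V) :=
  cl W + Complex.I • cl (Jp W)

/-- The operator of `W - i J₊ W`. -/
def holOp (Jp : GenVec V →ₗ[ℝ] GenVec V) (W : GenVec V) : Module.End ℂ (Polyform V) :=
  cl W - Complex.I • cl (Jp W)

theorem barOp_apply (W : GenVec V) (Φ : Polyform V) :
    barOp Jp W Φ = cl W Φ + Complex.I • cl (Jp W) Φ := rfl

theorem holOp_apply (W : GenVec V) (Φ : Polyform V) :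
    holOp Jp W Φ = cl W Φ - Complex.I • cl (Jp W) Φ := rfl

/-- `W + i J₊ W` lowers the degree of `e^{b + iω} ∧ Φ`. -/
theorem IsTypeZero.bar_lower (h : IsTypeZero Jp b om) {Φ : Polyform V} {m : ℕ} (W : GenVec V)
    (hΦ : eOp (cplx b + Complex.I • cplx om) Φ ∈ degLE (m + 1)) :
    eOp (cplx b + Complex.I • cplx om) (barOp Jp W Φ) ∈ degLE m := by
  obtain ⟨X, Y, rfl⟩ := h.exists_rep W
  rw [barOp_apply, h.bar_rep, map_sub, map_smul, ← int_eOp_apply, ← int_eOp_apply]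
  exact Submodule.sub_mem _ (intOp_mem_degLE_pred hΦ)
    (Submodule.smul_mem _ _ (intOp_mem_degLE_pred hΦ))

theorem IsTypeZero.bar_kill (h : IsTypeZero Jp b om) {Φ : Polyform V} (W : GenVec V)
    (hΦ : eOp (cplx b + Complex.I • cplx om) Φ ∈ degLE 0) : barOp Jp W Φ = 0 := by
  have : eOp (cplx b + Complex.I • cplx om) (barOp Jp W Φ) = 0 := by
    obtain ⟨X, Y, rfl⟩ := h.exists_rep W
    rw [barOp_apply, h.bar_rep, map_sub, map_smul, ← int_eOp_apply, ← int_eOp_apply,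
      intOp_of_degLE_zero hΦ, intOp_of_degLE_zero hΦ, smul_zero, sub_zero]
  have e := congrArg (fun f => f (barOp Jp W Φ)) (eOp_neg_mul (cplx b + Complex.I • cplx om))
  simp only [Module.End.mul_apply, this, map_zero, Module.End.one_apply] at e
  exact e.symm

/-- Up to multiplication by the exponential the operators in the annihilator of `e^{-b + iω}` are
interior products, and these have no top degree component. -/
theorem tau_hol (h : IsTypeZero Jp b om) (u : Module.Basis (Fin 6) ℝ V) (W : GenVec V)
    (Φ : Polyform V) : tau u (cplx b - Complex.I • cplx om) (holOp Jp W Φ) = 0 := by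
  obtain ⟨X, Y, rfl⟩ := h.exists_rep W
  rw [holOp_apply, h.hol_rep, map_add, map_smul, tau_int, tau_int]
  simp

theorem tau_cl (h : IsTypeZero Jp b om) (u : Module.Basis (Fin 6) ℝ V) (W : GenVec V)
    (Φ : Polyform V) : tau u (cplx b - Complex.I • cplx om) (cl W Φ)
      = Complex.I * tau u (cplx b - Complex.I • cplx om) (cl (Jp W) Φ) := by
  have := tau_hol h u W Φ
  rw [holOp_apply, map_sub, map_smul, smul_eq_mul] at this
  linear_combination this

theorem cl_raise {γ : Form V ℂ 2} {Φ : Polyform V} {m : ℕ} (W : GenVec V)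
    (hΦ : eOp γ Φ ∈ degLE m) : eOp γ (cl W Φ) ∈ degLE (m + 1) := by
  have e : cl W Φ = (intOp W.1 Φ + wedOp (contractC W.1 γ) Φ)
      + wedOp (Complex.ofRealCLM.comp W.2 - contractC W.1 γ) Φ := by
    rw [cl_eq, map_sub, LinearMap.add_apply, LinearMap.sub_apply]; abel
  have e2 : ∀ ν, eOp γ (wedOp ν Φ) = wedOp ν (eOp γ Φ) := fun ν => by
    rw [← Module.End.mul_apply, (eOp_wed γ ν).eq, Module.End.mul_apply]
  rw [e, map_add, ← int_eOp_apply, e2]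
  exact Submodule.add_mem _ (degLE_mono (by omega) (intOp_mem_degLE hΦ)) (wedOp_mem_degLE hΦ)

theorem barOp_raise {γ : Form V ℂ 2} {Φ : Polyform V} {m : ℕ} (W : GenVec V)
    (hΦ : eOp γ Φ ∈ degLE m) : eOp γ (barOp Jp W Φ) ∈ degLE (m + 1) := by
  rw [barOp_apply, map_add, map_smul]
  exact Submodule.add_mem _ (cl_raise W hΦ) (Submodule.smul_mem _ _ (cl_raise _ hΦ))

/-- The products of `n` operators `W + i J₊ W`. -/
def words (Jp : GenVec V →ₗ[ℝ] GenVec V) (n : ℕ) : Submodule ℂ (Module.End ℂ (Polyform V)) :=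
  Submodule.span ℂ {X | ∃ L : List (GenVec V), L.length = n ∧ X = (L.map (barOp Jp)).prod}

theorem words_mul {n : ℕ} {X : Module.End ℂ (Polyform V)} (W : GenVec V) (hX : X ∈ words Jp n) :
    barOp Jp W * X ∈ words Jp (n + 1) := by
  induction hX using Submodule.span_induction with
  | mem X hX =>
    obtain ⟨L, hL, rfl⟩ := hX
    exact Submodule.subset_span ⟨W :: L, by simp [hL], by simp⟩
  | zero => rw [mul_zero]; exact Submodule.zero_mem _
  | add X Y _ _ hX hY => rw [mul_add]; exact Submodule.add_mem _ hX hY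
  | smul c X _ hX => rw [mul_smul_comm]; exact Submodule.smul_mem _ c hX

/-- A polyform is determined by the top degree components of its images under products of operators
in the annihilator of `e^{-b - iω}`. -/
theorem eq_zero_of_barWords (ht : IsTypeZero Jp b om) (u : Module.Basis (Fin 6) ℝ V)
    {Φ : Polyform V}
    (hΦ : ∀ L : List (GenVec V),
      tau u (cplx b - Complex.I • cplx om) ((L.map (barOp Jp)).prod Φ) = 0) : Φ = 0 := by
  refine eq_zero_of_words u (cplx b - Complex.I • cplx om) (holOp Jp) (barOp Jp)
    (fun W Φ => tau_hol ht u W Φ) ?_ ?_ _ hΦ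
  · intro W Z
    refine ⟨((2 * pairing Z W : ℝ) : ℂ) + ((2 * pairing (Jp Z) (Jp W) : ℝ) : ℂ)
      + Complex.I * ((2 * pairing (Jp Z) W : ℝ) : ℂ)
      - Complex.I * ((2 * pairing Z (Jp W) : ℝ) : ℂ), fun Φ => ?_⟩
    simp only [barOp_apply, holOp_apply, map_sub, map_add, map_smul]
    rw [cl_cl_apply Z W, cl_cl_apply Z (Jp W), cl_cl_apply (Jp Z) W, cl_cl_apply (Jp Z) (Jp W)]
    simp only [smul_sub, smul_add, smul_smul]
    match_scalars <;> ring_nf <;> simp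
  · intro W
    rw [barOp, holOp]
    module

theorem barWord_raise {γ : Form V ℂ 2} {Φ : Polyform V} {m : ℕ} (hΦ : eOp γ Φ ∈ degLE m)
    (L : List (GenVec V)) : eOp γ ((L.map (barOp Jp)).prod Φ) ∈ degLE (m + L.length) := by
  induction L with
  | nil => simpa using hΦ
  | cons W L ih => exact barOp_raise W ih

/-- A polyform of degree at most two relative to both `e^{-b + iω}` and `e^{-b - iω}` vanishes. -/
theorem eq_zero_of_degLE_two (ht : IsTypeZero Jp b om) (u : Module.Basis (Fin 6) ℝ V)
    {Φ : Polyform V} (k1 : eOp (cplx b - Complex.I • cplx om) Φ ∈ degLE 2)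
    (k2 : eOp (cplx b + Complex.I • cplx om) Φ ∈ degLE 2) : Φ = 0 := by
  refine eq_zero_of_barWords ht u fun L => ?_
  rcases Nat.lt_or_ge L.length 4 with h4 | h4
  · rw [tau_apply, barWord_raise k1 L 6 (by omega)]; rfl
  · have hhigh : ∀ L : List (GenVec V), 3 ≤ L.length → (L.map (barOp Jp)).prod Φ = 0 := by
      intro L
      induction L with
      | nil => intro hL; simp at hL
      | cons W L ih =>
        intro hL
        rw [List.map_cons, List.prod_cons, Module.End.mul_apply]
        rcases Nat.lt_or_ge L.length 3 with h3 | h3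
        · obtain ⟨W₁, W₂, rfl⟩ : ∃ W₁ W₂, L = [W₁, W₂] :=
            List.length_eq_two.mp (by simp at hL; omega)
          refine ht.bar_kill W ?_
          simp only [List.map_cons, List.map_nil, List.prod_cons, List.prod_nil, mul_one,
            Module.End.mul_apply]
          exact ht.bar_lower _ (ht.bar_lower _ k2)
        · rw [ih h3, map_zero]
    rw [hhigh L (by omega), map_zero]

section Star

variable (h : IsGenKahler Jm Jp)
include h

theorem algOp_bar (W : GenVec V) (Φ : Polyform V) :
    algOp Jm (barOp Jp W Φ) = barOp Jp W (algOp Jm Φ) + barOp Jp (Jm W) Φ := by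
  rw [barOp_apply, barOp_apply, barOp_apply, map_add, map_smul, algOp_cl Jm h.skew_m,
    algOp_cl Jm h.skew_m, h.comm]
  module

theorem algOp_word (L : List (GenVec V)) :
    algOp Jm * (L.map (barOp Jp)).prod - (L.map (barOp Jp)).prod * algOp Jm
      ∈ words Jp L.length := by
  induction L with
  | nil => simp
  | cons W L ih =>
    have e : algOp Jm * barOp Jp W = barOp Jp W * algOp Jm + barOp Jp (Jm W) := by
      ext1 Φ; exact algOp_bar h W Φ
    have : algOp Jm * ((W :: L).map (barOp Jp)).prod - ((W :: L).map (barOp Jp)).prod * algOp Jm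
        = barOp Jp W * (algOp Jm * (L.map (barOp Jp)).prod - (L.map (barOp Jp)).prod * algOp Jm)
          + barOp Jp (Jm W) * (L.map (barOp Jp)).prod := by
      rw [List.map_cons, List.prod_cons, ← mul_assoc, e, mul_sub, add_mul, mul_assoc, mul_assoc]
      abel
    rw [this]
    exact Submodule.add_mem _ (words_mul W ih)
      (words_mul _ (Submodule.subset_span ⟨L, rfl, rfl⟩))

variable {c d : Fin 3 → GenVec V} (ha : IsAdapted Jm Jp c d)
include ha

theorem bar_hodge (W : GenVec V) (Φ : Polyform V) :
    barOp Jp W (hodge Jm c Φ) = -hodge Jm c (barOp Jp (gOf Jm Jp W) Φ) := by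
  rw [barOp_apply, barOp_apply, map_add, map_smul, hodge_cl h ha, hodge_cl h ha, h.g_g, ← h.g_p,
    h.g_g]
  module

theorem word_hodge (L : List (GenVec V)) (Φ : Polyform V) :
    (L.map (barOp Jp)).prod (hodge Jm c Φ)
      = (-1 : ℂ) ^ L.length • hodge Jm c (((L.map (gOf Jm Jp)).map (barOp Jp)).prod Φ) := by
  induction L with
  | nil => simp
  | cons W L ih =>
    simp only [List.map_cons, List.prod_cons, Module.End.mul_apply, ih, map_smul,
      bar_hodge h ha, List.length_cons, pow_succ]
    module

/-- The type decomposition of the three-fold products: if all the products of pure type vanish then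
`J₋ ·` acts on the mixed types as the inverse of the generalized Hodge operator. -/
theorem hodge_algOp_eq (ht : IsTypeZero Jp b om) (u : Module.Basis (Fin 6) ℝ V) {κ : Polyform V}
    (k1 : eOp (cplx b - Complex.I • cplx om) κ ∈ degLE 3)
    (k2 : eOp (cplx b + Complex.I • cplx om) κ ∈ degLE 3)
    (k3 : ∀ s : ℂ, s = Complex.I ∨ s = -Complex.I → ∀ W₁ W₂ W₃,
      tau u (cplx b - Complex.I • cplx om)
        ((barOp Jp W₁ + s • barOp Jp (Jm W₁)) ((barOp Jp W₂ + s • barOp Jp (Jm W₂))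
          ((barOp Jp W₃ + s • barOp Jp (Jm W₃)) κ))) = 0) :
    hodge Jm c (algOp Jm κ) = κ := by
  set t := tau u (cplx b - Complex.I • cplx om) with ht_def
  have tcl := tau_cl ht u
  rw [← ht_def] at tcl
  -- the functional vanishes on all words of length different from three
  have hlow : ∀ (L : List (GenVec V)), L.length ≤ 2 → t ((L.map (barOp Jp)).prod κ) = 0 := by
    intro L hL
    have := barWord_raise (Jp := Jp) k1 L 6 (by omega)
    rw [ht_def, tau_apply, this]; rfl
  have hhigh : ∀ (L : List (GenVec V)), 4 ≤ L.length → (L.map (barOp Jp)).prod κ = 0 := by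
    intro L
    induction L with
    | nil => intro hL; simp at hL
    | cons W L ih =>
      intro hL
      rw [List.map_cons, List.prod_cons, Module.End.mul_apply]
      rcases Nat.lt_or_ge L.length 4 with h4 | h4
      · obtain ⟨W₁, W₂, W₃, rfl⟩ : ∃ W₁ W₂ W₃, L = [W₁, W₂, W₃] :=
          List.length_eq_three.mp (by simp at hL; omega)
        refine ht.bar_kill W ?_
        simp only [List.map_cons, List.map_nil, List.prod_cons, List.prod_nil, mul_one,
          Module.End.mul_apply]
        exact ht.bar_lower _ (ht.bar_lower _ (ht.bar_lower _ k2))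
      · rw [ih h4, map_zero]
  have hne : ∀ n ≠ 3, ∀ X ∈ words Jp n, t (X κ) = 0 := by
    intro n hn X hX
    induction hX using Submodule.span_induction with
    | mem X hX =>
      obtain ⟨L, hL, rfl⟩ := hX
      rcases Nat.lt_or_ge n 3 with h3 | h3
      · exact hlow L (by omega)
      · rw [hhigh L (by omega), map_zero]
    | zero => simp
    | add X Y _ _ hX hY => rw [LinearMap.add_apply, map_add, hX, hY, add_zero]
    | smul c X _ hX => rw [LinearMap.smul_apply, map_smul, hX, smul_zero]
  have hJ : ∀ Φ, t (algOp Jm Φ) = 0 := functional_algOp_m h ha tcl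
  have hS : ∀ Φ, t (hodge Jm c Φ) = -Complex.I * t Φ := functional_hodge h ha tcl
  rw [← sub_eq_zero]
  refine eq_zero_of_barWords ht u ?_
  · intro L
    rw [map_sub, map_sub, word_hodge h ha, map_smul, hS]
    have hw : ∀ L : List (GenVec V), t ((L.map (barOp Jp)).prod (algOp Jm κ))
        = -t ((algOp Jm * (L.map (barOp Jp)).prod - (L.map (barOp Jp)).prod * algOp Jm) κ) := by
      intro L
      rw [LinearMap.sub_apply, map_sub, Module.End.mul_apply, Module.End.mul_apply, hJ]
      ring
    by_cases h3 : L.length = 3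
    · obtain ⟨W₁, W₂, W₃, rfl⟩ := List.length_eq_three.mp h3
      set f : GenVec V → GenVec V → GenVec V → ℂ := fun W₁ W₂ W₃ =>
        t (barOp Jp W₁ (barOp Jp W₂ (barOp Jp W₃ κ))) with hf
      have lin : ∀ W, barOp Jp (Jp W) = -Complex.I • barOp Jp W := by
        intro W
        rw [barOp, barOp, h.sq_p, map_neg, smul_add, smul_smul]
        have : -Complex.I * Complex.I = 1 := by simp
        rw [this]
        module
      have hneg : ∀ W, barOp Jp (-W) = -barOp Jp W := by
        intro W
        rw [barOp, barOp, map_neg, map_neg, map_neg]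
        module
      -- on the conjugate annihilator bundle `G` acts as `i J₋`
      have hG : ∀ W, barOp Jp (gOf Jm Jp W) = Complex.I • barOp Jp (Jm W) := by
        intro W
        rw [gOf_apply, hneg, h.comm, lin]
        module
      have hmm : ∀ W, barOp Jp (Jm (Jm W)) = -barOp Jp W := fun W => by rw [h.sq_m, hneg]
      have hGm : ∀ W, barOp Jp (Jm (gOf Jm Jp W)) = -Complex.I • barOp Jp W := by
        intro W
        rw [← h.g_m, hG, h.sq_m, hneg]
        module
      have e1 := k3 Complex.I (Or.inl rfl) W₁ W₂ W₃
      have e2 := k3 (-Complex.I) (Or.inr rfl) W₁ W₂ W₃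
      have e3 := hw [gOf Jm Jp W₁, gOf Jm Jp W₂, gOf Jm Jp W₃]
      simp only [List.map_cons, List.map_nil, List.prod_cons, List.prod_nil, mul_one,
        Module.End.mul_apply, LinearMap.sub_apply, algOp_bar h, map_add, map_sub, hG, hGm, hmm,
        LinearMap.neg_apply, map_neg,
        LinearMap.smul_apply, map_smul, smul_eq_mul, hJ, LinearMap.add_apply, smul_add,
        List.length_cons, List.length_nil] at e1 e2 e3 ⊢
      rw [e3]
      -- the claim is the sum of the vanishing of the two components of charge `±3`
      linear_combination (-1 / 2 : ℂ) * e1 + (-1 / 2 : ℂ) * e2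
        + Complex.I ^ 2 * (t (barOp Jp (Jm W₁) (barOp Jp (Jm W₂) (barOp Jp W₃ κ)))
          + t (barOp Jp (Jm W₁) (barOp Jp W₂ (barOp Jp (Jm W₃) κ)))
          + t (barOp Jp W₁ (barOp Jp (Jm W₂) (barOp Jp (Jm W₃) κ)))) * Complex.I_sq
    · have e1 := hne L.length h3 _ (Submodule.subset_span ⟨L, rfl, rfl⟩)
      have e2 := hne (L.map (gOf Jm Jp)).length (by simpa using h3) _
        (algOp_word h (L.map (gOf Jm Jp)))
      rw [hw, e1, e2]
      simp

end Star

end TypeZero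

/-! ### Structures of pure spinors -/

section Spinors

variable {V : Type*} [NormedAddCommGroup V] [NormedSpace ℝ V]

theorem IsAssociated.cl_iff {Ω : Polyform V} {J : GenVec V →ₗ[ℝ] GenVec V} (h : IsAssociated Ω J)
    (W Z : GenVec V) : cl W Ω + Complex.I • cl Z Ω = 0 ↔ Z = -J W := h.2 W Z

theorem IsAssociated.cl_eq {Ω : Polyform V} {J : GenVec V →ₗ[ℝ] GenVec V} (h : IsAssociated Ω J)
    (W : GenVec V) : cl W Ω = Complex.I • cl (J W) Ω := by
  have := (h.cl_iff W _).mpr rfl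
  rw [map_neg, LinearMap.neg_apply, smul_neg] at this
  exact add_neg_eq_zero.mp this

theorem IsAssociated.eq_zero_of_cl {Ω : Polyform V} {J : GenVec V →ₗ[ℝ] GenVec V}
    (h : IsAssociated Ω J) {W : GenVec V} (hW : cl W Ω = 0) : W = 0 := by
  have h1 := (h.cl_iff W 0).mp (by rw [hW]; simp)
  have h2 := h.1 W
  rw [neg_eq_zero.mp h1.symm, map_zero] at h2
  exact neg_eq_zero.mp h2.symm

theorem IsAssociated.ne_zero [Nontrivial V] {Ω : Polyform V} {J : GenVec V →ₗ[ℝ] GenVec V}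
    (h : IsAssociated Ω J) : Ω ≠ 0 := by
  rintro rfl
  obtain ⟨v, hv⟩ := exists_ne (0 : V)
  have := h.eq_zero_of_cl (W := (v, 0)) (map_zero _)
  exact hv (congrArg Prod.fst this)

/-- The eigenspaces of the structure of a pure spinor are isotropic. -/
theorem IsAssociated.skew [FiniteDimensional ℝ V] [Nontrivial V] {Ω : Polyform V} {J : GenVec V →ₗ[ℝ] GenVec V}
    (h : IsAssociated Ω J) (W Z : GenVec V) : pairing (J W) Z = -pairing W (J Z) := by
  have k : ∀ W Z, cl W (cl Z Ω) - Complex.I • cl W (cl (J Z) Ω) = 0 := by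
    intro W Z
    rw [h.cl_eq Z, map_smul, sub_self]
  have e1 := k W Z
  have e2 := k (J W) Z
  have e3 := k Z W
  have e4 := k (J Z) W
  have a1 := cl_cl_apply W Z Ω
  have a2 := cl_cl_apply W (J Z) Ω
  have a3 := cl_cl_apply (J W) Z Ω
  have a4 := cl_cl_apply (J W) (J Z) Ω
  have : (((2 * pairing W Z - 2 * pairing (J W) (J Z) : ℝ) : ℂ)
      - Complex.I * ((2 * pairing (J W) Z + 2 * pairing W (J Z) : ℝ) : ℂ)) • Ω = 0 := by
    have : (((2 * pairing W Z - 2 * pairing (J W) (J Z) : ℝ) : ℂ)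
      - Complex.I * ((2 * pairing (J W) Z + 2 * pairing W (J Z) : ℝ) : ℂ)) • Ω
      = (cl W (cl Z Ω) - Complex.I • cl W (cl (J Z) Ω))
        - Complex.I • (cl (J W) (cl Z Ω) - Complex.I • cl (J W) (cl (J Z) Ω))
        + (cl Z (cl W Ω) - Complex.I • cl Z (cl (J W) Ω))
        - Complex.I • (cl (J Z) (cl W Ω) - Complex.I • cl (J Z) (cl (J W) Ω)) := by
      rw [a1, a2, a3, a4]
      push_cast
      linear_combination (norm := module)
        ((-2 * (pairing (J W) (J Z) : ℂ)) * Complex.I_mul_I) • Ω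
    rw [this, e1, e2, e3, e4]
    simp
  have := congrArg Complex.im ((smul_eq_zero.mp this).resolve_right h.ne_zero)
  simp at this
  linarith

variable [FiniteDimensional ℝ V]

theorem isAssociated_genStruct {Ω : Polyform V} (h : genStruct Ω ≠ 0) :
    IsAssociated Ω (genStruct Ω) := by
  unfold genStruct at h ⊢
  split_ifs with hJ
  · exact hJ.choose_spec
  · simp [hJ] at h

theorem IsCompatible.ne_zero [Nontrivial V] {Ωm Ωp : Polyform V} (h : IsCompatible Ωm Ωp) :
    genStruct Ωm ≠ 0 ∧ genStruct Ωp ≠ 0 := by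
  obtain ⟨v, hv⟩ := exists_ne (0 : V)
  have h1 := h.2 (v, 0) fun h0 => hv (congrArg Prod.fst h0)
  constructor <;> intro h0 <;> simp [genMetric, h0, pairing] at h1

theorem IsCompatible.minus [Nontrivial V] {Ωm Ωp : Polyform V} (h : IsCompatible Ωm Ωp) :
    IsAssociated Ωm (genStruct Ωm) := isAssociated_genStruct h.ne_zero.1

theorem IsCompatible.plus [Nontrivial V] {Ωm Ωp : Polyform V} (h : IsCompatible Ωm Ωp) :
    IsAssociated Ωp (genStruct Ωp) := isAssociated_genStruct h.ne_zero.2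

theorem IsCompatible.isGenKahler [Nontrivial V] {Ωm Ωp : Polyform V} (h : IsCompatible Ωm Ωp) :
    IsGenKahler (genStruct Ωm) (genStruct Ωp) where
  sq_m := h.minus.1
  sq_p := h.plus.1
  comm := h.1
  skew_m := h.minus.skew
  skew_p := h.plus.skew
  pos W hW := h.2 W hW

theorem constP_mem_degLE (c : ℂ) : (constP c : Polyform V) ∈ degLE 0 := fun k hk =>
  Pi.single_eq_of_ne (by omega) _

theorem constP_apply_zero (c : ℂ) : (constP c : Polyform V) 0 ![] = c := by
  simp [constP]

theorem intOp_constP (c : ℂ) (v : V) : intOp v (constP c : Polyform V) = 0 :=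
  intOp_of_degLE_zero (constP_mem_degLE c)

variable [hd : Fact (Module.finrank ℝ V = 6)]

/-- The exponential `e^{-b + iω}`. -/
def expP (b om : Form V ℝ 2) : Polyform V :=
  eOp (-cplx b + Complex.I • cplx om) (constP 1)

theorem intOp_expP (v : V) (b om : Form V ℝ 2) : intOp v (expP b om)
    = wedOp (contractC v (-cplx b + Complex.I • cplx om)) (expP b om) := by
  rw [expP, int_eOp_apply, intOp_constP, zero_add, ← Module.End.mul_apply, (eOp_wed _ _).eq,
    Module.End.mul_apply]

theorem contractC_beta (v : V) (b om : Form V ℝ 2) :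
    contractC v (-cplx b + Complex.I • cplx om)
      = -(Complex.ofRealCLM.comp (contract v b)) + Complex.I • Complex.ofRealCLM.comp (contract v om) := by
  have : contractC v (-cplx b) = -contractC v (cplx b) := by
    have := contractC_smul v (-1) (cplx b)
    rw [neg_one_smul] at this
    rw [this]
    module
  rw [contractC_add, contractC_smul, contractC_cplx, ← contractC_cplx v b, this]

theorem cl_expP (v : V) (b om : Form V ℝ 2) : cl ((v, contract v b) : GenVec V) (expP b om)
    = Complex.I • cl ((0, contract v om) : GenVec V) (expP b om) := by
  have e : ((v, contract v b) : GenVec V) = (v, 0) + (0, contract v b) := by simp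
  rw [e, map_add, LinearMap.add_apply, cl_vec, intOp_expP, cl_form, cl_form, contractC_beta, map_add,
    map_neg, map_smul, LinearMap.add_apply, LinearMap.neg_apply, LinearMap.smul_apply]
  abel

theorem IsAssociated.isTypeZero {Ω : Polyform V} {J : GenVec V →ₗ[ℝ] GenVec V}
    (h : IsAssociated Ω J) {α : ℂ} {b om : Form V ℝ 2} (hΩ : Ω = α • expP b om) :
    IsTypeZero J b om where
  sq := h.1
  vec v := by
    have h1 : cl ((v, contract v b) : GenVec V) Ω
        + Complex.I • cl (-((0, contract v om) : GenVec V)) Ω = 0 := by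
      rw [hΩ, map_smul, map_smul, cl_expP, map_neg, LinearMap.neg_apply]
      module
    have h2 := (h.cl_iff _ _).mp h1
    rw [neg_inj] at h2
    exact h2.symm

end Spinors

/-! ### The metric and the two-form of a generalized metric -/

section Metric

variable {V : Type*} [NormedAddCommGroup V] [NormedSpace ℝ V] [FiniteDimensional ℝ V]
variable {Jm Jp : GenVec V →ₗ[ℝ] GenVec V} (h : IsGenKahler Jm Jp)

theorem wedgeReal_apply (μ ν : V →L[ℝ] ℝ) (v w : V) :
    wedgeReal μ ν ![v, w] = μ v * ν w - μ w * ν v := by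
  have : Fin.removeNth (1 : Fin 2) ![v, w] 0 = v := rfl
  simp [wedgeReal, ContinuousAlternatingMap.alternatizeUncurryFin_apply, oneForm,
    Fin.sum_univ_two, this]
  ring

theorem metricInv_apply (G : GenVec V →ₗ[ℝ] GenVec V) (ν : V →L[ℝ] ℝ) :
    metricInv G ν = (G (0, ν)).1 := rfl

namespace IsGenKahler

include h

theorem metricInv_injective : Function.Injective (metricInv (gOf Jm Jp)) := by
  rw [injective_iff_map_eq_zero]
  intro ν hν
  by_contra h0
  have h1 := h.pos (0, ν) fun h2 => h0 (congrArg Prod.snd h2)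
  rw [← gOf_apply, pairing_comm] at h1
  have h2 := pair_form ν (gOf Jm Jp (0, ν))
  rw [← metricInv_apply, hν, map_zero] at h2
  linarith

theorem exists_metricInv : ∃ e : (V →L[ℝ] ℝ) ≃L[ℝ] V, (e : (V →L[ℝ] ℝ) →L[ℝ] V)
    = metricInv (gOf Jm Jp) := by
  have hfr : Module.finrank ℝ (V →L[ℝ] ℝ) = Module.finrank ℝ V := by
    rw [← LinearMap.toContinuousLinearMap.finrank_eq, Subspace.dual_finrank_eq]
  refine ⟨(LinearEquiv.ofInjectiveOfFinrankEq (metricInv (gOf Jm Jp)).toLinearMap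
    h.metricInv_injective hfr).toContinuousLinearEquiv, ?_⟩
  ext ν
  rfl

theorem g_metric (v : V) : (gOf Jm Jp (0, metric (gOf Jm Jp) v)).1 = v := by
  obtain ⟨e, he⟩ := h.exists_metricInv
  rw [← metricInv_apply, metric, ← he, ContinuousLinearMap.inverse_equiv]
  simp

theorem metric_eq (v : V) (W : GenVec V) :
    metric (gOf Jm Jp) v W.1 = 2 * pairing (0, metric (gOf Jm Jp) v) W := (pair_form _ _).symm

theorem metric_comm (v w : V) : metric (gOf Jm Jp) v w = metric (gOf Jm Jp) w v := by
  have h1 := pair_form (metric (gOf Jm Jp) v) (gOf Jm Jp (0, metric (gOf Jm Jp) w))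
  have h2 := pair_form (metric (gOf Jm Jp) w) (gOf Jm Jp (0, metric (gOf Jm Jp) v))
  rw [h.g_metric] at h1 h2
  rw [← h1, ← h2, ← h.g_symm, pairing_comm]

theorem metric_pos (v : V) (hv : v ≠ 0) : 0 < metric (gOf Jm Jp) v v := by
  have h1 := pair_form (metric (gOf Jm Jp) v) (gOf Jm Jp (0, metric (gOf Jm Jp) v))
  rw [h.g_metric, pairing_comm] at h1
  rw [← h1, gOf_apply]
  refine mul_pos two_pos (h.pos _ fun h0 => hv ?_)
  rw [← h.g_metric v, h0, map_zero]
  rfl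

theorem metric_unique {v : V} {ν : V →L[ℝ] ℝ} (hν : (gOf Jm Jp (0, ν)).1 = v) :
    metric (gOf Jm Jp) v = ν := by
  refine h.metricInv_injective ?_
  rw [metricInv_apply, metricInv_apply, h.g_metric, hν]

/-- The two-form `B` is the second block of the graph of the generalized metric. -/
theorem bField_eq (v : V) : contract v (bField (gOf Jm Jp))
    = (gOf Jm Jp (0, metric (gOf Jm Jp) v)).2 := by
  set g := metric (gOf Jm Jp)
  have e1 : ∀ v w, g v (gOf Jm Jp (w, 0)).1 = (gOf Jm Jp (0, g v)).2 w := by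
    intro v w
    rw [h.metric_eq, ← h.g_symm, pairing_comm, pair_vec]
  have e2 : ∀ v w, (gOf Jm Jp (0, g v)).2 w = -(gOf Jm Jp (0, g w)).2 v := by
    intro v w
    have h1 := h.g_symm (0, g v) (gOf Jm Jp (0, g w))
    rw [h.g_g] at h1
    have h2 : pairing ((0, g v) : GenVec V) (0, g w) = 0 := by simp [pairing]
    rw [h2, pairing, h.g_metric, h.g_metric] at h1
    linarith
  ext w
  have e3 : ∀ (x y : V), ∑ a, dualBas (V := V) a x * g (gOf Jm Jp (bas V a, 0)).1 y
      = (gOf Jm Jp (0, g y)).2 x := by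
    intro x y
    rw [← e1, h.metric_comm]
    conv_rhs => rw [← sum_dualBas_smul x]
    have : ((∑ a, dualBas (V := V) a x • bas V a, 0) : GenVec V)
        = ∑ a, dualBas (V := V) a x • ((bas V a, 0) : GenVec V) := by
      refine Prod.ext ?_ ?_
      · rw [Prod.fst_sum]; rfl
      · rw [Prod.snd_sum]; simp
    rw [this, map_sum, Prod.fst_sum, map_sum, sum_apply]
    refine Finset.sum_congr rfl fun a _ => ?_
    rw [map_smul, Prod.smul_fst, map_smul]
    rfl
  rw [contract_apply, bField]
  have e5 : ((-1 / 2 : ℝ) • ∑ a, wedgeReal (dualBas a) (g (gOf Jm Jp (bas V a, 0)).1)) ![v, w]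
      = (-1 / 2 : ℝ) * ∑ a, wedgeReal (dualBas (V := V) a) (g (gOf Jm Jp (bas V a, 0)).1) ![v, w] := by
    rw [ContinuousAlternatingMap.smul_apply, ContinuousAlternatingMap.sum_apply]
    rfl
  rw [e5]
  simp only [wedgeReal_apply, Finset.sum_sub_distrib, e3]
  rw [e2 w v]
  ring

theorem bField_of_vec {v : V} {ν : V →L[ℝ] ℝ} (hv : gOf Jm Jp (v, 0) = (0, ν)) :
    metric (gOf Jm Jp) v = ν ∧ contract v (bField (gOf Jm Jp)) = 0 := by
  have h1 : gOf Jm Jp (0, ν) = (v, 0) := by rw [← hv, h.g_g]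
  have h2 := h.metric_unique (v := v) (ν := ν) (by rw [h1])
  exact ⟨h2, by rw [h.bField_eq, h2, h1]⟩

end IsGenKahler

end Metric

/-! ### Unitary frames -/

section Unitary

variable {V : Type*} [NormedAddCommGroup V] [NormedSpace ℝ V] [FiniteDimensional ℝ V]
  [hd : Fact (Module.finrank ℝ V = 6)]

theorem exists_unit_orthogonal (B : V →ₗ[ℝ] V →ₗ[ℝ] ℝ) (pos : ∀ v, v ≠ 0 → 0 < B v v) {n : ℕ}
    (hn : n < 6) (f : Fin n → V) : ∃ v, B v v = 1 ∧ ∀ i, B v (f i) = 0 := by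
  have hker : LinearMap.ker (LinearMap.pi fun i => B.flip (f i)) ≠ ⊥ :=
    LinearMap.ker_ne_bot_of_finrank_lt (by simpa [hd.out] using hn)
  obtain ⟨v, hv, h0⟩ := Submodule.exists_mem_ne_zero_of_ne_bot hker
  have hv' : ∀ i, B v (f i) = 0 := fun i => congrFun (LinearMap.mem_ker.mp hv) i
  have hp := pos v h0
  refine ⟨(Real.sqrt (B v v))⁻¹ • v, ?_, fun i => ?_⟩
  · rw [map_smul, map_smul, LinearMap.smul_apply, smul_eq_mul, smul_eq_mul, ← mul_assoc,
      ← mul_inv, Real.mul_self_sqrt hp.le, inv_mul_cancel₀ hp.ne']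
  · rw [map_smul, LinearMap.smul_apply, hv', smul_zero]

theorem exists_unitary (B : V →ₗ[ℝ] V →ₗ[ℝ] ℝ) (symm : ∀ v w, B v w = B w v)
    (pos : ∀ v, v ≠ 0 → 0 < B v v) (I : V → V)
    (hI : ∀ v w, B v (I w) = -B (I v) w) :
    ∃ e : Fin 3 → V, (∀ i j, B (e i) (e j) = if i = j then 1 else 0) ∧
      ∀ i j, B (e i) (I (e j)) = 0 := by
  have hI0 : ∀ v, B v (I v) = 0 := fun v => by
    have := hI v v
    rw [symm (I v) v] at this
    linarith
  obtain ⟨e0, h0, -⟩ := exists_unit_orthogonal B pos (n := 0) (by norm_num) Fin.elim0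
  obtain ⟨e1, h1, k1⟩ := exists_unit_orthogonal B pos (n := 2) (by norm_num) ![e0, I e0]
  obtain ⟨e2, h2, k2⟩ := exists_unit_orthogonal B pos (n := 4) (by norm_num) ![e0, I e0, e1, I e1]
  have a1 : B e1 e0 = 0 := k1 0
  have a2 : B e1 (I e0) = 0 := k1 1
  have a3 : B e2 e0 = 0 := k2 0
  have a4 : B e2 (I e0) = 0 := k2 1
  have a5 : B e2 e1 = 0 := k2 2
  have a6 : B e2 (I e1) = 0 := k2 3
  have b1 : B e0 (I e1) = 0 := by rw [hI, symm, a2, neg_zero]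
  have b2 : B e0 (I e2) = 0 := by rw [hI, symm, a4, neg_zero]
  have b3 : B e1 (I e2) = 0 := by rw [hI, symm, a6, neg_zero]
  refine ⟨![e0, e1, e2], ?_, ?_⟩
  · intro i j
    fin_cases i <;> fin_cases j <;> simp [h0, h1, h2, a1, a3, a5, symm e0 e1, symm e0 e2, symm e1 e2]
  · intro i j
    fin_cases i <;> fin_cases j <;> simp [hI0, a2, a4, a6, b1, b2, b3]

theorem exists_basis_of_orthonormal (B : V →ₗ[ℝ] V →ₗ[ℝ] ℝ) (u : Fin 6 → V)
    (hu : ∀ i j, B (u i) (u j) = if i = j then 1 else 0) :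
    ∃ b : Module.Basis (Fin 6) ℝ V, (b : Fin 6 → V) = u ∧ ∀ x i, b.repr x i = B x (u i) := by
  have hsum : ∀ (a : Fin 6 → ℝ) j, B (∑ i, a i • u i) (u j) = a j := by
    intro a j
    rw [map_sum, LinearMap.sum_apply]
    simp [hu]
  have hli : LinearIndependent ℝ u := by
    rw [Fintype.linearIndependent_iff]
    intro a ha j
    rw [← hsum a j, ha, map_zero, LinearMap.zero_apply]
  refine ⟨basisOfLinearIndependentOfCardEqFinrank hli (by simp [hd.out]), by simp, fun x i => ?_⟩
  set b := basisOfLinearIndependentOfCardEqFinrank hli (by simp [hd.out])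
  have hb : ∀ i, b i = u i := fun i => by simp [b]
  conv_rhs => rw [← b.sum_repr x]
  simp only [hb]
  rw [hsum]

/-- The frame `(e₁, I e₁, e₂, I e₂, e₃, I e₃)`. -/
def pairFrame {W : Type*} (e f : Fin 3 → W) : Fin 6 → W := ![e 0, f 0, e 1, f 1, e 2, f 2]

theorem pairFrame_orthonormal (B : V →ₗ[ℝ] V →ₗ[ℝ] ℝ) (symm : ∀ v w, B v w = B w v) (e f : Fin 3 → V)
    (he : ∀ i j, B (e i) (e j) = if i = j then 1 else 0)
    (hf : ∀ i j, B (f i) (f j) = if i = j then 1 else 0)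
    (hef : ∀ i j, B (e i) (f j) = 0) (i j : Fin 6) :
    B (pairFrame e f i) (pairFrame e f j) = if i = j then 1 else 0 := by
  have hfe : ∀ i j, B (f i) (e j) = 0 := fun i j => by rw [symm, hef]
  fin_cases i <;> fin_cases j <;> simp [pairFrame, he, hf, hef, hfe]

end Unitary

section GenFrame

variable {V : Type*} [NormedAddCommGroup V] [NormedSpace ℝ V] [FiniteDimensional ℝ V]
variable {Jm Jp : GenVec V →ₗ[ℝ] GenVec V}

/-- The lift of a vector to the `ε`-eigenspace of the generalized metric, `ε = ±1`. -/
def lift (Jm Jp : GenVec V →ₗ[ℝ] GenVec V) (ε : ℝ) : V →ₗ[ℝ] GenVec V :=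
  (gOf Jm Jp + ε • LinearMap.id) ∘ₗ LinearMap.inr ℝ V (V →L[ℝ] ℝ) ∘ₗ
    (metric (gOf Jm Jp)).toLinearMap

theorem lift_apply (ε : ℝ) (v : V) : lift Jm Jp ε v
    = gOf Jm Jp (0, metric (gOf Jm Jp) v) + ε • ((0, metric (gOf Jm Jp) v) : GenVec V) := rfl

namespace IsGenKahler

variable (h : IsGenKahler Jm Jp) {ε : ℝ} (hε : ε * ε = 1)
include h

theorem lift_fst (ε : ℝ) (v : V) : (lift Jm Jp ε v).1 = v := by
  rw [lift_apply, Prod.fst_add, h.g_metric]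
  simp

theorem lift_snd (ε : ℝ) (v : V) : (lift Jm Jp ε v).2
    = contract v (bField (gOf Jm Jp)) + ε • metric (gOf Jm Jp) v := by
  rw [lift_apply, Prod.snd_add, h.bField_eq]
  simp

include hε

theorem g_lift (v : V) : gOf Jm Jp (lift Jm Jp ε v) = ε • lift Jm Jp ε v := by
  rw [lift_apply, map_add, h.g_g, map_smul, smul_add, smul_smul, hε, one_smul, add_comm]

theorem eq_lift {W : GenVec V} (hW : gOf Jm Jp W = ε • W) : lift Jm Jp ε W.1 = W := by
  have h1 : gOf Jm Jp (lift Jm Jp ε W.1 - W) = ε • (lift Jm Jp ε W.1 - W) := by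
    rw [map_sub, h.g_lift hε, hW, smul_sub]
  have h2 : lift Jm Jp ε W.1 - W = (0, (lift Jm Jp ε W.1 - W).2) := by
    refine Prod.ext ?_ rfl
    rw [Prod.fst_sub, h.lift_fst]
    simp
  rw [h2] at h1
  have h3 := h.metricInv_injective (a₁ := (lift Jm Jp ε W.1 - W).2) (a₂ := 0) (by
    rw [metricInv_apply, h1]
    simp)
  rw [h3] at h2
  exact sub_eq_zero.mp h2

theorem pairing_lift (v w : V) :
    pairing (lift Jm Jp ε v) (lift Jm Jp ε w) = ε * metric (gOf Jm Jp) v w := by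
  have h1 := contract_skew (bField (gOf Jm Jp)) v w
  have h2 := h.metric_comm v w
  rw [pairing, h.lift_fst, h.lift_fst, h.lift_snd, h.lift_snd]
  simp only [add_apply, smul_apply, smul_eq_mul]
  rw [h1, h2]
  ring

theorem lift_m (v : V) : lift Jm Jp ε (Jm (lift Jm Jp ε v)).1 = Jm (lift Jm Jp ε v) :=
  h.eq_lift hε (by rw [h.g_m, h.g_lift hε, map_smul])

/-- Unitary frames of both eigenspaces of the generalized metric. -/
theorem exists_unitary_lift [hd : Fact (Module.finrank ℝ V = 6)] :
    ∃ (e : Fin 3 → V) (u : Module.Basis (Fin 6) ℝ V),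
      (u : Fin 6 → V) = pairFrame e (fun i => (Jm (lift Jm Jp ε (e i))).1) ∧
      (∀ x i, u.repr x i = metric (gOf Jm Jp) x (u i)) ∧
      (∀ i j, metric (gOf Jm Jp) (e i) (e j) = if i = j then 1 else 0) ∧
      (∀ i j, metric (gOf Jm Jp) (e i) (Jm (lift Jm Jp ε (e j))).1 = 0) := by
  set I : V → V := fun v => (Jm (lift Jm Jp ε v)).1
  let B : V →ₗ[ℝ] V →ₗ[ℝ] ℝ := LinearMap.mk₂ ℝ (fun v w => metric (gOf Jm Jp) v w)
    (fun v w x => by simp) (fun c v w => by simp) (fun v w x => by simp) (fun c v w => by simp)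
  have hB : ∀ v w, B v w = metric (gOf Jm Jp) v w := fun _ _ => rfl
  have hε0 : ε ≠ 0 := by rintro rfl; norm_num at hε
  have symm : ∀ v w, B v w = B w v := h.metric_comm
  have hII : ∀ v w, B (I v) (I w) = B v w := by
    intro v w
    refine mul_left_cancel₀ hε0 ?_
    rw [hB, hB, ← h.pairing_lift hε, ← h.pairing_lift hε, h.lift_m hε, h.lift_m hε, h.m_m]
  have hI : ∀ v w, B v (I w) = -B (I v) w := by
    intro v w
    refine mul_left_cancel₀ hε0 ?_
    rw [mul_neg, hB, hB, ← h.pairing_lift hε, ← h.pairing_lift hε, h.lift_m hε, h.lift_m hε, h.skew_m,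
      neg_neg]
  obtain ⟨e, he, hei⟩ := exists_unitary B symm h.metric_pos I hI
  obtain ⟨u, hu, hr⟩ := exists_basis_of_orthonormal B (pairFrame e fun i => I (e i))
    (pairFrame_orthonormal B symm e _ he (fun i j => by rw [hII, he]) hei)
  exact ⟨e, u, hu, fun x i => by rw [hr, hu]; rfl, he, hei⟩

theorem expand_lift {e : Fin 3 → V} {u : Module.Basis (Fin 6) ℝ V}
    (hu : (u : Fin 6 → V) = pairFrame e (fun i => (Jm (lift Jm Jp ε (e i))).1))
    (hr : ∀ x i, u.repr x i = metric (gOf Jm Jp) x (u i)) (W : GenVec V) :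
    (1 / 2 : ℝ) • (W + ε • gOf Jm Jp W) = ε • ∑ i, (pairing W (lift Jm Jp ε (e i)) • lift Jm Jp ε (e i)
      + pairing W (Jm (lift Jm Jp ε (e i))) • Jm (lift Jm Jp ε (e i))) := by
  set P := (1 / 2 : ℝ) • (W + ε • gOf Jm Jp W) with hP
  have hGP : gOf Jm Jp P = ε • P := by
    rw [hP, map_smul, map_add, map_smul, h.g_g]
    linear_combination (norm := module) (-(1 / 2) * hε) • gOf Jm Jp W
  have hp : ∀ v, ε * metric (gOf Jm Jp) P.1 v = pairing W (lift Jm Jp ε v) := by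
    intro v
    rw [← h.pairing_lift hε, h.eq_lift hε hGP, hP, pairing_smul_left, pairing_add_left,
      pairing_smul_left, h.g_symm, h.g_lift hε, pairing_smul_right, ← mul_assoc, hε]
    ring
  have hmet : ∀ v, metric (gOf Jm Jp) P.1 v = ε * pairing W (lift Jm Jp ε v) := by
    intro v
    rw [← hp, ← mul_assoc, hε, one_mul]
  have h1 : P.1 = ∑ i, metric (gOf Jm Jp) P.1 (u i) • u i := by
    conv_lhs => rw [← u.sum_repr P.1]
    simp only [hr]
  have h2 : P = ∑ i, metric (gOf Jm Jp) P.1 (u i) • lift Jm Jp ε (u i) := by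
    conv_lhs => rw [← h.eq_lift hε hGP, h1, map_sum]
    simp only [map_smul]
  rw [h2]
  simp only [hmet, hu, Fin.sum_univ_succ, pairFrame, Finset.univ_eq_empty, Finset.sum_empty]
  simp only [Matrix.cons_val_zero, Matrix.cons_val_succ, h.lift_m hε]
  simp only [Fin.succ_zero_eq_one, Fin.succ_one_eq_two]
  module

end IsGenKahler

theorem IsGenKahler.exists_adapted (h : IsGenKahler Jm Jp) [hd : Fact (Module.finrank ℝ V = 6)] :
    ∃ (e : Fin 3 → V) (d : Fin 3 → GenVec V) (u : Module.Basis (Fin 6) ℝ V),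
      IsAdapted Jm Jp (fun i => lift Jm Jp 1 (e i)) d ∧
      (u : Fin 6 → V) = pairFrame e (fun i => (Jm (lift Jm Jp 1 (e i))).1) ∧
      (∀ x i, u.repr x i = metric (gOf Jm Jp) x (u i)) := by
  have hp : (1 : ℝ) * 1 = 1 := by norm_num
  have hm : (-1 : ℝ) * (-1) = 1 := by norm_num
  obtain ⟨e, u, hu, hr, he, hei⟩ := h.exists_unitary_lift hp
  obtain ⟨e', u', hu', hr', he', hei'⟩ := h.exists_unitary_lift hm
  refine ⟨e, fun i => lift Jm Jp (-1) (e' i), u, ?_, hu, hr⟩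
  constructor
  · intro i
    rw [h.m_of_g (h.g_lift hp (e i)), one_smul]
  · intro i
    rw [h.m_of_g (h.g_lift hm (e' i))]
    module
  · intro i j
    rw [h.pairing_lift hp, he, one_mul]
  · intro i j
    rw [← h.lift_m hp, h.pairing_lift hp, hei, mul_zero]
  · intro i j
    rw [h.pairing_lift hm, he']
    split_ifs <;> norm_num
  · intro i j
    rw [← h.lift_m hm, h.pairing_lift hm, hei', mul_zero]
  · intro W
    have e1 := h.expand_lift hp hu hr W
    have e2 := h.expand_lift hm hu' hr' W
    have e3 : W = (1 / 2 : ℝ) • (W + (1 : ℝ) • gOf Jm Jp W)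
        + (1 / 2 : ℝ) • (W + (-1 : ℝ) • gOf Jm Jp W) := by module
    conv_lhs => rw [e3, e1, e2]
    module

end GenFrame

/-! ### The Mukai pairing and the volume form -/

section Mukai

variable {V : Type*} [NormedAddCommGroup V] [NormedSpace ℝ V] [FiniteDimensional ℝ V]

theorem wedgeForm_add (k : ℕ) (φ ψ : Form V ℂ k) (Ψ : Polyform V) :
    wedgeForm k (φ + ψ) Ψ = wedgeForm k φ Ψ + wedgeForm k ψ Ψ := by
  induction k with
  | zero => simp [wedgeForm, add_smul]
  | succ k ih =>
    simp only [wedgeForm, ContinuousAlternatingMap.curryLeft_add, add_apply, ih, ← wedOp_apply,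
      map_add, Finset.sum_add_distrib, smul_add]

theorem wedgeForm_smul (k : ℕ) (c : ℂ) (φ : Form V ℂ k) (Ψ : Polyform V) :
    wedgeForm k (c • φ) Ψ = c • wedgeForm k φ Ψ := by
  induction k with
  | zero => simp [wedgeForm, smul_smul]
  | succ k ih =>
    have : ∀ v, (c • φ).curryLeft v = c • φ.curryLeft v := fun v => rfl
    simp only [wedgeForm, this, ih, ← wedOp_apply, map_smul, ← Finset.smul_sum]
    rw [smul_comm]

theorem sum_wed_dualBas (ν : V →L[ℝ] ℂ) (Ψ : Polyform V) :
    ∑ a, ν (bas V a) • wedOp (Complex.ofRealCLM.comp (dualBas a)) Ψ = wedOp ν Ψ := by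
  conv_rhs => rw [← sum_dualBas ν]
  simp only [map_sum, LinearMap.sum_apply, map_smul, LinearMap.smul_apply]

theorem wedgeForm_wed (ν : V →L[ℝ] ℂ) (Ψ : Polyform V) (k : ℕ) : ∀ Φ : Polyform V,
    wedgeForm (k + 1) (wedOp ν Φ (k + 1)) Ψ = wedOp ν (wedgeForm k (Φ k) Ψ) := by
  have key : ∀ k (Φ : Polyform V) a, (wedOp ν Φ (k + 1)).curryLeft (bas V a)
      = ν (bas V a) • Φ k - wedOp ν (intOp (bas V a) Φ) k := by
    intro k Φ a
    have := congrFun (int_wed' (bas V a) ν Φ) k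
    exact this
  induction k with
  | zero =>
    intro Φ
    have : ∀ a, (wedOp ν Φ (0 + 1)).curryLeft (bas V a) ![] = ν (bas V a) * Φ 0 ![] := by
      intro a
      rw [key, wedOp_apply_zero, sub_zero]
      rfl
    simp only [wedgeForm, this, ← wedOp_apply, map_smul]
    simp only [mul_smul, smul_comm _ (Φ 0 ![]), ← Finset.smul_sum]
    simp only [smul_comm (Φ 0 ![]), ← Finset.smul_sum, sum_wed_dualBas]
    simp
  | succ k ih =>
    intro Φ
    rw [wedgeForm]
    have hs : ∀ φ ψ : Form V ℂ (k + 1), wedgeForm (k + 1) (φ - ψ) Ψ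
        = wedgeForm (k + 1) φ Ψ - wedgeForm (k + 1) ψ Ψ := by
      intro φ ψ
      have := wedgeForm_add (k + 1) (φ - ψ) ψ Ψ
      rw [sub_add_cancel] at this
      rw [this, add_sub_cancel_right]
    have e1 : ∀ a, wedgeForm (k + 1) ((wedOp ν Φ (k + 1 + 1)).curryLeft (bas V a)) Ψ
        = ν (bas V a) • wedgeForm (k + 1) (Φ (k + 1)) Ψ
          - wedOp ν (wedgeForm k ((Φ (k + 1)).curryLeft (bas V a)) Ψ) := by
      intro a
      rw [key, hs, wedgeForm_smul, ih]
      rfl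
    have e2 : wedgeForm (k + 1) (Φ (k + 1)) Ψ = ((k : ℂ) + 1)⁻¹ •
        ∑ a, wedOp (Complex.ofRealCLM.comp (dualBas a))
          (wedgeForm k ((Φ (k + 1)).curryLeft (bas V a)) Ψ) := rfl
    have hk : ((k : ℂ) + 1) ≠ 0 := by exact_mod_cast Nat.succ_ne_zero k
    have e3 : ∑ a, wedOp (Complex.ofRealCLM.comp (dualBas a))
        (wedgeForm k ((Φ (k + 1)).curryLeft (bas V a)) Ψ)
        = ((k : ℂ) + 1) • wedgeForm (k + 1) (Φ (k + 1)) Ψ := by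
      rw [e2, smul_smul, mul_inv_cancel₀ hk, one_smul]
    have e4 : ∀ a (Ξ : Polyform V), wedOp (Complex.ofRealCLM.comp (dualBas a)) (wedOp ν Ξ)
        = -wedOp ν (wedOp (Complex.ofRealCLM.comp (dualBas a)) Ξ) := by
      intro a Ξ
      have := congrArg (fun f => f Ξ) (wed_anticomm (Complex.ofRealCLM.comp (dualBas a)) ν)
      simp only [Module.End.mul_apply, LinearMap.smul_apply] at this
      rw [this]
      module
    simp only [e1, ← wedOp_apply, map_sub, map_smul, e4, Finset.sum_sub_distrib,
      Finset.sum_neg_distrib, sum_wed_dualBas]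
    rw [← map_sum, e3, map_smul, sub_neg_eq_add]
    have hk2 : (((k + 1 : ℕ) : ℂ) + 1) ≠ 0 := by exact_mod_cast Nat.succ_ne_zero (k + 1)
    rw [show wedOp ν (wedgeForm (k + 1) (Φ (k + 1)) Ψ)
      + ((k : ℂ) + 1) • wedOp ν (wedgeForm (k + 1) (Φ (k + 1)) Ψ)
      = (((k + 1 : ℕ) : ℂ) + 1) • wedOp ν (wedgeForm (k + 1) (Φ (k + 1)) Ψ) by push_cast; module]
    rw [smul_smul, inv_mul_cancel₀ hk2, one_smul]

/-- The wedge product with a fixed right factor, as a linear map. -/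
def wedgeHom (Ψ : Polyform V) : Polyform V →ₗ[ℂ] Polyform V where
  toFun Φ := wedge Φ Ψ
  map_add' Φ Φ' := by
    funext n
    simp only [wedge, Pi.add_apply, wedgeForm_add, Finset.sum_add_distrib]
  map_smul' c Φ := by
    funext n
    simp only [wedge, Pi.smul_apply, wedgeForm_smul, Finset.smul_sum, RingHom.id_apply]

theorem wedge_wed (ν : V →L[ℝ] ℂ) (Φ Ψ : Polyform V) :
    wedge (wedOp ν Φ) Ψ = wedOp ν (wedge Φ Ψ) := by
  funext n
  cases n with
  | zero =>
    simp only [wedge, zero_add, Finset.sum_range_one, wedOp_apply_zero]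
    have := wedgeForm_smul 0 0 0 Ψ
    rw [smul_zero, zero_smul] at this
    rw [this]
    rfl
  | succ n =>
    have h0 : wedgeForm 0 (wedOp ν Φ 0) Ψ = 0 := by
      have := wedgeForm_smul 0 0 0 Ψ
      rw [smul_zero, zero_smul] at this
      rw [wedOp_apply_zero, this]
    have h1 : wedge (wedOp ν Φ) Ψ (n + 1) = ∑ k ∈ Finset.range (n + 1),
        wedOp ν (wedgeForm k (Φ k) Ψ) (n + 1) := by
      simp only [wedge]
      rw [Finset.sum_range_succ', h0]
      simp only [wedgeForm_wed, Pi.zero_apply, add_zero]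
    rw [h1, ← Finset.sum_apply, ← map_sum]
    have h2 : (∑ k ∈ Finset.range (n + 1), wedgeForm k (Φ k) Ψ) n = wedge Φ Ψ n := by
      rw [Finset.sum_apply]; rfl
    rw [← sub_eq_zero, ← Pi.sub_apply, ← map_sub]
    refine wedOp_component ?_
    rw [Pi.sub_apply, h2, sub_self]

theorem wedge_two (β : Form V ℂ 2) (Φ Ψ : Polyform V) :
    wedge (twoOp β Φ) Ψ = twoOp β (wedge Φ Ψ) := by
  change wedgeHom Ψ (twoOp β Φ) = twoOp β (wedgeHom Ψ Φ)
  have h : ∀ ν Φ, wedgeHom Ψ (wedOp ν Φ) = wedOp ν (wedgeHom Ψ Φ) := fun ν Φ => wedge_wed ν Φ Ψ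
  simp only [twoOp_eq, LinearMap.smul_apply, LinearMap.sum_apply, Module.End.mul_apply, map_smul,
    map_sum, h]

theorem wedge_one (Ψ : Polyform V) : wedge (constP 1) Ψ = Ψ := by
  funext n
  simp only [wedge]
  rw [Finset.sum_eq_single_of_mem 0 (by simp)]
  · rw [wedgeForm, constP_apply_zero, one_smul]
  · intro k _ hk
    have h0 : (constP 1 : Polyform V) k = 0 := Pi.single_eq_of_ne hk _
    have := wedgeForm_smul k 0 0 Ψ
    rw [smul_zero, zero_smul] at this
    rw [h0, this]
    rfl

variable [hd : Fact (Module.finrank ℝ V = 6)]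

theorem eOp_apply_eq (β : Form V ℂ 2) (Φ : Polyform V) : eOp β Φ = Φ + twoOp β Φ
    + (1 / 2 : ℂ) • twoOp β (twoOp β Φ) + (1 / 6 : ℂ) • twoOp β (twoOp β (twoOp β Φ)) := by
  rw [eOp_eq_sum]
  simp [Finset.sum_range_succ, pow_succ, Nat.factorial]

theorem wedge_exp (β : Form V ℂ 2) (Ψ : Polyform V) : wedge (eOp β (constP 1)) Ψ = eOp β Ψ := by
  have h : ∀ Φ, wedgeHom Ψ (twoOp β Φ) = twoOp β (wedgeHom Ψ Φ) := fun Φ => wedge_two β Φ Ψ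
  change wedgeHom Ψ (eOp β (constP 1)) = _
  have h1 : wedgeHom Ψ (constP 1) = Ψ := wedge_one Ψ
  simp only [eOp_apply_eq, map_smul, h, h1, map_add]

theorem exp_apply_rec (γ : Form V ℂ 2) (n : ℕ) (v : Fin (n + 2) → V) :
    eOp γ (constP 1) (n + 2) v = ∑ i : Fin (n + 1), (-1 : ℂ) ^ (i : ℕ) * (γ ![v 0, v i.succ]
      * eOp γ (constP 1) n (fun j => v (i.succAbove j).succ)) := by
  have h1 : eOp γ (constP 1) (n + 2) v = intOp (v 0) (eOp γ (constP 1)) (n + 1) (Fin.tail v) := by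
    rw [intOp_apply_apply]
    congr 1
    exact (Fin.cons_self_tail v).symm
  rw [h1, int_eOp_apply, intOp_constP, zero_add, ← Module.End.mul_apply, (eOp_wed _ _).eq,
    Module.End.mul_apply, wedOp_apply_succ]
  refine Finset.sum_congr rfl fun i _ => ?_
  rw [contractC_apply]
  rfl

/-- Complex conjugation of a form. -/
def conjForm {k : ℕ} (φ : Form V ℂ k) : Form V ℂ k :=
  (Complex.conjCLE : ℂ →L[ℝ] ℂ).compContinuousAlternatingMap φ

theorem conjP_add (Φ Ψ : Polyform V) : conjP (Φ + Ψ) = conjP Φ + conjP Ψ := by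
  funext k; ext v; simp [conjP]

theorem conjP_smul (c : ℂ) (Φ : Polyform V) : conjP (c • Φ) = (starRingEnd ℂ) c • conjP Φ := by
  funext k; ext v; simp [conjP]

theorem conjP_wed (ν : V →L[ℝ] ℂ) (Φ : Polyform V) : conjP (wedOp ν Φ)
    = wedOp ((Complex.conjCLE : ℂ →L[ℝ] ℂ).comp ν) (conjP Φ) := by
  funext k
  cases k with
  | zero => ext v; simp [conjP, wedOp_apply_zero]
  | succ k =>
    ext v
    rw [wedOp_apply_succ]
    simp [conjP, wedOp_apply_succ]

theorem conjP_int (v : V) (Φ : Polyform V) : conjP (intOp v Φ) = intOp v (conjP Φ) := by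
  funext k; ext w; rfl

theorem conjP_cl (W : GenVec V) (Φ : Polyform V) : conjP (cl W Φ) = cl W (conjP Φ) := by
  have : (Complex.conjCLE : ℂ →L[ℝ] ℂ).comp (Complex.ofRealCLM.comp W.2)
      = Complex.ofRealCLM.comp W.2 := by
    ext w; simp
  rw [cl_eq, LinearMap.add_apply, LinearMap.add_apply, conjP_add, conjP_int, conjP_wed, this]

theorem conjP_sum {ι : Type*} (s : Finset ι) (f : ι → Polyform V) :
    conjP (∑ i ∈ s, f i) = ∑ i ∈ s, conjP (f i) :=
  map_sum (⟨⟨conjP, by funext k; ext v; simp [conjP]⟩, conjP_add⟩ : Polyform V →+ Polyform V) f s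

theorem conjP_two (β : Form V ℂ 2) (Φ : Polyform V) :
    conjP (twoOp β Φ) = twoOp (conjForm β) (conjP Φ) := by
  have h1 : ∀ a, (Complex.conjCLE : ℂ →L[ℝ] ℂ).comp (contractC (bas V a) β)
      = contractC (bas V a) (conjForm β) := by
    intro a; ext w; simp [contractC_apply, conjForm]
  have h2 : ∀ a, (Complex.conjCLE : ℂ →L[ℝ] ℂ).comp (Complex.ofRealCLM.comp (dualBas (V := V) a))
      = Complex.ofRealCLM.comp (dualBas a) := by
    intro a; ext w; simp
  simp only [twoOp_eq, LinearMap.smul_apply, LinearMap.sum_apply, Module.End.mul_apply, conjP_smul,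
    conjP_sum, conjP_wed, h1, h2]
  simp [Complex.conj_ofNat]

theorem lam_two (β : Form V ℂ 2) (Φ : Polyform V) : lam (twoOp β Φ) = -twoOp β (lam Φ) := by
  have hlow : ∀ (Ψ : Polyform V) n, n < 2 → twoOp β Ψ n = 0 := fun Ψ n hn =>
    twoOp_mem_degGE (mem_degGE_zero Ψ) n (by omega)
  have hloc : ∀ (Ψ : Polyform V) k, Ψ k = 0 → twoOp β Ψ (k + 2) = 0 := by
    intro Ψ k h
    rw [twoOp_eq, LinearMap.smul_apply, LinearMap.sum_apply, Pi.smul_apply, Finset.sum_apply,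
      Finset.sum_eq_zero, smul_zero]
    intro a _
    exact wedOp_component (wedOp_component h)
  funext n
  rcases Nat.lt_or_ge n 2 with hn | hn
  · rw [lam, Pi.neg_apply, hlow _ n hn, hlow _ n hn, smul_zero, neg_zero]
  · obtain ⟨k, rfl⟩ := Nat.exists_eq_add_of_le' hn
    have h1 := hloc (lam Φ - (-1 : ℂ) ^ (k / 2) • Φ) k (by rw [Pi.sub_apply]; exact sub_self _)
    rw [map_sub, map_smul, Pi.sub_apply, sub_eq_zero, Pi.smul_apply] at h1
    rw [Pi.neg_apply, h1, lam, Nat.add_div_right k (by norm_num), pow_succ]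
    module

theorem lam_add (Φ Ψ : Polyform V) : lam (Φ + Ψ) = lam Φ + lam Ψ := by
  funext k; simp [lam]

theorem lam_smul (c : ℂ) (Φ : Polyform V) : lam (c • Φ) = c • lam Φ := by
  funext k
  simp only [lam, Pi.smul_apply]
  rw [smul_comm]

theorem conjP_one : conjP (constP 1 : Polyform V) = constP 1 := by
  funext k
  rcases Nat.eq_zero_or_pos k with rfl | hk
  · ext v; simp [conjP, constP]
  · rw [conjP, constP_mem_degLE 1 k hk]; ext v; simp

theorem lam_one : lam (constP 1 : Polyform V) = constP 1 := by
  funext k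
  rcases Nat.eq_zero_or_pos k with rfl | hk
  · simp [lam]
  · rw [lam, constP_mem_degLE 1 k hk, smul_zero]

theorem conjP_eOp (β : Form V ℂ 2) (Φ : Polyform V) :
    conjP (eOp β Φ) = eOp (conjForm β) (conjP Φ) := by
  simp only [eOp_apply_eq, conjP_add, conjP_smul, conjP_two]
  simp [Complex.conj_ofNat]

theorem lam_eOp (β : Form V ℂ 2) (Φ : Polyform V) : lam (eOp β Φ) = eOp (-β) (lam Φ) := by
  simp only [eOp_apply_eq, lam_add, lam_smul, lam_two, twoOp_neg, LinearMap.neg_apply, map_neg]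

theorem conjForm_beta (b om : Form V ℝ 2) :
    conjForm (-cplx b + Complex.I • cplx om) = -cplx b - Complex.I • cplx om := by
  ext v
  simp [conjForm, cplx]
  ring

theorem mukai_exp (α : ℂ) (b om : Form V ℝ 2) (w : Fin 6 → V) :
    mukai (α • expP b om) (conjP (α • expP b om)) w
      = (Complex.normSq α : ℂ) * eOp ((2 * Complex.I) • cplx om) (constP 1) 6 w := by
  have h1 : lam (conjP (α • expP b om))
      = (starRingEnd ℂ) α • eOp (-(-cplx b - Complex.I • cplx om)) (constP 1) := by
    rw [conjP_smul, lam_smul, expP, conjP_eOp, lam_eOp, conjForm_beta, conjP_one, lam_one]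
  have h2 : mukai (α • expP b om) (conjP (α • expP b om))
      = (wedgeHom (lam (conjP (α • expP b om))) (α • expP b om)) 6 := rfl
  have h3 : ∀ Ψ, wedgeHom Ψ (expP b om) = eOp (-cplx b + Complex.I • cplx om) Ψ :=
    fun Ψ => wedge_exp _ Ψ
  have h4 : -cplx b + Complex.I • cplx om + -(-cplx b - Complex.I • cplx om)
      = (2 * Complex.I) • cplx om := by module
  rw [h2, map_smul, h3, h1, map_smul, ← Module.End.mul_apply, ← eOp_add, h4, smul_smul,
    Complex.mul_conj]
  rfl

theorem exp_apply_two (γ : Form V ℂ 2) (x y : V) :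
    eOp γ (constP 1) 2 ![x, y] = γ ![x, y] := by
  have h0 : ∀ w : Fin 0 → V, eOp γ (constP 1) 0 w = 1 := by
    intro w
    rw [eOp_apply_zero, Subsingleton.elim w ![], constP_apply_zero]
  rw [exp_apply_rec γ 0]
  simp [h0]

theorem exp_apply_four (γ : Form V ℂ 2) (x y z w : V) :
    eOp γ (constP 1) 4 ![x, y, z, w] = γ ![x, y] * γ ![z, w] - γ ![x, z] * γ ![y, w]
      + γ ![x, w] * γ ![y, z] := by
  rw [exp_apply_rec γ 2, Fin.sum_univ_three]
  have e0 : (fun j => ![x, y, z, w] ((0 : Fin 3).succAbove j).succ) = ![z, w] := by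
    funext j; fin_cases j <;> rfl
  have e1 : (fun j => ![x, y, z, w] ((1 : Fin 3).succAbove j).succ) = ![y, w] := by
    funext j; fin_cases j <;> rfl
  have e2 : (fun j => ![x, y, z, w] ((2 : Fin 3).succAbove j).succ) = ![y, z] := by
    funext j; fin_cases j <;> rfl
  have f0 : ![x, y, z, w] (0 : Fin 3).succ = y := rfl
  have f1 : ![x, y, z, w] (1 : Fin 3).succ = z := rfl
  have f2 : ![x, y, z, w] (2 : Fin 3).succ = w := rfl
  have f3 : ![x, y, z, w] 0 = x := rfl
  rw [e0, e1, e2, f0, f1, f2, f3, exp_apply_two, exp_apply_two, exp_apply_two]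
  simp
  ring

/-- The Pfaffian expansion of the top degree component of `e^γ`, along the first vector. -/
theorem exp_apply_six (γ : Form V ℂ 2) (x y z w s t : V) :
    eOp γ (constP 1) 6 ![x, y, z, w, s, t] =
      γ ![x, y] * (γ ![z, w] * γ ![s, t] - γ ![z, s] * γ ![w, t] + γ ![z, t] * γ ![w, s])
      - γ ![x, z] * (γ ![y, w] * γ ![s, t] - γ ![y, s] * γ ![w, t] + γ ![y, t] * γ ![w, s])
      + γ ![x, w] * (γ ![y, z] * γ ![s, t] - γ ![y, s] * γ ![z, t] + γ ![y, t] * γ ![z, s])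
      - γ ![x, s] * (γ ![y, z] * γ ![w, t] - γ ![y, w] * γ ![z, t] + γ ![y, t] * γ ![z, w])
      + γ ![x, t] * (γ ![y, z] * γ ![w, s] - γ ![y, w] * γ ![z, s] + γ ![y, s] * γ ![z, w]) := by
  rw [exp_apply_rec γ 4, Fin.sum_univ_five]
  have e0 : (fun j => ![x, y, z, w, s, t] ((0 : Fin 5).succAbove j).succ) = ![z, w, s, t] := by
    funext j; fin_cases j <;> rfl
  have e1 : (fun j => ![x, y, z, w, s, t] ((1 : Fin 5).succAbove j).succ) = ![y, w, s, t] := by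
    funext j; fin_cases j <;> rfl
  have e2 : (fun j => ![x, y, z, w, s, t] ((2 : Fin 5).succAbove j).succ) = ![y, z, s, t] := by
    funext j; fin_cases j <;> rfl
  have e3 : (fun j => ![x, y, z, w, s, t] ((3 : Fin 5).succAbove j).succ) = ![y, z, w, t] := by
    funext j; fin_cases j <;> rfl
  have e4 : (fun j => ![x, y, z, w, s, t] ((4 : Fin 5).succAbove j).succ) = ![y, z, w, s] := by
    funext j; fin_cases j <;> rfl
  have f0 : ![x, y, z, w, s, t] (0 : Fin 5).succ = y := rfl
  have f1 : ![x, y, z, w, s, t] (1 : Fin 5).succ = z := rfl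
  have f2 : ![x, y, z, w, s, t] (2 : Fin 5).succ = w := rfl
  have f3 : ![x, y, z, w, s, t] (3 : Fin 5).succ = s := rfl
  have f4 : ![x, y, z, w, s, t] (4 : Fin 5).succ = t := rfl
  have f5 : ![x, y, z, w, s, t] 0 = x := rfl
  rw [e0, e1, e2, e3, e4, f0, f1, f2, f3, f4, f5]
  simp only [exp_apply_four]
  simp
  ring

end Mukai

/-! ### Orientation and volume -/

section Volume

variable {V : Type*} [NormedAddCommGroup V] [NormedSpace ℝ V] [FiniteDimensional ℝ V]
  [hd : Fact (Module.finrank ℝ V = 6)]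
variable {Jm Jp : GenVec V →ₗ[ℝ] GenVec V} {b om : Form V ℝ 2}

/-- The positive definite eigenspace of the generalized metric in terms of `b` and `ω`:
`g(v, ·) + v ⌟ B = v ⌟ b - (I v) ⌟ ω`. -/
theorem lift_snd_eq (h : IsGenKahler Jm Jp) (ht : IsTypeZero Jp b om) (v : V) :
    (lift Jm Jp 1 v).2 = contract v b - contract (Jm (lift Jm Jp 1 v)).1 om := by
  have h1 := h.m_of_g (h.g_lift (one_mul 1) v)
  rw [one_smul] at h1
  obtain ⟨X, Y, hXY⟩ := ht.exists_rep (lift Jm Jp 1 v)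
  have hX : v = X := by
    rw [← h.lift_fst 1 v, hXY]; simp
  rw [← h1, hXY, map_add, ht.vec, ht.form, hX]
  simp only [Prod.snd_add, Prod.fst_add, Prod.fst_neg, zero_add]
  rw [sub_eq_add_neg]
  congr 1
  have := map_neg (contractHom om) Y
  rw [contractHom_apply, contractHom_apply] at this
  rw [this, neg_neg]

/-- The symmetric part of `ω(v, I w)` is the metric, so `ω` tames the structure `I` that `J₋`
induces on the positive eigenspace. -/
theorem metric_om (h : IsGenKahler Jm Jp) (ht : IsTypeZero Jp b om) (v w : V) :
    om ![v, (Jm (lift Jm Jp 1 w)).1] + om ![w, (Jm (lift Jm Jp 1 v)).1]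
      = 2 * metric (gOf Jm Jp) v w := by
  have h1 := h.pairing_lift (one_mul 1) v w
  rw [pairing, h.lift_fst, h.lift_fst, lift_snd_eq h ht, lift_snd_eq h ht, one_mul] at h1
  simp only [sub_apply, contract_apply] at h1
  rw [twoForm_skew b w v, twoForm_skew om _ v, twoForm_skew om _ w] at h1
  linarith

/-- The orientation for which the Mukai norm of `Ω₊` is positive is that of the unitary frames. -/
theorem exp_om_frame (h : IsGenKahler Jm Jp) (ht : IsTypeZero Jp b om) {e : Fin 3 → V}
    {u : Module.Basis (Fin 6) ℝ V}
    (hu : (u : Fin 6 → V) = pairFrame e (fun i => (Jm (lift Jm Jp 1 (e i))).1))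
    (hr : ∀ x i, u.repr x i = metric (gOf Jm Jp) x (u i)) :
    ∃ P : ℝ, 0 < P ∧ eOp ((2 * Complex.I) • cplx om) (constP 1) 6 u = -8 * Complex.I * P := by
  set I : V → V := fun v => (Jm (lift Jm Jp 1 v)).1 with hI
  have hII : ∀ v, I (I v) = -v := by
    intro v
    simp only [hI]
    rw [h.lift_m (one_mul 1), h.sq_m, Prod.fst_neg, h.lift_fst]
  have hneg : ∀ v w, om ![v, -w] = -om ![v, w] := by
    intro v w
    rw [← contract_apply, ← contract_apply, map_neg]
  have hmu : ∀ i j, metric (gOf Jm Jp) (u i) (u j) = if i = j then 1 else 0 := by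
    intro i j
    rw [← hr, Module.Basis.repr_self, Finsupp.single_apply]
  have hme : ∀ i j, metric (gOf Jm Jp) (e i) (e j) = if i = j then 1 else 0 := by
    have u0 : u 0 = e 0 := by rw [hu]; rfl
    have u2 : u 2 = e 1 := by rw [hu]; rfl
    have u4 : u 4 = e 2 := by rw [hu]; rfl
    intro i j
    fin_cases i <;> fin_cases j <;> simp [← u0, ← u2, ← u4, hmu]
  have h1 : ∀ i j, om ![e i, I (e j)] + om ![e j, I (e i)] = 2 * if i = j then 1 else 0 := by
    intro i j
    rw [← hme i j]
    exact metric_om h ht (e i) (e j)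
  have hmI : ∀ i j, metric (gOf Jm Jp) (e i) (I (e j)) = 0 := by
    have u0 : u 0 = e 0 := by rw [hu]; rfl
    have u2 : u 2 = e 1 := by rw [hu]; rfl
    have u4 : u 4 = e 2 := by rw [hu]; rfl
    have u1 : u 1 = I (e 0) := by rw [hu]; rfl
    have u3 : u 3 = I (e 1) := by rw [hu]; rfl
    have u5 : u 5 = I (e 2) := by rw [hu]; rfl
    intro i j
    have q : ∀ (i j : Fin 6) (x y : V), i ≠ j → u i = x → u j = y →
        metric (gOf Jm Jp) x y = 0 := by
      rintro i j _ _ hij rfl rfl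
      rw [hmu, if_neg hij]
    fin_cases i <;> fin_cases j
    exacts [q 0 1 _ _ (by decide) u0 u1, q 0 3 _ _ (by decide) u0 u3, q 0 5 _ _ (by decide) u0 u5,
      q 2 1 _ _ (by decide) u2 u1, q 2 3 _ _ (by decide) u2 u3, q 2 5 _ _ (by decide) u2 u5,
      q 4 1 _ _ (by decide) u4 u1, q 4 3 _ _ (by decide) u4 u3, q 4 5 _ _ (by decide) u4 u5]
  have h2 : ∀ i j, om ![I (e i), I (e j)] = -om ![e i, e j] := by
    intro i j
    have h3 := metric_om h ht (e j) (I (e i))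
    change om ![e j, I (I (e i))] + om ![I (e i), I (e j)] = _ at h3
    rw [hII, hneg, hmI, twoForm_skew om (e j)] at h3
    linarith
  have hd' : ∀ i, om ![e i, I (e i)] = 1 := by
    intro i
    have := h1 i i
    simp at this
    linarith
  have k1 := h1 0 1
  have k2 := h1 0 2
  have k3 := h1 1 2
  simp at k1 k2 k3
  have l1 : om ![e 1, I (e 0)] = -om ![e 0, I (e 1)] := by linarith
  have l2 : om ![e 2, I (e 0)] = -om ![e 0, I (e 2)] := by linarith
  have l3 : om ![e 2, I (e 1)] = -om ![e 1, I (e 2)] := by linarith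
  refine ⟨1 + (om ![e 0, e 1] ^ 2 + om ![e 0, I (e 1)] ^ 2 + om ![e 0, e 2] ^ 2
    + om ![e 0, I (e 2)] ^ 2 + om ![e 1, e 2] ^ 2 + om ![e 1, I (e 2)] ^ 2), by positivity, ?_⟩
  have hc : ∀ v w, ((2 * Complex.I) • cplx om) ![v, w] = 2 * Complex.I * (om ![v, w] : ℂ) :=
    fun v w => rfl
  rw [hu]
  change eOp _ _ 6 ![e 0, I (e 0), e 1, I (e 1), e 2, I (e 2)] = _
  rw [exp_apply_six]
  simp only [hc, h2, hd', twoForm_skew om (I (e 0)) (e 1), twoForm_skew om (I (e 0)) (e 2),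
    twoForm_skew om (I (e 1)) (e 2), l1, l2, l3]
  push_cast
  linear_combination (8 * Complex.I * (1 + ((om ![e 0, e 1] : ℂ) ^ 2 + (om ![e 0, I (e 1)] : ℂ) ^ 2
    + (om ![e 0, e 2] : ℂ) ^ 2 + (om ![e 0, I (e 2)] : ℂ) ^ 2 + (om ![e 1, e 2] : ℂ) ^ 2
    + (om ![e 1, I (e 2)] : ℂ) ^ 2))) * Complex.I_sq

/-- The Riemannian volume form takes the value one on positively oriented orthonormal bases. -/
theorem volForm_apply {G : GenVec V →ₗ[ℝ] GenVec V} {u : Module.Basis (Fin 6) ℝ V}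
    (hr : ∀ x i, u.repr x i = metric G x (u i))
    (m : Form V ℂ 6) {p : ℝ} (hp : 0 < p) (hm : m u = p) : volForm hd.out G m u = 1 := by
  set f : Module.Basis (Fin 6) ℝ V := (bas V).reindex (finCongr hd.out) with hf
  have hfi : (fun i => bas V (Fin.cast hd.out.symm i)) = f := by
    funext i
    simp [hf]
  set M := u.toMatrix f with hM
  have hdet : Matrix.det (Matrix.of fun a b => metric G (bas V a) (bas V b)) = M.det ^ 2 := by
    have h1 : (Matrix.of fun a b => metric G (bas V a) (bas V b))
        = (M.transpose * M).submatrix (finCongr hd.out) (finCongr hd.out) := by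
      ext a b
      rw [Matrix.submatrix_apply, Matrix.mul_apply, Matrix.of_apply]
      have e1 : ∀ a, f (finCongr hd.out a) = bas V a := fun a => by simp [hf]
      simp only [hM, Matrix.transpose_apply, Module.Basis.toMatrix_apply, e1, hr]
      conv_lhs => rw [← u.sum_repr (bas V b)]
      rw [map_sum]
      refine Finset.sum_congr rfl fun i _ => ?_
      rw [map_smul, hr, smul_eq_mul, mul_comm]
    rw [h1, Matrix.det_submatrix_equiv_self, Matrix.det_mul, Matrix.det_transpose, sq]
  have hmf : m f = M.det * p := by
    have h1 : m f = u.det f • m u := by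
      have h2 := AlternatingMap.eq_smul_basis_det (R := ℝ) (e := u)
        (f := (Complex.reCLM.compContinuousAlternatingMap m).toAlternatingMap)
      have h3 := AlternatingMap.eq_smul_basis_det (R := ℝ) (e := u)
        (f := (Complex.imCLM.compContinuousAlternatingMap m).toAlternatingMap)
      have h4 := congrArg (fun g => g f) h2
      have h5 := congrArg (fun g => g f) h3
      have h4' : (m f).re = (m u).re * u.det f := h4
      have h5' : (m f).im = (m u).im * u.det f := h5
      apply Complex.ext
      · simp [h4', mul_comm]
      · simp [h5', mul_comm]
    rw [h1, hm, Module.Basis.det_apply]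
    simp [hM]
  have hM0 : M.det ≠ 0 := by
    have := u.isUnit_det f
    rw [Module.Basis.det_apply] at this
    exact this.ne_zero
  rw [volForm, hfi, hdet, hmf, ContinuousAlternatingMap.smul_apply, hm, Real.sqrt_sq_eq_abs,
    norm_mul, Complex.norm_real, Complex.norm_real, Real.norm_eq_abs, Real.norm_eq_abs,
    abs_of_pos hp, smul_eq_mul, ← Complex.ofReal_mul]
  have : |M.det| ≠ 0 := abs_ne_zero.mpr hM0
  rw [show |M.det| / (|M.det| * p) * p = 1 by field_simp, Complex.ofReal_one]

/-- The functional `[e^B ∧ ·]₆` composed with the generalized Hodge operator is the degree zero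
component. -/
theorem tau_hodge (h : IsGenKahler Jm Jp) {e : Fin 3 → V} {u : Module.Basis (Fin 6) ℝ V}
    (hu : (u : Fin 6 → V) = pairFrame e (fun i => (Jm (lift Jm Jp 1 (e i))).1))
    (hr : ∀ x i, u.repr x i = metric (gOf Jm Jp) x (u i)) (Φ : Polyform V) :
    tau u (cplx (bField (gOf Jm Jp))) (hodge Jm (fun i => lift Jm Jp 1 (e i)) Φ) = Φ 0 ![] := by
  set β := cplx (bField (gOf Jm Jp)) with hβ
  set g := metric (gOf Jm Jp) with hg
  let w : V → Module.End ℂ (Polyform V) := fun v => wedOp (Complex.ofRealCLM.comp (g v))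
  let K : V → Module.End ℂ (Polyform V) := fun v => intOp v + wedOp (contractC v β)
  have hcl : ∀ v, cl (lift Jm Jp 1 v) = K v + w v := by
    intro v
    rw [cl_eq, h.lift_fst, h.lift_snd, one_smul, ContinuousLinearMap.comp_add, map_add, ← add_assoc]
    simp only [K, w]
    rw [hβ, contractC_cplx]
  have hmu : ∀ i j, g (u i) (u j) = if i = j then 1 else 0 := by
    intro i j
    rw [← hr, Module.Basis.repr_self, Finsupp.single_apply]
  -- in the functional each factor can be replaced by its one-form part, working from the left
  have step : ∀ t : Polyform V →ₗ[ℂ] ℂ, ∀ v x, g x v = 0 → (∀ Φ, t (K v Φ) = 0) →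
      ∀ Φ, (t ∘ₗ w x) (K v Φ) = 0 := by
    intro t v x hx ht Φ
    have h1 : w x (K v Φ) = -K v (w x Φ) := by
      have a1 := int_wed' v (Complex.ofRealCLM.comp (g x)) Φ
      have a2 := congrArg (fun f => f Φ) (wed_anticomm (Complex.ofRealCLM.comp (g x)) (contractC v β))
      simp only [Module.End.mul_apply, LinearMap.smul_apply] at a2
      simp only [w, K, LinearMap.add_apply, map_add, a1, a2]
      simp only [ContinuousLinearMap.comp_apply, hx, map_zero, zero_smul]
      module
    rw [LinearMap.comp_apply, h1, map_neg, ht, neg_zero]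
  have repl : ∀ t : Polyform V →ₗ[ℂ] ℂ, ∀ v, (∀ Φ, t (K v Φ) = 0) →
      ∀ Φ, t (cl (lift Jm Jp 1 v) Φ) = (t ∘ₗ w v) Φ := by
    intro t v ht Φ
    rw [hcl, LinearMap.add_apply, map_add, ht, zero_add, LinearMap.comp_apply]
  have u0 : u 0 = e 0 := by rw [hu]; rfl
  have u2 : u 2 = e 1 := by rw [hu]; rfl
  have u4 : u 4 = e 2 := by rw [hu]; rfl
  have u1 : lift Jm Jp 1 (u 1) = Jm (lift Jm Jp 1 (e 0)) := by
    rw [hu]; exact h.lift_m (one_mul 1) _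
  have u3 : lift Jm Jp 1 (u 3) = Jm (lift Jm Jp 1 (e 1)) := by
    rw [hu]; exact h.lift_m (one_mul 1) _
  have u5 : lift Jm Jp 1 (u 5) = Jm (lift Jm Jp 1 (e 2)) := by
    rw [hu]; exact h.lift_m (one_mul 1) _
  have t0 : ∀ i, ∀ Φ, tau u β (K i Φ) = 0 := fun i Φ => tau_int u β i Φ
  have z : ∀ i j, i ≠ j → g (u i) (u j) = 0 := fun i j hij => by rw [hmu, if_neg hij]
  have s1 : ∀ i, 0 < i → ∀ Φ, (tau u β ∘ₗ w (u 0)) (K (u i) Φ) = 0 := fun i hi =>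
    step _ _ _ (z 0 i hi.ne) (t0 _)
  have s2 : ∀ i, 1 < i → ∀ Φ, ((tau u β ∘ₗ w (u 0)) ∘ₗ w (u 1)) (K (u i) Φ) = 0 := fun i hi =>
    step _ _ _ (z 1 i hi.ne) (s1 i (by omega))
  have s3 : ∀ i, 2 < i → ∀ Φ, (((tau u β ∘ₗ w (u 0)) ∘ₗ w (u 1)) ∘ₗ w (u 2)) (K (u i) Φ) = 0 :=
    fun i hi => step _ _ _ (z 2 i hi.ne) (s2 i (by omega))
  have s4 : ∀ i, 3 < i → ∀ Φ,
      ((((tau u β ∘ₗ w (u 0)) ∘ₗ w (u 1)) ∘ₗ w (u 2)) ∘ₗ w (u 3)) (K (u i) Φ) = 0 :=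
    fun i hi => step _ _ _ (z 3 i hi.ne) (s3 i (by omega))
  have s5 : ∀ i, 4 < i → ∀ Φ,
      (((((tau u β ∘ₗ w (u 0)) ∘ₗ w (u 1)) ∘ₗ w (u 2)) ∘ₗ w (u 3)) ∘ₗ w (u 4)) (K (u i) Φ) = 0 :=
    fun i hi => step _ _ _ (z 4 i hi.ne) (s4 i (by omega))
  rw [hodge_apply, ← u1, ← u3, ← u5, ← u0, ← u2, ← u4, repl _ _ (t0 _), repl _ _ (s1 1 (by omega)),
    repl _ _ (s2 2 (by omega)), repl _ _ (s3 3 (by omega)), repl _ _ (s4 4 (by omega)),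
    repl _ _ (s5 5 (by omega))]
  simp only [LinearMap.comp_apply]
  have hw : ∀ v, Commute (eOp β) (w v) := fun v => eOp_wed β _
  rw [tau_apply]
  have hc : ∀ v Φ, eOp β (w v Φ) = w v (eOp β Φ) := fun v Φ => by
    rw [← Module.End.mul_apply, (hw v).eq, Module.End.mul_apply]
  simp only [hc]
  -- the first vector of the remaining ones is dual to the leftmost one-form
  have collapse : ∀ (i : Fin 6) (Φ : Polyform V) (n : ℕ) (v : Fin (n + 1) → V), v 0 = u i →
      (∀ j : Fin n, ∃ k, k ≠ i ∧ v j.succ = u k) → w (u i) Φ (n + 1) v = Φ n (Fin.tail v) := by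
    intro i Φ n v h0 hv
    rw [wedOp_apply_succ, Fin.sum_univ_succ, Finset.sum_eq_zero]
    · simp only [ContinuousLinearMap.comp_apply, h0, hmu]
      simp
    · intro j _
      obtain ⟨k, hk, hjk⟩ := hv j
      simp only [ContinuousLinearMap.comp_apply, hjk, hmu, if_neg hk.symm]
      simp
  rw [collapse 0 _ 5 u rfl fun j => ⟨j.succ, Fin.succ_ne_zero j, rfl⟩]
  rw [collapse 1 _ 4 (Fin.tail u) rfl fun j => ⟨j.succ.succ, fun hj => by
    have : j.val + 2 = 1 := congrArg Fin.val hj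
    omega, rfl⟩]
  rw [collapse 2 _ 3 (Fin.tail (Fin.tail u)) rfl fun j => ⟨j.succ.succ.succ, fun hj => by
    have : j.val + 3 = 2 := congrArg Fin.val hj
    omega, rfl⟩]
  rw [collapse 3 _ 2 (Fin.tail (Fin.tail (Fin.tail u))) rfl
    fun j => ⟨j.succ.succ.succ.succ, fun hj => by
    have : j.val + 4 = 3 := congrArg Fin.val hj
    omega, rfl⟩]
  rw [collapse 4 _ 1 (Fin.tail (Fin.tail (Fin.tail (Fin.tail u)))) rfl
    fun j => ⟨j.succ.succ.succ.succ.succ, fun hj => by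
    have : j.val + 5 = 4 := congrArg Fin.val hj
    omega, rfl⟩]
  rw [collapse 5 _ 0 (Fin.tail (Fin.tail (Fin.tail (Fin.tail (Fin.tail u))))) rfl fun j => j.elim0]
  rw [eOp_apply_zero]
  congr 1
  exact Subsingleton.elim _ _

end Volume

/-! ### Pull-back of polyforms by linear maps -/

section Pull

variable {V : Type*} [NormedAddCommGroup V] [NormedSpace ℝ V]

/-- The pull-back of a polyform by a linear map. -/
def pullP (L : V →L[ℝ] V) : Polyform V →ₗ[ℂ] Polyform V where
  toFun Φ k := (Φ k).compContinuousLinearMap L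
  map_add' _ _ := rfl
  map_smul' _ _ := rfl

theorem pullP_apply (L : V →L[ℝ] V) (Φ : Polyform V) (k : ℕ) :
    pullP L Φ k = (Φ k).compContinuousLinearMap L := rfl

theorem pullP_id (Φ : Polyform V) : pullP (ContinuousLinearMap.id ℝ V) Φ = Φ := by
  funext k; ext v; rfl

theorem pullP_int (L : V →L[ℝ] V) (v : V) (Φ : Polyform V) :
    pullP L (intOp (L v) Φ) = intOp v (pullP L Φ) := by
  funext k
  ext w
  rw [pullP_apply, intOp_apply_apply, pullP_apply]
  simp only [ContinuousAlternatingMap.compContinuousLinearMap_apply]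
  rw [intOp_apply_apply]
  congr 1
  funext i
  refine Fin.cases rfl (fun i => rfl) i

theorem pullP_wed (L : V →L[ℝ] V) (ν : V →L[ℝ] ℂ) (Φ : Polyform V) :
    pullP L (wedOp ν Φ) = wedOp (ν.comp L) (pullP L Φ) := by
  funext k
  cases k with
  | zero => rfl
  | succ k =>
    ext w
    rw [pullP_apply]
    simp only [ContinuousAlternatingMap.compContinuousLinearMap_apply]
    rw [wedOp_apply_succ, wedOp_apply_succ]
    rfl

theorem pullP_cl (L : V →L[ℝ] V) (v : V) (ν : V →L[ℝ] ℝ) (Φ : Polyform V) :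
    pullP L (cl (L v, ν) Φ) = cl (v, ν.comp L) (pullP L Φ) := by
  rw [cl_eq, cl_eq, LinearMap.add_apply, map_add, pullP_int, pullP_wed]
  rfl

variable [FiniteDimensional ℝ V]

theorem pullP_two (L : V →L[ℝ] V) (β : Form V ℂ 2) (Φ : Polyform V) :
    pullP L (twoOp β Φ) = twoOp (β.compContinuousLinearMap L) (pullP L Φ) := by
  have h1 : ∀ a, (Complex.ofRealCLM.comp (dualBas (V := V) a)).comp L
      = ∑ c, ((dualBas (V := V) a (L (bas V c)) : ℝ) : ℂ) • Complex.ofRealCLM.comp (dualBas c) := by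
    intro a
    rw [← sum_dualBas ((Complex.ofRealCLM.comp (dualBas (V := V) a)).comp L)]
    rfl
  have h2 : ∀ c, ∑ a, ((dualBas (V := V) a (L (bas V c)) : ℝ) : ℂ) • (contractC (bas V a) β).comp L
      = contractC (bas V c) (β.compContinuousLinearMap L) := by
    intro c
    ext w
    rw [contractC_apply, sum_apply]
    have e1 : (β.compContinuousLinearMap L) ![bas V c, w] = contractC (L w) β (-(L (bas V c))) := by
      rw [map_neg, contractC_apply, ← twoForm_skew]
      simp only [ContinuousAlternatingMap.compContinuousLinearMap_apply]
      congr 1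
      funext i
      fin_cases i <;> rfl
    rw [e1, map_neg]
    conv_rhs => rw [← sum_dualBas_smul (L (bas V c)), map_sum]
    rw [← Finset.sum_neg_distrib]
    refine Finset.sum_congr rfl fun a _ => ?_
    rw [map_smul, contractC_apply, twoForm_skew]
    simp only [smul_apply, ContinuousLinearMap.comp_apply, contractC_apply, smul_neg, map_smul]
    first | rfl | simp
  simp only [twoOp_eq, LinearMap.smul_apply, LinearMap.sum_apply, Module.End.mul_apply, map_smul,
    map_sum, pullP_wed, h1]
  congr 1
  rw [Finset.sum_comm]
  refine Finset.sum_congr rfl fun c _ => ?_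
  rw [← h2, map_sum, LinearMap.sum_apply, map_sum]
  refine Finset.sum_congr rfl fun a _ => ?_
  rw [map_smul, LinearMap.smul_apply, map_smul]

theorem pullP_constP (L : V →L[ℝ] V) (c : ℂ) : pullP L (constP c) = constP c := by
  funext k
  rcases Nat.eq_zero_or_pos k with rfl | hk
  · ext v; simp [pullP_apply, constP]
  · rw [pullP_apply, constP_mem_degLE c k hk]; rfl

theorem pullP_eOp [hd : Fact (Module.finrank ℝ V = 6)] (L : V →L[ℝ] V) (β : Form V ℂ 2)
    (Φ : Polyform V) : pullP L (eOp β Φ) = eOp (β.compContinuousLinearMap L) (pullP L Φ) := by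
  simp only [eOp_apply_eq, map_add, map_smul, pullP_two]

end Pull

/-! ### The exterior derivative of polyforms on a vector space -/

section Flat

variable {V : Type*} [NormedAddCommGroup V] [NormedSpace ℝ V] [FiniteDimensional ℝ V]

instance finiteDimensional_form {F : Type*} [NormedAddCommGroup F] [NormedSpace ℝ F]
    [FiniteDimensional ℝ F] (k : ℕ) : FiniteDimensional ℝ (Form V F k) := by
  let f : Form V F k →ₗ[ℝ] MultilinearMap ℝ (fun _ : Fin k => V) F :=
    { toFun := fun φ => φ.toContinuousMultilinearMap.toMultilinearMap
      map_add' := fun _ _ => rfl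
      map_smul' := fun _ _ => rfl }
  refine Module.Finite.of_injective f fun φ ψ h => ?_
  ext v
  exact congrArg (fun g => g v) h

/-- Differentiability of a field of polyforms. -/
def DiffP (Φ : V → Polyform V) (y : V) : Prop := ∀ k, DifferentiableAt ℝ (fun z => Φ z k) y

/-- Smoothness of a field of polyforms. -/
def SmoothP (Φ : V → Polyform V) (y : V) : Prop := ∀ k, ContDiffAt ℝ ∞ (fun z => Φ z k) y

theorem SmoothP.diffP {Φ : V → Polyform V} {y : V} (h : SmoothP Φ y) : DiffP Φ y :=
  fun k => (h k).differentiableAt (by simp)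

/-- The directional derivative of a field of polyforms. -/
def pd (Φ : V → Polyform V) (y v : V) : Polyform V := fun k => fderiv ℝ (fun z => Φ z k) y v

/-- The exterior derivative of a field of polyforms. -/
def flatD (Φ : V → Polyform V) (y : V) : Polyform V
  | 0 => 0
  | k + 1 => extDeriv (fun z => Φ z k) y

theorem flatD_eq (Φ : V → Polyform V) (y : V) :
    flatD Φ y = ∑ a, wedOp (Complex.ofRealCLM.comp (dualBas a)) (pd Φ y (bas V a)) := by
  funext k
  rw [Finset.sum_apply]
  cases k with
  | zero => rw [Finset.sum_eq_zero fun a _ => wedOp_apply_zero _ _]; rfl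
  | succ k =>
    have h : fderiv ℝ (fun z => Φ z k) y = ∑ a, ((ContinuousLinearMap.toSpanSingleton ℂ
        (pd Φ y (bas V a) k)).restrictScalars ℝ).comp (Complex.ofRealCLM.comp (dualBas a)) := by
      ext1 w
      rw [sum_apply]
      conv_lhs => rw [← sum_dualBas_smul w, map_sum]
      refine Finset.sum_congr rfl fun a _ => ?_
      rw [map_smul]
      ext u
      simp [pd]
    change extDeriv (fun z => Φ z k) y = _
    rw [extDeriv, h]
    have := map_sum (ContinuousAlternatingMap.alternatizeUncurryFinCLM ℝ V ℂ (n := k))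
      (fun a => ((ContinuousLinearMap.toSpanSingleton ℂ
        (pd Φ y (bas V a) k)).restrictScalars ℝ).comp (Complex.ofRealCLM.comp (dualBas a))) Finset.univ
    exact this

/-- Linear operators on polyforms that commute with differentiation. -/
structure IsTame (T : Module.End ℂ (Polyform V)) : Prop where
  diff : ∀ {Φ : V → Polyform V} {y}, DiffP Φ y → DiffP (fun z => T (Φ z)) y
  pd : ∀ {Φ : V → Polyform V} {y}, DiffP Φ y → ∀ v, pd (fun z => T (Φ z)) y v = T (pd Φ y v)
  smooth : ∀ {Φ : V → Polyform V} {y}, SmoothP Φ y → SmoothP (fun z => T (Φ z)) y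

theorem isTame_of_local {T : Module.End ℂ (Polyform V)}
    (h : ∀ k, ∃ (j : ℕ) (L : Form V ℂ j →ₗ[ℝ] Form V ℂ k), ∀ Φ, T Φ k = L (Φ j)) : IsTame T := by
  choose j L hL using h
  have e : ∀ (Φ : V → Polyform V) k, (fun z => T (Φ z) k)
      = fun z => (L k).toContinuousLinearMap (Φ z (j k)) := fun Φ k => funext fun z => hL k (Φ z)
  refine ⟨fun {Φ y} hΦ k => ?_, fun {Φ y} hΦ v => ?_, fun {Φ y} hΦ k => ?_⟩
  · simp only [e]
    exact (L k).toContinuousLinearMap.differentiableAt.comp y (hΦ (j k))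
  · funext k
    change fderiv ℝ (fun z => T (Φ z) k) y v = _
    rw [e, hL, fderiv_fun_comp y (L k).toContinuousLinearMap.differentiableAt (hΦ (j k)),
      ContinuousLinearMap.fderiv]
    rfl
  · simp only [e]
    exact (L k).toContinuousLinearMap.contDiff.contDiffAt.comp y (hΦ (j k))

theorem isTame_int (v : V) : IsTame (intOp v) := by
  refine isTame_of_local fun k => ⟨k + 1, ⟨⟨fun φ => φ.curryLeft v, fun _ _ => rfl⟩,
    fun _ _ => rfl⟩, fun Φ => rfl⟩

theorem isTame_wed (ν : V →L[ℝ] ℂ) : IsTame (wedOp ν) := by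
  refine isTame_of_local fun k => ?_
  cases k with
  | zero => exact ⟨0, 0, fun Φ => rfl⟩
  | succ k =>
    refine ⟨k, ⟨⟨fun φ => wedOp ν (Pi.single k φ) (k + 1), fun φ ψ => ?_⟩, fun c φ => ?_⟩, fun Φ => ?_⟩
    · rw [Pi.single_add, map_add]; rfl
    · ext w
      simp [wedOp_apply_succ, Finset.mul_sum, mul_left_comm]
    · ext w
      simp [wedOp_apply_succ]

theorem IsTame.mul {S T : Module.End ℂ (Polyform V)} (hS : IsTame S) (hT : IsTame T) :
    IsTame (S * T) :=
  ⟨fun h => hS.diff (hT.diff h), fun h v => (hS.pd (hT.diff h) v).trans (by rw [hT.pd h]; rfl),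
    fun h => hS.smooth (hT.smooth h)⟩

theorem pd_add {Φ Ψ : V → Polyform V} {y : V} (h : DiffP Φ y) (h' : DiffP Ψ y) (v : V) :
    pd (fun z => Φ z + Ψ z) y v = pd Φ y v + pd Ψ y v := by
  funext k
  exact congrArg (fun f => f v) (fderiv_add (h k) (h' k))

theorem DiffP.add {Φ Ψ : V → Polyform V} {y : V} (h : DiffP Φ y) (h' : DiffP Ψ y) :
    DiffP (fun z => Φ z + Ψ z) y := fun k => (h k).add (h' k)

theorem SmoothP.add {Φ Ψ : V → Polyform V} {y : V} (h : SmoothP Φ y) (h' : SmoothP Ψ y) :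
    SmoothP (fun z => Φ z + Ψ z) y := fun k => (h k).add (h' k)

theorem pd_smul {f : V → ℂ} {Φ : V → Polyform V} {y : V} (hf : DifferentiableAt ℝ f y)
    (h : DiffP Φ y) (v : V) :
    pd (fun z => f z • Φ z) y v = fderiv ℝ f y v • Φ y + f y • pd Φ y v := by
  funext k
  have := congrArg (fun f => f v) (fderiv_smul hf (h k))
  refine this.trans ?_
  ext w
  simp [pd, add_comm]

theorem DiffP.smul {f : V → ℂ} {Φ : V → Polyform V} {y : V} (hf : DifferentiableAt ℝ f y)
    (h : DiffP Φ y) : DiffP (fun z => f z • Φ z) y := fun k => hf.smul (h k)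

theorem SmoothP.smul {f : V → ℂ} {Φ : V → Polyform V} {y : V} (hf : ContDiffAt ℝ ∞ f y)
    (h : SmoothP Φ y) : SmoothP (fun z => f z • Φ z) y := fun k => hf.smul (h k)

theorem DiffP.sum {ι : Type*} {s : Finset ι} {Φ : ι → V → Polyform V} {y : V}
    (h : ∀ i ∈ s, DiffP (Φ i) y) : DiffP (fun z => ∑ i ∈ s, Φ i z) y := by
  intro k
  simp only [Finset.sum_apply]
  exact DifferentiableAt.fun_sum fun i hi => h i hi k

theorem SmoothP.sum {ι : Type*} {s : Finset ι} {Φ : ι → V → Polyform V} {y : V}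
    (h : ∀ i ∈ s, SmoothP (Φ i) y) : SmoothP (fun z => ∑ i ∈ s, Φ i z) y := by
  intro k
  simp only [Finset.sum_apply]
  exact ContDiffAt.sum fun i hi => h i hi k

theorem pd_sum {ι : Type*} {s : Finset ι} {Φ : ι → V → Polyform V} {y : V}
    (h : ∀ i ∈ s, DiffP (Φ i) y) (v : V) :
    pd (fun z => ∑ i ∈ s, Φ i z) y v = ∑ i ∈ s, pd (Φ i) y v := by
  funext k
  simp only [pd, Finset.sum_apply]
  rw [fderiv_fun_sum fun i hi => h i hi k, sum_apply]

/-- A field of operators `∑ᵢ fᵢ Tᵢ` with constant tame `Tᵢ`: the product rule. -/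
theorem pd_operator {ι : Type*} [Fintype ι] {T : ι → Module.End ℂ (Polyform V)}
    (hT : ∀ i, IsTame (T i)) {f : ι → V → ℂ} {Φ : V → Polyform V} {y : V}
    (hf : ∀ i, DifferentiableAt ℝ (f i) y) (hΦ : DiffP Φ y) :
    DiffP (fun z => (∑ i, f i z • T i) (Φ z)) y ∧ ∀ v,
      pd (fun z => (∑ i, f i z • T i) (Φ z)) y v
        = (∑ i, fderiv ℝ (f i) y v • T i) (Φ y) + (∑ i, f i y • T i) (pd Φ y v) := by
  simp only [LinearMap.sum_apply, LinearMap.smul_apply]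
  have h1 : ∀ i ∈ Finset.univ, DiffP (fun z => f i z • T i (Φ z)) y := fun i _ =>
    DiffP.smul (hf i) ((hT i).diff hΦ)
  refine ⟨DiffP.sum h1, fun v => ?_⟩
  rw [pd_sum h1, ← Finset.sum_add_distrib]
  refine Finset.sum_congr rfl fun i _ => ?_
  rw [pd_smul (hf i) ((hT i).diff hΦ), (hT i).pd hΦ]

theorem smooth_operator {ι : Type*} [Fintype ι] {T : ι → Module.End ℂ (Polyform V)}
    (hT : ∀ i, IsTame (T i)) {f : ι → V → ℂ} {Φ : V → Polyform V} {y : V}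
    (hf : ∀ i, ContDiffAt ℝ ∞ (f i) y) (hΦ : SmoothP Φ y) :
    SmoothP (fun z => (∑ i, f i z • T i) (Φ z)) y := by
  simp only [LinearMap.sum_apply, LinearMap.smul_apply]
  exact SmoothP.sum fun i _ => SmoothP.smul (hf i) ((hT i).smooth hΦ)

/-- The coefficients of a generalized vector. -/
def clCoef (W : GenVec V) : Fin (Module.finrank ℝ V) ⊕ Fin (Module.finrank ℝ V) → ℝ :=
  Sum.elim (fun a => dualBas a W.1) fun a => W.2 (bas V a)

/-- The Clifford action of the basis. -/
def clBasis : Fin (Module.finrank ℝ V) ⊕ Fin (Module.finrank ℝ V) → Module.End ℂ (Polyform V) :=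
  Sum.elim (fun a => intOp (bas V a)) fun a => wedOp (Complex.ofRealCLM.comp (dualBas a))

theorem cl_eq_sum (W : GenVec V) : cl W = ∑ i, (clCoef W i : ℂ) • clBasis i := by
  conv_lhs => rw [genVec_expand W]
  rw [map_sum, Fintype.sum_sum_type, ← Finset.sum_add_distrib]
  refine Finset.sum_congr rfl fun a _ => ?_
  rw [map_add, cl_smul, cl_smul, cl_vec, cl_form]
  rfl

theorem isTame_clBasis (i) : IsTame (clBasis (V := V) i) := by
  rcases i with a | a
  · exact isTame_int _
  · exact isTame_wed _

/-- The coefficients as continuous linear functionals. -/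
def clCoefL (i : Fin (Module.finrank ℝ V) ⊕ Fin (Module.finrank ℝ V)) : GenVec V →L[ℝ] ℂ :=
  Complex.ofRealCLM.comp (Sum.elim (fun a => (dualBas a).comp (ContinuousLinearMap.fst ℝ V (V →L[ℝ] ℝ)))
    (fun a => (ContinuousLinearMap.apply ℝ ℝ (bas V a)).comp
      (ContinuousLinearMap.snd ℝ V (V →L[ℝ] ℝ))) i)

theorem clCoefL_apply (i) (W : GenVec V) : clCoefL i W = (clCoef W i : ℂ) := by
  rcases i with a | a <;> rfl

theorem pd_cl {W : V → GenVec V} {Φ : V → Polyform V} {y : V} (hW : DifferentiableAt ℝ W y)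
    (hΦ : DiffP Φ y) : DiffP (fun z => cl (W z) (Φ z)) y ∧ ∀ v,
      pd (fun z => cl (W z) (Φ z)) y v = cl (fderiv ℝ W y v) (Φ y) + cl (W y) (pd Φ y v) := by
  have h := pd_operator (T := clBasis) isTame_clBasis (f := fun i z => clCoefL i (W z))
    (fun i => (clCoefL i).differentiableAt.comp y hW) hΦ
  have e : ∀ i v, fderiv ℝ (fun z => clCoefL i (W z)) y v = clCoefL i (fderiv ℝ W y v) := by
    intro i v
    rw [fderiv_fun_comp y (clCoefL i).differentiableAt hW, ContinuousLinearMap.fderiv]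
    rfl
  simp only [e] at h
  simp only [clCoefL_apply, ← cl_eq_sum] at h
  exact h

theorem smooth_cl {W : V → GenVec V} {Φ : V → Polyform V} {y : V} (hW : ContDiffAt ℝ ∞ W y)
    (hΦ : SmoothP Φ y) : SmoothP (fun z => cl (W z) (Φ z)) y := by
  have h := smooth_operator (T := clBasis) isTame_clBasis (f := fun i z => clCoefL i (W z))
    (fun i => (clCoefL i).contDiff.contDiffAt.comp y hW) hΦ
  simp only [clCoefL_apply, ← cl_eq_sum] at h
  exact h

theorem twoOp_eq_sum (β : Form V ℂ 2) : twoOp β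
    = ∑ p : Fin (Module.finrank ℝ V) × Fin (Module.finrank ℝ V), ((1 / 2 : ℂ) * β ![bas V p.1, bas V p.2]) •
      (wedOp (Complex.ofRealCLM.comp (dualBas p.1)) * wedOp (Complex.ofRealCLM.comp (dualBas p.2))) := by
  rw [twoOp_eq, Fintype.sum_prod_type, Finset.smul_sum]
  refine Finset.sum_congr rfl fun a _ => ?_
  have := sum_dualBas (contractC (bas V a) β)
  rw [← this, map_sum, Finset.mul_sum, Finset.smul_sum]
  refine Finset.sum_congr rfl fun c _ => ?_
  rw [map_smul, mul_smul_comm, smul_smul, contractC_apply]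

/-- The coefficients of a two-form. -/
def twoCoefL (p : Fin (Module.finrank ℝ V) × Fin (Module.finrank ℝ V)) : Form V ℂ 2 →L[ℝ] ℂ :=
  LinearMap.toContinuousLinearMap
    ⟨⟨fun β => (1 / 2 : ℂ) * β ![bas V p.1, bas V p.2], fun β γ => by simp [mul_add]⟩,
      fun c β => by simp [mul_left_comm]⟩

theorem twoCoefL_apply (p : Fin (Module.finrank ℝ V) × Fin (Module.finrank ℝ V)) (β : Form V ℂ 2) :
    twoCoefL p β = (1 / 2 : ℂ) * β ![bas V p.1, bas V p.2] := rfl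

theorem pd_two {β : V → Form V ℂ 2} {Φ : V → Polyform V} {y : V} (hβ : DifferentiableAt ℝ β y)
    (hΦ : DiffP Φ y) : DiffP (fun z => twoOp (β z) (Φ z)) y ∧ ∀ v,
      pd (fun z => twoOp (β z) (Φ z)) y v = twoOp (fderiv ℝ β y v) (Φ y) + twoOp (β y) (pd Φ y v) := by
  have h := pd_operator (T := fun p : Fin (Module.finrank ℝ V) × Fin (Module.finrank ℝ V) =>
    (wedOp (Complex.ofRealCLM.comp (dualBas p.1)) * wedOp (Complex.ofRealCLM.comp (dualBas p.2))))
    (fun p => (isTame_wed _).mul (isTame_wed _)) (f := fun i z => twoCoefL i (β z))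
    (fun i => (twoCoefL i).differentiableAt.comp y hβ) hΦ
  have e : ∀ i v, fderiv ℝ (fun z => twoCoefL i (β z)) y v = twoCoefL i (fderiv ℝ β y v) := by
    intro i v
    rw [fderiv_fun_comp y (twoCoefL i).differentiableAt hβ, ContinuousLinearMap.fderiv]
    rfl
  simp only [e] at h
  simp only [twoCoefL_apply, ← twoOp_eq_sum] at h
  exact h

theorem smooth_two {β : V → Form V ℂ 2} {Φ : V → Polyform V} {y : V} (hβ : ContDiffAt ℝ ∞ β y)
    (hΦ : SmoothP Φ y) : SmoothP (fun z => twoOp (β z) (Φ z)) y := by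
  have h := smooth_operator (T := fun p : Fin (Module.finrank ℝ V) × Fin (Module.finrank ℝ V) =>
    (wedOp (Complex.ofRealCLM.comp (dualBas p.1)) * wedOp (Complex.ofRealCLM.comp (dualBas p.2))))
    (fun p => (isTame_wed _).mul (isTame_wed _)) (f := fun i z => twoCoefL i (β z))
    (fun i => (twoCoefL i).contDiff.contDiffAt.comp y hβ) hΦ
  simp only [twoCoefL_apply, ← twoOp_eq_sum] at h
  exact h

theorem flatD_add {Φ Ψ : V → Polyform V} {y : V} (h : DiffP Φ y) (h' : DiffP Ψ y) :
    flatD (fun z => Φ z + Ψ z) y = flatD Φ y + flatD Ψ y := by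
  simp only [flatD_eq, pd_add h h', map_add, Finset.sum_add_distrib]

theorem flatD_smul {f : V → ℂ} {Φ : V → Polyform V} {y : V} (hf : DifferentiableAt ℝ f y)
    (h : DiffP Φ y) :
    flatD (fun z => f z • Φ z) y = wedOp (fderiv ℝ f y) (Φ y) + f y • flatD Φ y := by
  simp only [flatD_eq, pd_smul hf h, map_add, map_smul, Finset.sum_add_distrib, Finset.smul_sum,
    sum_wed_dualBas]

/-- The Lie derivative of a polyform along a generalized vector field. -/
def flatLie (W : V → GenVec V) (Φ : V → Polyform V) (y : V) : Polyform V :=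
  flatD (fun z => cl (W z) (Φ z)) y + cl (W y) (flatD Φ y)

/-- The one-form `⟨∂ W, Z⟩`, up to a factor two. -/
def pairD (W : V → GenVec V) (Z : GenVec V) (y : V) : V →L[ℝ] ℝ :=
  LinearMap.toContinuousLinearMap
    ⟨⟨fun v => 2 * pairing (fderiv ℝ W y v) Z, fun v w => by rw [map_add, pairing_add_left]; ring⟩,
      fun c v => by
        change 2 * pairing (fderiv ℝ W y (c • v)) Z = c * (2 * pairing (fderiv ℝ W y v) Z)
        rw [map_smul, pairing_smul_left]; ring⟩

/-- The Dorfman bracket of generalized vector fields on a vector space. -/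
def dorf (W Z : V → GenVec V) (y : V) : GenVec V :=
  fderiv ℝ Z y (W y).1 - fderiv ℝ W y (Z y).1 + (0, pairD W (Z y) y)

theorem sum_dualBas_pd (Φ : V → Polyform V) (y v : V) :
    ∑ a, ((dualBas (V := V) a v : ℝ) : ℂ) • pd Φ y (bas V a) = pd Φ y v := by
  funext k
  rw [Finset.sum_apply]
  change _ = fderiv ℝ (fun z => Φ z k) y v
  conv_rhs => rw [← sum_dualBas_smul v, map_sum]
  refine Finset.sum_congr rfl fun a _ => ?_
  rw [map_smul]
  rfl

/-- The Lie derivative is a first order operator: differentiation along the vector part plus an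
algebraic term. -/
theorem flatLie_eq {W : V → GenVec V} {Φ : V → Polyform V} {y : V} (hW : DifferentiableAt ℝ W y)
    (hΦ : DiffP Φ y) : flatLie W Φ y = pd Φ y (W y).1
      + ∑ a, cl (0, dualBas a) (cl (fderiv ℝ W y (bas V a)) (Φ y)) := by
  rw [flatLie, flatD_eq, flatD_eq]
  simp only [(pd_cl hW hΦ).2, map_add, Finset.sum_add_distrib, map_sum, ← cl_form]
  have : ∀ a, cl (W y) (cl (0, dualBas a) (pd Φ y (bas V a)))
      = ((dualBas (V := V) a (W y).1 : ℝ) : ℂ) • pd Φ y (bas V a)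
        - cl (0, dualBas a) (cl (W y) (pd Φ y (bas V a))) := by
    intro a
    rw [cl_cl_apply, pairing_comm, pair_form]
  simp only [this, Finset.sum_sub_distrib, sum_dualBas_pd]
  abel

/-- The derived bracket: the commutator of a Lie derivative and a Clifford action is the action of
the Dorfman bracket. -/
theorem flatLie_cl {W Z : V → GenVec V} {Φ : V → Polyform V} {y : V} (hW : DifferentiableAt ℝ W y)
    (hZ : DifferentiableAt ℝ Z y) (hΦ : DiffP Φ y) :
    flatLie W (fun z => cl (Z z) (Φ z)) y - cl (Z y) (flatLie W Φ y) = cl (dorf W Z y) (Φ y) := by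
  rw [flatLie_eq hW (pd_cl hZ hΦ).1, flatLie_eq hW hΦ, (pd_cl hZ hΦ).2, map_add, map_sum]
  have h1 : ∀ a, cl (Z y) (cl (0, dualBas a) (cl (fderiv ℝ W y (bas V a)) (Φ y)))
      = ((dualBas (V := V) a (Z y).1 : ℝ) : ℂ) • cl (fderiv ℝ W y (bas V a)) (Φ y)
        - ((2 * pairing (fderiv ℝ W y (bas V a)) (Z y) : ℝ) : ℂ) • cl (0, dualBas a) (Φ y)
        + cl (0, dualBas a) (cl (fderiv ℝ W y (bas V a)) (cl (Z y) (Φ y))) := by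
    intro a
    rw [cl_cl_apply (Z y), pairing_comm, pair_form, cl_cl_apply (Z y) (fderiv ℝ W y (bas V a)),
      pairing_comm (Z y), map_sub, map_smul]
    abel
  have h2 : ∑ a, ((dualBas (V := V) a (Z y).1 : ℝ) : ℂ) • cl (fderiv ℝ W y (bas V a)) (Φ y)
      = cl (fderiv ℝ W y (Z y).1) (Φ y) := by
    conv_rhs => rw [← sum_dualBas_smul (Z y).1, map_sum, map_sum, LinearMap.sum_apply]
    refine Finset.sum_congr rfl fun a _ => ?_
    rw [map_smul, cl_smul]
    rfl
  have h3 : ∑ a, ((2 * pairing (fderiv ℝ W y (bas V a)) (Z y) : ℝ) : ℂ) • cl (0, dualBas a) (Φ y)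
      = cl (0, pairD W (Z y) y) (Φ y) := by
    simp only [cl_form]
    have := sum_wed_dualBas (Complex.ofRealCLM.comp (pairD W (Z y) y)) (Φ y)
    rw [← this]
    rfl
  simp only [h1, Finset.sum_add_distrib, Finset.sum_sub_distrib, h2, h3]
  rw [dorf, map_add, map_sub, LinearMap.add_apply, LinearMap.sub_apply]
  abel

end Flat

section FlatExp

variable {V : Type*} [NormedAddCommGroup V] [NormedSpace ℝ V] [FiniteDimensional ℝ V]
  [hd : Fact (Module.finrank ℝ V = 6)]

theorem smoothP_const (Φ : Polyform V) (y : V) : SmoothP (fun _ => Φ) y := fun _ => contDiffAt_const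

theorem pd_const (Φ : Polyform V) (y v : V) : pd (fun _ => Φ) y v = 0 := by
  funext k
  simp [pd]

theorem diffP_const (Φ : Polyform V) (y : V) : DiffP (fun _ => Φ) y :=
  (smoothP_const Φ y).diffP

theorem eOp_two_eq (β γ : Form V ℂ 2) (Φ : Polyform V) : eOp β (twoOp γ Φ)
    = twoOp γ Φ + twoOp β (twoOp γ Φ) + (1 / 2 : ℂ) • twoOp β (twoOp β (twoOp γ Φ)) := by
  have : twoOp β (twoOp β (twoOp β (twoOp γ Φ))) = 0 := eq_zero_of_degGE_seven fun k hk =>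
    twoOp_mem_degGE (twoOp_mem_degGE (twoOp_mem_degGE (twoOp_mem_degGE (mem_degGE_zero Φ)))) k
      (by omega)
  rw [eOp_apply_eq, this, smul_zero, add_zero]

theorem pd_exp {β : V → Form V ℂ 2} {y : V} (hβ : DifferentiableAt ℝ β y) :
    DiffP (fun z => eOp (β z) (constP 1)) y ∧ ∀ v,
      pd (fun z => eOp (β z) (constP 1)) y v
        = eOp (β y) (twoOp (fderiv ℝ β y v) (constP 1)) := by
  have h0 := diffP_const (constP 1 : Polyform V) y
  have h1 := pd_two hβ h0
  have h2 := pd_two hβ h1.1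
  have h3 := pd_two hβ h2.1
  have c : ∀ γ Φ, twoOp γ (twoOp (β y) Φ) = twoOp (β y) (twoOp γ Φ) := by
    intro γ Φ
    rw [← Module.End.mul_apply, (two_two γ (β y)).eq, Module.End.mul_apply]
  have d2 : DiffP (fun z => (1 / 2 : ℂ) • twoOp (β z) (twoOp (β z) (constP 1))) y :=
    DiffP.smul (f := fun _ => (1 / 2 : ℂ)) (differentiableAt_const _) h2.1
  have d3 : DiffP (fun z => (1 / 6 : ℂ) • twoOp (β z) (twoOp (β z) (twoOp (β z) (constP 1)))) y :=
    DiffP.smul (f := fun _ => (1 / 6 : ℂ)) (differentiableAt_const _) h3.1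
  simp only [eOp_apply_eq (β _) (constP 1)]
  refine ⟨((h0.add h1.1).add d2).add d3, fun v => ?_⟩
  rw [pd_add ((h0.add h1.1).add d2) d3, pd_add (h0.add h1.1) d2, pd_add h0 h1.1,
    pd_smul (f := fun _ => (1 / 2 : ℂ)) (differentiableAt_const _) h2.1,
    pd_smul (f := fun _ => (1 / 6 : ℂ)) (differentiableAt_const _) h3.1, h3.2, h2.2, h1.2, pd_const,
    eOp_two_eq]
  simp only [c, map_add, map_zero, fderiv_fun_const, zero_apply, Pi.zero_apply, zero_smul]
  module

theorem smooth_exp {β : V → Form V ℂ 2} {y : V} (hβ : ContDiffAt ℝ ∞ β y) :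
    SmoothP (fun z => eOp (β z) (constP 1)) y := by
  have h0 := smoothP_const (constP 1 : Polyform V) y
  have h1 := smooth_two hβ h0
  have h2 := smooth_two hβ h1
  have h3 := smooth_two hβ h2
  have d2 : SmoothP (fun z => (1 / 2 : ℂ) • twoOp (β z) (twoOp (β z) (constP 1))) y :=
    SmoothP.smul (f := fun _ => (1 / 2 : ℂ)) contDiffAt_const h2
  have d3 : SmoothP (fun z => (1 / 6 : ℂ) • twoOp (β z) (twoOp (β z) (twoOp (β z) (constP 1)))) y :=
    SmoothP.smul (f := fun _ => (1 / 6 : ℂ)) contDiffAt_const h3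
  simp only [eOp_apply_eq (β _) (constP 1)]
  exact ((h0.add h1).add d2).add d3

/-- `d (f e^β) = e^β (df + f dβ)`. -/
theorem flatD_exp {f : V → ℂ} {β : V → Form V ℂ 2} {y : V} (hf : DifferentiableAt ℝ f y)
    (hβ : DifferentiableAt ℝ β y) : flatD (fun z => f z • eOp (β z) (constP 1)) y
      = eOp (β y) (wedOp (fderiv ℝ f y) (constP 1)
        + f y • flatD (fun z => twoOp (β z) (constP 1)) y) := by
  have hw : ∀ ν Φ, eOp (β y) (wedOp ν Φ) = wedOp ν (eOp (β y) Φ) := by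
    intro ν Φ
    rw [← Module.End.mul_apply, (eOp_wed (β y) ν).eq, Module.End.mul_apply]
  rw [flatD_smul hf (pd_exp hβ).1, map_add, map_smul, hw]
  congr 2
  rw [flatD_eq, flatD_eq, map_sum]
  refine Finset.sum_congr rfl fun a _ => ?_
  rw [(pd_exp hβ).2, (pd_two hβ (diffP_const _ y)).2, pd_const, map_zero, add_zero, hw]

end FlatExp

/-! ### Charts -/

section Charts

open Filter

variable {E : Type*} [NormedAddCommGroup E] [NormedSpace ℝ E]
  {F : Type*} [NormedAddCommGroup F] [NormedSpace ℝ F]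
  {H : Type*} [TopologicalSpace H] (I : ModelWithCorners ℝ E H) [I.Boundaryless]
  {M : Type*} [TopologicalSpace M] [ChartedSpace H M] [IsManifold I ∞ M]

theorem minSmoothness_two_le : minSmoothness ℝ 2 ≤ (∞ : WithTop ℕ∞) := by
  rw [minSmoothness_of_isRCLikeNormedField]
  exact WithTop.coe_le_coe.mpr le_top

/-- The derivative of the inverse of the preferred chart. -/
def chartL (x₀ : M) (y : E) : E →L[ℝ] E := mfderiv 𝓘(ℝ, E) I (extChartAt I x₀).symm y

/-- The derivative of the preferred chart, at the point with coordinates `y`. -/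
def chartA (x₀ : M) (y : E) : E →L[ℝ] E :=
  mfderiv I 𝓘(ℝ, E) (extChartAt I x₀) ((extChartAt I x₀).symm y)

theorem chartA_chartL {x₀ : M} {y : E} (hy : y ∈ (extChartAt I x₀).target) (v : E) :
    chartA I x₀ y (chartL I x₀ y v) = v := by
  have h := mfderiv_extChartAt_comp_mfderivWithin_extChartAt_symm hy
  rw [I.range_eq_univ, mfderivWithin_univ] at h
  exact congrArg (fun f => f v) h

theorem chartL_chartA {x₀ : M} {y : E} (hy : y ∈ (extChartAt I x₀).target) (v : E) :
    chartL I x₀ y (chartA I x₀ y v) = v := by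
  have h := mfderivWithin_extChartAt_symm_comp_mfderiv_extChartAt hy
  rw [I.range_eq_univ, mfderivWithin_univ] at h
  exact congrArg (fun f => f v) h

theorem chartL_self (x : M) : chartL I x (extChartAt I x x) = ContinuousLinearMap.id ℝ E := by
  have h := mfderivWithin_range_extChartAt_symm (I := I) (x := x)
  rw [I.range_eq_univ, mfderivWithin_univ] at h
  exact h

theorem chartA_self (x : M) : chartA I x (extChartAt I x x) = ContinuousLinearMap.id ℝ E := by
  ext v
  have h := chartL_chartA I (mem_extChartAt_target (I := I) x) v
  rw [chartL_self] at h
  exact h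

theorem inverse_chartL {x₀ : M} {y : E} (hy : y ∈ (extChartAt I x₀).target) :
    (chartL I x₀ y).inverse = chartA I x₀ y := by
  refine ContinuousLinearMap.inverse_eq ?_ ?_ <;> ext v
  · exact chartL_chartA I hy v
  · exact chartA_chartL I hy v

/-- The change of charts. -/
def transition (x₀ x : M) (y : E) : E := extChartAt I x ((extChartAt I x₀).symm y)

theorem contDiffAt_transition {x₀ : M} {y : E} (hy : y ∈ (extChartAt I x₀).target) :
    ContDiffAt ℝ ∞ (transition I x₀ ((extChartAt I x₀).symm y)) y := by
  have h1 : ContMDiffAt 𝓘(ℝ, E) I ∞ (extChartAt I x₀).symm y :=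
    (contMDiffOn_extChartAt_symm x₀).contMDiffAt (extChartAt_target_mem_nhds' hy)
  have h2 : ContMDiffAt I 𝓘(ℝ, E) ∞ (extChartAt I ((extChartAt I x₀).symm y))
      ((extChartAt I x₀).symm y) := contMDiffAt_extChartAt
  exact (h2.comp y h1).contDiffAt

theorem fderiv_transition {x₀ : M} {y : E} (hy : y ∈ (extChartAt I x₀).target) :
    ∀ᶠ z in 𝓝 y, chartL I ((extChartAt I x₀).symm y) (transition I x₀ ((extChartAt I x₀).symm y) z)
      ∘L fderiv ℝ (transition I x₀ ((extChartAt I x₀).symm y)) z = chartL I x₀ z := by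
  set x := (extChartAt I x₀).symm y with hx
  have c1 : ContinuousAt (extChartAt I x₀).symm y := continuousAt_extChartAt_symm'' hy
  have hs : ∀ᶠ z in 𝓝 y, (extChartAt I x₀).symm z ∈ (extChartAt I x).source :=
    c1.preimage_mem_nhds (extChartAt_source_mem_nhds x)
  have ht : ∀ᶠ z in 𝓝 y, z ∈ (extChartAt I x₀).target := extChartAt_target_mem_nhds' hy
  filter_upwards [hs.eventually_nhds, ht] with z hz ht
  have hz0 := hz.self_of_nhds
  have d1 : MDifferentiableAt 𝓘(ℝ, E) I (extChartAt I x₀).symm z :=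
    ((contMDiffOn_extChartAt_symm (n := ∞) x₀).contMDiffAt (extChartAt_target_mem_nhds' ht)).mdifferentiableAt
      (by simp)
  have d2 : MDifferentiableAt I 𝓘(ℝ, E) (extChartAt I x) ((extChartAt I x₀).symm z) :=
    mdifferentiableAt_extChartAt (by rwa [extChartAt_source] at hz0)
  have d12 : MDifferentiableAt 𝓘(ℝ, E) 𝓘(ℝ, E) (transition I x₀ x) z := d2.comp z d1
  have hz1 : transition I x₀ x z ∈ (extChartAt I x).target := (extChartAt I x).map_source hz0
  have d3 : MDifferentiableAt 𝓘(ℝ, E) I (extChartAt I x).symm (transition I x₀ x z) :=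
    ((contMDiffOn_extChartAt_symm (n := ∞) x).contMDiffAt (extChartAt_target_mem_nhds' hz1)).mdifferentiableAt
      (by simp)
  have e := mfderiv_comp z d3 d12
  have e' : ((extChartAt I x).symm ∘ transition I x₀ x) =ᶠ[𝓝 z] (extChartAt I x₀).symm := by
    filter_upwards [hz] with w hw
    exact (extChartAt I x).left_inv hw
  rw [e'.mfderiv_eq, mfderiv_eq_fderiv] at e
  exact e.symm

variable {I}

theorem chartForm_transition {k : ℕ} (φ : M → Form E F k) {x₀ : M} {y : E}
    (hy : y ∈ (extChartAt I x₀).target) :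
    ∀ᶠ z in 𝓝 y, chartForm I φ x₀ z = (chartForm I φ ((extChartAt I x₀).symm y)
      (transition I x₀ ((extChartAt I x₀).symm y) z)).compContinuousLinearMap
        (fderiv ℝ (transition I x₀ ((extChartAt I x₀).symm y)) z) := by
  have c1 : ContinuousAt (extChartAt I x₀).symm y := continuousAt_extChartAt_symm'' hy
  have hs : ∀ᶠ z in 𝓝 y, (extChartAt I x₀).symm z
      ∈ (extChartAt I ((extChartAt I x₀).symm y)).source :=
    c1.preimage_mem_nhds (extChartAt_source_mem_nhds _)
  filter_upwards [hs, fderiv_transition I hy] with z hz h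
  have e : (extChartAt I ((extChartAt I x₀).symm y)).symm
      (transition I x₀ ((extChartAt I x₀).symm y) z) = (extChartAt I x₀).symm z :=
    (extChartAt I _).left_inv hz
  rw [chartForm, chartForm, e]
  ext v
  exact congrArg (φ ((extChartAt I x₀).symm z))
    (funext fun i => (congrArg (fun f => f (v i)) h).symm)

theorem extD_eq {k : ℕ} (φ : M → Form E F k) (x : M) :
    extD I φ x = extDeriv (chartForm I φ x) (extChartAt I x x) := by
  rw [extD]
  have h := chartA_self I x
  rw [chartA, extChartAt_to_inv] at h
  rw [h]
  ext v
  rfl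

/-- The exterior derivative commutes with charts. -/
theorem chartForm_extD {k : ℕ} {φ : M → Form E F k} {x₀ : M} {y : E}
    (hy : y ∈ (extChartAt I x₀).target) (hφ : SmoothFormAt I φ ((extChartAt I x₀).symm y)) :
    chartForm I (extD I φ) x₀ y = extDeriv (chartForm I φ x₀) y := by
  set x := (extChartAt I x₀).symm y with hx
  have h1 := (chartForm_transition φ hy).self_of_nhds
  have hL : fderiv ℝ (transition I x₀ x) y = chartL I x₀ y := by
    have h2 := (fderiv_transition I hy).self_of_nhds
    have h3 : transition I x₀ x y = extChartAt I x x := rfl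
    rw [← hx, h3, chartL_self] at h2
    exact h2
  have e : chartForm I φ x₀ =ᶠ[𝓝 y] fun z => (chartForm I φ x
      (transition I x₀ x z)).compContinuousLinearMap (fderiv ℝ (transition I x₀ x) z) :=
    chartForm_transition φ hy
  rw [e.extDeriv_eq, extDeriv_pullback (f := transition I x₀ x) (r := ∞)
    (show DifferentiableAt ℝ (chartForm I φ x) (transition I x₀ x y) from
      hφ.differentiableAt (by simp))
    (contDiffAt_transition I hy) minSmoothness_two_le, hL, chartForm, extD_eq]
  rfl

theorem eventually_symm {P : M → Prop} {x : M} (h : ∀ᶠ z in 𝓝 x, P z) :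
    ∀ᶠ y in 𝓝 (extChartAt I x x), P ((extChartAt I x).symm y) := by
  have c := continuousAt_extChartAt_symm (I := I) x
  have := c.tendsto
  rw [extChartAt_to_inv] at this
  exact this.eventually h

theorem eventually_target (x : M) : ∀ᶠ y in 𝓝 (extChartAt I x x), y ∈ (extChartAt I x).target :=
  extChartAt_target_mem_nhds x

theorem smoothFormAt_congr {k : ℕ} {φ χ : M → Form E F k} {x : M} (h : ∀ᶠ z in 𝓝 x, φ z = χ z)
    (hφ : SmoothFormAt I φ x) : SmoothFormAt I χ x := by
  refine ContDiffAt.congr_of_eventuallyEq hφ ?_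
  filter_upwards [eventually_symm (I := I) h] with y hy
  rw [chartForm, chartForm, hy]

theorem chartForm_extD_eventually {k : ℕ} {φ : M → Form E F k} {x : M}
    (hφ : ∀ᶠ z in 𝓝 x, SmoothFormAt I φ z) :
    chartForm I (extD I φ) x =ᶠ[𝓝 (extChartAt I x x)] extDeriv (chartForm I φ x) := by
  filter_upwards [eventually_symm (I := I) hφ, eventually_target x] with y hy ht
  exact chartForm_extD ht hy

theorem smoothFormAt_extD {k : ℕ} {φ : M → Form E F k} {x : M}
    (hφ : ∀ᶠ z in 𝓝 x, SmoothFormAt I φ z) : SmoothFormAt I (extD I φ) x := by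
  refine ContDiffAt.congr_of_eventuallyEq ?_ (chartForm_extD_eventually hφ)
  have h := hφ.self_of_nhds
  exact (ContinuousAlternatingMap.alternatizeUncurryFinCLM ℝ E F).contDiff.contDiffAt.comp _
    (h.fderiv_right (m := ∞) (by simp))

theorem extD_extD {k : ℕ} {φ : M → Form E F k} {x : M}
    (hφ : ∀ᶠ z in 𝓝 x, SmoothFormAt I φ z) : extD I (extD I φ) x = 0 := by
  rw [extD_eq, (chartForm_extD_eventually hφ).extDeriv_eq]
  exact extDeriv_extDeriv_apply (r := ∞) hφ.self_of_nhds minSmoothness_two_le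

theorem dFun_eq (f : M → F) (x : M) :
    dFun I f x = fderiv ℝ (fun y => f ((extChartAt I x).symm y)) (extChartAt I x x) := by
  by_cases h : MDifferentiableAt I 𝓘(ℝ, F) f x
  · rw [dFun, h.mfderiv, I.range_eq_univ, fderivWithin_univ]
    rfl
  · have h' : ¬ DifferentiableAt ℝ (fun y => f ((extChartAt I x).symm y)) (extChartAt I x x) := by
      intro hd
      refine h ((mdifferentiableAt_iff _ _).mpr ⟨?_, ?_⟩)
      · have c := hd.continuousAt.comp (continuousAt_extChartAt (I := I) x)
        refine c.congr ?_
        filter_upwards [extChartAt_source_mem_nhds (I := I) x] with z hz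
        exact congrArg f ((extChartAt I x).left_inv hz)
      · rw [I.range_eq_univ, differentiableWithinAt_univ]
        exact hd
    rw [dFun, mfderiv_zero_of_not_mdifferentiableAt h, fderiv_zero_of_not_differentiableAt h']
    rfl

theorem contDiffAt_chart {f : M → F} {x : M} (h : ContMDiffAt I 𝓘(ℝ, F) ∞ f x) :
    ContDiffAt ℝ ∞ (fun y => f ((extChartAt I x).symm y)) (extChartAt I x x) := by
  have h1 : ContMDiffAt 𝓘(ℝ, E) I ∞ (extChartAt I x).symm (extChartAt I x x) :=
    (contMDiffOn_extChartAt_symm x).contMDiffAt (extChartAt_target_mem_nhds x)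
  refine (ContMDiffAt.comp _ ?_ h1).contDiffAt
  rwa [extChartAt_to_inv]

theorem contMDiffAt_of_chart {f : M → F} {x : M}
    (h : ContDiffAt ℝ ∞ (fun y => f ((extChartAt I x).symm y)) (extChartAt I x x)) :
    ContMDiffAt I 𝓘(ℝ, F) ∞ f x := by
  have h1 : ContMDiffAt I 𝓘(ℝ, E) ∞ (extChartAt I x) x := contMDiffAt_extChartAt
  have h2 := h.contMDiffAt.comp x h1
  refine h2.congr_of_eventuallyEq ?_
  filter_upwards [extChartAt_source_mem_nhds (I := I) x] with z hz
  exact (congrArg f ((extChartAt I x).left_inv hz)).symm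

end Charts

/-! ### Calculus of polyforms on a manifold -/

section Calculus

open Filter

variable {E : Type*} [NormedAddCommGroup E] [NormedSpace ℝ E] [FiniteDimensional ℝ E]
  {H : Type*} [TopologicalSpace H] (I : ModelWithCorners ℝ E H) [I.Boundaryless]
  {M : Type*} [TopologicalSpace M] [ChartedSpace H M] [IsManifold I ∞ M]

/-- A field of polyforms in the preferred chart. -/
def chartP (Φ : M → Polyform E) (x₀ : M) (y : E) : Polyform E :=
  pullP (chartL I x₀ y) (Φ ((extChartAt I x₀).symm y))

/-- A generalized vector field in the preferred chart. -/
def chartG (W : M → GenVec E) (x₀ : M) (y : E) : GenVec E :=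
  (chartA I x₀ y (W ((extChartAt I x₀).symm y)).1,
    (W ((extChartAt I x₀).symm y)).2.comp (chartL I x₀ y))

/-- Smoothness of a polyform at a point. -/
def SmoothPAt (Φ : M → Polyform E) (x : M) : Prop := ∀ k, SmoothFormAt I (fun y => Φ y k) x

/-- Smoothness of a generalized vector field at a point. -/
def SmoothGen (W : M → GenVec E) (x : M) : Prop :=
  ContDiffAt ℝ ∞ (chartG I W x) (extChartAt I x x)

variable {I}

theorem SmoothPAt.smoothP {Φ : M → Polyform E} {x : M} (h : SmoothPAt I Φ x) :
    SmoothP (chartP I Φ x) (extChartAt I x x) := h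

theorem SmoothPAt.diffP {Φ : M → Polyform E} {x : M} (h : SmoothPAt I Φ x) :
    DiffP (chartP I Φ x) (extChartAt I x x) := h.smoothP.diffP

theorem SmoothGen.diff {W : M → GenVec E} {x : M} (h : SmoothGen I W x) :
    DifferentiableAt ℝ (chartG I W x) (extChartAt I x x) := h.differentiableAt (by simp)

theorem chartP_self (Φ : M → Polyform E) (x : M) : chartP I Φ x (extChartAt I x x) = Φ x := by
  rw [chartP, chartL_self, extChartAt_to_inv, pullP_id]

theorem chartG_self (W : M → GenVec E) (x : M) : chartG I W x (extChartAt I x x) = W x := by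
  rw [chartG, chartL_self, chartA_self, extChartAt_to_inv]
  rfl

theorem chartP_cl (W : M → GenVec E) (Φ : M → Polyform E) {x₀ : M} {y : E}
    (hy : y ∈ (extChartAt I x₀).target) : chartP I (fun z => cl (W z) (Φ z)) x₀ y
      = cl (chartG I W x₀ y) (chartP I Φ x₀ y) := by
  have h := pullP_cl (chartL I x₀ y) (chartA I x₀ y (W ((extChartAt I x₀).symm y)).1)
    (W ((extChartAt I x₀).symm y)).2 (Φ ((extChartAt I x₀).symm y))
  rw [chartL_chartA I hy] at h
  exact h

theorem polyD_eq (Φ : M → Polyform E) (x : M) :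
    polyD I Φ x = flatD (chartP I Φ x) (extChartAt I x x) := by
  funext k
  cases k with
  | zero => rfl
  | succ k => exact extD_eq _ x

theorem pd_congr {Φ Ψ : E → Polyform E} {y : E} (h : ∀ᶠ z in 𝓝 y, Φ z = Ψ z) (v : E) :
    pd Φ y v = pd Ψ y v := by
  funext k
  have : (fun z => Φ z k) =ᶠ[𝓝 y] fun z => Ψ z k := h.mono fun _ hz => congrFun hz k
  exact congrArg (fun f : E →L[ℝ] Form E ℂ k => f v) this.fderiv_eq

theorem flatD_congr {Φ Ψ : E → Polyform E} {y : E} (h : ∀ᶠ z in 𝓝 y, Φ z = Ψ z) :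
    flatD Φ y = flatD Ψ y := by
  simp only [flatD_eq, pd_congr h]

theorem smoothP_congr {Φ Ψ : E → Polyform E} {y : E} (h : ∀ᶠ z in 𝓝 y, Φ z = Ψ z)
    (hΦ : SmoothP Φ y) : SmoothP Ψ y := fun k =>
  (hΦ k).congr_of_eventuallyEq (h.mono fun _ hz => (congrFun hz k).symm)

theorem chartP_congr {Φ Ψ : M → Polyform E} {x : M} (h : ∀ᶠ z in 𝓝 x, Φ z = Ψ z) :
    ∀ᶠ y in 𝓝 (extChartAt I x x), chartP I Φ x y = chartP I Ψ x y := by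
  filter_upwards [eventually_symm (I := I) h] with y hy
  rw [chartP, chartP, hy]

theorem polyD_congr {Φ Ψ : M → Polyform E} {x : M} (h : ∀ᶠ z in 𝓝 x, Φ z = Ψ z) :
    polyD I Φ x = polyD I Ψ x := by
  rw [polyD_eq, polyD_eq, flatD_congr (chartP_congr h)]

theorem smoothPAt_congr {Φ Ψ : M → Polyform E} {x : M} (h : ∀ᶠ z in 𝓝 x, Φ z = Ψ z)
    (hΦ : SmoothPAt I Φ x) : SmoothPAt I Ψ x :=
  smoothP_congr (chartP_congr h) hΦ.smoothP

theorem eventually_chartP_cl (W : M → GenVec E) (Φ : M → Polyform E) (x : M) :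
    ∀ᶠ y in 𝓝 (extChartAt I x x), chartP I (fun z => cl (W z) (Φ z)) x y
      = cl (chartG I W x y) (chartP I Φ x y) :=
  (eventually_target x).mono fun _ hy => chartP_cl W Φ hy

theorem SmoothPAt.add {Φ Ψ : M → Polyform E} {x : M} (h : SmoothPAt I Φ x) (h' : SmoothPAt I Ψ x) :
    SmoothPAt I (fun z => Φ z + Ψ z) x := by
  have := SmoothP.add h.smoothP h'.smoothP
  simp only [chartP, ← map_add] at this
  exact this

theorem SmoothPAt.smul {f : M → ℂ} {Φ : M → Polyform E} {x : M} (hf : ContMDiffAt I 𝓘(ℝ, ℂ) ∞ f x)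
    (h : SmoothPAt I Φ x) : SmoothPAt I (fun z => f z • Φ z) x := by
  have := SmoothP.smul (contDiffAt_chart hf) h.smoothP
  simp only [chartP, ← map_smul] at this
  exact this

theorem SmoothPAt.const_smul (c : ℂ) {Φ : M → Polyform E} {x : M} (h : SmoothPAt I Φ x) :
    SmoothPAt I (fun z => c • Φ z) x := h.smul contMDiffAt_const

theorem SmoothPAt.cl {W : M → GenVec E} {Φ : M → Polyform E} {x : M} (hW : SmoothGen I W x)
    (h : SmoothPAt I Φ x) : SmoothPAt I (fun z => cl (W z) (Φ z)) x :=
  smoothP_congr ((eventually_chartP_cl W Φ x).mono fun _ hy => hy.symm) (smooth_cl hW h.smoothP)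

theorem smoothPAt_zero (x : M) : SmoothPAt I (fun _ => (0 : Polyform E)) x := by
  have := (fun _ => contDiffAt_const : SmoothP (fun _ => (0 : Polyform E)) (extChartAt I x x))
  exact smoothP_congr (Ψ := chartP I (fun _ => 0) x)
    (Eventually.of_forall fun y => (map_zero (pullP (chartL I x y))).symm) this

theorem smoothPAt_constP (c : ℂ) (x : M) : SmoothPAt I (fun _ => (constP c : Polyform E)) x := by
  have := (fun _ => contDiffAt_const : SmoothP (fun _ => (constP c : Polyform E)) (extChartAt I x x))
  exact smoothP_congr (Ψ := chartP I (fun _ => constP c) x)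
    (Eventually.of_forall fun y => (pullP_constP _ c).symm) this

theorem SmoothPAt.polyD {Φ : M → Polyform E} {x : M} (h : ∀ᶠ z in 𝓝 x, SmoothPAt I Φ z) :
    SmoothPAt I (polyD I Φ) x := by
  intro k
  cases k with
  | zero => exact smoothPAt_zero x 0
  | succ k => exact smoothFormAt_extD (h.mono fun z hz => hz k)

theorem polyD_polyD {Φ : M → Polyform E} {x : M} (h : ∀ᶠ z in 𝓝 x, SmoothPAt I Φ z) :
    polyD I (polyD I Φ) x = 0 := by
  funext k
  rcases k with - | - | k
  · rfl
  · have := smoothPAt_zero (I := I) x 0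
    change extD I (fun _ => (0 : Form E ℂ 0)) x = 0
    rw [extD_eq]
    have e : chartForm I (fun _ : M => (0 : Form E ℂ 0)) x = fun _ => 0 := by
      funext y; rfl
    rw [e, extDeriv, fderiv_fun_const, Pi.zero_apply]
    exact (ContinuousAlternatingMap.alternatizeUncurryFinCLM ℝ E ℂ).map_zero
  · exact extD_extD (h.mono fun z hz => hz k)

theorem polyD_add {Φ Ψ : M → Polyform E} {x : M} (h : SmoothPAt I Φ x) (h' : SmoothPAt I Ψ x) :
    polyD I (fun z => Φ z + Ψ z) x = polyD I Φ x + polyD I Ψ x := by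
  rw [polyD_eq, polyD_eq, polyD_eq, ← flatD_add h.diffP h'.diffP]
  simp +unfoldPartialApp only [chartP, map_add]

theorem polyD_smul {f : M → ℂ} {Φ : M → Polyform E} {x : M} (hf : ContMDiffAt I 𝓘(ℝ, ℂ) ∞ f x)
    (h : SmoothPAt I Φ x) :
    polyD I (fun z => f z • Φ z) x = wedOp (dFun I f x) (Φ x) + f x • polyD I Φ x := by
  have := flatD_smul ((contDiffAt_chart hf).differentiableAt (by simp)) h.diffP
  rw [chartP_self, extChartAt_to_inv, ← dFun_eq, ← polyD_eq] at this
  rw [polyD_eq, ← this]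
  simp +unfoldPartialApp only [chartP, map_smul]

theorem dFun_const {F : Type*} [NormedAddCommGroup F] [NormedSpace ℝ F] (c : F) (x : M) :
    dFun I (fun _ => c) x = 0 := by
  rw [dFun_eq, fderiv_fun_const]
  rfl

theorem polyD_const_smul (c : ℂ) {Φ : M → Polyform E} {x : M} (h : SmoothPAt I Φ x) :
    polyD I (fun z => c • Φ z) x = c • polyD I Φ x := by
  rw [polyD_smul contMDiffAt_const h, dFun_const, map_zero, LinearMap.zero_apply, zero_add]

theorem polyD_zero (x : M) : polyD I (fun _ => (0 : Polyform E)) x = 0 := by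
  have := polyD_const_smul (I := I) 0 (smoothPAt_zero x)
  simpa using this

/-- Exact one-forms anticommute with the exterior derivative. -/
theorem polyD_wed_dFun {f : M → ℂ} {Φ : M → Polyform E} {x : M}
    (hf : ∀ᶠ z in 𝓝 x, ContMDiffAt I 𝓘(ℝ, ℂ) ∞ f z) (h : ∀ᶠ z in 𝓝 x, SmoothPAt I Φ z) :
    polyD I (fun z => wedOp (dFun I f z) (Φ z)) x = -wedOp (dFun I f x) (polyD I Φ x)
    ∧ SmoothPAt I (fun z => wedOp (dFun I f z) (Φ z)) x := by
  have e : ∀ᶠ z in 𝓝 x, wedOp (dFun I f z) (Φ z)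
      = polyD I (fun z => f z • Φ z) z + (-1 : ℂ) • (f z • polyD I Φ z) := by
    filter_upwards [hf, h] with z hz hz'
    rw [polyD_smul hz hz']
    module
  have s1 : ∀ᶠ z in 𝓝 x, SmoothPAt I (fun z => f z • Φ z) z := by
    filter_upwards [hf, h] with z hz hz' using hz'.smul hz
  have s2 := SmoothPAt.polyD s1
  have s3 := (SmoothPAt.polyD h).smul hf.self_of_nhds
  refine ⟨?_, smoothPAt_congr (e.mono fun z hz => hz.symm) (s2.add (s3.const_smul _))⟩
  rw [polyD_congr e, polyD_add s2 (s3.const_smul _), polyD_const_smul _ s3, polyD_polyD s1,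
    polyD_smul hf.self_of_nhds (SmoothPAt.polyD h), polyD_polyD h]
  module

theorem lieP_def (W : M → GenVec E) (Φ : M → Polyform E) (x : M) :
    lieP I W Φ x = polyD I (fun y => cl (W y) (Φ y)) x + cl (W x) (polyD I Φ x) := rfl

theorem lieP_eq (W : M → GenVec E) (Φ : M → Polyform E) (x : M) :
    lieP I W Φ x = flatLie (chartG I W x) (chartP I Φ x) (extChartAt I x x) := by
  rw [lieP_def, flatLie, chartG_self, ← polyD_eq, polyD_eq, flatD_congr (eventually_chartP_cl W Φ x)]

theorem dFun_real_mul {F : Type*} [NormedAddCommGroup F] [NormedSpace ℝ F] {G : Type*}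
    [NormedAddCommGroup G] [NormedSpace ℝ G] (L : F →L[ℝ] G) {f : M → F} {x : M}
    (hf : ContMDiffAt I 𝓘(ℝ, F) ∞ f x) : dFun I (fun z => L (f z)) x = L.comp (dFun I f x) := by
  rw [dFun_eq, dFun_eq, fderiv_fun_comp _ L.differentiableAt
    ((contDiffAt_chart hf).differentiableAt (by simp)), ContinuousLinearMap.fderiv]

theorem extDeriv_oneForm {n : E → E →L[ℝ] ℝ} {y : E} (hn : DifferentiableAt ℝ n y) (v w : E) :
    extDeriv (fun z => oneForm (n z)) y ![v, w] = fderiv ℝ n y v w - fderiv ℝ n y w v := by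
  have h : DifferentiableAt ℝ (fun z => oneForm (n z)) y := by
    let L : (E →L[ℝ] ℝ) →ₗ[ℝ] Form E ℝ 1 := ⟨⟨oneForm, fun _ _ => rfl⟩, fun _ _ => rfl⟩
    exact L.toContinuousLinearMap.differentiableAt.comp y hn
  rw [extDeriv_apply h, Fin.sum_univ_two]
  have e : ∀ u u' : E, fderiv ℝ (fun z => n z u) y u' = fderiv ℝ n y u' u := by
    intro u u'
    rw [fderiv_clm_apply hn (differentiableAt_const _)]
    simp
  have e1 : (fun z => oneForm (n z) ((0 : Fin 2).removeNth ![v, w])) = fun z => n z w := rfl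
  have e2 : (fun z => oneForm (n z) ((1 : Fin 2).removeNth ![v, w])) = fun z => n z v := rfl
  rw [e1, e2, e, e]
  simp [sub_eq_add_neg]

theorem contract_extD_oneForm {ν : M → E →L[ℝ] ℝ} {x : M}
    (hν : DifferentiableAt ℝ (fun y => (ν ((extChartAt I x).symm y)).comp (chartL I x y))
      (extChartAt I x x)) (v w : E) :
    contract v (extD I (fun z => oneForm (ν z)) x) w
      = fderiv ℝ (fun y => (ν ((extChartAt I x).symm y)).comp (chartL I x y))
          (extChartAt I x x) v w
        - fderiv ℝ (fun y => (ν ((extChartAt I x).symm y)).comp (chartL I x y))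
          (extChartAt I x x) w v := by
  rw [contract_apply, extD_eq]
  exact extDeriv_oneForm hν v w

/-- In a chart the generalized Lie derivative of generalized fields is the Dorfman bracket. -/
theorem genLie_eq {W Z : M → GenVec E} {x : M} (hW : SmoothGen I W x) (hZ : SmoothGen I Z x) :
    genLie I W Z x = dorf (chartG I W x) (chartG I Z x) (extChartAt I x x) := by
  have dW := hW.diff
  have dZ := hZ.diff
  set y₀ := extChartAt I x x
  have hW1 : DifferentiableAt ℝ (fun y => (chartG I W x y).1) y₀ := dW.fst
  have hW2 : DifferentiableAt ℝ (fun y => (chartG I W x y).2) y₀ := dW.snd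
  have hZ1 : DifferentiableAt ℝ (fun y => (chartG I Z x y).1) y₀ := dZ.fst
  have hZ2 : DifferentiableAt ℝ (fun y => (chartG I Z x y).2) y₀ := dZ.snd
  have f1 : ∀ {U : M → GenVec E}, DifferentiableAt ℝ (chartG I U x) y₀ → ∀ v,
      (fderiv ℝ (chartG I U x) y₀ v).1 = fderiv ℝ (fun y => (chartG I U x y).1) y₀ v := by
    intro U hU v
    rw [fderiv.fst hU]; rfl
  have f2 : ∀ {U : M → GenVec E}, DifferentiableAt ℝ (chartG I U x) y₀ → ∀ v,
      (fderiv ℝ (chartG I U x) y₀ v).2 = fderiv ℝ (fun y => (chartG I U x y).2) y₀ v := by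
    intro U hU v
    rw [fderiv.snd hU]; rfl
  have sW := chartG_self (I := I) W x
  have sZ := chartG_self (I := I) Z x
  refine Prod.ext ?_ ?_
  · let P : (M → GenVec E) → E → E := fun U => VectorField.mpullbackWithin 𝓘(ℝ, E) I
      (extChartAt I x).symm (fun y => (U y).1) (Set.range I)
    have e0 : ∀ (T : E →L[ℝ] E), T = ContinuousLinearMap.id ℝ E → ∀ v, T.inverse v = v := by
      rintro T rfl v
      rw [ContinuousLinearMap.inverse_id]; rfl
    have hm := chartA_self I x
    rw [chartA, extChartAt_to_inv] at hm
    refine (e0 _ hm (VectorField.lieBracketWithin ℝ (E := E) (P W) (P Z)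
        ((extChartAt I x).symm ⁻¹' Set.univ ∩ Set.range I) y₀)).trans ?_
    rw [I.range_eq_univ, Set.preimage_univ, Set.univ_inter, VectorField.lieBracketWithin_univ]
    have hb : ∀ U : M → GenVec E, P U =ᶠ[𝓝 y₀] fun y => (chartG I U x y).1 := by
      intro U
      filter_upwards [eventually_target x] with y hy
      change ContinuousLinearMap.inverse (mfderivWithin 𝓘(ℝ, E) I (extChartAt I x).symm (Set.range I) y
        : E →L[ℝ] E) (U ((extChartAt I x).symm y)).1 = _
      rw [I.range_eq_univ, mfderivWithin_univ]
      exact congrArg (fun f => f (U ((extChartAt I x).symm y)).1) (inverse_chartL I hy)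
    rw [Filter.EventuallyEq.lieBracket_vectorField_eq (hb W) (hb Z)]
    rw [VectorField.lieBracket, dorf]
    simp only [Prod.fst_add, Prod.fst_sub, add_zero, f1 dW, f1 dZ]
  · ext v
    have e1 : dFun I (fun y => (Z y).2 (W y).1) x v
        = fderiv ℝ (fun y => (chartG I Z x y).2) y₀ v (W x).1
          + (Z x).2 (fderiv ℝ (fun y => (chartG I W x y).1) y₀ v) := by
      rw [dFun_eq]
      have : (fun y => (Z ((extChartAt I x).symm y)).2 (W ((extChartAt I x).symm y)).1)
          =ᶠ[𝓝 y₀] fun y => (chartG I Z x y).2 (chartG I W x y).1 := by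
        filter_upwards [eventually_target x] with y hy
        change _ = (Z ((extChartAt I x).symm y)).2 (chartL I x y (chartA I x y _))
        rw [chartL_chartA I hy]
      rw [this.fderiv_eq, fderiv_clm_apply hZ2 hW1, sW, sZ]
      simp [add_comm]
    change dFun I (fun y => (Z y).2 (W y).1) x v
      + contract (W x).1 (extD I (fun y => oneForm (Z y).2) x) v
      - contract (Z x).1 (extD I (fun y => oneForm (W y).2) x) v = _
    rw [e1, contract_extD_oneForm hZ2, contract_extD_oneForm hW2]
    change _ = (fderiv ℝ (chartG I Z x) y₀ (chartG I W x y₀).1).2 v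
      - (fderiv ℝ (chartG I W x) y₀ (chartG I Z x y₀).1).2 v
      + 2 * (((fderiv ℝ (chartG I W x) y₀ v).2 (chartG I Z x y₀).1
        + (chartG I Z x y₀).2 (fderiv ℝ (chartG I W x) y₀ v).1) / 2)
    rw [f2 dZ, f2 dW, f2 dW, f1 dW, sW, sZ]
    change _ + (fderiv ℝ (fun y => (chartG I Z x y).2) y₀ (W x).1 v
      - fderiv ℝ (fun y => (chartG I Z x y).2) y₀ v (W x).1)
      - (fderiv ℝ (fun y => (chartG I W x y).2) y₀ (Z x).1 v
      - fderiv ℝ (fun y => (chartG I W x y).2) y₀ v (Z x).1) = _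
    ring

/-- The generalized Lie derivative of generalized vector fields is the derived bracket of the
exterior derivative. -/
theorem lieP_cl {W Z : M → GenVec E} {Φ : M → Polyform E} {x : M} (hW : SmoothGen I W x)
    (hZ : SmoothGen I Z x) (hΦ : SmoothPAt I Φ x) :
    lieP I W (fun y => cl (Z y) (Φ y)) x = cl (genLie I W Z x) (Φ x) + cl (Z x) (lieP I W Φ x) := by
  have h := flatLie_cl hW.diff hZ.diff hΦ.diffP
  rw [← lieP_eq, ← genLie_eq hW hZ, chartP_self, chartG_self] at h
  rw [← h, lieP_eq, flatLie, flatLie, flatD_congr (Ψ := fun z => cl (chartG I W x z)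
      (cl (chartG I Z x z) (chartP I Φ x z))), flatD_congr (eventually_chartP_cl Z Φ x)]
  · abel
  · filter_upwards [eventually_chartP_cl Z Φ x] with y h2
    exact congrArg _ h2

/-- The generalized vector field through `W₀` which is constant in the preferred chart at `x`. -/
def locConst (I : ModelWithCorners ℝ E H) (x : M) (W₀ : GenVec E) (z : M) : GenVec E :=
  (chartL I x (extChartAt I x z) W₀.1, W₀.2.comp (mfderiv I 𝓘(ℝ, E) (extChartAt I x) z))

theorem chartG_locConst {x : M} (W₀ : GenVec E) {y : E} (hy : y ∈ (extChartAt I x).target) :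
    chartG I (locConst I x W₀) x y = W₀ := by
  rw [chartG, locConst, (extChartAt I x).right_inv hy]
  refine Prod.ext (chartA_chartL I hy _) ?_
  ext v
  exact congrArg W₀.2 (chartA_chartL I hy v)

theorem smoothGen_locConst (x : M) (W₀ : GenVec E) : SmoothGen I (locConst I x W₀) x :=
  ContDiffAt.congr_of_eventuallyEq contDiffAt_const
    ((eventually_target x).mono fun _ hy => chartG_locConst W₀ hy)

theorem locConst_self (x : M) (W₀ : GenVec E) : locConst I x W₀ x = W₀ := by
  rw [← chartG_self (I := I) (locConst I x W₀) x,
    chartG_locConst W₀ (mem_extChartAt_target (I := I) x)]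

end Calculus

/-! ### Homogeneous, real and exponential polyforms on a manifold -/

section Homogeneous

variable {V : Type*} [NormedAddCommGroup V] [NormedSpace ℝ V]

/-- A real form as a polyform. -/
def emb {k : ℕ} (φ : Form V ℝ k) : Polyform V := Pi.single k (cplx φ)

theorem cplx_injective {k : ℕ} : Function.Injective (cplx (V := V) (k := k)) := by
  intro φ χ h
  ext v
  have := congrArg (fun f => f v) h
  simpa [cplx] using this

theorem single_injective {k : ℕ} {φ χ : Form V ℂ k}
    (h : (Pi.single k φ : Polyform V) = Pi.single k χ) : φ = χ := Pi.single_injective k h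

theorem emb_injective {k : ℕ} {φ χ : Form V ℝ k} (h : emb φ = emb χ) : φ = χ :=
  cplx_injective (single_injective h)

theorem emb_add {k : ℕ} (φ χ : Form V ℝ k) : emb (φ + χ) = emb φ + emb χ := by
  rw [emb, emb, emb, ← Pi.single_add]
  congr 1
  ext v; simp [cplx]

theorem emb_smul {k : ℕ} (c : ℝ) (φ : Form V ℝ k) : emb (c • φ) = (c : ℂ) • emb φ := by
  rw [emb, emb, ← Pi.single_smul]
  congr 1
  ext v; simp [cplx]

theorem emb_zero {k : ℕ} : emb (0 : Form V ℝ k) = 0 := by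
  have := emb_smul (V := V) 0 (0 : Form V ℝ k)
  simpa using this

theorem int_single (v : V) {k : ℕ} (φ : Form V ℂ (k + 1)) :
    intOp v (Pi.single (k + 1) φ) = Pi.single k (φ.curryLeft v) := by
  funext j
  change ((Pi.single (k + 1) φ : Polyform V) (j + 1)).curryLeft v = _
  rcases eq_or_ne j k with rfl | hj
  · simp
  · rw [Pi.single_eq_of_ne hj, Pi.single_eq_of_ne (by omega)]
    rfl

theorem int_emb_two (v : V) (β : Form V ℝ 2) :
    intOp v (emb β) = emb (oneForm (contract v β)) := by
  rw [emb, int_single, emb]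
  congr 1
  ext w
  change ((β (Fin.cons v w) : ℝ) : ℂ) = ((β (Fin.cons v fun _ => w 0) : ℝ) : ℂ)
  congr 3
  funext i
  rw [Subsingleton.elim i 0]

theorem int_emb_one (v : V) (ν : V →L[ℝ] ℝ) : intOp v (emb (oneForm ν)) = constP (ν v : ℂ) := by
  rw [emb, int_single]
  rfl

theorem wed_single (ν : V →L[ℝ] ℂ) {k : ℕ} (φ : Form V ℂ k) :
    wedOp ν (Pi.single k φ) = Pi.single (k + 1) (wedOp ν (Pi.single k φ) (k + 1)) := by
  funext j
  rcases eq_or_ne j (k + 1) with rfl | hj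
  · simp
  · rw [Pi.single_eq_of_ne hj]
    cases j with
    | zero => rfl
    | succ j => exact wedOp_component (Pi.single_eq_of_ne (by omega) _)

theorem wed_one (ν : V →L[ℝ] ℝ) :
    wedOp (Complex.ofRealCLM.comp ν) (constP 1) = emb (oneForm ν) := by
  rw [constP, wed_single]
  congr 1
  ext v
  rw [wedOp_apply_succ]
  simp [oneForm, cplx]

theorem wed_emb_one (μ ν : V →L[ℝ] ℝ) :
    wedOp (Complex.ofRealCLM.comp μ) (emb (oneForm ν)) = emb (wedgeReal μ ν) := by
  rw [emb, wed_single]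
  congr 1
  ext v
  rw [wedOp_apply_succ]
  simp [oneForm, cplx, wedgeReal, ContinuousAlternatingMap.alternatizeUncurryFin_apply]

theorem two_one [FiniteDimensional ℝ V] (β : Form V ℂ 2) :
    twoOp β (constP 1) = Pi.single 2 β := by
  rw [← sub_eq_zero]
  refine polyform_eq_zero ?_ fun v => ?_
  · have h1 : twoOp β (constP 1) ∈ degGE (2 + 0) := twoOp_mem_degGE (mem_degGE_zero _)
    rw [Pi.sub_apply, h1 0 (by norm_num), Pi.single_eq_of_ne (by norm_num), sub_zero]
  · rw [map_sub, int_single, int_two, intOp_constP, map_zero, zero_add, constP,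
      wed_single, ← Pi.single_sub, ← Pi.single_zero 1]
    congr 1
    ext w
    rw [ContinuousAlternatingMap.sub_apply, wedOp_apply_succ]
    simp [contractC_apply]
    rw [show ![v, w 0] = Matrix.vecCons v w from funext fun i => by fin_cases i <;> rfl, sub_self]

end Homogeneous

section Homogeneous

open Filter

variable {E : Type*} [NormedAddCommGroup E] [NormedSpace ℝ E] [FiniteDimensional ℝ E]
  {H : Type*} [TopologicalSpace H] {I : ModelWithCorners ℝ E H} [I.Boundaryless]
  {M : Type*} [TopologicalSpace M] [ChartedSpace H M] [IsManifold I ∞ M]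
  {F : Type*} [NormedAddCommGroup F] [NormedSpace ℝ F] [FiniteDimensional ℝ F]
  {G : Type*} [NormedAddCommGroup G] [NormedSpace ℝ G] [FiniteDimensional ℝ G]

/-- Composition with a linear map of the coefficients. -/
def compL (L : F →L[ℝ] G) (k : ℕ) : Form E F k →L[ℝ] Form E G k :=
  LinearMap.toContinuousLinearMap ⟨⟨fun φ => L.compContinuousAlternatingMap φ,
    fun φ χ => by ext v; simp⟩, fun c φ => by ext v; simp⟩

theorem compL_apply (L : F →L[ℝ] G) (k : ℕ) (φ : Form E F k) :
    compL L k φ = L.compContinuousAlternatingMap φ := rfl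

theorem chartForm_comp (L : F →L[ℝ] G) {k : ℕ} (φ : M → Form E F k) (x₀ : M) :
    chartForm I (fun y => L.compContinuousAlternatingMap (φ y)) x₀
      = fun y => compL L k (chartForm I φ x₀ y) := rfl

theorem SmoothFormAt.comp (L : F →L[ℝ] G) {k : ℕ} {φ : M → Form E F k} {x : M}
    (h : SmoothFormAt I φ x) :
    SmoothFormAt I (fun y => L.compContinuousAlternatingMap (φ y)) x := by
  rw [SmoothFormAt, chartForm_comp]
  exact (compL L k).contDiff.contDiffAt.comp _ h

theorem extD_comp (L : F →L[ℝ] G) {k : ℕ} {φ : M → Form E F k} {x : M}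
    (h : SmoothFormAt I φ x) : extD I (fun y => L.compContinuousAlternatingMap (φ y)) x
      = L.compContinuousAlternatingMap (extD I φ x) := by
  rw [extD_eq, extD_eq, chartForm_comp, extDeriv, fderiv_fun_comp _ (compL L k).differentiableAt
    (h.differentiableAt (by simp)), ContinuousLinearMap.fderiv, extDeriv]
  ext v
  simp [ContinuousAlternatingMap.alternatizeUncurryFin_apply, compL_apply]

theorem smoothPAt_single {k : ℕ} {φ : M → Form E ℂ k} {x : M} (h : SmoothFormAt I φ x) :
    SmoothPAt I (fun y => Pi.single k (φ y)) x := by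
  intro j
  rcases eq_or_ne j k with rfl | hj
  · simpa only [Pi.single_eq_same] using h
  · simp only [Pi.single_eq_of_ne hj]
    exact smoothPAt_zero x j

theorem polyD_single {k : ℕ} (φ : M → Form E ℂ k) (x : M) :
    polyD I (fun y => Pi.single k (φ y)) x = Pi.single (k + 1) (extD I φ x) := by
  funext j
  rcases eq_or_ne j (k + 1) with rfl | hj
  · rw [Pi.single_eq_same]
    simp only [polyD, Pi.single_eq_same]
  · rw [Pi.single_eq_of_ne hj]
    cases j with
    | zero => rfl
    | succ j =>
      simp only [polyD, Pi.single_eq_of_ne (show j ≠ k by omega)]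
      exact congrFun (polyD_zero (I := I) x) (j + 1)

theorem smoothPAt_emb_iff {k : ℕ} {φ : M → Form E ℝ k} {x : M} :
    SmoothPAt I (fun y => emb (φ y)) x ↔ SmoothFormAt I φ x := by
  refine ⟨fun h => ?_, fun h => smoothPAt_single (h.comp Complex.ofRealCLM)⟩
  have h1 := (h k).comp Complex.reCLM
  simp only [emb, Pi.single_eq_same] at h1
  refine smoothFormAt_congr (Eventually.of_forall fun y => ?_) h1
  ext v; simp [cplx]

theorem polyD_emb {k : ℕ} {φ : M → Form E ℝ k} {x : M} (h : SmoothFormAt I φ x) :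
    polyD I (fun y => emb (φ y)) x = emb (extD I φ x) := by
  rw [emb, cplx, ← extD_comp _ h]
  exact polyD_single _ x

theorem polyD_one (x : M) : polyD I (fun _ : M => (constP 1 : Polyform E)) x = 0 := by
  refine (polyD_single (k := 0)
    (fun _ : M => ContinuousAlternatingMap.constOfIsEmpty ℝ E (Fin 0) (1 : ℂ)) x).trans ?_
  rw [extD_eq]
  have e : chartForm I (fun _ : M => ContinuousAlternatingMap.constOfIsEmpty ℝ E (Fin 0) (1 : ℂ)) x
      = fun _ => ContinuousAlternatingMap.constOfIsEmpty ℝ E (Fin 0) (1 : ℂ) := by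
    funext y
    ext v
    rfl
  rw [e, extDeriv, fderiv_fun_const, Pi.zero_apply]
  have := (ContinuousAlternatingMap.alternatizeUncurryFinCLM ℝ E ℂ (n := 0)).map_zero
  exact (congrArg (Pi.single 1) this).trans (Pi.single_zero 1)

theorem polyD_conj {Φ : M → Polyform E} {x : M} (h : SmoothPAt I Φ x) :
    polyD I (fun y => conjP (Φ y)) x = conjP (polyD I Φ x) ∧ SmoothPAt I (fun y => conjP (Φ y)) x := by
  refine ⟨?_, fun k => (h k).comp (Complex.conjCLE : ℂ →L[ℝ] ℂ)⟩
  funext k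
  cases k with
  | zero => ext v; simp [conjP, polyD]
  | succ k => exact extD_comp (Complex.conjCLE : ℂ →L[ℝ] ℂ) (h k)

theorem SmoothGen.add {W Z : M → GenVec E} {x : M} (h : SmoothGen I W x) (h' : SmoothGen I Z x) :
    SmoothGen I (fun y => W y + Z y) x := by
  have := ContDiffAt.add h h'
  refine this.congr_of_eventuallyEq (Eventually.of_forall fun y => ?_)
  simp [chartG]

theorem SmoothGen.smul {f : M → ℝ} {W : M → GenVec E} {x : M} (hf : ContMDiffAt I 𝓘(ℝ, ℝ) ∞ f x)
    (h : SmoothGen I W x) : SmoothGen I (fun y => f y • W y) x := by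
  have := (contDiffAt_chart hf).smul h
  refine this.congr_of_eventuallyEq (Eventually.of_forall fun y => ?_)
  simp [chartG]

theorem smoothGen_iff {W : M → GenVec E} {x : M} : SmoothGen I W x ↔
    SmoothVecAt I (fun y => (W y).1) x ∧ SmoothFormAt I (fun y => oneForm (W y).2) x := by
  have h1 : SmoothFormAt I (fun y => oneForm (W y).2) x
      ↔ ContDiffAt ℝ ∞ (fun y => (chartG I W x y).2) (extChartAt I x x) := by
    let L : (E →L[ℝ] ℝ) ≃ₗ[ℝ] Form E ℝ 1 :=
      { toFun := oneForm, map_add' := fun _ _ => rfl, map_smul' := fun _ _ => rfl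
        invFun := (ContinuousAlternatingMap.ofSubsingleton ℝ E ℝ (0 : Fin 1)).symm
        left_inv := fun ν => (ContinuousAlternatingMap.ofSubsingleton ℝ E ℝ (0 : Fin 1)).left_inv ν
        right_inv := fun ν => (ContinuousAlternatingMap.ofSubsingleton ℝ E ℝ (0 : Fin 1)).right_inv ν }
    have e : chartForm I (fun y => oneForm (W y).2) x
        = fun y => L.toContinuousLinearEquiv (chartG I W x y).2 := rfl
    rw [SmoothFormAt, e]
    exact L.toContinuousLinearEquiv.comp_contDiffAt_iff
  have h2 : SmoothVecAt I (fun y => (W y).1) x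
      ↔ ContDiffAt ℝ ∞ (fun y => (chartG I W x y).1) (extChartAt I x x) := by
    have e : (fun z => ((trivializationAt E (TangentSpace I) x) ⟨z, (W z).1⟩).2)
        =ᶠ[𝓝 x] fun z => (mfderiv I 𝓘(ℝ, E) (extChartAt I x) z : E →L[ℝ] E) (W z).1 := by
      filter_upwards [(chartAt H x).open_source.mem_nhds (mem_chart_source H x)] with z hz
      have h3 := congrArg (fun f => f (W z).1)
        (TangentBundle.continuousLinearMapAt_trivializationAt (I := I) hz)
      refine Eq.trans ?_ h3
      refine (Bundle.Trivialization.continuousLinearMapAt_apply_of_mem ℝ _ ?_ _).symm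
      simpa using hz
    refine (Bundle.contMDiffAt_section (E := fun y : M => TangentSpace I y)
      (s := fun y => ((W y).1 : TangentSpace I y)) x).trans ?_
    refine ⟨fun h => contDiffAt_chart (h.congr_of_eventuallyEq e.symm), fun h => ?_⟩
    exact ContMDiffAt.congr_of_eventuallyEq (contMDiffAt_of_chart h) e
  rw [h1, h2, SmoothGen]
  exact ⟨fun h => ⟨h.fst, h.snd⟩, fun h => h.1.prodMk h.2⟩

end Homogeneous

/-! ### Pure spinors on a manifold -/

section SpinorFields

open Filter

variable {E : Type*} [NormedAddCommGroup E] [NormedSpace ℝ E] [FiniteDimensional ℝ E]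
  {H : Type*} [TopologicalSpace H] {I : ModelWithCorners ℝ E H} [I.Boundaryless]
  {M : Type*} [TopologicalSpace M] [ChartedSpace H M] [IsManifold I ∞ M]

/-- The Clifford action of the complex generalized vector `P.1 + i P.2`. -/
def opC (P : GenVec E × GenVec E) : Module.End ℂ (Polyform E) := cl P.1 + Complex.I • cl P.2

theorem opC_apply (P : GenVec E × GenVec E) (Φ : Polyform E) :
    opC P Φ = cl P.1 Φ + Complex.I • cl P.2 Φ := rfl

/-- The product of two complex generalized vectors. -/
def pairC (P Q : GenVec E × GenVec E) : ℂ :=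
  (2 * pairing P.1 Q.1 - 2 * pairing P.2 Q.2 : ℝ)
    + Complex.I * (2 * pairing P.1 Q.2 + 2 * pairing P.2 Q.1 : ℝ)

theorem opC_opC (P Q : GenVec E × GenVec E) (Φ : Polyform E) :
    opC P (opC Q Φ) = pairC P Q • Φ - opC Q (opC P Φ) := by
  simp only [opC_apply, map_add, map_smul, pairC]
  rw [cl_cl_apply P.1 Q.1, cl_cl_apply P.1 Q.2, cl_cl_apply P.2 Q.1, cl_cl_apply P.2 Q.2]
  push_cast
  linear_combination (norm := module) ((2 * pairing P.2 Q.2 : ℝ) * Complex.I_sq) • Φ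

/-- Three complex generalized vector fields in the annihilator of a polyform act on its exterior
derivative as multiplication with a function that does not depend on the polyform. -/
theorem exists_torsion (x : M) (P : Fin 3 → M → GenVec E × GenVec E)
    (h1 : ∀ i, SmoothGen I (fun y => (P i y).1) x) (h2 : ∀ i, SmoothGen I (fun y => (P i y).2) x) :
    ∃ c : ℂ, ∀ Φ : M → Polyform E, SmoothPAt I Φ x → (∀ i, ∀ᶠ y in 𝓝 x, opC (P i y) (Φ y) = 0) →
      opC (P 0 x) (opC (P 1 x) (opC (P 2 x) (polyD I Φ x))) = c • Φ x := by
  -- the complexified Dorfman bracket of `P 2` and `P 1`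
  let D : GenVec E × GenVec E :=
    (genLie I (fun y => (P 2 y).1) (fun y => (P 1 y).1) x
      - genLie I (fun y => (P 2 y).2) (fun y => (P 1 y).2) x,
     genLie I (fun y => (P 2 y).1) (fun y => (P 1 y).2) x
      + genLie I (fun y => (P 2 y).2) (fun y => (P 1 y).1) x)
  refine ⟨-pairC (P 0 x) D, fun Φ hΦ h0 => ?_⟩
  have s1 : ∀ i, SmoothPAt I (fun y => cl (P i y).1 (Φ y)) x := fun i => hΦ.cl (h1 i)
  have s2 : ∀ i, SmoothPAt I (fun y => cl (P i y).2 (Φ y)) x := fun i => hΦ.cl (h2 i)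
  -- the complexified Lie derivative
  have lieC : ∀ Ψ : M → Polyform E, SmoothPAt I Ψ x → ∀ i,
      lieP I (fun y => (P i y).1) Ψ x + Complex.I • lieP I (fun y => (P i y).2) Ψ x
        = polyD I (fun y => opC (P i y) (Ψ y)) x + opC (P i x) (polyD I Ψ x) := by
    intro Ψ hΨ i
    have t1 : SmoothPAt I (fun y => cl (P i y).1 (Ψ y)) x := hΨ.cl (h1 i)
    have t2 : SmoothPAt I (fun y => cl (P i y).2 (Ψ y)) x := hΨ.cl (h2 i)
    simp only [opC_apply]
    rw [lieP_def, lieP_def, polyD_add t1 (t2.const_smul _), polyD_const_smul _ t2]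
    module
  have z : ∀ i, opC (P i x) (Φ x) = 0 := fun i => (h0 i).self_of_nhds
  have e1 := lieC Φ hΦ 2
  rw [polyD_congr (h0 2), polyD_zero, zero_add] at e1
  have sΨ : SmoothPAt I (fun y => opC (P 1 y) (Φ y)) x := (s1 1).add ((s2 1).const_smul _)
  have e2 := lieC (fun y => opC (P 1 y) (Φ y)) sΨ 2
  have e3 : ∀ᶠ y in 𝓝 x, opC (P 2 y) (opC (P 1 y) (Φ y)) = 0 :=
    (h0 1).mono fun y hy => by rw [hy, map_zero]
  rw [polyD_congr e3, polyD_zero, zero_add, polyD_congr (h0 1), polyD_zero, map_zero] at e2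
  have e4 : ∀ W : M → GenVec E, SmoothGen I W x → lieP I W (fun y => opC (P 1 y) (Φ y)) x
      = cl (genLie I W (fun y => (P 1 y).1) x) (Φ x)
        + Complex.I • cl (genLie I W (fun y => (P 1 y).2) x) (Φ x)
        + opC (P 1 x) (lieP I W Φ x) := by
    intro W hW
    have l1 := lieP_cl hW (h1 1) hΦ
    have l2 := lieP_cl hW (h2 1) hΦ
    rw [lieP_def] at l1 l2
    have t1 : SmoothPAt I (fun y => cl (W y) (cl (P 1 y).1 (Φ y))) x := (s1 1).cl hW
    have t2 : SmoothPAt I (fun y => cl (W y) (cl (P 1 y).2 (Φ y))) x := (s2 1).cl hW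
    simp only [opC_apply]
    rw [lieP_def]
    simp only [map_add, map_smul]
    rw [polyD_add t1 (t2.const_smul _), polyD_const_smul _ t2, polyD_add (s1 1) ((s2 1).const_smul _),
      polyD_const_smul _ (s2 1), map_add, map_smul]
    linear_combination (norm := module) l1 + Complex.I • l2
  rw [e4 _ (h1 2), e4 _ (h2 2)] at e2
  have e5 : opC D (Φ x) + opC (P 1 x) (opC (P 2 x) (polyD I Φ x)) = 0 := by
    rw [← e1, ← e2, map_add, map_smul, opC_apply D]
    simp only [D, map_sub, map_add, LinearMap.sub_apply, LinearMap.add_apply]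
    linear_combination (norm := module)
      (-Complex.I_sq) • cl (genLie I (fun y => (P 2 y).2) (fun y => (P 1 y).2) x) (Φ x)
  rw [eq_neg_of_add_eq_zero_right e5, map_neg, opC_opC, z 0, map_zero, sub_zero]
  module

variable [hd : Fact (Module.finrank ℝ E = 6)]

theorem chartP_exp (β : M → Form E ℂ 2) (x₀ : M) :
    chartP I (fun y => eOp (β y) (constP 1)) x₀
      = fun y => eOp (chartForm I β x₀ y) (constP 1) := by
  funext y
  rw [chartP, pullP_eOp, pullP_constP]
  rfl

theorem smoothPAt_exp {β : M → Form E ℂ 2} {x : M} (hβ : SmoothFormAt I β x) :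
    SmoothPAt I (fun y => eOp (β y) (constP 1)) x := by
  have := smooth_exp hβ
  rw [← chartP_exp] at this
  exact this

theorem chartForm_self {F : Type*} [NormedAddCommGroup F] [NormedSpace ℝ F] {k : ℕ}
    (φ : M → Form E F k) (x : M) : chartForm I φ x (extChartAt I x x) = φ x := by
  change (φ ((extChartAt I x).symm (extChartAt I x x))).compContinuousLinearMap
    (chartL I x (extChartAt I x x)) = φ x
  rw [chartL_self, extChartAt_to_inv]
  ext v
  rfl

theorem chartP_two (β : M → Form E ℂ 2) (x : M) : chartP I (fun y => Pi.single 2 (β y)) x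
    = fun y => twoOp (chartForm I β x y) (constP 1) := by
  funext y
  change pullP (chartL I x y) (Pi.single 2 (β ((extChartAt I x).symm y))) = _
  rw [← two_one, pullP_two, pullP_constP]
  rfl

theorem polyD_exp {f : M → ℂ} {β : M → Form E ℂ 2} {x : M} (hf : ContMDiffAt I 𝓘(ℝ, ℂ) ∞ f x)
    (hβ : SmoothFormAt I β x) : polyD I (fun y => f y • eOp (β y) (constP 1)) x
      = eOp (β x) (wedOp (dFun I f x) (constP 1) + f x • polyD I (fun y => Pi.single 2 (β y)) x) := by
  have h := flatD_exp ((contDiffAt_chart hf).differentiableAt (by simp)) (hβ.differentiableAt (by simp))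
  have e : chartP I (fun y => f y • eOp (β y) (constP 1)) x
      = fun y => f ((extChartAt I x).symm y) • eOp (chartForm I β x y) (constP 1) := by
    funext y
    have e1 := congrFun (chartP_exp (I := I) β x) y
    rw [chartP] at e1
    rw [chartP, map_smul, e1]
  rw [polyD_eq, polyD_eq, e, h, ← dFun_eq, chartForm_self, extChartAt_to_inv, chartP_two]

/-- The components of degree at most six of a polyform. -/
def truncP : Polyform E →ₗ[ℝ] ((k : Fin 7) → Form E ℂ k) where
  toFun Φ k := Φ k
  map_add' _ _ := rfl
  map_smul' _ _ := rfl

theorem truncP_injective {Φ : Polyform E} (h : truncP Φ = 0) : Φ = 0 := by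
  refine eq_zero_of_degGE_seven fun k hk => ?_
  exact congrFun h ⟨k, hk⟩

theorem contDiffAt_truncP {Φ : E → Polyform E} {y : E} (h : SmoothP Φ y) :
    ContDiffAt ℝ ∞ (fun z => truncP (Φ z)) y := contDiffAt_pi.mpr fun k => h k

/-- The real coefficients of a generalized vector. -/
def clCoefR (i : Fin (Module.finrank ℝ E) ⊕ Fin (Module.finrank ℝ E)) : GenVec E →L[ℝ] ℝ :=
  Sum.elim (fun a => (dualBas a).comp (ContinuousLinearMap.fst ℝ E (E →L[ℝ] ℝ)))
    (fun a => (ContinuousLinearMap.apply ℝ ℝ (bas E a)).comp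
      (ContinuousLinearMap.snd ℝ E (E →L[ℝ] ℝ))) i

/-- The map `W ↦ W · Φ`, with the components of degree at most six. -/
def clMap (Φ : Polyform E) : GenVec E →L[ℝ] ((k : Fin 7) → Form E ℂ k) :=
  ∑ i, ContinuousLinearMap.smulRightL ℝ _ _ (clCoefR i) (truncP (clBasis i Φ))

theorem clMap_apply (Φ : Polyform E) (W : GenVec E) : clMap Φ W = truncP (cl W Φ) := by
  rw [cl_eq_sum, LinearMap.sum_apply, map_sum, clMap, sum_apply]
  refine Finset.sum_congr rfl fun i _ => ?_
  have : ((clCoef W i : ℝ) : ℂ) • clBasis i Φ = clCoef W i • clBasis i Φ := rfl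
  rw [LinearMap.smul_apply, this, map_smul]
  rcases i with a | a <;> rfl

/-- If `W · Ω = i Z · Ω` with `W` and the pure spinor `Ω` smooth then `Z` is smooth. -/
theorem smoothGen_of_cl {Ω : M → Polyform E} {W Z : M → GenVec E} {x : M} (hΩ : SmoothPAt I Ω x)
    (hW : SmoothGen I W x) (h : ∀ᶠ y in 𝓝 x, cl (W y) (Ω y) = Complex.I • cl (Z y) (Ω y))
    (hinj : ∀ Z₀, cl Z₀ (Ω x) = 0 → Z₀ = 0) : SmoothGen I Z x := by
  set y₀ := extChartAt I x x with hy₀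
  set N : E → GenVec E →L[ℝ] ((k : Fin 7) → Form E ℂ k) := fun y => clMap (chartP I Ω x y) with hN
  have sN : ContDiffAt ℝ ∞ N y₀ := by
    refine ContDiffAt.sum fun i _ => ?_
    exact (ContinuousLinearMap.contDiff _).contDiffAt.comp y₀
      (contDiffAt_truncP ((isTame_clBasis i).smooth hΩ.smoothP))
  have inj : Function.Injective (N y₀) := by
    refine (injective_iff_map_eq_zero _).mpr fun Z₀ hZ => ?_
    rw [hN, clMap_apply, chartP_self] at hZ
    exact hinj Z₀ (truncP_injective hZ)
  -- a left inverse of `W ↦ W · Ω` at `x` turns the equation for `Z` into one with an invertible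
  -- coefficient near `x`
  obtain ⟨R, hR⟩ := (N y₀).toLinearMap.exists_leftInverse_of_injective (LinearMap.ker_eq_bot.mpr inj)
  set R' := R.toContinuousLinearMap
  have hR' : R'.comp (N y₀) = (ContinuousLinearEquiv.refl ℝ (GenVec E) : GenVec E →L[ℝ] GenVec E) := by
    exact ContinuousLinearMap.ext fun Z₀ => congrArg (fun f => f Z₀) hR
  set T : E → GenVec E →L[ℝ] GenVec E := fun y => R'.comp (N y)
  have sT : ContDiffAt ℝ ∞ T y₀ := contDiffAt_const.clm_comp sN
  have inv : ContDiffAt ℝ ∞ (fun y => (T y).inverse) y₀ := by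
    refine ContDiffAt.comp (g := ContinuousLinearMap.inverse) y₀ ?_ sT
    change ContDiffAt ℝ ∞ ContinuousLinearMap.inverse (R'.comp (N y₀))
    rw [hR']
    exact contDiffAt_map_inverse (ContinuousLinearEquiv.refl ℝ (GenVec E))
  have sS : ContDiffAt ℝ ∞ (fun y => R' (truncP (-Complex.I • cl (chartG I W x y) (chartP I Ω x y)))) y₀ := by
    refine R'.contDiff.contDiffAt.comp y₀ (contDiffAt_truncP ?_)
    exact SmoothP.smul (f := fun _ => -Complex.I) contDiffAt_const (smooth_cl hW hΩ.smoothP)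
  have hT : ∀ᶠ y in 𝓝 y₀, (T y).IsInvertible := by
    have : {f : GenVec E →L[ℝ] GenVec E | f.IsInvertible} ∈ 𝓝 (T y₀) := by
      change _ ∈ 𝓝 (R'.comp (N y₀))
      rw [hR']
      exact ContinuousLinearEquiv.nhds (ContinuousLinearEquiv.refl ℝ (GenVec E))
    exact sT.continuousAt this
  refine (inv.clm_apply sS).congr_of_eventuallyEq ?_
  filter_upwards [hT, eventually_symm (I := I) h, eventually_target x] with y hy h1 h2
  have h3 : cl (chartG I W x y) (chartP I Ω x y) = Complex.I • cl (chartG I Z x y) (chartP I Ω x y) := by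
    rw [← chartP_cl W Ω h2, ← chartP_cl Z Ω h2, chartP, h1, map_smul]
    rfl
  have h4 : R' (truncP (-Complex.I • cl (chartG I W x y) (chartP I Ω x y))) = T y (chartG I Z x y) := by
    rw [h3, smul_smul, neg_mul, Complex.I_mul_I, neg_neg, one_smul]
    change _ = R' (clMap _ _)
    rw [clMap_apply]
  rw [h4]
  exact (hy.inverse_apply_eq.mpr rfl).symm

theorem IsAssociated.smoothGen {Ω : M → Polyform E} {J : M → GenVec E →ₗ[ℝ] GenVec E}
    (hJ : ∀ y, IsAssociated (Ω y) (J y)) {W : M → GenVec E} {x : M} (hΩ : SmoothPAt I Ω x)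
    (hW : SmoothGen I W x) : SmoothGen I (fun y => J y (W y)) x :=
  smoothGen_of_cl hΩ hW (Eventually.of_forall fun y => (hJ y).cl_eq (W y))
    fun _ hZ => (hJ x).eq_zero_of_cl hZ

/-- A generalized vector field which preserves the line of a pure spinor commutes with its
generalized complex structure. -/
theorem IsAssociated.genLie_comm {Ω : M → Polyform E} {J : M → GenVec E →ₗ[ℝ] GenVec E}
    (hJ : ∀ y, IsAssociated (Ω y) (J y)) {W Z : M → GenVec E} {x : M} (hΩ : SmoothPAt I Ω x)
    (hW : SmoothGen I W x) (hZ : SmoothGen I Z x) {c : ℂ} (hc : lieP I W Ω x = c • Ω x) :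
    genLie I W (fun y => J y (Z y)) x = J x (genLie I W Z x) := by
  have hJZ := IsAssociated.smoothGen hJ hΩ hZ
  have e1 := lieP_cl hW hZ hΩ
  have e2 := lieP_cl hW hJZ hΩ
  have sJZ : SmoothPAt I (fun y => cl (J y (Z y)) (Ω y)) x := hΩ.cl hJZ
  have e3 : (fun y => cl (Z y) (Ω y)) = fun y => Complex.I • cl (J y (Z y)) (Ω y) :=
    funext fun y => (hJ y).cl_eq (Z y)
  have e4 : lieP I W (fun y => cl (Z y) (Ω y)) x
      = Complex.I • lieP I W (fun y => cl (J y (Z y)) (Ω y)) x := by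
    rw [e3, lieP_def, lieP_def, polyD_const_smul _ sJZ]
    simp only [map_smul]
    have : SmoothPAt I (fun y => cl (W y) (cl (J y (Z y)) (Ω y))) x := sJZ.cl hW
    rw [polyD_const_smul _ this, smul_add]
  rw [e1, e2, hc, map_smul, map_smul] at e4
  have e5 := (hJ x).cl_eq (Z x)
  have e6 : cl (genLie I W Z x) (Ω x)
      + Complex.I • cl (-genLie I W (fun y => J y (Z y)) x) (Ω x) = 0 := by
    rw [map_neg, LinearMap.neg_apply]
    linear_combination (norm := module) e4 - c • e5
  have := ((hJ x).cl_iff _ _).mp e6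
  exact neg_injective this

end SpinorFields

/-! ### The generalized Hodge operator of a compatible pair -/

section HodgeData

variable {V : Type*} [NormedAddCommGroup V] [NormedSpace ℝ V] [FiniteDimensional ℝ V]
  [hd : Fact (Module.finrank ℝ V = 6)]

theorem imP_eq (Φ : Polyform V) : imP Φ = (-Complex.I / 2) • (Φ - conjP Φ) := by
  funext k
  ext v
  change ((Φ k v).im : ℂ) = (-Complex.I / 2) * (Φ k v - (starRingEnd ℂ) (Φ k v))
  rw [Complex.sub_conj]
  push_cast
  linear_combination ((Φ k v).im : ℂ) * Complex.I_sq

theorem reP_eq (Φ : Polyform V) : reP Φ = (1 / 2 : ℂ) • (Φ + conjP Φ) := by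
  funext k
  ext v
  change ((Φ k v).re : ℂ) = (1 / 2 : ℂ) * (Φ k v + (starRingEnd ℂ) (Φ k v))
  rw [Complex.add_conj]
  push_cast
  ring

theorem conjP_conjP (Φ : Polyform V) : conjP (conjP Φ) = Φ := by
  funext k
  ext v
  simp [conjP]

theorem conjP_zero : conjP (0 : Polyform V) = 0 := by
  have := conjP_smul 0 (0 : Polyform V)
  simpa using this

/-- Polyforms annihilated by the `+i`-eigenspace `{W - i J₊ W}` of a generalized complex
structure. -/
def IsVacuum (Jp : GenVec V →ₗ[ℝ] GenVec V) (Ω : Polyform V) : Prop :=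
  ∀ W, cl W Ω = Complex.I • cl (Jp W) Ω

theorem conjP_algOp (J : GenVec V →ₗ[ℝ] GenVec V) (Φ : Polyform V) :
    conjP (algOp J Φ) = algOp J (conjP Φ) := by
  rw [← algAct_eq, ← algAct_eq, algAct, algAct, conjP_smul, conjP_sum]
  have : (starRingEnd ℂ) (1 / 2 : ℂ) = 1 / 2 := by simp [Complex.conj_ofNat]
  rw [this]
  congr 1
  refine Finset.sum_congr rfl fun a _ => ?_
  rw [conjP_add, ← cl_apply, ← cl_apply, ← cl_apply, ← cl_apply, conjP_cl, conjP_cl, conjP_cl,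
    conjP_cl]
  rfl

variable {Jm Jp : GenVec V →ₗ[ℝ] GenVec V} {b om : Form V ℝ 2}

/-- The properties of the generalized Hodge operator `S` of a compatible pair that do not refer to
the frame which defines it; `u` is an oriented orthonormal basis. The hypotheses of `star` say that
`κ` has charge zero for `J₊` and no component of charge `±3` for `J₋`. -/
structure IsHodge (Jm Jp : GenVec V →ₗ[ℝ] GenVec V) (b om : Form V ℝ 2)
    (S : Module.End ℂ (Polyform V)) (u : Module.Basis (Fin 6) ℝ V) : Prop where
  clifford : ∀ W Φ, S (cl W Φ) = -cl (gOf Jm Jp W) (S Φ)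
  sq : ∀ Φ, S (S Φ) = -Φ
  vacuum : ∀ Ω, IsVacuum Jp Ω → S Ω = Complex.I • Ω
  algOp_vacuum : ∀ Ω, IsVacuum Jp Ω → algOp Jm Ω = 0
  conj : ∀ Φ, S (conjP Φ) = conjP (S Φ)
  star : ∀ κ, eOp (cplx b - Complex.I • cplx om) κ ∈ degLE 3 →
    eOp (cplx b + Complex.I • cplx om) κ ∈ degLE 3 →
    (∀ s : ℂ, s = Complex.I ∨ s = -Complex.I → ∀ W₁ W₂ W₃,
      (barOp Jp W₁ + s • barOp Jp (Jm W₁)) ((barOp Jp W₂ + s • barOp Jp (Jm W₂))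
        ((barOp Jp W₃ + s • barOp Jp (Jm W₃)) κ)) = 0) → S (algOp Jm κ) = κ
  top : ∀ Φ, eOp (cplx (bField (gOf Jm Jp))) (S Φ) 6 u = Φ 0 ![]
  vol : ∀ α : ℂ, α ≠ 0 → volForm hd.out (gOf Jm Jp)
    (Complex.I • mukai (α • expP b om) (conjP (α • expP b om))) u = 1

theorem exists_isHodge (h : IsGenKahler Jm Jp) (ht : IsTypeZero Jp b om) :
    ∃ S u, IsHodge Jm Jp b om S u := by
  obtain ⟨e, d, u, ha, hu, hr⟩ := h.exists_adapted
  refine ⟨hodge Jm fun i => lift Jm Jp 1 (e i), u, hodge_cl h ha, hodge_hodge h ha,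
    fun Ω hΩ => hodge_vacuum h ha hΩ, fun Ω hΩ => algOp_m_vacuum h ha hΩ, ?_, ?_, ?_, ?_⟩
  · intro Φ
    simp only [hodge_apply, conjP_cl]
  · intro κ k1 k2 k3
    refine hodge_algOp_eq h ha ht u k1 k2 fun s hs W₁ W₂ W₃ => ?_
    rw [k3 s hs, map_zero]
  · exact fun Φ => tau_hodge h hu hr Φ
  · intro α hα
    obtain ⟨P, hP, hP'⟩ := exp_om_frame h ht hu hr
    refine volForm_apply hr _ (p := 8 * (Complex.normSq α * P))
      (by have := Complex.normSq_pos.mpr hα; positivity) ?_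
    rw [ContinuousAlternatingMap.smul_apply, mukai_exp, hP', smul_eq_mul]
    push_cast
    linear_combination (-8 * Complex.normSq α * P : ℂ) * Complex.I_sq

variable {S : Module.End ℂ (Polyform V)} {u : Module.Basis (Fin 6) ℝ V}

theorem IsHodge.algOp_im (hS : IsHodge Jm Jp b om S u) {ρ : Polyform V} (hρ : IsVacuum Jp ρ) :
    algOp Jm (imP ρ) = 0 := by
  rw [imP_eq, map_smul, map_sub, ← conjP_algOp, hS.algOp_vacuum ρ hρ, conjP_zero, sub_zero, smul_zero]

theorem IsHodge.hodge_algOp_cl (hS : IsHodge Jm Jp b om S u) (h : IsGenKahler Jm Jp) {ρ : Polyform V}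
    (hρ : IsVacuum Jp ρ) (W : GenVec V) : S (algOp Jm (cl W ρ)) = -cl W ρ := by
  rw [algOp_cl Jm h.skew_m, hS.algOp_vacuum ρ hρ, map_zero, zero_add, hS.clifford, hS.vacuum ρ hρ, hρ W,
    gOf_apply, ← h.comm, h.sq_m, neg_neg, map_smul]

/-- The operators `S` and `J₋ ·` exchange the derivatives of two rescalings of `Im ρ`. -/
theorem IsHodge.hodge_algOp_scaled (hS : IsHodge Jm Jp b om S u) (h : IsGenKahler Jm Jp)
    {ρ κ : Polyform V} (hρ : IsVacuum Jp ρ) (hκ : S (algOp Jm κ) = κ) (W : GenVec V) :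
    S (algOp Jm (κ - (2 : ℂ) • cl W (imP ρ))) = κ + (2 : ℂ) • cl W (imP ρ) := by
  have h1 := hS.hodge_algOp_cl h hρ W
  have h2 : S (algOp Jm (cl W (conjP ρ))) = -cl W (conjP ρ) := by
    rw [← conjP_cl, ← conjP_algOp, hS.conj, h1]
    have := conjP_smul (-1) (cl W ρ)
    simpa using this
  rw [imP_eq, map_smul, map_sub, map_sub, map_sub, hκ]
  simp only [map_smul, map_sub, h1, h2]
  module

theorem holOp_eq (W : GenVec V) : holOp Jp W = (2 : ℂ) • cl W - barOp Jp W := by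
  rw [holOp, barOp]
  module

theorem barOp_conj (W : GenVec V) (Φ : Polyform V) : barOp Jp W (conjP Φ) = conjP (holOp Jp W Φ) := by
  rw [barOp_apply, holOp_apply, sub_eq_add_neg, conjP_add, conjP_cl, ← neg_smul, conjP_smul, conjP_cl]
  simp

theorem IsVacuum.holOp {ρ : Polyform V} (hρ : IsVacuum Jp ρ) (W : GenVec V) : holOp Jp W ρ = 0 := by
  rw [holOp_apply, hρ W, sub_self]

theorem IsTypeZero.hol_lower (h : IsTypeZero Jp b om) {Φ : Polyform V} {m : ℕ} (W : GenVec V)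
    (hΦ : eOp (cplx b - Complex.I • cplx om) Φ ∈ degLE (m + 1)) :
    eOp (cplx b - Complex.I • cplx om) (holOp Jp W Φ) ∈ degLE m := by
  obtain ⟨X, Y, rfl⟩ := h.exists_rep W
  rw [holOp_apply, h.hol_rep, map_add, map_smul, ← int_eOp_apply, ← int_eOp_apply]
  exact Submodule.add_mem _ (intOp_mem_degLE_pred hΦ)
    (Submodule.smul_mem _ _ (intOp_mem_degLE_pred hΦ))

theorem eOp_smul_exp {c : ℂ} {β : Form V ℂ 2} : eOp (-β) (c • eOp β (constP 1)) = c • constP 1 := by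
  rw [map_smul, ← Module.End.mul_apply, eOp_neg_mul, Module.End.one_apply]

theorem eOp_wed_apply (β : Form V ℂ 2) (ν : V →L[ℝ] ℂ) (Φ : Polyform V) :
    eOp β (wedOp ν Φ) = wedOp ν (eOp β Φ) := by
  rw [← Module.End.mul_apply, (eOp_wed β ν).eq, Module.End.mul_apply]

/-- The mixed components of the derivative of the spinor are determined by the function `A`: both
sides differ by a polyform of degree at most two in the frames of `ρ` and of its conjugate. -/
theorem holOp_deriv (ht : IsTypeZero Jp b om) (u : Module.Basis (Fin 6) ℝ V) {f : ℂ}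
    {ρ κ : Polyform V} (hρ : ρ = f • expP b om)
    (k1 : eOp (cplx b - Complex.I • cplx om) κ ∈ degLE 3)
    (k2 : eOp (cplx b + Complex.I • cplx om) κ ∈ degLE 3) (μ ν : V →L[ℝ] ℝ)
    (hμ : cl (0, μ) κ = -cl (0, μ) (cl (0, ν) (ρ - conjP ρ))) :
    holOp Jp (0, μ) κ = -(2 : ℂ) • cl (0, μ) (cl (0, ν) ρ) := by
  have e1 : eOp (cplx b - Complex.I • cplx om) ρ = f • constP 1 := by
    have h1 : cplx b - Complex.I • cplx om = -(-cplx b + Complex.I • cplx om) := by module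
    rw [hρ, h1, expP, eOp_smul_exp]
  have e2 : eOp (cplx b + Complex.I • cplx om) (conjP ρ) = (starRingEnd ℂ) f • constP 1 := by
    have h1 : cplx b + Complex.I • cplx om = -(-cplx b - Complex.I • cplx om) := by module
    rw [hρ, expP, conjP_smul, conjP_eOp, conjForm_beta, conjP_one, h1, eOp_smul_exp]
  have two : ∀ (β : Form V ℂ 2) (c : ℂ) (Φ : Polyform V), eOp β Φ = c • constP 1 →
      eOp β (cl (0, μ) (cl (0, ν) Φ)) ∈ degLE 2 := by
    intro β c Φ hΦ
    rw [cl_form, cl_form, eOp_wed_apply, eOp_wed_apply, hΦ]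
    exact wedOp_mem_degLE (wedOp_mem_degLE (Submodule.smul_mem _ _ (constP_mem_degLE 1)))
  have key : (1 / 2 : ℂ) • holOp Jp (0, μ) κ + cl (0, μ) (cl (0, ν) ρ) = 0 := by
    refine eq_zero_of_degLE_two ht u ?_ ?_
    · rw [map_add, map_smul]
      exact Submodule.add_mem _ (Submodule.smul_mem _ _ (ht.hol_lower _ k1)) (two _ _ _ e1)
    · have : (1 / 2 : ℂ) • holOp Jp (0, μ) κ + cl (0, μ) (cl (0, ν) ρ)
          = cl (0, μ) (cl (0, ν) (conjP ρ)) - (1 / 2 : ℂ) • barOp Jp (0, μ) κ := by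
        rw [holOp_eq, LinearMap.sub_apply, LinearMap.smul_apply, hμ]
        simp only [map_sub]
        module
      rw [this, map_sub, map_smul]
      exact Submodule.sub_mem _ (two _ _ _ e2) (Submodule.smul_mem _ _ (ht.bar_lower _ k2))
  linear_combination (norm := module) (2 : ℂ) • key

theorem holOp_cl (W : GenVec V) (Z : GenVec V) (Φ : Polyform V) : holOp Jp W (cl Z Φ)
    = ((2 * pairing W Z : ℝ) - Complex.I * (2 * pairing (Jp W) Z : ℝ) : ℂ) • Φ
      - cl Z (holOp Jp W Φ) := by
  rw [holOp_apply, holOp_apply, map_sub, map_smul, cl_cl_apply W Z, cl_cl_apply (Jp W) Z]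
  module

theorem holOp_sq (h : IsGenKahler Jm Jp) (W : GenVec V) (hW : pairing W W = 0) (Φ : Polyform V) :
    holOp Jp W (holOp Jp W Φ) = 0 := by
  have h1 : pairing (Jp W) (Jp W) = 0 := by rw [h.p_p, hW]
  have h2 : pairing W (Jp W) = 0 := by
    have := h.skew_p W W
    rw [pairing_comm] at this
    linarith
  have h3 : pairing (Jp W) W = 0 := by rw [pairing_comm, h2]
  rw [holOp_apply (Φ := Φ), map_sub, map_smul, holOp_cl, holOp_cl, hW, h1, h2, h3, holOp_apply]
  have c1 := cl_cl_apply W W Φ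
  have c2 := cl_cl_apply (Jp W) (Jp W) Φ
  have c3 := cl_cl_apply W (Jp W) Φ
  rw [hW] at c1
  rw [h1] at c2
  rw [h2] at c3
  simp only [map_sub, map_smul, mul_zero, Complex.ofReal_zero, zero_smul, zero_sub, sub_zero] at *
  have d1 : cl W (cl W Φ) = 0 := by
    linear_combination (norm := module) (1 / 2 : ℂ) • c1
  have d2 : cl (Jp W) (cl (Jp W) Φ) = 0 := by
    linear_combination (norm := module) (1 / 2 : ℂ) • c2
  rw [d1, d2, c3]
  module

/-- The function `A` is constant along the Reeb vector. -/
theorem reeb_invariance (h : IsGenKahler Jm Jp) {ρ κ : Polyform V} (hρ : IsVacuum Jp ρ)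
    (hinj : ∀ W, cl W ρ = 0 → W = 0) {μ ν : V →L[ℝ] ℝ} (hμ : μ ≠ 0)
    (hk : holOp Jp (0, μ) κ = -(2 : ℂ) • cl (0, μ) (cl (0, ν) ρ)) : ν (Jp (0, μ)).1 = 0 := by
  have p1 : pairing ((0, μ) : GenVec V) (0, μ) = 0 := by simp [pairing]
  have p2 : pairing ((0, μ) : GenVec V) (0, ν) = 0 := by simp [pairing]
  have p3 : pairing (Jp (0, μ)) (0, μ) = 0 := by
    have := h.skew_p (0, μ) (0, μ)
    rw [pairing_comm ((0, μ) : GenVec V)] at this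
    linarith
  have p4 : 2 * pairing (Jp (0, μ)) (0, ν) = ν (Jp (0, μ)).1 := by
    rw [pairing_comm, pair_form]
  have e := holOp_sq h (0, μ) p1 κ
  rw [hk, map_smul, holOp_cl, holOp_cl, hρ.holOp, p1, p2, p3, p4] at e
  have e2 : cl (0, μ) ((ν (Jp (0, μ)).1 : ℂ) • ρ) = 0 := by
    simp only [map_sub, map_smul, map_zero, mul_zero, Complex.ofReal_zero, zero_sub, sub_zero,
      zero_smul] at e
    rw [map_smul]
    linear_combination (norm := module) ((1 / 2 : ℂ) * Complex.I) • e
      + ((ν (Jp (0, μ)).1 : ℂ) * Complex.I_sq) • cl (0, μ) ρ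
  by_contra hne
  rw [map_smul] at e2
  have e3 := (smul_eq_zero.mp e2).resolve_left (by exact_mod_cast hne)
  exact hμ (congrArg Prod.snd (hinj _ e3))

end HodgeData

/-! ### Charts of the cone -/

section ConeCharts

open Filter

instance fact_finrank_E₆ : Fact (Module.finrank ℝ E₆ = 6) := ⟨finrank_E₆⟩

variable {Y : Type*} [TopologicalSpace Y] [ChartedSpace (EuclideanSpace ℝ (Fin 5)) Y]

theorem extChartAt_posReals_source (p : posReals) : (extChartAt 𝓘(ℝ, ℝ) p).source = Set.univ := by
  simp [extChartAt_source, TopologicalSpace.Opens.chartAt_eq]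
  exact fun _ _ => trivial

theorem extChartAt_posReals_symm (p : posReals) {t : ℝ} (ht : 0 < t) :
    (extChartAt 𝓘(ℝ, ℝ) p).symm t = ⟨t, ht⟩ :=
  (extChartAt 𝓘(ℝ, ℝ) p).left_inv (x := ⟨t, ht⟩) (by rw [extChartAt_posReals_source]; trivial)

theorem extChartAt_posReals_target (p : posReals) : (extChartAt 𝓘(ℝ, ℝ) p).target = Set.Ioi 0 := by
  ext t
  refine ⟨fun h => ?_, fun h => ?_⟩
  · have h1 := (extChartAt 𝓘(ℝ, ℝ) p).right_inv h
    rw [← h1]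
    exact ((extChartAt 𝓘(ℝ, ℝ) p).symm t).2
  · have := (extChartAt 𝓘(ℝ, ℝ) p).map_source (x := ⟨t, h⟩)
      (by rw [extChartAt_posReals_source]; trivial)
    exact this

theorem extChartAt_cone (x : Cone Y) : extChartAt coneI x
    = (extChartAt 𝓘(ℝ, ℝ) x.1).prod (extChartAt (𝓡 5) x.2) := extChartAt_prod x

theorem extChartAt_cone_self (x : Cone Y) :
    extChartAt coneI x x = (rad x, extChartAt (𝓡 5) x.2 x.2) := by
  rw [extChartAt_cone]; rfl

theorem extChartAt_cone_symm (x : Cone Y) {z : E₆} (hz : 0 < z.1) :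
    (extChartAt coneI x).symm z = (⟨z.1, hz⟩, (extChartAt (𝓡 5) x.2).symm z.2) := by
  rw [extChartAt_cone, PartialEquiv.prod_symm]
  exact Prod.ext (extChartAt_posReals_symm _ hz) rfl

theorem mem_extChartAt_cone_target {x : Cone Y} {z : E₆} :
    z ∈ (extChartAt coneI x).target ↔ 0 < z.1 ∧ z.2 ∈ (extChartAt (𝓡 5) x.2).target := by
  rw [extChartAt_cone, PartialEquiv.prod_target, extChartAt_posReals_target]
  rfl

theorem rad_pos (x : Cone Y) : 0 < rad x := x.1.2

variable [IsManifold (𝓡 5) ∞ Y]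

theorem chartL_posReals (p : posReals) {t : ℝ} (ht : 0 < t) :
    chartL 𝓘(ℝ, ℝ) p t = ContinuousLinearMap.id ℝ ℝ := by
  have := chartL_self 𝓘(ℝ, ℝ) (⟨t, ht⟩ : posReals)
  exact this

/-- In the preferred charts of the cone the change of coordinates acts on the factor `Y` only. -/
theorem chartL_cone {x : Cone Y} {z : E₆} (hz : z ∈ (extChartAt coneI x).target) (v : E₆) :
    chartL coneI x z v = (v.1, chartL (𝓡 5) x.2 z.2 v.2) := by
  have hz' := mem_extChartAt_cone_target.mp hz
  have d : MDifferentiableAt 𝓘(ℝ, E₆) coneI (extChartAt coneI x).symm z :=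
    ((contMDiffOn_extChartAt_symm (n := ∞) x).contMDiffAt
      (extChartAt_target_mem_nhds' hz)).mdifferentiableAt (by simp)
  have hpos : ∀ᶠ w : E₆ in 𝓝 z, 0 < w.1 :=
    (isOpen_lt continuous_const continuous_fst).mem_nhds hz'.1
  have d1 : MDifferentiableAt 𝓘(ℝ, ℝ) 𝓘(ℝ, ℝ) (extChartAt 𝓘(ℝ, ℝ) x.1).symm z.1 :=
    ((contMDiffOn_extChartAt_symm (n := ∞) x.1).contMDiffAt
      (extChartAt_target_mem_nhds' (by rw [extChartAt_posReals_target]; exact hz'.1))).mdifferentiableAt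
        (by simp)
  have d2 : MDifferentiableAt 𝓘(ℝ, E₅) (𝓡 5) (extChartAt (𝓡 5) x.2).symm z.2 :=
    ((contMDiffOn_extChartAt_symm (n := ∞) x.2).contMDiffAt
      (extChartAt_target_mem_nhds' hz'.2)).mdifferentiableAt (by simp)
  have f1 : MDifferentiableAt 𝓘(ℝ, E₆) 𝓘(ℝ, ℝ) (Prod.fst : E₆ → ℝ) z :=
    (differentiableAt_fst (𝕜 := ℝ)).mdifferentiableAt
  have f2 : MDifferentiableAt 𝓘(ℝ, E₆) 𝓘(ℝ, E₅) (Prod.snd : E₆ → E₅) z :=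
    (differentiableAt_snd (𝕜 := ℝ)).mdifferentiableAt
  refine Prod.ext ?_ ?_
  · have e1 := mfderiv_comp z (mdifferentiableAt_fst (x := (extChartAt coneI x).symm z)) d
    have e2 := mfderiv_comp z d1 f1
    have e3 : ((Prod.fst : Cone Y → posReals) ∘ (extChartAt coneI x).symm)
        =ᶠ[𝓝 z] (extChartAt 𝓘(ℝ, ℝ) x.1).symm ∘ (Prod.fst : E₆ → ℝ) := by
      filter_upwards [hpos] with w hw
      simp only [Function.comp]
      rw [extChartAt_cone_symm x hw, extChartAt_posReals_symm _ hw]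
    rw [e3.mfderiv_eq, e2, mfderiv_fst, mfderiv_eq_fderiv, fderiv_fst] at e1
    have e4 := chartL_posReals x.1 hz'.1
    have e5 := congrArg (fun f => f v) e1
    have e6 := congrArg (fun f => f v.1) e4
    exact e5.symm.trans e6
  · have e1 := mfderiv_comp z (mdifferentiableAt_snd (x := (extChartAt coneI x).symm z)) d
    have e2 := mfderiv_comp z d2 f2
    have e3 : ((Prod.snd : Cone Y → Y) ∘ (extChartAt coneI x).symm)
        =ᶠ[𝓝 z] (extChartAt (𝓡 5) x.2).symm ∘ (Prod.snd : E₆ → E₅) := by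
      filter_upwards [hpos] with w hw
      simp only [Function.comp]
      rw [extChartAt_cone_symm x hw]
    rw [e3.mfderiv_eq, e2, mfderiv_snd, mfderiv_eq_fderiv, fderiv_snd] at e1
    exact (congrArg (fun f => f v) e1).symm

theorem chartA_cone {x : Cone Y} {z : E₆} (hz : z ∈ (extChartAt coneI x).target) (v : E₆) :
    chartA coneI x z v = (v.1, chartA (𝓡 5) x.2 z.2 v.2) := by
  have h1 := chartL_cone hz (v.1, chartA (𝓡 5) x.2 z.2 v.2)
  rw [chartL_chartA (𝓡 5) (mem_extChartAt_cone_target.mp hz).2] at h1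
  have h2 := chartA_chartL coneI hz (v.1, chartA (𝓡 5) x.2 z.2 v.2)
  rw [h1] at h2
  exact h2

theorem rad_symm (x : Cone Y) : ∀ᶠ z in 𝓝 (extChartAt coneI x x),
    rad ((extChartAt coneI x).symm z) = z.1 := by
  filter_upwards [eventually_target (I := coneI) x] with z hz
  have h := (mem_extChartAt_cone_target.mp hz).1
  rw [extChartAt_cone_symm x h]
  rfl

theorem contMDiff_rad : ContMDiff coneI 𝓘(ℝ, ℝ) ∞ (rad : Cone Y → ℝ) := fun x =>
  contMDiffAt_of_chart (contDiffAt_fst.congr_of_eventuallyEq (rad_symm x))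

theorem dFun_rad (x : Cone Y) : dFun coneI rad x = ContinuousLinearMap.fst ℝ ℝ E₅ := by
  rw [dFun_eq, Filter.EventuallyEq.fderiv_eq (rad_symm x), fderiv_fst]

/-- The chain rule for functions of a real function. -/
theorem dFun_comp {g : ℝ → ℝ} {g' : ℝ} {f : Cone Y → ℝ} {x : Cone Y}
    (hf : ContMDiffAt coneI 𝓘(ℝ, ℝ) ∞ f x) (hg : HasDerivAt g g' (f x)) :
    dFun coneI (fun y => g (f y)) x = g' • dFun coneI f x := by
  rw [dFun_eq, dFun_eq]
  have h1 := ((contDiffAt_chart hf).differentiableAt (by simp)).hasFDerivAt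
  have h2 : HasDerivAt g g' (f ((extChartAt coneI x).symm (extChartAt coneI x x))) := by
    rwa [extChartAt_to_inv]
  have h3 : HasFDerivAt (fun y => g (f ((extChartAt coneI x).symm y))) _ (extChartAt coneI x x) :=
    HasDerivAt.comp_hasFDerivAt (f := fun y => f ((extChartAt coneI x).symm y))
      (extChartAt coneI x x) h2 h1
  exact h3.fderiv

theorem contMDiff_log_rad : ContMDiff coneI 𝓘(ℝ, ℝ) ∞ (fun x : Cone Y => Real.log (rad x)) := by
  intro x
  exact (Real.contDiffAt_log.mpr (rad_pos x).ne').contMDiffAt.comp x (contMDiff_rad x)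

theorem dFun_log_rad (x : Cone Y) : dFun coneI (fun x => Real.log (rad x)) x = dlogr x := by
  rw [dFun_comp (contMDiff_rad x) (Real.hasDerivAt_log (rad_pos x).ne'), dFun_rad]
  rfl

theorem dFun_ofReal {f : Cone Y → ℝ} {x : Cone Y} (hf : ContMDiffAt coneI 𝓘(ℝ, ℝ) ∞ f x) :
    dFun coneI (fun y => (f y : ℂ)) x = Complex.ofRealCLM.comp (dFun coneI f x) :=
  dFun_real_mul Complex.ofRealCLM hf

theorem contMDiffAt_ofReal {f : Cone Y → ℝ} {x : Cone Y} (hf : ContMDiffAt coneI 𝓘(ℝ, ℝ) ∞ f x) :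
    ContMDiffAt coneI 𝓘(ℝ, ℂ) ∞ (fun y => (f y : ℂ)) x :=
  Complex.ofRealCLM.contDiff.contMDiff.contMDiffAt.comp x hf

theorem dlogr_euler (x : Cone Y) : dlogr x (euler x).1 = 1 := by
  simp [dlogr, euler, (rad_pos x).ne']

theorem dlogr_ne_zero (x : Cone Y) : dlogr x ≠ 0 := fun h => by
  have := dlogr_euler x
  rw [h] at this
  simp at this

theorem smoothGen_euler (x : Cone Y) : SmoothGen coneI euler x := by
  have h : ContDiffAt ℝ ∞ (fun z : E₆ => (((z.1, 0), 0) : GenVec E₆)) (extChartAt coneI x x) :=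
    ((contDiff_fst.prodMk contDiff_const).prodMk contDiff_const).contDiffAt
  refine h.congr_of_eventuallyEq ?_
  filter_upwards [eventually_target (I := coneI) x, rad_symm x] with z hz hr
  refine Prod.ext ?_ ?_
  · change chartA coneI x z (rad _, 0) = _
    rw [chartA_cone hz, hr, map_zero]
  · change (0 : E₆ →L[ℝ] ℝ).comp _ = 0
    rw [ContinuousLinearMap.zero_comp]

theorem euler_eq (x : Cone Y) : euler x = ((euler x).1, 0) := rfl

/-- `d(d log r ∧ Φ) = - d log r ∧ dΦ`. -/
theorem polyD_dlogr {Φ : Cone Y → Polyform E₆} (h : ∀ x, SmoothPAt coneI Φ x) (x : Cone Y) :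
    polyD coneI (fun y => cl (0, dlogr y) (Φ y)) x = -cl (0, dlogr x) (polyD coneI Φ x)
    ∧ SmoothPAt coneI (fun y => cl (0, dlogr y) (Φ y)) x := by
  have h1 := polyD_wed_dFun (I := coneI) (f := fun y => (Real.log (rad y) : ℂ)) (Φ := Φ) (x := x)
    (Eventually.of_forall fun z => contMDiffAt_ofReal (contMDiff_log_rad z))
    (Eventually.of_forall h)
  have e : ∀ z : Cone Y, dFun coneI (fun y : Cone Y => (Real.log (rad y) : ℂ)) z
      = Complex.ofRealCLM.comp (dlogr z) := fun z => by
    rw [dFun_ofReal (contMDiff_log_rad z), dFun_log_rad]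
  simp only [e, ← cl_form] at h1
  exact h1

theorem polyD_real_smul {f : Cone Y → ℝ} {Φ : Cone Y → Polyform E₆} {x : Cone Y}
    (hf : ContMDiffAt coneI 𝓘(ℝ, ℝ) ∞ f x) (h : SmoothPAt coneI Φ x) :
    polyD coneI (fun z => (f z : ℂ) • Φ z) x
      = cl (0, dFun coneI f x) (Φ x) + (f x : ℂ) • polyD coneI Φ x := by
  rw [polyD_smul (contMDiffAt_ofReal hf) h, dFun_ofReal hf, cl_form]

theorem lieP_real_smul {f : Cone Y → ℝ} {W : Cone Y → GenVec E₆} {Φ : Cone Y → Polyform E₆}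
    {x : Cone Y} (hf : ContMDiffAt coneI 𝓘(ℝ, ℝ) ∞ f x) (hW : SmoothGen coneI W x)
    (h : SmoothPAt coneI Φ x) : lieP coneI W (fun z => (f z : ℂ) • Φ z) x
      = (dFun coneI f x (W x).1 : ℂ) • Φ x + (f x : ℂ) • lieP coneI W Φ x := by
  rw [lieP_def, lieP_def, polyD_real_smul hf h]
  simp only [map_smul]
  rw [polyD_real_smul hf (h.cl hW), map_add, map_smul]
  have := cl_cl_apply (W x) (0, dFun coneI f x) (Φ x)
  rw [pairing_comm, pair_form] at this
  rw [this]
  module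

end ConeCharts

/-! ### The spinor `e^{-A} Ω₊` and its derivative -/

section RealParts

variable {V : Type*} [NormedAddCommGroup V] [NormedSpace ℝ V]

theorem reP_real_smul (c : ℝ) (Φ : Polyform V) : reP ((c : ℂ) • Φ) = (c : ℂ) • reP Φ := by
  funext k
  ext v
  change (((c : ℂ) * Φ k v).re : ℂ) = (c : ℂ) * ((Φ k v).re : ℂ)
  rw [Complex.re_ofReal_mul, Complex.ofReal_mul]

theorem imP_real_smul (c : ℝ) (Φ : Polyform V) : imP ((c : ℂ) • Φ) = (c : ℂ) • imP Φ := by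
  funext k
  ext v
  change (((c : ℂ) * Φ k v).im : ℂ) = (c : ℂ) * ((Φ k v).im : ℂ)
  rw [Complex.im_ofReal_mul, Complex.ofReal_mul]

theorem reP_add_imP (Φ : Polyform V) : Φ = reP Φ + Complex.I • imP Φ := by
  funext k
  ext v
  change Φ k v = ((Φ k v).re : ℂ) + Complex.I * ((Φ k v).im : ℂ)
  rw [mul_comm, Complex.re_add_im]

theorem conjP_imP (Φ : Polyform V) : conjP (imP Φ) = imP Φ := by
  funext k
  ext v
  change (starRingEnd ℂ) (((Φ k v).im : ℝ) : ℂ) = _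
  rw [Complex.conj_ofReal]
  rfl

/-- Real and imaginary parts of a complex form can be separated. -/
theorem emb_add_I_emb {k : ℕ} {φ χ : Form V ℝ k} (h : emb φ + Complex.I • emb χ = 0) :
    φ = 0 ∧ χ = 0 := by
  have key : ∀ v, (φ v : ℂ) + Complex.I * (χ v : ℂ) = 0 := fun v => by
    have := congrArg (fun Φ : Polyform V => Φ k v) h
    simpa [emb, cplx] using this
  constructor
  · ext v
    simpa using congrArg Complex.re (key v)
  · ext v
    simpa using congrArg Complex.im (key v)

theorem cl_form_congr {ν : V →L[ℝ] ℝ} {Φ Ψ : Polyform V} {k : ℕ} (h : Φ k = Ψ k) :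
    cl (0, ν) Φ (k + 1) = cl (0, ν) Ψ (k + 1) := by
  rw [← sub_eq_zero, ← Pi.sub_apply, ← map_sub, cl_form]
  exact wedOp_component (by rw [Pi.sub_apply, h, sub_self])

theorem cl_vec_congr {v : V} {Φ Ψ : Polyform V} {k : ℕ} (h : Φ (k + 1) = Ψ (k + 1)) :
    cl (v, 0) Φ k = cl (v, 0) Ψ k := by
  rw [← sub_eq_zero, ← Pi.sub_apply, ← map_sub, cl_vec]
  exact intOp_component (by rw [Pi.sub_apply, h, sub_self])

theorem cl_form_self (ν : V →L[ℝ] ℝ) (Φ : Polyform V) : cl (0, ν) (cl (0, ν) Φ) = 0 := by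
  have := congrArg (fun f => f Φ) (cl_sq ((0, ν) : GenVec V))
  simpa using this

/-- `v ⌟ (ν ∧ Φ) = ν(v) Φ - ν ∧ (v ⌟ Φ)`. -/
theorem cl_vec_form (v : V) (ν : V →L[ℝ] ℝ) (Φ : Polyform V) :
    cl (v, 0) (cl (0, ν) Φ) = (ν v : ℂ) • Φ - cl (0, ν) (cl (v, 0) Φ) := by
  rw [cl_vec, cl_form, int_wed']
  rfl

theorem cl_form_form (μ ν : V →L[ℝ] ℝ) (Φ : Polyform V) :
    cl (0, μ) (cl (0, ν) Φ) = -cl (0, ν) (cl (0, μ) Φ) := by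
  rw [cl_form, cl_form, ← Module.End.mul_apply, wed_anticomm]
  simp [LinearMap.smul_apply]

theorem cl_form_smul (c : ℝ) (ν : V →L[ℝ] ℝ) (Φ : Polyform V) :
    cl (0, c • ν) Φ = (c : ℂ) • cl (0, ν) Φ := by
  have h : ((0, c • ν) : GenVec V) = c • (0, ν) := by simp
  rw [h, cl_smul, LinearMap.smul_apply]

theorem cl_form_add (μ ν : V →L[ℝ] ℝ) (Φ : Polyform V) :
    cl (0, μ + ν) Φ = cl (0, μ) Φ + cl (0, ν) Φ := by
  have h : ((0, μ + ν) : GenVec V) = (0, μ) + (0, ν) := by simp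
  rw [h, map_add, LinearMap.add_apply]

theorem vec_eq_cons (v : Fin 2 → V) : v = ![v 0, v 1] := by
  funext i
  fin_cases i <;> rfl

theorem emb_apply_self {k : ℕ} (φ : Form V ℝ k) : emb φ k = cplx φ := by
  simp [emb]

theorem eq_single {k : ℕ} {Φ : Polyform V} (h : ∀ j, j ≠ k → Φ j = 0) :
    Φ = Pi.single k (Φ k) := by
  funext j
  by_cases hj : j = k
  · subst hj; simp
  · rw [h j hj, Pi.single_eq_of_ne hj]

end RealParts

section ConeSpinor

open Filter

variable {Y : Type*} [TopologicalSpace Y] [ChartedSpace (EuclideanSpace ℝ (Fin 5)) Y]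
  [IsManifold (𝓡 5) ∞ Y]

theorem polyD_component {Φ Ψ : Cone Y → Polyform E₆} {k : ℕ} (h : ∀ y, Φ y k = Ψ y k)
    (x : Cone Y) : polyD coneI Φ x (k + 1) = polyD coneI Ψ x (k + 1) := by
  change extD coneI (fun y => Φ y k) x = extD coneI (fun y => Ψ y k) x
  simp only [h]

/-- The Lie derivative along a vector field preserves the degree. -/
theorem lieP_component {v : Cone Y → E₆} {Φ Ψ : Cone Y → Polyform E₆} {k : ℕ}
    (h : ∀ y, Φ y (k + 1) = Ψ y (k + 1)) (x : Cone Y) :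
    lieP coneI (fun y => (v y, 0)) Φ x (k + 1) = lieP coneI (fun y => (v y, 0)) Ψ x (k + 1) := by
  rw [lieP_def, lieP_def, Pi.add_apply, Pi.add_apply]
  congr 1
  · exact polyD_component (fun y => cl_vec_congr (h y)) x
  · exact cl_vec_congr (polyD_component h x)

theorem lieP_smul {f : Cone Y → ℂ} {W : Cone Y → GenVec E₆} {Φ : Cone Y → Polyform E₆}
    {x : Cone Y} (hf : ContMDiffAt coneI 𝓘(ℝ, ℂ) ∞ f x) (hW : SmoothGen coneI W x)
    (h : SmoothPAt coneI Φ x) : lieP coneI W (fun z => f z • Φ z) x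
      = dFun coneI f x (W x).1 • Φ x + f x • lieP coneI W Φ x := by
  rw [lieP_def, lieP_def, polyD_smul hf h]
  simp only [map_smul]
  rw [polyD_smul hf (h.cl hW), map_add, map_smul]
  have h1 : cl (W x) (wedOp (dFun coneI f x) (Φ x)) = dFun coneI f x (W x).1 • Φ x
      - wedOp (dFun coneI f x) (cl (W x) (Φ x)) := by
    have := congrArg (fun f => f (Φ x))
      (wed_anticomm (Complex.ofRealCLM.comp (W x).2) (dFun coneI f x))
    simp only [Module.End.mul_apply, LinearMap.smul_apply] at this
    rw [cl_eq, LinearMap.add_apply, LinearMap.add_apply, map_add, int_wed', this]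
    module
  rw [h1]
  module

variable {Ωm Ωp : Cone Y → Polyform E₆} {α : Cone Y → ℂ} {b om : Cone Y → Form E₆ ℝ 2}
  {A Δ : Cone Y → ℝ} {f₅ : ℝ}

/-- The rescaled spinor `ρ = e^{-A} Ω₊`. -/
def rho (Ωp : Cone Y → Polyform E₆) (A : Cone Y → ℝ) (x : Cone Y) : Polyform E₆ :=
  (Real.exp (-A x) : ℂ) • Ωp x

/-- The derivative of the imaginary part of `ρ = e^{-A} Ω₊`. -/
def kappa (Ωp : Cone Y → Polyform E₆) (A : Cone Y → ℝ) (x : Cone Y) : Polyform E₆ :=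
  polyD coneI (fun y => imP (rho Ωp A y)) x

/-- The function `φ` with `e^{-A} Ω₊ = i φ e^{-b + i ω}`. -/
def phi (α : Cone Y → ℂ) (A : Cone Y → ℝ) (x : Cone Y) : ℝ := Real.exp (-A x) * (α x).im

namespace IsConeStructure

variable (hX : IsConeStructure Ωm Ωp α b om A Δ f₅)
include hX

theorem kahler (x : Cone Y) : IsGenKahler (genStruct (Ωm x)) (genStruct (Ωp x)) :=
  (hX.compatible x).isGenKahler

theorem assoc_m (x : Cone Y) : IsAssociated (Ωm x) (genStruct (Ωm x)) := (hX.compatible x).minus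

theorem assoc_p (x : Cone Y) : IsAssociated (Ωp x) (genStruct (Ωp x)) := (hX.compatible x).plus

theorem plus_exp (x : Cone Y) : Ωp x = α x • expP (b x) (om x) := by
  rw [hX.plus_eq x, expWedge_eq]
  rfl

theorem typeZero (x : Cone Y) : IsTypeZero (genStruct (Ωp x)) (b x) (om x) :=
  (hX.assoc_p x).isTypeZero (hX.plus_exp x)

theorem plus_smooth (x : Cone Y) : SmoothPAt coneI Ωp x := fun k => hX.smooth_plus k x

theorem minus_smooth (x : Cone Y) : SmoothPAt coneI Ωm x := fun k => hX.smooth_minus k x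

theorem plus_zero (x : Cone Y) : Ωp x 0 ![] = α x := by
  rw [hX.plus_exp, expP, Pi.smul_apply, eOp_apply_zero, ContinuousAlternatingMap.smul_apply,
    constP_apply_zero, smul_eq_mul, mul_one]

theorem plus_two (x : Cone Y) : Ωp x 2 = α x • (-cplx (b x) + Complex.I • cplx (om x)) := by
  ext v
  rw [hX.plus_exp, expP, Pi.smul_apply, vec_eq_cons v]
  change α x • eOp _ (constP 1) 2 ![v 0, v 1] = _
  rw [exp_apply_two]
  rfl

theorem smooth_α (x : Cone Y) : ContMDiffAt coneI 𝓘(ℝ, ℂ) ∞ α x := by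
  refine contMDiffAt_of_chart ?_
  have h := hX.smooth_plus 0 x
  have h2 : ContDiffAt ℝ ∞ (fun y => ContinuousAlternatingMap.apply ℝ E₆ ℂ
      (![] : Fin 0 → E₆) (chartForm coneI (fun y => Ωp y 0) x y)) (extChartAt coneI x x) :=
    (ContinuousLinearMap.contDiff _).contDiffAt.comp _ h
  refine h2.congr_of_eventuallyEq (Eventually.of_forall fun y => ?_)
  change α _ = chartForm coneI (fun y => Ωp y 0) x y ![]
  rw [← hX.plus_zero]
  change _ = Ωp ((extChartAt coneI x).symm y) 0 _
  congr 1
  exact Subsingleton.elim _ _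

theorem beta_eq (x : Cone Y) : -cplx (b x) + Complex.I • cplx (om x) = (α x)⁻¹ • Ωp x 2 := by
  rw [hX.plus_two, smul_smul, inv_mul_cancel₀ (hX.type_zero x), one_smul]

theorem smooth_beta (x : Cone Y) :
    SmoothFormAt coneI (fun y => -cplx (b y) + Complex.I • cplx (om y)) x := by
  have h1 : ContMDiffAt coneI 𝓘(ℝ, ℂ) ∞ (fun y => (α y)⁻¹) x := by
    have h0 : ContDiffAt ℝ ∞ (fun z : ℂ => z⁻¹) (α x) := contDiffAt_inv ℝ (hX.type_zero x)
    exact h0.contMDiffAt.comp x (hX.smooth_α x)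
  have h2 := SmoothPAt.smul h1 (hX.plus_smooth x) 2
  exact smoothFormAt_congr (Eventually.of_forall fun y => (hX.beta_eq y).symm) h2

theorem smooth_om (x : Cone Y) : SmoothFormAt coneI om x := by
  refine smoothFormAt_congr (Eventually.of_forall fun y => ?_)
    (SmoothFormAt.comp Complex.imCLM (hX.smooth_beta x))
  ext v
  simp [cplx]

theorem smooth_b (x : Cone Y) : SmoothFormAt coneI b x := by
  refine smoothFormAt_congr (Eventually.of_forall fun y => ?_)
    (SmoothFormAt.comp (-Complex.reCLM) (hX.smooth_beta x))
  ext v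
  simp [cplx]

theorem dα_euler (x : Cone Y) : dFun coneI α x (euler x).1 = 3 * α x := by
  have h := hX.homog_plus x
  have e : lieP coneI euler Ωp x
      = lieP coneI euler (fun y => α y • eOp (-cplx (b y) + Complex.I • cplx (om y)) (constP 1)) x := by
    congr 1
    funext y
    exact hX.plus_exp y
  rw [e, lieP_smul (hX.smooth_α x) (smoothGen_euler x) (smoothPAt_exp (hX.smooth_beta x))] at h
  have h0 := congrArg (fun Φ : Polyform E₆ => Φ 0 ![]) h
  have e2 : lieP coneI euler (fun y => eOp (-cplx (b y) + Complex.I • cplx (om y)) (constP 1)) x 0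
      = 0 := by
    have h1 := polyD_exp (I := coneI) (x := x) (f := fun _ => (1 : ℂ)) contMDiffAt_const
      (hX.smooth_beta x)
    simp only [one_smul, dFun_const] at h1
    rw [lieP_def, Pi.add_apply, h1, euler_eq, cl_vec]
    have h2 : (intOp (euler x).1 (eOp (-cplx (b x) + Complex.I • cplx (om x))
        (wedOp 0 (constP 1) + polyD coneI
          (fun y => Pi.single 2 (-cplx (b y) + Complex.I • cplx (om y))) x))) 0 = 0 := by
      have h3 : wedOp (0 : E₆ →L[ℝ] ℂ) (constP 1 : Polyform E₆) = 0 := by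
        have h4 := cl_form (0 : E₆ →L[ℝ] ℝ)
        rw [ContinuousLinearMap.comp_zero] at h4
        rw [← h4]
        exact congrArg (fun f => f (constP 1 : Polyform E₆)) (map_zero cl)
      rw [h3, zero_add, polyD_single]
      refine intOp_component ?_
      have : (Pi.single 3 (extD coneI (fun y => -cplx (b y) + Complex.I • cplx (om y)) x) :
          Polyform E₆) ∈ degGE 3 := by
        intro k hk
        rw [Pi.single_eq_of_ne hk.ne]
      exact eOp_mem_degGE this 1 (by norm_num)
    rw [h2, add_zero]
    rfl
  simp only [Pi.add_apply, Pi.smul_apply, e2, smul_zero, add_zero, ContinuousAlternatingMap.smul_apply,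
    smul_eq_mul, eOp_apply_zero, constP_apply_zero, mul_one, hX.plus_zero] at h0
  exact h0

/-- The two-forms `b` and `ω` are invariant under the Euler field. -/
theorem lie_two (x : Cone Y) : lieP coneI euler (fun y => emb (b y)) x = 0
    ∧ lieP coneI euler (fun y => emb (om y)) x = 0 := by
  have single : ∀ (β : Cone Y → Form E₆ ℝ 2), (∀ x, SmoothFormAt coneI β x) →
      ∃ χ : Form E₆ ℝ 2, lieP coneI euler (fun y => emb (β y)) x = emb χ := by
    intro β hβ
    have s1 : SmoothPAt coneI (fun y => cl (euler y) (emb (β y))) x :=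
      SmoothPAt.cl (smoothGen_euler x) (smoothPAt_emb_iff.mpr (hβ x))
    have e1 : ∀ y, cl (euler y) (emb (β y)) = emb (oneForm (contract (euler y).1 (β y))) := fun y => by
      rw [euler_eq, cl_vec, int_emb_two]
    simp only [e1] at s1
    refine ⟨extD coneI (fun y => oneForm (contract (euler y).1 (β y))) x
      + (extD coneI β x).curryLeft (euler x).1, ?_⟩
    rw [lieP_def, polyD_emb (hβ x)]
    simp only [e1]
    rw [polyD_emb (smoothPAt_emb_iff.mp s1), emb_add, euler_eq, cl_vec]
    congr 1
    exact int_single _ _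
  obtain ⟨χ, hχ⟩ := single b hX.smooth_b
  obtain ⟨θ, hθ⟩ := single om hX.smooth_om
  have h := congrFun (hX.homog_plus x) 2
  have e : lieP coneI euler Ωp x 2
      = lieP coneI euler (fun y => α y • (((-1 : ℂ) • emb (b y)) + Complex.I • emb (om y))) x 2 := by
    refine lieP_component (v := fun y => (euler y).1) (fun y => ?_) x
    rw [hX.plus_two]
    simp [emb_apply_self]
  have sb := smoothPAt_emb_iff.mpr (hX.smooth_b x)
  have so := smoothPAt_emb_iff.mpr (hX.smooth_om x)
  have e3 : lieP coneI euler (fun y => ((-1 : ℂ) • emb (b y)) + Complex.I • emb (om y)) x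
      = (-1 : ℂ) • emb χ + Complex.I • emb θ := by
    rw [← hχ, ← hθ, lieP_def, lieP_def, lieP_def,
      polyD_add (sb.const_smul _) (so.const_smul _), polyD_const_smul _ sb, polyD_const_smul _ so]
    simp only [map_add, map_smul]
    rw [polyD_add ((sb.cl (smoothGen_euler x)).const_smul _) ((so.cl (smoothGen_euler x)).const_smul _),
      polyD_const_smul _ (sb.cl (smoothGen_euler x)), polyD_const_smul _ (so.cl (smoothGen_euler x))]
    module
  rw [e, lieP_smul (hX.smooth_α x) (smoothGen_euler x)
    ((sb.const_smul _).add (so.const_smul _)), hX.dα_euler, e3] at h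
  simp only [Pi.add_apply, Pi.smul_apply, emb_apply_self, hX.plus_two] at h
  have h2 : α x • ((-1 : ℂ) • cplx χ + Complex.I • cplx θ) = 0 := by
    linear_combination (norm := module) h
  have h3 := (smul_eq_zero.mp h2).resolve_left (hX.type_zero x)
  have h4 : emb (-χ) + Complex.I • emb θ = 0 := by
    refine (eq_single (k := 2) fun j hj => ?_).trans ?_
    · simp [emb, Pi.single_eq_of_ne hj]
    · rw [Pi.add_apply, Pi.smul_apply, emb_apply_self, emb_apply_self]
      have : cplx (-χ) = (-1 : ℂ) • cplx χ := by ext v; simp [cplx]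
      rw [this, h3, Pi.single_zero]
  obtain ⟨h5, h6⟩ := emb_add_I_emb h4
  rw [hχ, hθ, neg_eq_zero.mp h5, h6, emb_zero]
  exact ⟨rfl, rfl⟩

end IsConeStructure

end ConeSpinor

/-! ### The closedness conditions -/

section Mixed

variable {V : Type*} [NormedAddCommGroup V] [NormedSpace ℝ V] [FiniteDimensional ℝ V]
  [hd : Fact (Module.finrank ℝ V = 6)] {Jm Jp : GenVec V →ₗ[ℝ] GenVec V}

/-- The component of `W` in the intersection of the `-i`-eigenspace of `Jp` and an eigenspace of
`Jm`, which is that of `-i` or `i` for `ε = 1` or `ε = -1`, up to a constant factor. -/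
def mixed (Jm Jp : GenVec V →ₗ[ℝ] GenVec V) (ε : ℝ) (W : GenVec V) : GenVec V × GenVec V :=
  (W + (-ε) • Jp (Jm W), Jp W + ε • Jm W)

theorem opC_mixed (ε : ℝ) (W : GenVec V) : opC (mixed Jm Jp ε W)
    = barOp Jp W + ((ε : ℂ) * Complex.I) • barOp Jp (Jm W) := by
  refine LinearMap.ext fun Φ => ?_
  rw [opC_apply, LinearMap.add_apply, LinearMap.smul_apply, barOp_apply, barOp_apply, mixed]
  simp only [map_add, cl_smul, LinearMap.add_apply, LinearMap.smul_apply, Complex.ofReal_neg]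
  linear_combination (norm := module) (-(ε : ℂ) * Complex.I_sq) • cl (Jp (Jm W)) Φ

/-- The mixed vectors with `ε = -1` annihilate `Ω₋`, those with `ε = 1` its conjugate. -/
theorem opC_mixed_minus (h : IsGenKahler Jm Jp) {Ω : Polyform V}
    (hΩ : ∀ W, cl W Ω = Complex.I • cl (Jm W) Ω) (W : GenVec V) :
    opC (mixed Jm Jp (-1) W) Ω = 0 := by
  have c1 := hΩ W
  have c2 := hΩ (Jp W)
  rw [h.comm] at c2
  rw [opC_apply, mixed]
  simp only [map_add, cl_smul, LinearMap.add_apply, LinearMap.smul_apply]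
  rw [c1, c2]
  push_cast
  linear_combination (norm := module) (Complex.I_sq) • cl (Jp (Jm W)) Ω

theorem opC_mixed_conj (h : IsGenKahler Jm Jp) {Ω : Polyform V}
    (hΩ : ∀ W, cl W Ω = Complex.I • cl (Jm W) Ω) (W : GenVec V) :
    opC (mixed Jm Jp 1 W) (conjP Ω) = 0 := by
  have c1 := congrArg conjP (hΩ W)
  have c2 := congrArg conjP (hΩ (Jp W))
  rw [h.comm] at c2
  rw [conjP_smul, conjP_cl, conjP_cl, Complex.conj_I] at c1 c2
  rw [opC_apply, mixed]
  simp only [map_add, cl_smul, LinearMap.add_apply, LinearMap.smul_apply]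
  rw [c1, c2]
  push_cast
  linear_combination (norm := module) (-Complex.I_sq) • cl (Jp (Jm W)) (conjP Ω)

end Mixed

section Closedness

open Filter

variable {Y : Type*} [TopologicalSpace Y] [ChartedSpace (EuclideanSpace ℝ (Fin 5)) Y]
  [IsManifold (𝓡 5) ∞ Y]

theorem dFun_smul {F : Type*} [NormedAddCommGroup F] [NormedSpace ℝ F] {f : Cone Y → ℝ}
    {g : Cone Y → F} {x : Cone Y} (hf : ContMDiffAt coneI 𝓘(ℝ, ℝ) ∞ f x)
    (hg : ContMDiffAt coneI 𝓘(ℝ, F) ∞ g x) (v : E₆) :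
    dFun coneI (fun y => f y • g y) x v = f x • dFun coneI g x v + dFun coneI f x v • g x := by
  have h1 := ((contDiffAt_chart hf).differentiableAt (by simp))
  have h2 := ((contDiffAt_chart hg).differentiableAt (by simp))
  rw [dFun_eq, dFun_eq, dFun_eq]
  have := congrArg (fun L => L v) (fderiv_smul h1 h2)
  simp only [extChartAt_to_inv] at this
  refine this.trans ?_
  simp [extChartAt_to_inv]

theorem contMDiffAt_smul {F : Type*} [NormedAddCommGroup F] [NormedSpace ℝ F] {f : Cone Y → ℝ}
    {g : Cone Y → F} {x : Cone Y} (hf : ContMDiffAt coneI 𝓘(ℝ, ℝ) ∞ f x)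
    (hg : ContMDiffAt coneI 𝓘(ℝ, F) ∞ g x) :
    ContMDiffAt coneI 𝓘(ℝ, F) ∞ (fun y => f y • g y) x :=
  contMDiffAt_of_chart ((contDiffAt_chart hf).smul (contDiffAt_chart hg))

theorem contMDiffAt_exp {f : Cone Y → ℝ} {x : Cone Y} (hf : ContMDiffAt coneI 𝓘(ℝ, ℝ) ∞ f x) :
    ContMDiffAt coneI 𝓘(ℝ, ℝ) ∞ (fun y => Real.exp (f y)) x :=
  Real.contDiff_exp.contDiffAt.contMDiffAt.comp x hf

theorem dFun_exp_mul {f : Cone Y → ℝ} {x : Cone Y} (hf : ContMDiffAt coneI 𝓘(ℝ, ℝ) ∞ f x) (c : ℝ) :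
    dFun coneI (fun y => Real.exp (c * f y)) x = (c * Real.exp (c * f x)) • dFun coneI f x := by
  have h : HasDerivAt (fun t => Real.exp (c * t)) (c * Real.exp (c * f x)) (f x) := by
    have := ((hasDerivAt_id (f x)).const_mul c).exp
    simpa [mul_comm] using this
  exact dFun_comp (g := fun t => Real.exp (c * t)) hf h

theorem contMDiffAt_exp_mul {f : Cone Y → ℝ} {x : Cone Y} (hf : ContMDiffAt coneI 𝓘(ℝ, ℝ) ∞ f x)
    (c : ℝ) : ContMDiffAt coneI 𝓘(ℝ, ℝ) ∞ (fun y => Real.exp (c * f y)) x :=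
  contMDiffAt_exp (contMDiffAt_smul (f := fun _ => c) contMDiffAt_const hf)

theorem smoothPAt_imP {Φ : Cone Y → Polyform E₆} {x : Cone Y} (h : SmoothPAt coneI Φ x) :
    SmoothPAt coneI (fun y => imP (Φ y)) x := fun k =>
  SmoothFormAt.comp Complex.ofRealCLM (SmoothFormAt.comp Complex.imCLM (h k))

theorem smoothPAt_reP {Φ : Cone Y → Polyform E₆} {x : Cone Y} (h : SmoothPAt coneI Φ x) :
    SmoothPAt coneI (fun y => reP (Φ y)) x := fun k =>
  SmoothFormAt.comp Complex.ofRealCLM (SmoothFormAt.comp Complex.reCLM (h k))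

variable {Ωm Ωp : Cone Y → Polyform E₆} {α : Cone Y → ℂ} {b om : Cone Y → Form E₆ ℝ 2}
  {A Δ : Cone Y → ℝ} {f₅ : ℝ}

namespace IsConeStructure

variable (hX : IsConeStructure Ωm Ωp α b om A Δ f₅)
include hX

theorem dA_euler (x : Cone Y) : dFun coneI A x (euler x).1 = 1 := by
  have h := hX.homog_A x
  rw [dFun_comp (hX.smooth_A x) (Real.hasDerivAt_exp (A x))] at h
  have h2 : Real.exp (A x) * dFun coneI A x (euler x).1 = Real.exp (A x) := h
  have := Real.exp_pos (A x)
  exact mul_left_cancel₀ this.ne' (by rw [h2, mul_one])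

theorem smooth_expA (c : ℝ) (x : Cone Y) :
    ContMDiffAt coneI 𝓘(ℝ, ℝ) ∞ (fun y => Real.exp (c * A y)) x :=
  contMDiffAt_exp_mul (hX.smooth_A x) c

theorem smooth_expA_neg (x : Cone Y) :
    ContMDiffAt coneI 𝓘(ℝ, ℝ) ∞ (fun y => Real.exp (-A y)) x := by
  have := hX.smooth_expA (-1) x
  simpa only [neg_one_mul] using this

theorem dFun_expA_neg (x : Cone Y) :
    dFun coneI (fun y => Real.exp (-A y)) x = -Real.exp (-A x) • dFun coneI A x := by
  have := dFun_exp_mul (hX.smooth_A x) (-1)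
  simpa only [neg_one_mul] using this

theorem rho_smooth (x : Cone Y) : SmoothPAt coneI (rho Ωp A) x :=
  SmoothPAt.smul (contMDiffAt_ofReal (hX.smooth_expA_neg x)) (hX.plus_smooth x)

/-- The real part of `ρ = e^{-A} Ω₊` is closed. -/
theorem closed_re_rho (x : Cone Y) : polyD coneI (fun y => reP (rho Ωp A y)) x = 0 := by
  have h := hX.closed_re x
  simpa only [rho, reP_real_smul] using h

/-- The degree zero component of the closed form `e^{-A} Re Ω₊` is locally constant and homogeneous
of degree two in `r`, so it vanishes. -/
theorem re_α (x : Cone Y) : (α x).re = 0 := by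
  have s1 := hX.smooth_expA_neg x
  have s2 : ContMDiffAt coneI 𝓘(ℝ, ℝ) ∞ (fun y => (α y).re) x :=
    Complex.reCLM.contDiff.contMDiff.contMDiffAt.comp x (hX.smooth_α x)
  have h := congrFun (hX.closed_re_rho x) 1
  have e : ∀ y, reP (rho Ωp A y) 0
      = (((Real.exp (-A y) • (α y).re : ℝ) : ℂ) • (constP 1 : Polyform E₆)) 0 := by
    intro y
    ext v
    have hv : v = ![] := Subsingleton.elim _ _
    subst hv
    change (((Real.exp (-A y) : ℂ) * Ωp y 0 ![]).re : ℂ)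
      = ((Real.exp (-A y) • (α y).re : ℝ) : ℂ) * (constP 1 : Polyform E₆) 0 ![]
    rw [hX.plus_zero, constP_apply_zero, Complex.re_ofReal_mul, mul_one]
    rfl
  rw [polyD_component e x, polyD_real_smul (contMDiffAt_smul s1 s2) (smoothPAt_constP 1 x), polyD_one,
    smul_zero, add_zero, cl_form, wed_one] at h
  have h2 : dFun coneI (fun y => Real.exp (-A y) • (α y).re) x (euler x).1 = 0 := by
    have h3 := congrArg (fun φ : Form E₆ ℂ 1 => φ ![(euler x).1]) h
    simp only [emb_apply_self] at h3
    change ((dFun coneI (fun y => Real.exp (-A y) • (α y).re) x (euler x).1 : ℝ) : ℂ) = 0 at h3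
    exact_mod_cast h3
  rw [dFun_smul s1 s2, hX.dFun_expA_neg] at h2
  have h4 : dFun coneI (fun y => (α y).re) x (euler x).1 = 3 * (α x).re := by
    have h5 := dFun_real_mul Complex.reCLM (hX.smooth_α x)
    have h6 := congrArg (fun L => L (euler x).1) h5
    refine h6.trans ?_
    change (dFun coneI α x (euler x).1).re = _
    rw [hX.dα_euler]
    simp
  rw [h4, smul_apply, hX.dA_euler] at h2
  simp only [smul_eq_mul] at h2
  have h7 : Real.exp (-A x) * (2 * (α x).re) = 0 := by linear_combination h2
  have := (mul_eq_zero.mp h7).resolve_left (Real.exp_pos _).ne'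
  linarith

theorem α_eq (x : Cone Y) : α x = Complex.I * ((α x).im : ℂ) := by
  conv_lhs => rw [← Complex.re_add_im (α x), hX.re_α, Complex.ofReal_zero, zero_add, mul_comm]

theorem im_α_ne (x : Cone Y) : (α x).im ≠ 0 := fun h => by
  have := hX.α_eq x
  rw [h] at this
  exact hX.type_zero x (by simpa using this)

theorem smooth_im_α (x : Cone Y) : ContMDiffAt coneI 𝓘(ℝ, ℝ) ∞ (fun y => (α y).im) x :=
  Complex.imCLM.contDiff.contMDiff.contMDiffAt.comp x (hX.smooth_α x)

theorem smooth_phi (x : Cone Y) : ContMDiffAt coneI 𝓘(ℝ, ℝ) ∞ (phi α A) x :=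
  contMDiffAt_smul (hX.smooth_expA_neg x) (hX.smooth_im_α x)

theorem phi_ne (x : Cone Y) : phi α A x ≠ 0 :=
  mul_ne_zero (Real.exp_pos _).ne' (hX.im_α_ne x)

theorem dphi_euler (x : Cone Y) : dFun coneI (phi α A) x (euler x).1 = 2 * phi α A x := by
  have h4 : dFun coneI (fun y => (α y).im) x (euler x).1 = 3 * (α x).im := by
    have h5 := dFun_real_mul Complex.imCLM (hX.smooth_α x)
    have h6 := congrArg (fun L => L (euler x).1) h5
    refine h6.trans ?_
    change (dFun coneI α x (euler x).1).im = _
    rw [hX.dα_euler]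
    simp
  have := dFun_smul (hX.smooth_expA_neg x) (hX.smooth_im_α x) (euler x).1
  refine this.trans ?_
  rw [h4, hX.dFun_expA_neg, smul_apply, hX.dA_euler, phi]
  simp only [smul_eq_mul]
  ring

theorem rho_exp (x : Cone Y) :
    rho Ωp A x = (Complex.I * (phi α A x : ℂ)) • expP (b x) (om x) := by
  rw [rho, hX.plus_exp, smul_smul, phi]
  congr 1
  conv_lhs => rw [hX.α_eq x]
  push_cast
  ring

theorem re_rho_two (x : Cone Y) : reP (rho Ωp A x) 2 = cplx (-phi α A x • om x) := by
  ext v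
  change (((Real.exp (-A x) : ℂ) * Ωp x 2 v).re : ℂ) = ((-phi α A x * om x v : ℝ) : ℂ)
  congr 1
  rw [hX.plus_two, hX.α_eq x, phi, Complex.re_ofReal_mul]
  simp [cplx]
  ring

theorem im_rho_two (x : Cone Y) : imP (rho Ωp A x) 2 = cplx (-phi α A x • b x) := by
  ext v
  change (((Real.exp (-A x) : ℂ) * Ωp x 2 v).im : ℂ) = ((-phi α A x * b x v : ℝ) : ℂ)
  congr 1
  rw [hX.plus_two, hX.α_eq x, phi, Complex.im_ofReal_mul]
  simp [cplx]
  ring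

theorem im_rho_zero (x : Cone Y) : imP (rho Ωp A x) 0 ![] = phi α A x := by
  change (((Real.exp (-A x) : ℂ) * Ωp x 0 ![]).im : ℂ) = _
  rw [hX.plus_zero, phi, Complex.im_ofReal_mul]

/-- The degree two component of the closed form `e^{-A} Re Ω₊` is `-φ ω`. -/
theorem polyD_om (x : Cone Y) : polyD coneI (fun y => emb (phi α A y • om y)) x = 0 := by
  have h := congrFun (hX.closed_re_rho x) 3
  have e : ∀ y, reP (rho Ωp A y) 2 = ((-1 : ℂ) • emb (phi α A y • om y)) 2 := by
    intro y
    rw [hX.re_rho_two, Pi.smul_apply, emb_apply_self]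
    ext v
    simp [cplx]
  have s : SmoothPAt coneI (fun y => emb (phi α A y • om y)) x := by
    simp only [emb_smul]
    exact SmoothPAt.smul (contMDiffAt_ofReal (hX.smooth_phi x)) (smoothPAt_emb_iff.mpr (hX.smooth_om x))
  rw [polyD_component e x, polyD_const_smul _ s] at h
  have e2 := polyD_emb (smoothPAt_emb_iff.mp s)
  rw [e2] at h ⊢
  simp only [Pi.smul_apply, emb_apply_self, Pi.zero_apply] at h
  have h3 : cplx (extD coneI (fun y => phi α A y • om y) x) = cplx 0 := by
    have : (cplx (0 : Form E₆ ℝ 3)) = 0 := by ext v; simp [cplx]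
    rw [this]
    linear_combination (norm := module) (-1 : ℂ) • h
  rw [cplx_injective h3, emb_zero]

theorem polyD_rho (x : Cone Y) : polyD coneI (rho Ωp A) x = Complex.I • kappa Ωp A x := by
  have e : rho Ωp A = fun y => reP (rho Ωp A y) + Complex.I • imP (rho Ωp A y) := by
    funext y
    exact reP_add_imP _
  conv_lhs => rw [e]
  rw [polyD_add (smoothPAt_reP (hX.rho_smooth x)) ((smoothPAt_imP (hX.rho_smooth x)).const_smul _),
    hX.closed_re_rho, zero_add, polyD_const_smul _ (smoothPAt_imP (hX.rho_smooth x))]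
  rfl

theorem conj_kappa (x : Cone Y) : conjP (kappa Ωp A x) = kappa Ωp A x := by
  have := (polyD_conj (smoothPAt_imP (hX.rho_smooth x))).1
  simp only [conjP_imP] at this
  exact this.symm

/-- The derivative of `f e^β` is `e^β` times a polyform of degree at most three. Since `κ` is real,
this also gives the corresponding statement for the conjugate spinor. -/
theorem kappa_lower (x : Cone Y) :
    eOp (cplx (b x) - Complex.I • cplx (om x)) (kappa Ωp A x) ∈ degLE 3 := by
  have h := hX.polyD_rho x
  have e : rho Ωp A = fun y => (Complex.I * (phi α A y : ℂ))
      • eOp (-cplx (b y) + Complex.I • cplx (om y)) (constP 1) := by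
    funext y
    exact hX.rho_exp y
  have hf : ContMDiffAt coneI 𝓘(ℝ, ℂ) ∞ (fun y => Complex.I * (phi α A y : ℂ)) x :=
    contMDiffAt_of_chart (contDiffAt_const.mul (contDiffAt_chart (contMDiffAt_ofReal (hX.smooth_phi x))))
  rw [e, polyD_exp hf (hX.smooth_beta x)] at h
  have h1 : kappa Ωp A x = (-Complex.I) • eOp (-cplx (b x) + Complex.I • cplx (om x))
      (wedOp (dFun coneI (fun y => Complex.I * (phi α A y : ℂ)) x) (constP 1)
        + (Complex.I * (phi α A x : ℂ)) • polyD coneI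
          (fun y => Pi.single 2 (-cplx (b y) + Complex.I • cplx (om y))) x) := by
    rw [h, smul_smul]
    simp
  have h2 : cplx (b x) - Complex.I • cplx (om x) = -(-cplx (b x) + Complex.I • cplx (om x)) := by
    module
  rw [h1, h2, map_smul, ← Module.End.mul_apply, eOp_neg_mul, Module.End.one_apply]
  refine Submodule.smul_mem _ _ (Submodule.add_mem _ ?_ (Submodule.smul_mem _ _ ?_))
  · exact degLE_mono (by norm_num) (wedOp_mem_degLE (constP_mem_degLE 1))
  · rw [polyD_single]
    intro k hk
    rw [Pi.single_eq_of_ne hk.ne']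

theorem kappa_lower' (x : Cone Y) :
    eOp (cplx (b x) + Complex.I • cplx (om x)) (kappa Ωp A x) ∈ degLE 3 := by
  have h := hX.kappa_lower x
  have e : eOp (cplx (b x) + Complex.I • cplx (om x)) (kappa Ωp A x)
      = conjP (eOp (cplx (b x) - Complex.I • cplx (om x)) (kappa Ωp A x)) := by
    rw [conjP_eOp, hX.conj_kappa]
    congr 2
    ext v
    simp [conjForm, cplx]
  rw [e]
  intro k hk
  ext v
  have := congrArg (fun φ : Form E₆ ℂ k => φ v) (h k hk)
  simp only [conjP]
  change (starRingEnd ℂ) (eOp (cplx (b x) - Complex.I • cplx (om x)) (kappa Ωp A x) k v) = 0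
  rw [this]
  exact map_zero _

theorem rho_vacuum (x : Cone Y) : IsVacuum (genStruct (Ωp x)) (rho Ωp A x) := fun W => by
  rw [rho, map_smul, map_smul, (hX.assoc_p x).cl_eq W]
  module

theorem rho_injective (x : Cone Y) (W : GenVec E₆) (h : cl W (rho Ωp A x) = 0) : W = 0 := by
  rw [rho, map_smul] at h
  exact (hX.assoc_p x).eq_zero_of_cl ((smul_eq_zero.mp h).resolve_left
    (by exact_mod_cast (Real.exp_pos _).ne'))

/-- Integrability of `J₋`: the derivative of `ρ` has no component of extreme type with respect to
both structures. -/
theorem kappa_torsion (x : Cone Y) (ε : ℝ) (hε : ε = 1 ∨ ε = -1) (W₁ W₂ W₃ : GenVec E₆) :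
    opC (mixed (genStruct (Ωm x)) (genStruct (Ωp x)) ε W₁)
      (opC (mixed (genStruct (Ωm x)) (genStruct (Ωp x)) ε W₂)
        (opC (mixed (genStruct (Ωm x)) (genStruct (Ωp x)) ε W₃) (kappa Ωp A x))) = 0 := by
  obtain ⟨Z, sZ, h₁, h₂, h₃⟩ : ∃ Z : Fin 3 → Cone Y → GenVec E₆,
      (∀ i, SmoothGen coneI (Z i) x) ∧ Z 0 x = W₁ ∧ Z 1 x = W₂ ∧ Z 2 x = W₃ :=
    ⟨fun i => locConst coneI x (![W₁, W₂, W₃] i), fun i => smoothGen_locConst x _,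
      locConst_self x _, locConst_self x _, locConst_self x _⟩
  have sm : ∀ i, SmoothGen coneI (fun y => genStruct (Ωm y) (Z i y)) x := fun i =>
    IsAssociated.smoothGen hX.assoc_m (hX.minus_smooth x) (sZ i)
  have sp : ∀ {V : Cone Y → GenVec E₆}, SmoothGen coneI V x →
      SmoothGen coneI (fun y => genStruct (Ωp y) (V y)) x := fun hV =>
    IsAssociated.smoothGen hX.assoc_p (hX.plus_smooth x) hV
  obtain ⟨c, hc⟩ := exists_torsion (I := coneI) x
    (fun i y => mixed (genStruct (Ωm y)) (genStruct (Ωp y)) ε (Z i y))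
    (fun i => (sZ i).add (SmoothGen.smul contMDiffAt_const (sp (sm i))))
    (fun i => (sp (sZ i)).add (SmoothGen.smul contMDiffAt_const (sm i)))
  have hne : Ωm x ≠ 0 := (hX.assoc_m x).ne_zero
  have hc0 : c = 0 := by
    rcases hε with rfl | rfl
    · have := hc (fun y => conjP (Ωm y)) (polyD_conj (hX.minus_smooth x)).2
        fun i => Eventually.of_forall fun y =>
          opC_mixed_conj (hX.kahler y) (hX.assoc_m y).cl_eq (Z i y)
      rw [(polyD_conj (hX.minus_smooth x)).1, hX.closed_minus, conjP_zero, map_zero, map_zero,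
        map_zero] at this
      refine (smul_eq_zero.mp this.symm).resolve_right fun h0 => hne ?_
      rw [← conjP_conjP (Ωm x), h0, conjP_zero]
    · have := hc Ωm (hX.minus_smooth x) fun i => Eventually.of_forall fun y =>
          opC_mixed_minus (hX.kahler y) (hX.assoc_m y).cl_eq (Z i y)
      rw [hX.closed_minus, map_zero, map_zero, map_zero] at this
      exact (smul_eq_zero.mp this.symm).resolve_right hne
  have hr := hc (fun y => conjP (rho Ωp A y)) (polyD_conj (hX.rho_smooth x)).2
    fun i => Eventually.of_forall fun y => by
      rw [opC_mixed, LinearMap.add_apply, LinearMap.smul_apply, barOp_conj, barOp_conj,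
        (hX.rho_vacuum y).holOp, (hX.rho_vacuum y).holOp, conjP_zero, smul_zero, add_zero]
  have e : polyD coneI (fun y => conjP (rho Ωp A y)) x = (-Complex.I) • kappa Ωp A x := by
    rw [(polyD_conj (hX.rho_smooth x)).1, hX.polyD_rho, conjP_smul, hX.conj_kappa, Complex.conj_I]
  rw [hc0, zero_smul, e, map_smul, map_smul, map_smul] at hr
  beta_reduce at hr
  rw [h₁, h₂, h₃] at hr
  rw [(smul_eq_zero.mp hr).resolve_left (neg_ne_zero.mpr Complex.I_ne_zero)]

/-- The generalized Hodge operator and `J₋ ·` are inverse to each other on the derivative of `ρ`. -/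
theorem hodge_kappa (x : Cone Y) {S : Module.End ℂ (Polyform E₆)} {u : Module.Basis (Fin 6) ℝ E₆}
    (hS : IsHodge (genStruct (Ωm x)) (genStruct (Ωp x)) (b x) (om x) S u) :
    S (algOp (genStruct (Ωm x)) (kappa Ωp A x)) = kappa Ωp A x := by
  refine hS.star _ (hX.kappa_lower x) (hX.kappa_lower' x) fun s hs W₁ W₂ W₃ => ?_
  obtain ⟨ε, rfl, hε⟩ : ∃ ε : ℝ, s = ε * Complex.I ∧ (ε = 1 ∨ ε = -1) := by
    rcases hs with rfl | rfl
    · exact ⟨1, by simp, Or.inl rfl⟩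
    · exact ⟨-1, by simp, Or.inr rfl⟩
  rw [← opC_mixed, ← opC_mixed, ← opC_mixed]
  exact hX.kappa_torsion x ε hε W₁ W₂ W₃

end IsConeStructure

end Closedness

/-! ### The flux and the radial dependence of `A` -/

section Flux

open Filter

variable {Y : Type*} [TopologicalSpace Y] [ChartedSpace (EuclideanSpace ℝ (Fin 5)) Y]
  [IsManifold (𝓡 5) ∞ Y]
  {Ωm Ωp : Cone Y → Polyform E₆} {α : Cone Y → ℂ} {b om : Cone Y → Form E₆ ℝ 2}
  {A Δ : Cone Y → ℝ} {f₅ : ℝ}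

theorem scaledIm_eq (y : Cone Y) :
    scaledIm Ωp A y = (Real.exp (-2 * A y) : ℂ) • imP (rho Ωp A y) := by
  rw [scaledIm, rho, imP_real_smul, smul_smul, ← Complex.ofReal_mul, ← Real.exp_add]
  congr 3
  ring

/-- `κ + 2 dA ∧ Im ρ`, the image of `d^{J₋}(e^{-3A} Im Ω₊)` under the generalized Hodge operator up
to a factor. -/
def dualFlux (Ωp : Cone Y → Polyform E₆) (A : Cone Y → ℝ) (x : Cone Y) : Polyform E₆ :=
  kappa Ωp A x + (2 : ℂ) • cl (0, dFun coneI A x) (imP (rho Ωp A x))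

theorem emb_one_apply (ν : E₆ →L[ℝ] ℝ) (v : E₆) :
    (emb (oneForm ν) : Polyform E₆) 1 ![v] = (ν v : ℂ) := by
  rw [emb_apply_self]
  rfl

namespace IsConeStructure

variable (hX : IsConeStructure Ωm Ωp α b om A Δ f₅)
include hX

theorem exists_hodge (x : Cone Y) : ∃ S u,
    IsHodge (genStruct (Ωm x)) (genStruct (Ωp x)) (b x) (om x) S u :=
  exists_isHodge (hX.kahler x) (hX.typeZero x)

theorem algOp_scaledIm (x : Cone Y) : algOp (genStruct (Ωm x)) (scaledIm Ωp A x) = 0 := by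
  obtain ⟨S, u, hS⟩ := hX.exists_hodge x
  rw [scaledIm_eq, map_smul, hS.algOp_im (hX.rho_vacuum x), smul_zero]

theorem scaledIm_smooth (x : Cone Y) : SmoothPAt coneI (scaledIm Ωp A) x := by
  have e : scaledIm Ωp A = fun y => (Real.exp (-2 * A y) : ℂ) • imP (rho Ωp A y) := by
    funext y; exact scaledIm_eq y
  rw [e]
  exact SmoothPAt.smul (contMDiffAt_ofReal (hX.smooth_expA (-2) x))
    (smoothPAt_imP (hX.rho_smooth x))

theorem polyD_scaledIm (x : Cone Y) : polyD coneI (scaledIm Ωp A) x = (Real.exp (-2 * A x) : ℂ) •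
    (kappa Ωp A x - (2 : ℂ) • cl (0, dFun coneI A x) (imP (rho Ωp A x))) := by
  have e : scaledIm Ωp A = fun y => (Real.exp (-2 * A y) : ℂ) • imP (rho Ωp A y) := by
    funext y; exact scaledIm_eq y
  rw [e, polyD_real_smul (hX.smooth_expA (-2) x) (smoothPAt_imP (hX.rho_smooth x)),
    dFun_exp_mul (hX.smooth_A x), cl_form_smul]
  change _ + _ • kappa Ωp A x = _
  push_cast
  module

theorem dJ_scaledIm (x : Cone Y) : dJ coneI (fun y => genStruct (Ωm y)) (scaledIm Ωp A) x
    = algOp (genStruct (Ωm x)) (polyD coneI (scaledIm Ωp A) x) := by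
  rw [dJ, algAct_eq]
  simp only [algAct_eq, hX.algOp_scaledIm]
  rw [polyD_zero, sub_zero]

/-- The dual form of the flux: `J₋ ·` is inverted by the generalized Hodge operator `S`. -/
theorem hodge_flux (x : Cone Y) {S : Module.End ℂ (Polyform E₆)} {u : Module.Basis (Fin 6) ℝ E₆}
    (hS : IsHodge (genStruct (Ωm x)) (genStruct (Ωp x)) (b x) (om x) S u) :
    S (dJ coneI (fun y => genStruct (Ωm y)) (scaledIm Ωp A) x)
      = (Real.exp (-2 * A x) : ℂ) • dualFlux Ωp A x := by
  rw [hX.dJ_scaledIm, hX.polyD_scaledIm, map_smul, map_smul,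
    hS.hodge_algOp_scaled (hX.kahler x) (hX.rho_vacuum x) (hX.hodge_kappa x hS)]
  rfl

theorem metric_euler' (x : Cone Y) : gOf (genStruct (Ωm x)) (genStruct (Ωp x)) (euler x)
    = (0, Real.exp (2 * Δ x) • dlogr x) := hX.metric_euler x

theorem contract_bField (x : Cone Y) : contract (euler x).1 (bField (metricG Ωm Ωp x)) = 0 :=
  ((hX.kahler x).bField_of_vec (hX.metric_euler' x)).2

/-- The twisted flux has no component along the Euler field. -/
theorem euler_flux (x : Cone Y) :
    cl (euler x) (dJ coneI (fun y => genStruct (Ωm y)) (scaledIm Ωp A) x) = 0 := by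
  have h := hX.flux_horizontal x
  rw [flux, expWedge_eq, ← intOp_apply, int_eOp_apply, contractC_cplx, hX.contract_bField,
    ContinuousLinearMap.comp_zero] at h
  have h0 : wedOp (0 : E₆ →L[ℝ] ℂ) = 0 := by
    have h4 := cl_form (0 : E₆ →L[ℝ] ℝ)
    rw [ContinuousLinearMap.comp_zero] at h4
    rw [← h4]
    exact map_zero cl
  rw [h0, LinearMap.zero_apply, add_zero, twistedFlux, map_smul, map_smul] at h
  have h1 := (smul_eq_zero.mp h).resolve_left (by norm_num)
  have h2 := congrArg (eOp (-cplx (bField (metricG Ωm Ωp x)))) h1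
  rw [← Module.End.mul_apply, eOp_neg_mul, Module.End.one_apply, map_zero] at h2
  rw [euler_eq, cl_vec]
  exact h2

/-- `S` exchanges the actions of `r∂_r` and of `G(r∂_r) = e^{2Δ} d log r`, and the twisted flux is
annihilated by `r∂_r`. -/
theorem dlogr_dualFlux (x : Cone Y) : cl (0, dlogr x) (dualFlux Ωp A x) = 0 := by
  obtain ⟨S, u, hS⟩ := hX.exists_hodge x
  have h := hS.clifford (euler x) (dJ coneI (fun y => genStruct (Ωm y)) (scaledIm Ωp A) x)
  rw [hX.euler_flux, map_zero, hX.metric_euler', hX.hodge_flux x hS, cl_form_smul, map_smul,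
    smul_smul] at h
  have h2 := neg_eq_zero.mp h.symm
  refine (smul_eq_zero.mp h2).resolve_left ?_
  exact_mod_cast mul_ne_zero (Real.exp_pos _).ne' (Real.exp_pos _).ne'

/-- `dφ + 2 φ dA`, the component of degree one of the dual flux. -/
theorem dualFlux_one (x : Cone Y) : dualFlux Ωp A x 1
    = cl (0, dFun coneI (phi α A) x + (2 * phi α A x) • dFun coneI A x) (constP 1) 1 := by
  have e : ∀ y, imP (rho Ωp A y) 0 = ((phi α A y : ℂ) • (constP 1 : Polyform E₆)) 0 := by
    intro y
    ext v
    have hv : v = ![] := Subsingleton.elim _ _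
    subst hv
    rw [hX.im_rho_zero, Pi.smul_apply, ContinuousAlternatingMap.smul_apply, constP_apply_zero,
      smul_eq_mul, mul_one]
  rw [dualFlux, Pi.add_apply, Pi.smul_apply, cl_form_congr (e x), kappa, polyD_component e x,
    polyD_real_smul (hX.smooth_phi x) (smoothPAt_constP 1 x), polyD_one, smul_zero, add_zero,
    cl_form_add, cl_form_smul, map_smul]
  simp only [Pi.add_apply, Pi.smul_apply]
  push_cast
  module

/-- The degree one component of `d log r ∧ S(e^{-B} F) = 0`, the coefficient being fixed by the
homogeneity of `φ` and `A`. -/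
theorem dphi (x : Cone Y) : dFun coneI (phi α A) x + (2 * phi α A x) • dFun coneI A x
    = (4 * phi α A x) • dlogr x := by
  refine ContinuousLinearMap.ext fun v => ?_
  have h := congrFun (hX.dlogr_dualFlux x) 2
  rw [cl_form_congr (hX.dualFlux_one x)] at h
  have h2 := cl_vec_congr (v := (euler x).1) (k := 1) (Ψ := 0) h
  rw [cl_vec_form, map_zero, cl_vec_form, dlogr_euler] at h2
  rw [cl_vec, intOp_constP, map_zero, sub_zero, map_smul, cl_form, cl_form, wed_one, wed_one] at h2
  have h3 := congrArg (fun φ : Form E₆ ℂ 1 => φ ![v]) h2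
  simp only [Pi.sub_apply, Pi.smul_apply, ContinuousAlternatingMap.sub_apply,
    ContinuousAlternatingMap.smul_apply, emb_one_apply] at h3
  have h5 : (dFun coneI (phi α A) x + (2 * phi α A x) • dFun coneI A x) (euler x).1
      = 2 * phi α A x + 2 * phi α A x * 1 := by
    rw [add_apply, smul_apply, hX.dphi_euler, hX.dA_euler, smul_eq_mul]
  rw [h5] at h3
  simp only [Complex.ofReal_one, one_smul, smul_eq_mul] at h3
  have h4 : (dFun coneI (phi α A) x + (2 * phi α A x) • dFun coneI A x) v
      - (2 * phi α A x + 2 * phi α A x * 1) * dlogr x v = 0 := by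
    have : (0 : Polyform E₆) 1 ![v] = 0 := rfl
    rw [this, one_mul] at h3
    exact_mod_cast h3
  rw [smul_apply, smul_eq_mul]
  linear_combination h4

/-- `d log r ∧ db = 0`. -/
theorem dlogr_db (x : Cone Y) : cl (0, dlogr x) (polyD coneI (fun y => emb (b y)) x) = 0 := by
  have sb := smoothPAt_emb_iff.mpr (hX.smooth_b x)
  have h := congrFun (hX.dlogr_dualFlux x) 4
  have e : ∀ y, imP (rho Ωp A y) 2 = (((-phi α A y : ℝ) : ℂ) • emb (b y)) 2 := by
    intro y
    rw [hX.im_rho_two, ← emb_smul, emb_apply_self]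
  have sφ : ContMDiffAt coneI 𝓘(ℝ, ℝ) ∞ (fun y => (-1 : ℝ) • phi α A y) x :=
    contMDiffAt_smul (f := fun _ => (-1 : ℝ)) contMDiffAt_const (hX.smooth_phi x)
  have dφ : dFun coneI (fun y => (-1 : ℝ) • phi α A y) x = (-1 : ℝ) • dFun coneI (phi α A) x := by
    refine ContinuousLinearMap.ext fun v => ?_
    rw [dFun_smul (f := fun _ => (-1 : ℝ)) contMDiffAt_const (hX.smooth_phi x), dFun_const]
    simp
  have e3 : dualFlux Ωp A x 3 = (-((4 * phi α A x : ℝ) : ℂ) • cl (0, dlogr x) (emb (b x))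
      - (phi α A x : ℂ) • polyD coneI (fun y => emb (b y)) x) 3 := by
    have h1 := polyD_real_smul sφ sb
    rw [dφ, cl_form_smul] at h1
    have h2 : kappa Ωp A x 3
        = polyD coneI (fun y => (((-1 : ℝ) • phi α A y : ℝ) : ℂ) • emb (b y)) x 3 := by
      refine polyD_component (fun y => ?_) x
      rw [e, smul_eq_mul, neg_one_mul]
    have h3 := cl_form_smul (4 * phi α A x) (dlogr x) (emb (b x))
    rw [← hX.dphi, cl_form_add, cl_form_smul] at h3
    have h4 := congrFun h3 3
    rw [dualFlux, Pi.add_apply, Pi.smul_apply, cl_form_congr (e x), h2, h1, map_smul]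
    simp only [Pi.add_apply, Pi.sub_apply, Pi.smul_apply, Pi.neg_apply, smul_eq_mul] at h4 ⊢
    push_cast at h4 ⊢
    linear_combination (norm := module) (-1 : ℂ) • h4
  rw [cl_form_congr e3, map_sub, map_smul, map_smul, cl_form_self, smul_zero, zero_sub,
    Pi.neg_apply, Pi.zero_apply, neg_eq_zero, Pi.smul_apply] at h
  have h4 := (smul_eq_zero.mp h).resolve_left (by exact_mod_cast hX.phi_ne x)
  have h5 : cl (0, dlogr x) (polyD coneI (fun y => emb (b y)) x)
      = Pi.single 4 (cl (0, dlogr x) (polyD coneI (fun y => emb (b y)) x) 4) := by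
    rw [polyD_emb (hX.smooth_b x), cl_form]
    conv_lhs => rw [emb, wed_single]
    rfl
  rw [h5, h4, Pi.single_zero]

theorem flux_eq (x : Cone Y) : flux Ωm Ωp A x = eOp (cplx (bField (metricG Ωm Ωp x)))
    ((8 : ℂ) • dJ coneI (fun y => genStruct (Ωm y)) (scaledIm Ωp A) x) := by
  rw [flux, expWedge_eq]
  rfl

/-- The five-form flux determines the function `a` in `Ω₊ = i a e^{-b + i ω}`. -/
theorem flux_constant (x : Cone Y) :
    f₅ = -32 * (α x).im * Real.exp (4 * Δ x - 3 * A x) := by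
  obtain ⟨S, u, hS⟩ := hX.exists_hodge x
  set T := dJ coneI (fun y => genStruct (Ωm y)) (scaledIm Ωp A) x with hT
  set w : E₆ →L[ℝ] ℝ := Real.exp (2 * Δ x) • dlogr x with hw
  have g1 : gOf (genStruct (Ωm x)) (genStruct (Ωp x)) (0, w) = euler x := by
    rw [hw, ← hX.metric_euler', (hX.kahler x).g_g]
  -- the top component of `d log r ∧ F`, computed with the generalized Hodge operator
  have h1 : S (cl (euler x) ((Real.exp (-2 * A x) : ℂ) • dualFlux Ωp A x)) = cl (0, w) T := by
    rw [hS.clifford, hX.metric_euler', ← hX.hodge_flux x hS, hS.sq, map_neg, neg_neg]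
  have h2 := hS.top (cl (euler x) ((Real.exp (-2 * A x) : ℂ) • dualFlux Ωp A x))
  rw [h1, hw, cl_form_smul, map_smul, map_smul, euler_eq, cl_form, eOp_wed_apply] at h2
  have h3 : cl ((euler x).1, 0) (dualFlux Ωp A x) 0 ![] = ((4 * phi α A x : ℝ) : ℂ) := by
    rw [cl_vec_congr (hX.dualFlux_one x), hX.dphi, cl_form, wed_one, cl_vec, int_emb_one,
      constP_apply_zero, smul_apply, dlogr_euler, smul_eq_mul, mul_one]
  -- the same component, computed from the definition of the constant
  have h4 : eOp (cplx (bField (gOf (genStruct (Ωm x)) (genStruct (Ωp x))))) T 5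
      = ((f₅ / 8 : ℝ) : ℂ) • volY Ωm Ωp Δ x := by
    have := hX.flux_five x
    rw [hX.flux_eq, map_smul, Pi.smul_apply] at this
    change (8 : ℂ) • eOp (cplx (bField (gOf (genStruct (Ωm x)) (genStruct (Ωp x))))) T 5 = _ at this
    push_cast
    linear_combination (norm := module) (1 / 8 : ℂ) • this
  have h5 : wedOp (Complex.ofRealCLM.comp (dlogr x))
      (eOp (cplx (bField (gOf (genStruct (Ωm x)) (genStruct (Ωp x))))) T) 6
      = ((f₅ / 8 : ℝ) : ℂ) • (-(Real.exp (-6 * Δ x) : ℂ)) • volX Ωm Ωp x := by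
    have e1 : (Pi.single 6 (volX Ωm Ωp x) : Polyform E₆) ∈ degGE 6 := by
      intro k hk
      rw [Pi.single_eq_of_ne hk.ne]
    have e2 : wedOp (Complex.ofRealCLM.comp (dlogr x)) (Pi.single 6 (volX Ωm Ωp x) : Polyform E₆)
        = 0 := by
      refine eq_zero_of_degGE_seven fun k hk => ?_
      cases k with
      | zero => rfl
      | succ k => exact wedOp_component (e1 k (by omega))
    have e3 := int_wed' (euler x).1 (Complex.ofRealCLM.comp (dlogr x))
      (Pi.single 6 (volX Ωm Ωp x) : Polyform E₆)
    have e4 : (Complex.ofRealCLM.comp (dlogr x)) (euler x).1 = 1 := by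
      change ((dlogr x (euler x).1 : ℝ) : ℂ) = 1
      rw [dlogr_euler, Complex.ofReal_one]
    rw [e2, map_zero, e4, one_smul, int_single] at e3
    have e5 : eOp (cplx (bField (gOf (genStruct (Ωm x)) (genStruct (Ωp x))))) T 5
        = (((f₅ / 8 : ℝ) : ℂ) • (-(Real.exp (-6 * Δ x) : ℂ)) •
          (Pi.single 5 ((volX Ωm Ωp x).curryLeft (euler x).1) : Polyform E₆)) 5 := by
      rw [h4, Pi.smul_apply, Pi.smul_apply, Pi.single_eq_same]
      rfl
    have e6 := cl_form_congr (ν := dlogr x) e5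
    rw [cl_form] at e6
    rw [e6, map_smul, map_smul, ← sub_eq_zero.mp e3.symm, Pi.smul_apply, Pi.smul_apply,
      Pi.single_eq_same]
  rw [Pi.smul_apply, h5, Pi.smul_apply, ContinuousAlternatingMap.smul_apply,
    ContinuousAlternatingMap.smul_apply, ContinuousAlternatingMap.smul_apply,
    ContinuousAlternatingMap.smul_apply, h3] at h2
  have h6 : volX Ωm Ωp x u = 1 := by
    have := hS.vol (α x) (hX.type_zero x)
    rw [volX, hX.plus_exp x]
    have e : genStruct (α x • expP (b x) (om x)) = genStruct (Ωp x) := by rw [hX.plus_exp x]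
    rw [metricG, hX.plus_exp x] at *
    exact this
  rw [h6] at h2
  simp only [smul_eq_mul, mul_one] at h2
  have h7 : Real.exp (2 * Δ x) * (f₅ / 8 * -Real.exp (-6 * Δ x))
      = Real.exp (-2 * A x) * (4 * (Real.exp (-A x) * (α x).im)) := by
    rw [phi] at h2
    exact_mod_cast h2
  have e1 : Real.exp (4 * Δ x - 3 * A x)
      = Real.exp (-2 * A x) * Real.exp (-A x) * Real.exp (4 * Δ x) := by
    rw [← Real.exp_add, ← Real.exp_add]; congr 1; ring
  have e2 : Real.exp (2 * Δ x) * Real.exp (-6 * Δ x) * Real.exp (4 * Δ x) = 1 := by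
    rw [← Real.exp_add, ← Real.exp_add, ← Real.exp_zero]; congr 1; ring
  rw [e1]
  linear_combination (-8 * Real.exp (4 * Δ x)) * h7 - f₅ * e2

end IsConeStructure

end Flux

/-! ### The normalisation of `A` -/

section Normalisation

open Filter

variable {Y : Type*} [TopologicalSpace Y] [ChartedSpace (EuclideanSpace ℝ (Fin 5)) Y]
  [IsManifold (𝓡 5) ∞ Y]

instance nonempty_posReals : Nonempty posReals := ⟨⟨1, Set.mem_Ioi.mpr one_pos⟩⟩

instance preconnectedSpace_posReals : PreconnectedSpace posReals :=
  Subtype.preconnectedSpace isPreconnected_Ioi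

theorem eq_of_dFun_eq_zero [PreconnectedSpace Y] {f : Cone Y → ℝ}
    (hf : ContMDiff coneI 𝓘(ℝ, ℝ) ∞ f) (h : ∀ x, dFun coneI f x = 0) (x y : Cone Y) : f x = f y := by
  have loc : IsLocallyConstant f := by
    rw [IsLocallyConstant.iff_eventually_eq]
    intro x
    obtain ⟨ε, hε, hb⟩ := Metric.mem_nhds_iff.mp (extChartAt_target_mem_nhds (I := coneI) x)
    have hd : ∀ z ∈ Metric.ball (extChartAt coneI x x) ε,
        HasFDerivAt (fun z => f ((extChartAt coneI x).symm z)) (0 : E₆ →L[ℝ] ℝ) z := by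
      intro z hz
      have d : MDifferentiableAt 𝓘(ℝ, E₆) coneI (extChartAt coneI x).symm z :=
        ((contMDiffOn_extChartAt_symm (n := ∞) x).contMDiffAt
          (extChartAt_target_mem_nhds' (hb hz))).mdifferentiableAt (by simp)
      have d2 := (hf ((extChartAt coneI x).symm z)).mdifferentiableAt (by simp)
      have e := mfderiv_comp z d2 d
      have d3 := (d2.comp z d).differentiableAt
      have e2 : fderiv ℝ (f ∘ (extChartAt coneI x).symm) z = 0 := by
        rw [mfderiv_eq_fderiv] at e
        refine e.trans ?_
        have := h ((extChartAt coneI x).symm z)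
        rw [dFun] at this
        rw [this]
        exact ContinuousLinearMap.zero_comp _
      have := d3.hasFDerivAt
      rw [e2] at this
      exact this
    have hc : ∀ z ∈ Metric.ball (extChartAt coneI x x) ε,
        f ((extChartAt coneI x).symm z) = f ((extChartAt coneI x).symm (extChartAt coneI x x)) := by
      intro z hz
      exact (convex_ball (extChartAt coneI x x) ε).is_const_of_fderivWithin_eq_zero (𝕜 := ℝ)
        (fun w hw => (hd w hw).differentiableAt.differentiableWithinAt)
        (fun w hw => by
          rw [fderivWithin_of_isOpen Metric.isOpen_ball hw, (hd w hw).fderiv])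
        hz (Metric.mem_ball_self hε)
    have e1 : ∀ᶠ y in 𝓝 x, extChartAt coneI x y ∈ Metric.ball (extChartAt coneI x x) ε :=
      (continuousAt_extChartAt x).preimage_mem_nhds (Metric.ball_mem_nhds _ hε)
    filter_upwards [e1, extChartAt_source_mem_nhds (I := coneI) x] with y h1 h2
    have := hc _ h1
    rwa [(extChartAt coneI x).left_inv h2, extChartAt_to_inv] at this
  exact loc.apply_eq_of_preconnectedSpace x y

theorem polyD_const_smul' (c : ℂ) (Φ : Cone Y → Polyform E₆) (x : Cone Y) :
    polyD coneI (fun z => c • Φ z) x = c • polyD coneI Φ x := by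
  funext k
  cases k with
  | zero => exact (smul_zero c).symm
  | succ k =>
    change extD coneI (fun z => c • Φ z k) x = c • extD coneI (fun z => Φ z k) x
    rw [extD_eq, extD_eq]
    have e : chartForm coneI (fun z => c • Φ z k) x = c • chartForm coneI (fun z => Φ z k) x := by
      funext y
      rfl
    have e2 : fderiv ℝ (c • chartForm coneI (fun z => Φ z k) x) (extChartAt coneI x x)
        = c • fderiv ℝ (chartForm coneI (fun z => Φ z k) x) (extChartAt coneI x x) := by
      by_cases hc : c = 0
      · subst hc
        rw [zero_smul, zero_smul]
        exact fderiv_const_apply 0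
      · let _ := invertibleOfNonzero hc
        exact fderiv_const_smul_of_invertible (𝕜 := ℝ) (F := Form E₆ ℂ k)
          (f := chartForm coneI (fun z => Φ z k) x) c
    rw [e, extDeriv, extDeriv, e2]
    ext v
    simp [ContinuousAlternatingMap.alternatizeUncurryFin_apply, Finset.mul_sum, mul_left_comm]

variable {Ωm Ωp : Cone Y → Polyform E₆} {α : Cone Y → ℂ} {b om : Cone Y → Form E₆ ℝ 2}
  {A Δ : Cone Y → ℝ} {f₅ : ℝ}

namespace IsConeStructure

variable (hX : IsConeStructure Ωm Ωp α b om A Δ f₅)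
include hX

/-- The function `e^{2A} φ = e^A a` is a constant multiple of `r⁴`. -/
theorem exists_constant [ConnectedSpace Y] : ∃ C : ℝ, ∀ x,
    Real.exp (A x) * (α x).im = C * rad x ^ 4 := by
  set F : Cone Y → ℝ := fun y => Real.exp (-4 * Real.log (rad y)) • (Real.exp (2 * A y) • phi α A y)
    with hF
  have s1 : ∀ x, ContMDiffAt coneI 𝓘(ℝ, ℝ) ∞ (fun y : Cone Y => Real.exp (-4 * Real.log (rad y))) x :=
    fun x => contMDiffAt_exp_mul (contMDiff_log_rad x) (-4)
  have s2 := fun x => contMDiffAt_smul (hX.smooth_expA 2 x) (hX.smooth_phi x)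
  have hd : ∀ x, dFun coneI F x = 0 := by
    intro x
    refine ContinuousLinearMap.ext fun v => ?_
    rw [hF, dFun_smul (s1 x) (s2 x), dFun_smul (hX.smooth_expA 2 x) (hX.smooth_phi x),
      dFun_exp_mul (contMDiff_log_rad x), dFun_exp_mul (hX.smooth_A x), dFun_log_rad]
    have := congrArg (fun L => L v) (hX.dphi x)
    simp only [add_apply, smul_apply, smul_eq_mul, zero_apply] at this ⊢
    linear_combination (Real.exp (-4 * Real.log (rad x)) * Real.exp (2 * A x)) * this
  obtain ⟨x₀⟩ : Nonempty (Cone Y) := inferInstance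
  refine ⟨F x₀, fun x => ?_⟩
  rw [eq_of_dFun_eq_zero (f := F) (fun x => contMDiffAt_smul (s1 x) (s2 x)) hd x₀ x]
  have e1 : Real.exp (-4 * Real.log (rad x)) * rad x ^ 4 = 1 := by
    have : Real.exp (-4 * Real.log (rad x)) = (rad x ^ 4)⁻¹ := by
      rw [neg_mul, Real.exp_neg]
      congr 1
      rw [mul_comm, Real.exp_mul, Real.exp_log (rad_pos x)]
      norm_cast
    rw [this, inv_mul_cancel₀ (pow_ne_zero _ (rad_pos x).ne')]
  have e2 : Real.exp (2 * A x) * Real.exp (-A x) = Real.exp (A x) := by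
    rw [← Real.exp_add]; congr 1; ring
  change _ = Real.exp (-4 * Real.log (rad x)) * (Real.exp (2 * A x) * (Real.exp (-A x) * (α x).im))
    * rad x ^ 4
  linear_combination (-(α x).im * Real.exp (2 * A x) * Real.exp (-A x)) * e1 - (α x).im * e2

/-- `f₅` is the product of a nowhere vanishing function and `Im α₊`. -/
theorem f₅_ne [Nonempty Y] : f₅ ≠ 0 := by
  obtain ⟨x₀⟩ : Nonempty (Cone Y) := inferInstance
  rw [hX.flux_constant x₀]
  exact mul_ne_zero (mul_ne_zero (by norm_num) (hX.im_α_ne _)) (Real.exp_pos _).ne'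

/-- The difference `A - log r - Δ` is constant. -/
theorem exists_shift [ConnectedSpace Y] : ∃ c : ℝ, ∀ x, A x + c = Real.log (rad x) + Δ x := by
  obtain ⟨C, hC⟩ := hX.exists_constant
  have key : ∀ x, f₅ * Real.exp (4 * A x) = -32 * C * Real.exp (4 * (Real.log (rad x) + Δ x)) := by
    intro x
    have e1 : Real.exp (4 * (Real.log (rad x) + Δ x)) = rad x ^ 4 * Real.exp (4 * Δ x) := by
      rw [mul_add, Real.exp_add]
      congr 1
      rw [mul_comm, Real.exp_mul, Real.exp_log (rad_pos x)]
      norm_cast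
    have e2 : Real.exp (4 * Δ x - 3 * A x) * Real.exp (4 * A x)
        = Real.exp (A x) * Real.exp (4 * Δ x) := by
      rw [← Real.exp_add, ← Real.exp_add]; congr 1; ring
    rw [hX.flux_constant x, e1]
    linear_combination (-32 * (α x).im) * e2 - (32 * Real.exp (4 * Δ x)) * hC x
  obtain ⟨x₀⟩ : Nonempty (Cone Y) := inferInstance
  refine ⟨Real.log (rad x₀) + Δ x₀ - A x₀, fun x => ?_⟩
  have hf : f₅ ≠ 0 := hX.f₅_ne
  have h1 := key x
  have h0 := key x₀
  have h2 : f₅ * (Real.exp (4 * A x) * Real.exp (4 * (Real.log (rad x₀) + Δ x₀)))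
      = f₅ * (Real.exp (4 * A x₀) * Real.exp (4 * (Real.log (rad x) + Δ x))) := by
    linear_combination Real.exp (4 * (Real.log (rad x₀) + Δ x₀)) * h1
      - Real.exp (4 * (Real.log (rad x) + Δ x)) * h0
  have h3 := mul_left_cancel₀ hf h2
  rw [← Real.exp_add, ← Real.exp_add] at h3
  have h4 := Real.exp_injective h3
  linarith

/-- The hypotheses are preserved by adding a constant to `A`. -/
theorem shift (c : ℝ) : IsConeStructure Ωm Ωp α b om (fun x => A x + c) Δ
    (Real.exp (-3 * c) * f₅) := by
  have hs : scaledIm Ωp (fun x => A x + c) = fun y => (Real.exp (-3 * c) : ℂ) • scaledIm Ωp A y := by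
    funext y
    rw [scaledIm, scaledIm, smul_smul, ← Complex.ofReal_mul, ← Real.exp_add]
    congr 3
    ring
  have hJ : ∀ x, dJ coneI (fun y => genStruct (Ωm y)) (scaledIm Ωp (fun x => A x + c)) x
      = (Real.exp (-3 * c) : ℂ) • dJ coneI (fun y => genStruct (Ωm y)) (scaledIm Ωp A) x := by
    intro x
    rw [hX.dJ_scaledIm, dJ, hs, polyD_const_smul _ (hX.scaledIm_smooth x), algAct_eq]
    simp only [algAct_eq, map_smul, hX.algOp_scaledIm, smul_zero]
    rw [polyD_zero, sub_zero]
  have hT : ∀ x, twistedFlux Ωm Ωp (fun x => A x + c) x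
      = (Real.exp (-3 * c) : ℂ) • twistedFlux Ωm Ωp A x := by
    intro x
    rw [twistedFlux, twistedFlux, hJ, smul_comm]
  have hF : ∀ x, flux Ωm Ωp (fun x => A x + c) x = (Real.exp (-3 * c) : ℂ) • flux Ωm Ωp A x := by
    intro x
    rw [flux, flux, hT, expWedge_eq, expWedge_eq, map_smul]
  have hL : ∀ x, lieP coneI euler (flux Ωm Ωp (fun x => A x + c)) x
      = (Real.exp (-3 * c) : ℂ) • lieP coneI euler (flux Ωm Ωp A) x := by
    intro x
    have e : flux Ωm Ωp (fun x => A x + c) = fun y => (Real.exp (-3 * c) : ℂ) • flux Ωm Ωp A y := by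
      funext y; exact hF y
    rw [e, lieP_def, lieP_def]
    simp only [map_smul]
    rw [polyD_const_smul', polyD_const_smul', map_smul, smul_add]
  have hd : ∀ x, dFun coneI (fun x => A x + c) x = dFun coneI A x := by
    intro x
    have := dFun_comp (g := fun t => t + c) (hX.smooth_A x) ((hasDerivAt_id (A x)).add_const c)
    rwa [one_smul] at this
  have hsm : ContMDiff coneI 𝓘(ℝ, ℝ) ∞ (fun x => A x + c) := fun x =>
    contMDiffAt_of_chart ((contDiffAt_chart (hX.smooth_A x)).add contDiffAt_const)
  refine { hX with
    smooth_A := hsm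
    homog_A := fun x => ?_
    closed_re := fun x => ?_
    bianchi := fun x => ?_
    flux_homog := fun x => by rw [hL, hX.flux_homog, smul_zero]
    flux_horizontal := fun x => ?_
    flux_five := fun x => ?_ }
  · rw [dFun_comp (hsm x) (Real.hasDerivAt_exp (A x + c)), hd, smul_apply, hX.dA_euler]
    simp
  · have e : (fun y => (Real.exp (-(A y + c)) : ℂ) • reP (Ωp y))
        = fun y => (Real.exp (-c) : ℂ) • ((Real.exp (-A y) : ℂ) • reP (Ωp y)) := by
      funext y
      rw [smul_smul, ← Complex.ofReal_mul, ← Real.exp_add]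
      congr 3
      ring
    rw [e, polyD_const_smul', hX.closed_re, smul_zero]
  · have e : dJ coneI (fun y => genStruct (Ωm y)) (scaledIm Ωp (fun x => A x + c))
        = fun y => (Real.exp (-3 * c) : ℂ) • dJ coneI (fun y => genStruct (Ωm y)) (scaledIm Ωp A) y := by
      funext y; exact hJ y
    rw [e, polyD_const_smul', hX.bianchi, smul_zero]
  · rw [hF, ← intOp_apply, map_smul, intOp_apply, hX.flux_horizontal, smul_zero]
  · rw [hF, Pi.smul_apply, hX.flux_five, smul_smul, Complex.ofReal_mul]

end IsConeStructure

end Normalisation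

/-! ### The generalized Reeb symmetry -/

section ReebSymmetry

open Filter

variable {Y : Type*} [TopologicalSpace Y] [ChartedSpace (EuclideanSpace ℝ (Fin 5)) Y]
  [IsManifold (𝓡 5) ∞ Y]

theorem cl_imP {V : Type*} [NormedAddCommGroup V] [NormedSpace ℝ V] [FiniteDimensional ℝ V]
    [Fact (Module.finrank ℝ V = 6)] (W : GenVec V) (Φ : Polyform V) :
    cl W (imP Φ) = imP (cl W Φ) := by
  rw [imP_eq, imP_eq, map_smul, map_sub, conjP_cl]

theorem polyD_imP {Φ : Cone Y → Polyform E₆} {x : Cone Y} (h : SmoothPAt coneI Φ x) :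
    polyD coneI (fun y => imP (Φ y)) x = imP (polyD coneI Φ x) := by
  funext k
  cases k with
  | zero =>
    ext v
    exact (Complex.ofReal_zero).symm
  | succ k =>
    exact (extD_comp Complex.ofRealCLM (SmoothFormAt.comp Complex.imCLM (h k))).trans
      (congrArg _ (extD_comp Complex.imCLM (h k)))

theorem imP_add {V : Type*} [NormedAddCommGroup V] [NormedSpace ℝ V] (Φ Ψ : Polyform V) :
    imP (Φ + Ψ) = imP Φ + imP Ψ := by
  funext k
  ext v
  change (((Φ k v + Ψ k v).im : ℝ) : ℂ) = ((Φ k v).im : ℂ) + ((Ψ k v).im : ℂ)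
  rw [Complex.add_im, Complex.ofReal_add]

theorem lieP_imP {Φ : Cone Y → Polyform E₆} {W : Cone Y → GenVec E₆} {x : Cone Y}
    (hW : SmoothGen coneI W x) (h : SmoothPAt coneI Φ x) :
    lieP coneI W (fun y => imP (Φ y)) x = imP (lieP coneI W Φ x) := by
  rw [lieP_def, lieP_def, imP_add, polyD_imP h, cl_imP, ← polyD_imP (h.cl hW)]
  simp only [cl_imP]

theorem imP_zero {V : Type*} [NormedAddCommGroup V] [NormedSpace ℝ V] :
    imP (0 : Polyform V) = 0 := by
  funext k
  ext v
  exact Complex.ofReal_zero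

variable {Ωm Ωp : Cone Y → Polyform E₆} {α : Cone Y → ℂ} {b om : Cone Y → Form E₆ ℝ 2}
  {A Δ : Cone Y → ℝ} {f₅ : ℝ}

namespace IsConeStructure

variable (hX : IsConeStructure Ωm Ωp α b om A Δ f₅)
include hX

/-- `ξ = J₋(r∂_r) = J₊(G(r∂_r))`. -/
theorem plus_form (x : Cone Y) :
    genStruct (Ωp x) (0, Real.exp (2 * Δ x) • dlogr x) = xi Ωm x := by
  have k := hX.kahler x
  have h := k.g_g (euler x)
  rw [hX.metric_euler', gOf_apply] at h
  have h2 := congrArg (genStruct (Ωm x)) h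
  rw [map_neg, k.sq_m, neg_neg] at h2
  exact h2

theorem smooth_xi (x : Cone Y) : SmoothGen coneI (xi Ωm) x :=
  IsAssociated.smoothGen hX.assoc_m (hX.minus_smooth x) (smoothGen_euler x)

theorem dlogr_dρ (x : Cone Y) : cl (0, Real.exp (2 * Δ x) • dlogr x) (polyD coneI (rho Ωp A) x)
    = -cl (0, Real.exp (2 * Δ x) • dlogr x)
      (cl (0, dFun coneI A x) (rho Ωp A x - conjP (rho Ωp A x))) := by
  have h := hX.dlogr_dualFlux x
  rw [dualFlux, imP_eq] at h
  rw [hX.polyD_rho, cl_form_smul, cl_form_smul]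
  simp only [map_add, map_smul] at h ⊢
  linear_combination (norm := module) ((Real.exp (2 * Δ x) : ℂ) * Complex.I) • h
    + ((Real.exp (2 * Δ x) : ℂ) * (Complex.I_sq)) •
      cl (0, dlogr x) (cl (0, dFun coneI A x) (rho Ωp A x - conjP (rho Ωp A x)))

/-- The equation `d log r ∧ (κ + 2 dA ∧ Im ρ) = 0` determines the component of `dρ` along `d log
r`. -/
theorem holOp_dρ (x : Cone Y) : holOp (genStruct (Ωp x)) (0, Real.exp (2 * Δ x) • dlogr x)
      (polyD coneI (rho Ωp A) x) = -(2 : ℂ) • cl (0, Real.exp (2 * Δ x) • dlogr x)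
        (cl (0, dFun coneI A x) (rho Ωp A x)) := by
  obtain ⟨S, u, hS⟩ := hX.exists_hodge x
  refine holOp_deriv (hX.typeZero x) u (hX.rho_exp x) ?_ ?_ _ _ (hX.dlogr_dρ x)
  · rw [hX.polyD_rho, map_smul]
    exact Submodule.smul_mem _ _ (hX.kappa_lower x)
  · rw [hX.polyD_rho, map_smul]
    exact Submodule.smul_mem _ _ (hX.kappa_lower' x)

/-- The function `A` is constant along the Reeb field. -/
theorem dA_xi (x : Cone Y) : dFun coneI A x (xi Ωm x).1 = 0 := by
  have h := reeb_invariance (hX.kahler x) (hX.rho_vacuum x) (hX.rho_injective x)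
    (smul_ne_zero (Real.exp_pos (2 * Δ x)).ne' (dlogr_ne_zero x)) (hX.holOp_dρ x)
  rwa [hX.plus_form] at h

theorem cl_xi_rho (x : Cone Y) : cl (xi Ωm x) (rho Ωp A x)
    = (-Complex.I * (Real.exp (2 * Δ x) : ℂ)) • cl (0, dlogr x) (rho Ωp A x) := by
  have h := hX.rho_vacuum x (0, Real.exp (2 * Δ x) • dlogr x)
  rw [hX.plus_form, cl_form_smul] at h
  linear_combination (norm := module) Complex.I • h
    + Complex.I_sq • cl (xi Ωm x) (rho Ωp A x)

/-- `Ω₋` is closed, so that `L_ξ Ω₋ = -i L_{r∂_r} Ω₋`. -/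
theorem lie_xi_minus (x : Cone Y) :
    lieP coneI (xi Ωm) Ωm x = (-3 * Complex.I) • Ωm x := by
  have h := hX.homog_minus x
  rw [lieP_def, hX.closed_minus, map_zero, add_zero] at h
  have e : (fun y => cl (xi Ωm y) (Ωm y)) = fun y => (-Complex.I) • cl (euler y) (Ωm y) := by
    funext y
    have := (hX.assoc_m y).cl_eq (euler y)
    change _ = Complex.I • cl (xi Ωm y) (Ωm y) at this
    rw [this, smul_smul]
    simp
  rw [lieP_def, hX.closed_minus, map_zero, add_zero, e,
    polyD_const_smul _ ((hX.minus_smooth x).cl (smoothGen_euler x)), h]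
  module

variable (hA : ∀ x, A x = Real.log (rad x) + Δ x)
include hA

theorem dA_eq (x : Cone Y) : dFun coneI A x = dlogr x + dFun coneI Δ x := by
  have e : A = fun y => Real.log (rad y) + Δ y := funext hA
  have h1 := (contDiffAt_chart (contMDiff_log_rad x)).differentiableAt (by simp)
  have h2 := (contDiffAt_chart (hX.smooth_Δ x)).differentiableAt (by simp)
  rw [← dFun_log_rad, dFun_eq, dFun_eq, dFun_eq, e]
  exact fderiv_add h1 h2

/-- The derivative of `ξ · ρ = -i e^{2Δ} d log r ∧ ρ` produces a term in `dΔ`, which cancels that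
of `ξ · dρ` because `dA = d log r + dΔ`. -/
theorem lie_xi_rho (x : Cone Y) : lieP coneI (xi Ωm) (rho Ωp A) x = 0 := by
  have s := fun x => hX.rho_smooth x
  have e : (fun y => cl (xi Ωm y) (rho Ωp A y))
      = fun y => (-Complex.I) • ((Real.exp (2 * Δ y) : ℂ) • cl (0, dlogr y) (rho Ωp A y)) := by
    funext y
    rw [hX.cl_xi_rho, smul_smul]
  obtain ⟨d1, d2⟩ := polyD_dlogr s x
  have s2 : ContMDiffAt coneI 𝓘(ℝ, ℝ) ∞ (fun y => Real.exp (2 * Δ y)) x :=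
    contMDiffAt_exp_mul (hX.smooth_Δ x) 2
  have h := hX.holOp_dρ x
  rw [holOp_apply, hX.plus_form, hX.dA_eq hA, cl_form_smul, cl_form_smul, cl_form_add, map_add,
    cl_form_self, zero_add] at h
  rw [lieP_def, e, polyD_const_smul _ (SmoothPAt.smul (contMDiffAt_ofReal s2) d2),
    polyD_real_smul s2 d2, d1, dFun_exp_mul (hX.smooth_Δ x), cl_form_smul,
    cl_form_form (dFun coneI Δ x)]
  push_cast at h ⊢
  linear_combination (norm := module) Complex.I • h
    + Complex.I_sq • cl (xi Ωm x) (polyD coneI (rho Ωp A) x)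

theorem lie_xi_plus (x : Cone Y) : lieP coneI (xi Ωm) Ωp x = (0 : ℂ) • Ωp x := by
  have e : Ωp = fun y => (Real.exp (1 * A y) : ℂ) • rho Ωp A y := by
    funext y
    rw [rho, smul_smul, ← Complex.ofReal_mul, ← Real.exp_add]
    simp
  have h := lieP_real_smul (hX.smooth_expA 1 x) (hX.smooth_xi x) (hX.rho_smooth x)
  rw [hX.lie_xi_rho hA, dFun_exp_mul (hX.smooth_A x), smul_apply, hX.dA_xi] at h
  rw [zero_smul]
  conv_lhs => rw [e]
  rw [h]
  simp

theorem preserves_metric : Preserves coneI (xi Ωm) (metricG Ωm Ωp) := by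
  intro x Z hZ1 hZ2
  have hZ : SmoothGen coneI Z x := smoothGen_iff.mpr ⟨hZ1, hZ2⟩
  have sm : ∀ {V : Cone Y → GenVec E₆}, SmoothGen coneI V x →
      SmoothGen coneI (fun y => genStruct (Ωm y) (V y)) x := fun hV =>
    IsAssociated.smoothGen hX.assoc_m (hX.minus_smooth x) hV
  have sp : ∀ {V : Cone Y → GenVec E₆}, SmoothGen coneI V x →
      SmoothGen coneI (fun y => genStruct (Ωp y) (V y)) x := fun hV =>
    IsAssociated.smoothGen hX.assoc_p (hX.plus_smooth x) hV
  have cm : ∀ {V : Cone Y → GenVec E₆}, SmoothGen coneI V x →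
      genLie coneI (xi Ωm) (fun y => genStruct (Ωm y) (V y)) x
        = genStruct (Ωm x) (genLie coneI (xi Ωm) V x) := fun hV =>
    IsAssociated.genLie_comm hX.assoc_m (hX.minus_smooth x) (hX.smooth_xi x) hV (hX.lie_xi_minus x)
  have cp : ∀ {V : Cone Y → GenVec E₆}, SmoothGen coneI V x →
      genLie coneI (xi Ωm) (fun y => genStruct (Ωp y) (V y)) x
        = genStruct (Ωp x) (genLie coneI (xi Ωm) V x) := fun hV =>
    IsAssociated.genLie_comm hX.assoc_p (hX.plus_smooth x) (hX.smooth_xi x) hV (hX.lie_xi_plus hA x)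
  -- the sign in `G = - J₋ J₊` is absorbed by writing `-1 = J₋²`
  have e : ∀ y W, metricG Ωm Ωp y W
      = genStruct (Ωm y) (genStruct (Ωp y) (genStruct (Ωm y) (genStruct (Ωm y) W))) := by
    intro y W
    rw [(hX.kahler y).sq_m, map_neg, map_neg]
    exact gOf_apply W
  simp only [e]
  rw [cm (sp (sm (sm hZ))), cp (sm (sm hZ)), cm (sm hZ), cm hZ]

theorem cl_xi_scaledIm (x : Cone Y) : cl (xi Ωm x) (scaledIm Ωp A x)
    = (-1 : ℂ) • ((Real.exp (-2 * Real.log (rad x)) : ℂ) •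
      cl (0, dlogr x) (reP (rho Ωp A x))) := by
  have h := hX.cl_xi_rho x
  have h2 := congrArg conjP h
  rw [conjP_smul, conjP_cl, conjP_cl] at h2
  have e : (starRingEnd ℂ) (-Complex.I * (Real.exp (2 * Δ x) : ℂ))
      = Complex.I * (Real.exp (2 * Δ x) : ℂ) := by
    rw [map_mul, map_neg, Complex.conj_I, Complex.conj_ofReal, neg_neg]
  have e2 : Real.exp (-2 * Real.log (rad x)) = Real.exp (-2 * A x) * Real.exp (2 * Δ x) := by
    rw [← Real.exp_add, hA]; congr 1; ring
  rw [e] at h2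
  rw [scaledIm_eq, map_smul, imP_eq, map_smul, map_sub, h, h2, reP_eq, map_smul, map_add, e2]
  push_cast
  linear_combination (norm := module)
    ((Real.exp (-2 * A x) : ℂ) * (Real.exp (2 * Δ x) : ℂ) / 2 * Complex.I_sq) •
      (cl (0, dlogr x) (rho Ωp A x) + cl (0, dlogr x) (conjP (rho Ωp A x)))

theorem cl_xi_d_scaledIm (x : Cone Y) : cl (xi Ωm x) (polyD coneI (scaledIm Ωp A) x) = 0 := by
  have h1 : lieP coneI (xi Ωm) (scaledIm Ωp A) x = 0 := by
    have e : scaledIm Ωp A = fun y => (Real.exp (-2 * A y) : ℂ) • imP (rho Ωp A y) := by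
      funext y; exact scaledIm_eq y
    rw [e, lieP_real_smul (hX.smooth_expA (-2) x) (hX.smooth_xi x)
      (smoothPAt_imP (hX.rho_smooth x)), lieP_imP (hX.smooth_xi x) (hX.rho_smooth x),
      hX.lie_xi_rho hA, imP_zero, dFun_exp_mul (hX.smooth_A x), smul_apply, hX.dA_xi]
    simp
  have s := fun x => smoothPAt_reP (hX.rho_smooth x)
  obtain ⟨d1, d2⟩ := polyD_dlogr s x
  have s2 : ContMDiffAt coneI 𝓘(ℝ, ℝ) ∞ (fun y : Cone Y => Real.exp (-2 * Real.log (rad y))) x :=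
    contMDiffAt_exp_mul (contMDiff_log_rad x) (-2)
  have h2 : polyD coneI (fun y => cl (xi Ωm y) (scaledIm Ωp A y)) x = 0 := by
    simp only [hX.cl_xi_scaledIm hA]
    rw [polyD_const_smul', polyD_real_smul s2 d2, d1, hX.closed_re_rho, map_zero, neg_zero, smul_zero,
      add_zero, dFun_exp_mul (contMDiff_log_rad x), dFun_log_rad, cl_form_smul, cl_form_self, smul_zero,
      smul_zero]
  rwa [lieP_def, h2, zero_add] at h1

theorem cl_euler_d_scaledIm (x : Cone Y) : cl (euler x) (polyD coneI (scaledIm Ωp A) x)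
    = -polyD coneI (fun y => cl (euler y) (scaledIm Ωp A y)) x := by
  have h : lieP coneI euler (scaledIm Ωp A) x = 0 := by
    have e : scaledIm Ωp A = fun y => (Real.exp (-3 * A y) : ℂ) • imP (Ωp y) := rfl
    have h3 : imP ((3 : ℂ) • Ωp x) = (3 : ℂ) • imP (Ωp x) := by
      have := imP_real_smul 3 (Ωp x)
      exact_mod_cast this
    rw [e, lieP_real_smul (hX.smooth_expA (-3) x) (smoothGen_euler x)
      (smoothPAt_imP (hX.plus_smooth x)), lieP_imP (smoothGen_euler x) (hX.plus_smooth x),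
      hX.homog_plus, h3, dFun_exp_mul (hX.smooth_A x), smul_apply, hX.dA_euler]
    simp only [smul_eq_mul]
    push_cast
    module
  rw [lieP_def] at h
  exact eq_neg_of_add_eq_zero_right h

/-- The Bianchi identity gives `dT = 0` for `T = e^{-B} F`, and `ξ · T` is exact because `T = 8 J₋
· dΨ` with `ξ · dΨ = 0`, where `Ψ = e^{-3A} Im Ω₊`. -/
theorem lie_xi_flux (x : Cone Y) : lieP coneI (xi Ωm) (twistedFlux Ωm Ωp A) x = 0 := by
  have e : ∀ y, cl (xi Ωm y) (twistedFlux Ωm Ωp A y)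
      = (-8 : ℂ) • polyD coneI (fun y => cl (euler y) (scaledIm Ωp A y)) y := by
    intro y
    have h := algOp_cl (genStruct (Ωm y)) (hX.kahler y).skew_m (xi Ωm y)
      (polyD coneI (scaledIm Ωp A) y)
    have h2 : genStruct (Ωm y) (xi Ωm y) = (-1 : ℝ) • euler y := by
      refine ((hX.kahler y).sq_m _).trans ?_
      module
    rw [hX.cl_xi_d_scaledIm hA, map_zero, h2, cl_smul, LinearMap.smul_apply,
      hX.cl_euler_d_scaledIm hA] at h
    rw [twistedFlux, hX.dJ_scaledIm, map_smul]
    push_cast at h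
    linear_combination (norm := module) (-8 : ℂ) • h
  have s : ∀ y, SmoothPAt coneI (fun y => cl (euler y) (scaledIm Ωp A y)) y := fun y =>
    (hX.scaledIm_smooth y).cl (smoothGen_euler y)
  have hd : polyD coneI (twistedFlux Ωm Ωp A) x = 0 := by
    have : twistedFlux Ωm Ωp A = fun y => (8 : ℂ) •
      dJ coneI (fun y => genStruct (Ωm y)) (scaledIm Ωp A) y := rfl
    rw [this, polyD_const_smul', hX.bianchi, smul_zero]
  rw [lieP_def, hd, map_zero, add_zero]
  simp only [e]
  rw [polyD_const_smul', polyD_polyD (Eventually.of_forall s), smul_zero]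

end IsConeStructure

end ReebSymmetry

/-! ### The symplectic form on the cone and the one-form `σ` -/

section SymplecticCone

open Filter

theorem contract_wedgeReal {V : Type*} [NormedAddCommGroup V] [NormedSpace ℝ V]
    [FiniteDimensional ℝ V] (v : V) (μ ν : V →L[ℝ] ℝ) : contract v (wedgeReal μ ν) = μ v • ν - ν v • μ := by
  refine ContinuousLinearMap.ext fun w => ?_
  rw [contract_apply, wedgeReal_apply, sub_apply, smul_apply, smul_apply, smul_eq_mul, smul_eq_mul]
  ring

theorem wedgeReal_smul {V : Type*} [NormedAddCommGroup V] [NormedSpace ℝ V]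
    [FiniteDimensional ℝ V] (c : ℝ) (μ ν : V →L[ℝ] ℝ) : wedgeReal μ (c • ν) = c • wedgeReal μ ν := by
  ext v
  rw [vec_eq_cons v, ContinuousAlternatingMap.smul_apply, wedgeReal_apply, wedgeReal_apply,
    smul_apply, smul_apply]
  simp only [smul_eq_mul]
  ring

theorem emb_wedgeReal {V : Type*} [NormedAddCommGroup V] [NormedSpace ℝ V] (μ ν : V →L[ℝ] ℝ) :
    emb (wedgeReal μ ν) = cl (0, μ) (emb (oneForm ν)) := by
  rw [cl_form, wed_emb_one]

variable {Y : Type*} [TopologicalSpace Y] [ChartedSpace (EuclideanSpace ℝ (Fin 5)) Y]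
  [IsManifold (𝓡 5) ∞ Y]

/-- The closed two-form `b₂ = b - d log r ∧ (r∂_r ⌟ b)`. -/
def basicB (b : Cone Y → Form E₆ ℝ 2) (x : Cone Y) : Form E₆ ℝ 2 :=
  b x - wedgeReal (dlogr x) (contract (euler x).1 (b x))

theorem cl_euler_emb (β : Cone Y → Form E₆ ℝ 2) (x : Cone Y) :
    cl (euler x) (emb (β x)) = emb (oneForm (contract (euler x).1 (β x))) := by
  rw [euler_eq, cl_vec, int_emb_two]

variable {Ωm Ωp : Cone Y → Polyform E₆} {α : Cone Y → ℂ} {b om : Cone Y → Form E₆ ℝ 2}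
  {A Δ : Cone Y → ℝ} {f₅ : ℝ}

namespace IsConeStructure

variable (hX : IsConeStructure Ωm Ωp α b om A Δ f₅)
include hX

/-- The vector part of `ξ = J₊(e^{2Δ} d log r)`, for `J₊` of type zero. -/
theorem xi_om (x : Cone Y) : contract (xi Ωm x).1 (om x) = -(Real.exp (2 * Δ x) • dlogr x) := by
  obtain ⟨X, hw⟩ := (hX.typeZero x).surjective (Real.exp (2 * Δ x) • dlogr x)
  rw [contractHom_apply] at hw
  have h := (hX.typeZero x).form X
  rw [hw, hX.plus_form] at h
  rw [h, ← hw]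
  change contractHom (om x) (-X) = -contractHom (om x) X
  exact map_neg _ _

/-- `e^{2Δ} η = J₊(r∂_r)`, written in terms of `b` and `ω`. -/
theorem eta_eq (x : Cone Y) :
    Real.exp (2 * Δ x) • contract (eta Ωm x).1 (om x) = contract (euler x).1 (b x) ∧
    Real.exp (2 * Δ x) • (eta Ωm x).2 = contract (euler x).1 (om x)
      + Real.exp (2 * Δ x) • contract (eta Ωm x).1 (b x) := by
  have k := hX.kahler x
  have h := k.g_g (euler x)
  rw [hX.metric_euler', gOf_apply, k.comm] at h
  have h2 := congrArg (genStruct (Ωp x)) h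
  rw [map_neg, k.sq_p, neg_neg] at h2
  have h3 : Real.exp (2 * Δ x) • eta Ωm x = genStruct (Ωp x) (euler x) := by
    rw [← h2, eta, ← map_smul]
    congr 1
    simp
  obtain ⟨Z, hZ⟩ := (hX.typeZero x).surjective (contract (euler x).1 (b x))
  rw [contractHom_apply] at hZ
  have e : genStruct (Ωp x) (euler x)
      = (0, contract (euler x).1 (om x)) + (Z, contract Z (b x)) := by
    have h4 := (hX.typeZero x).form Z
    have h5 := (hX.typeZero x).vec (euler x).1
    have h6 : euler x = ((euler x).1, contract (euler x).1 (b x)) - (0, contract Z (om x)) := by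
      rw [hZ, Prod.mk_sub_mk, sub_self, sub_zero, ← euler_eq]
    rw [h6, map_sub, h4, ← h6, h5, sub_neg_eq_add]
  rw [e] at h3
  have e1 : Real.exp (2 * Δ x) • (eta Ωm x).1 = Z := by
    have := congrArg Prod.fst h3
    simpa using this
  have e2 : Real.exp (2 * Δ x) • (eta Ωm x).2 = contract (euler x).1 (om x) + contract Z (b x) := by
    have := congrArg Prod.snd h3
    simpa using this
  have hs : ∀ β : Form E₆ ℝ 2, Real.exp (2 * Δ x) • contract (eta Ωm x).1 β = contract Z β := by
    intro β
    rw [← e1]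
    change _ • contractHom β _ = contractHom β _
    rw [map_smul]
  exact ⟨by rw [hs, hZ], by rw [hs, e2]⟩

theorem dlogr_eta (x : Cone Y) : dlogr x (eta Ωm x).1 = 0 := by
  have h := (hX.kahler x).skew_m (0, dlogr x) (0, dlogr x)
  rw [pairing_comm ((0, dlogr x) : GenVec E₆)] at h
  have h2 : pairing (genStruct (Ωm x) (0, dlogr x)) (0, dlogr x) = 0 := by linarith
  have h3 := pair_form (dlogr x) (genStruct (Ωm x) (0, dlogr x))
  rw [pairing_comm, h2, mul_zero] at h3
  exact h3.symm

theorem b_eq (x : Cone Y) : b x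
    = Real.exp (2 * Δ x) • wedgeReal (dlogr x) (contract (eta Ωm x).1 (om x)) + basicB b x := by
  rw [← wedgeReal_smul, (hX.eta_eq x).1, basicB, add_sub_cancel]

theorem emb_basicB (x : Cone Y) :
    emb (basicB b x) = emb (b x) + (-1 : ℂ) • cl (0, dlogr x) (cl (euler x) (emb (b x))) := by
  rw [cl_euler_emb, ← emb_wedgeReal, basicB, sub_eq_add_neg, emb_add]
  congr 1
  have := emb_smul (-1) (wedgeReal (dlogr x) (contract (euler x).1 (b x)))
  simpa using this

/-- `d b₂ = 0` follows from `L_{r∂_r} b = 0` and `d log r ∧ db = 0`. -/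
theorem smooth_closed_basicB (x : Cone Y) :
    SmoothFormAt coneI (basicB b) x ∧ extD coneI (basicB b) x = 0 := by
  have sb := fun x => smoothPAt_emb_iff.mpr (hX.smooth_b x)
  have se := fun x => SmoothPAt.cl (smoothGen_euler x) (sb x)
  obtain ⟨d1, d2⟩ := polyD_dlogr se x
  have e : (fun y => emb (basicB b y))
      = fun y => emb (b y) + (-1 : ℂ) • cl (0, dlogr y) (cl (euler y) (emb (b y))) :=
    funext hX.emb_basicB
  have s : SmoothPAt coneI (fun y => emb (basicB b y)) x := by
    rw [e]
    exact (sb x).add (d2.const_smul _)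
  refine ⟨smoothPAt_emb_iff.mp s, emb_injective ?_⟩
  rw [← polyD_emb (smoothPAt_emb_iff.mp s), e, polyD_add (sb x) (d2.const_smul _),
    polyD_const_smul', d1, emb_zero]
  have h1 := (hX.lie_two x).1
  rw [lieP_def] at h1
  have h2 := congrArg (cl (0, dlogr x)) h1
  have h3 := congrArg (cl (euler x)) (hX.dlogr_db x)
  rw [euler_eq, cl_vec_form, dlogr_euler, ← euler_eq, map_zero] at h3
  rw [map_add, map_zero] at h2
  rw [Complex.ofReal_one] at h3
  linear_combination (norm := module) h2 + h3

/-- `σ = e^{-2Δ} r∂_r ⌟ ω`. -/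
theorem sigma_eq (x : Cone Y) :
    sigma Ωm (basicB b) x = Real.exp (-2 * Δ x) • contract (euler x).1 (om x) := by
  obtain ⟨h1, h2⟩ := hX.eta_eq x
  have h3 : contract (euler x).1 (b x) (eta Ωm x).1 = 0 := by
    rw [← h1, smul_apply, contract_self, smul_zero]
  have e : Real.exp (-2 * Δ x) * Real.exp (2 * Δ x) = 1 := by
    rw [← Real.exp_add, ← Real.exp_zero]; congr 1; ring
  have h4 := congrArg (fun ν => Real.exp (-2 * Δ x) • ν) h2
  simp only [smul_add, smul_smul, e, one_smul] at h4
  rw [sigma, basicB, contract_sub, contract_wedgeReal, hX.dlogr_eta, h3, h4]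
  module

theorem sigma_euler (x : Cone Y) : sigma Ωm (basicB b) x (euler x).1 = 0 := by
  rw [hX.sigma_eq, smul_apply, contract_self, smul_zero]

theorem dlogr_xi (x : Cone Y) : dlogr x (xi Ωm x).1 = 0 := by
  have h := congrArg (fun ν => ν (xi Ωm x).1) (hX.xi_om x)
  simp only [contract_self, neg_apply, smul_apply, smul_eq_mul] at h
  exact (mul_eq_zero.mp (neg_eq_zero.mp h.symm)).resolve_left (Real.exp_pos _).ne'

theorem sigma_xi (x : Cone Y) : sigma Ωm (basicB b) x (xi Ωm x).1 = 1 := by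
  have e : Real.exp (-2 * Δ x) * Real.exp (2 * Δ x) = 1 := by
    rw [← Real.exp_add, ← Real.exp_zero]; congr 1; ring
  rw [hX.sigma_eq, smul_apply, contract_skew, hX.xi_om, neg_apply, smul_apply, dlogr_euler]
  simp only [smul_eq_mul]
  linear_combination e

variable (hA : ∀ x, A x = Real.log (rad x) + Δ x)
include hA

theorem exp_A (x : Cone Y) : Real.exp (A x) = rad x * Real.exp (Δ x) := by
  rw [hA, Real.exp_add, Real.exp_log (rad_pos x)]

theorem im_α_eq (x : Cone Y) : (α x).im = -(f₅ / 32) * (rad x ^ 3 * Real.exp (-Δ x)) := by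
  have h := hX.flux_constant x
  have h1 := hX.exp_A hA x
  have e1 : Real.exp (4 * Δ x - 3 * A x) * Real.exp (A x) ^ 3 = Real.exp (Δ x) ^ 4 := by
    rw [← Real.exp_nat_mul, ← Real.exp_nat_mul, ← Real.exp_add]; congr 1; push_cast; ring
  have e2 : Real.exp (-Δ x) * Real.exp (Δ x) = 1 := by
    rw [← Real.exp_add, ← Real.exp_zero]; congr 1; ring
  rw [h1] at e1
  have e3 : Real.exp (4 * Δ x - 3 * A x) * rad x ^ 3 = Real.exp (Δ x) := by
    have := (Real.exp_pos (Δ x)).ne'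
    have e4 : Real.exp (Δ x) ^ 3 * (Real.exp (4 * Δ x - 3 * A x) * rad x ^ 3)
        = Real.exp (Δ x) ^ 3 * Real.exp (Δ x) := by linear_combination e1
    exact mul_left_cancel₀ (pow_ne_zero 3 this) e4
  linear_combination (rad x ^ 3 * Real.exp (-Δ x) / 32) * h - ((α x).im * Real.exp (-Δ x)) * e3
    - (α x).im * e2

/-- `φ` is a constant multiple of `r² e^{-2Δ}`. -/
theorem phi_eq (x : Cone Y) :
    phi α A x = -(f₅ / 32) * (rad x ^ 2 * Real.exp (-2 * Δ x)) := by
  have h1 := hX.exp_A hA x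
  have e0 : Real.exp (-A x) * Real.exp (A x) = 1 := by
    rw [← Real.exp_add, ← Real.exp_zero]; congr 1; ring
  have e2 : Real.exp (-Δ x) * Real.exp (Δ x) = 1 := by
    rw [← Real.exp_add, ← Real.exp_zero]; congr 1; ring
  have e3 : Real.exp (-2 * Δ x) = Real.exp (-Δ x) ^ 2 := by
    rw [← Real.exp_nat_mul]; congr 1; push_cast; ring
  rw [h1] at e0
  rw [phi, hX.im_α_eq hA, e3]
  linear_combination (-(f₅ / 32) * rad x ^ 2 * Real.exp (-Δ x) ^ 2) * e0
    + (f₅ / 32 * rad x ^ 3 * Real.exp (-A x) * Real.exp (-Δ x)) * e2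

/-- The Cartan formula for `E ⌟ (φ ω)` with `E` the Euler field. -/
theorem polyD_euler_om (x : Cone Y) :
    polyD coneI (fun y => cl (euler y) (emb (phi α A y • om y))) x
      = ((2 * phi α A x : ℝ) : ℂ) • emb (om x) := by
  have h := lieP_real_smul (hX.smooth_phi x) (smoothGen_euler x)
    (smoothPAt_emb_iff.mpr (hX.smooth_om x))
  rw [(hX.lie_two x).2, hX.dphi_euler, smul_zero, add_zero, lieP_def] at h
  have h2 := hX.polyD_om x
  simp only [emb_smul] at h2 ⊢
  rwa [h2, map_zero, add_zero] at h

theorem smooth_sigma (x : Cone Y) :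
    SmoothFormAt coneI (fun y => oneForm (sigma Ωm (basicB b) y)) x := by
  have s : SmoothPAt coneI (fun y => (Real.exp (-2 * Δ y) : ℂ) • cl (euler y) (emb (om y))) x :=
    SmoothPAt.smul (contMDiffAt_ofReal (contMDiffAt_exp_mul (hX.smooth_Δ x) (-2)))
      (SmoothPAt.cl (smoothGen_euler x) (smoothPAt_emb_iff.mpr (hX.smooth_om x)))
  refine smoothPAt_emb_iff.mp ((smoothPAt_congr (Eventually.of_forall fun y => ?_)) s)
  rw [cl_euler_emb, ← emb_smul, hX.sigma_eq]
  rfl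

/-- `½ d(r² σ) = r² e^{-2Δ} ω`. -/
theorem coneOmega_eq [Nonempty Y] (x : Cone Y) :
    coneOmega (sigma Ωm (basicB b)) x = (rad x ^ 2 * Real.exp (-2 * Δ x)) • om x := by
  have hf : f₅ ≠ 0 := hX.f₅_ne
  have e : (fun y => emb (oneForm (rad y ^ 2 • sigma Ωm (basicB b) y)))
      = fun y => ((-(32 / f₅) : ℝ) : ℂ) • cl (euler y) (emb (phi α A y • om y)) := by
    funext y
    rw [cl_euler_emb (fun y => phi α A y • om y), ← emb_smul, hX.sigma_eq, contract_smul, hX.phi_eq hA]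
    congr 1
    have h : rad y ^ 2 • Real.exp (-2 * Δ y) • contract (euler y).1 (om y)
        = -(32 / f₅) • ((-(f₅ / 32) * (rad y ^ 2 * Real.exp (-2 * Δ y)))
          • contract (euler y).1 (om y)) := by
      rw [smul_smul, smul_smul]
      congr 1
      field_simp
    rw [h]
    rfl
  have s : SmoothPAt coneI (fun y => emb (oneForm (rad y ^ 2 • sigma Ωm (basicB b) y))) x := by
    have s1 : ContMDiffAt coneI 𝓘(ℝ, ℝ) ∞ (fun y : Cone Y => rad y ^ 2) x :=
      contMDiffAt_of_chart ((contDiffAt_chart (contMDiff_rad x)).pow 2)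
    exact smoothPAt_congr (Eventually.of_forall fun y =>
        (emb_smul (rad y ^ 2) (oneForm (sigma Ωm (basicB b) y))).symm)
      (SmoothPAt.smul (contMDiffAt_ofReal s1) (smoothPAt_emb_iff.mpr (hX.smooth_sigma hA x)))
  refine emb_injective ?_
  rw [coneOmega, emb_smul, ← polyD_emb (smoothPAt_emb_iff.mp s), e, polyD_const_smul',
    hX.polyD_euler_om hA, hX.phi_eq hA, emb_smul, smul_smul, smul_smul, ← Complex.ofReal_mul,
    ← Complex.ofReal_mul]
  congr 2
  field_simp

theorem om_eq [Nonempty Y] (x : Cone Y) :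
    om x = (Real.exp (2 * Δ x) / rad x ^ 2) • coneOmega (sigma Ωm (basicB b)) x := by
  have e : Real.exp (-2 * Δ x) * Real.exp (2 * Δ x) = 1 := by
    rw [← Real.exp_add, ← Real.exp_zero]; congr 1; ring
  have hr := (rad_pos x).ne'
  have e2 : Real.exp (2 * Δ x) / rad x ^ 2 * (rad x ^ 2 * Real.exp (-2 * Δ x)) = 1 := by
    rw [div_mul_eq_mul_div, div_eq_one_iff_eq (pow_ne_zero 2 hr)]
    linear_combination rad x ^ 2 * e
  rw [hX.coneOmega_eq hA, smul_smul, e2, one_smul]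

theorem isSymplectic [Nonempty Y] : IsSymplectic (coneOmega (sigma Ωm (basicB b))) := by
  have hf : f₅ ≠ 0 := hX.f₅_ne
  have e : ∀ y, emb (coneOmega (sigma Ωm (basicB b)) y)
      = ((-(32 / f₅) : ℝ) : ℂ) • emb (phi α A y • om y) := by
    intro y
    rw [hX.coneOmega_eq hA, ← emb_smul, smul_smul, hX.phi_eq hA]
    congr 2
    field_simp
  have s : ∀ x, SmoothPAt coneI (fun y => emb (coneOmega (sigma Ωm (basicB b)) y)) x := by
    intro x
    have s0 : SmoothPAt coneI (fun y => emb (phi α A y • om y)) x := by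
      simp only [emb_smul]
      exact SmoothPAt.smul (contMDiffAt_ofReal (hX.smooth_phi x))
        (smoothPAt_emb_iff.mpr (hX.smooth_om x))
    exact smoothPAt_congr (Eventually.of_forall fun y => (e y).symm) (s0.const_smul _)
  refine ⟨fun x => smoothPAt_emb_iff.mp (s x), fun x => emb_injective ?_, fun x v hv => ?_⟩
  · rw [← polyD_emb (smoothPAt_emb_iff.mp (s x))]
    simp only [e]
    rw [polyD_const_smul', hX.polyD_om, smul_zero, emb_zero]
  · rw [hX.coneOmega_eq hA, contract_smul] at hv
    have h1 := (smul_eq_zero.mp hv).resolve_left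
      (mul_ne_zero (pow_ne_zero 2 (rad_pos x).ne') (Real.exp_pos _).ne')
    exact (hX.typeZero x).injective (by rw [contractHom_apply, h1, map_zero])

/-- `½ dσ = e^{-2Δ} ω - d log r ∧ σ`. -/
theorem omegaT_eq [Nonempty Y] (x : Cone Y) : omegaT (sigma Ωm (basicB b)) x
    = Real.exp (-2 * Δ x) • om x - wedgeReal (dlogr x) (sigma Ωm (basicB b) x) := by
  have s1 : ContMDiffAt coneI 𝓘(ℝ, ℝ) ∞ (fun y : Cone Y => rad y ^ 2) x :=
    contMDiffAt_of_chart ((contDiffAt_chart (contMDiff_rad x)).pow 2)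
  have h1 := polyD_real_smul s1 (smoothPAt_emb_iff.mpr (hX.smooth_sigma hA x))
  have d1 : dFun coneI (fun y : Cone Y => rad y ^ 2) x = (2 * rad x ^ 2) • dlogr x := by
    have h := dFun_comp (contMDiff_rad x) (hasDerivAt_pow 2 (rad x))
    rw [h, dFun_rad, dlogr, smul_smul]
    congr 1
    have := (rad_pos x).ne'
    field_simp
    norm_num
  have h2 := congrArg emb (hX.coneOmega_eq hA x)
  have s2 : SmoothPAt coneI (fun y => emb (oneForm (rad y ^ 2 • sigma Ωm (basicB b) y))) x :=
    smoothPAt_congr (Eventually.of_forall fun y =>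
        (emb_smul (rad y ^ 2) (oneForm (sigma Ωm (basicB b) y))).symm)
      (SmoothPAt.smul (contMDiffAt_ofReal s1) (smoothPAt_emb_iff.mpr (hX.smooth_sigma hA x)))
  rw [coneOmega, emb_smul, ← polyD_emb (smoothPAt_emb_iff.mp s2)] at h2
  have e : (fun y => emb (oneForm (rad y ^ 2 • sigma Ωm (basicB b) y)))
      = fun y => ((rad y ^ 2 : ℝ) : ℂ) • emb (oneForm (sigma Ωm (basicB b) y)) := by
    funext y
    exact emb_smul (rad y ^ 2) (oneForm (sigma Ωm (basicB b) y))
  rw [e, h1, d1, cl_form_smul, emb_smul] at h2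
  refine emb_injective ?_
  have hr : ((rad x ^ 2 : ℝ) : ℂ) ≠ 0 := by exact_mod_cast pow_ne_zero 2 (rad_pos x).ne'
  have e3 : emb (Real.exp (-2 * Δ x) • om x - wedgeReal (dlogr x) (sigma Ωm (basicB b) x))
      = (Real.exp (-2 * Δ x) : ℂ) • emb (om x)
        + (-1 : ℂ) • cl (0, dlogr x) (emb (oneForm (sigma Ωm (basicB b) x))) := by
    rw [← emb_wedgeReal, sub_eq_add_neg, emb_add, emb_smul]
    congr 1
    have := emb_smul (-1) (wedgeReal (dlogr x) (sigma Ωm (basicB b) x))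
    simpa using this
  rw [omegaT, emb_smul, ← polyD_emb (hX.smooth_sigma hA x), e3]
  refine smul_right_injective _ hr ?_
  simp only []
  push_cast at h2 ⊢
  linear_combination (norm := module) h2

theorem omegaT_xi [Nonempty Y] (x : Cone Y) :
    contract (xi Ωm x).1 (omegaT (sigma Ωm (basicB b)) x) = 0 := by
  have e : Real.exp (-2 * Δ x) * Real.exp (2 * Δ x) = 1 := by
    rw [← Real.exp_add, ← Real.exp_zero]; congr 1; ring
  rw [hX.omegaT_eq hA, contract_sub, contract_smul, hX.xi_om, contract_wedgeReal, hX.dlogr_xi,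
    hX.sigma_xi]
  linear_combination (norm := module) -e • dlogr x

theorem omegaT_euler [Nonempty Y] (x : Cone Y) :
    contract (euler x).1 (omegaT (sigma Ωm (basicB b)) x) = 0 := by
  rw [hX.omegaT_eq hA, contract_sub, contract_smul, contract_wedgeReal, dlogr_euler,
    hX.sigma_euler, hX.sigma_eq]
  module

end IsConeStructure

end SymplecticCone

/-! ### Descent to the link and the contact structure -/

section Descent

open Filter

variable {Y : Type*} [TopologicalSpace Y] [ChartedSpace (EuclideanSpace ℝ (Fin 5)) Y]
  [IsManifold (𝓡 5) ∞ Y]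

/-- The point `(1, y)` of the cone. -/
def unitPoint (y : Y) : Cone Y := (⟨1, Set.mem_Ioi.mpr one_pos⟩, y)

theorem fderiv_apply_const {E F : Type*} [NormedAddCommGroup E] [NormedSpace ℝ E]
    [NormedAddCommGroup F] [NormedSpace ℝ F] {N : E → F →L[ℝ] ℝ} {z : E}
    (h : DifferentiableAt ℝ N z) (v : E) (w : F) :
    fderiv ℝ N z v w = fderiv ℝ (fun y => N y w) z v := by
  have h1 := ((ContinuousLinearMap.apply ℝ ℝ w).hasFDerivAt.comp z h.hasFDerivAt).fderiv
  exact (congrArg (fun L => L v) h1).symm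

theorem apply_radial {ν : E₆ →L[ℝ] ℝ} {r : ℝ} (hr : r ≠ 0) (h : ν (r, 0) = 0) (v : E₆) :
    ν v = ν (0, v.2) := by
  have e : v = (v.1 / r) • ((r, 0) : E₆) + (0, v.2) := by
    refine Prod.ext ?_ ?_
    · simp [hr]
    · simp
  conv_lhs => rw [e]
  rw [map_add, map_smul, h, smul_zero, zero_add]

/-- A one-form annihilated by the contractions of the Euler field with it and with its derivative
does not depend on the radius. -/
theorem radial_const {σ : Cone Y → E₆ →L[ℝ] ℝ}
    (hs : ∀ x, DifferentiableAt ℝ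
      (fun z => (σ ((extChartAt coneI x).symm z)).comp (chartL coneI x z)) (extChartAt coneI x x))
    (h0 : ∀ x, σ x (euler x).1 = 0)
    (h1 : ∀ x, contract (euler x).1 (extD coneI (fun y => oneForm (σ y)) x) = 0)
    (p q : posReals) (y : Y) : σ (p, y) = σ (q, y) := by
  refine ContinuousLinearMap.ext fun v => ?_
  rw [apply_radial (rad_pos (p, y)).ne' (h0 (p, y)), apply_radial (rad_pos (q, y)).ne' (h0 (q, y))]
  let P : ℝ → posReals := (extChartAt 𝓘(ℝ, ℝ) p).symm
  have hP : ∀ {s : ℝ} (h : 0 < s), P s = ⟨s, h⟩ := fun h => extChartAt_posReals_symm p h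
  let f : ℝ → ℝ := fun s => σ (P s, y) (0, v.2)
  have hd : ∀ s : ℝ, 0 < s → HasFDerivAt f (0 : ℝ →L[ℝ] ℝ) s := by
    intro s hs0
    let x : Cone Y := (⟨s, hs0⟩, y)
    set e := extChartAt (𝓡 5) y y with he
    have hx : extChartAt coneI x x = (s, e) := extChartAt_cone_self x
    let N : E₆ → E₆ →L[ℝ] ℝ :=
      fun z => (σ ((extChartAt coneI x).symm z)).comp (chartL coneI x z)
    have dN : DifferentiableAt ℝ N (s, e) := hx ▸ hs x
    -- contraction with the Euler field vanishes identically in the chart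
    have k1 : fderiv ℝ N (s, e) (0, v.2) (euler x).1 = 0 := by
      rw [fderiv_apply_const dN]
      have : (fun z => N z (euler x).1) =ᶠ[𝓝 (s, e)] fun _ => (0 : ℝ) := by
        have ht := eventually_target (I := coneI) x
        rw [hx] at ht
        filter_upwards [ht] with z hz
        have hz1 := (mem_extChartAt_cone_target.mp hz).1
        change σ _ (chartL coneI x z (rad x, 0)) = 0
        rw [chartL_cone hz, map_zero]
        have h2 := h0 ((extChartAt coneI x).symm z)
        rw [extChartAt_cone_symm x hz1] at h2 ⊢
        rw [apply_radial (r := z.1) hz1.ne' h2]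
        exact map_zero _
      rw [this.fderiv_eq]
      simp
    have k2 : fderiv ℝ N (s, e) (euler x).1 (0, v.2) = 0 := by
      have h3 := congrArg (fun L => L (0, v.2)) (h1 x)
      have h4 := contract_extD_oneForm (I := coneI) (hs x) (euler x).1 (0, v.2)
      rw [h4, hx] at h3
      have h5 : fderiv ℝ N (s, e) (euler x).1 (0, v.2) - fderiv ℝ N (s, e) (0, v.2) (euler x).1 = 0 :=
        h3
      rwa [k1, sub_zero] at h5
    have k3 : fderiv ℝ N (s, e) (1, 0) (0, v.2) = 0 := by
      have : (euler x).1 = s • ((1, 0) : E₆) := by simp [euler, rad, x]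
      rw [this, map_smul, smul_apply, smul_eq_mul] at k2
      exact (mul_eq_zero.mp k2).resolve_left hs0.ne'
    have hf : f =ᶠ[𝓝 s] fun t => N (t, e) (0, v.2) := by
      filter_upwards [Ioi_mem_nhds hs0] with t ht
      have hz : ((t, e) : E₆) ∈ (extChartAt coneI x).target :=
        mem_extChartAt_cone_target.mpr ⟨ht, mem_extChartAt_target y⟩
      change σ (P t, y) (0, v.2) = σ _ (chartL coneI x (t, e) (0, v.2))
      rw [chartL_cone hz, extChartAt_cone_symm x (z := (t, e)) ht, hP ht]
      have e1 : (extChartAt (𝓡 5) y).symm e = y := extChartAt_to_inv y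
      have e2 : chartL (𝓡 5) y e = ContinuousLinearMap.id ℝ E₅ := chartL_self (𝓡 5) y
      change _ = σ (⟨t, ht⟩, (extChartAt (𝓡 5) y).symm e) (0, chartL (𝓡 5) y e v.2)
      rw [e1, e2]
      rfl
    have h6 : HasFDerivAt (fun t : ℝ => ((t, e) : E₆)) (ContinuousLinearMap.inl ℝ ℝ E₅) s :=
      (hasFDerivAt_id s).prodMk (hasFDerivAt_const e s)
    have h7 := ((ContinuousLinearMap.apply ℝ ℝ ((0, v.2) : E₆)).hasFDerivAt.comp _
      dN.hasFDerivAt).comp s h6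
    refine (h7.congr_of_eventuallyEq hf).congr_fderiv ?_
    refine ContinuousLinearMap.ext fun t => ?_
    change fderiv ℝ N (s, e) (t, 0) (0, v.2) = 0
    have : ((t, 0) : E₆) = t • (1, 0) := by simp
    rw [this, map_smul, smul_apply, k3, smul_zero]
  have hc := (convex_Ioi (0 : ℝ)).is_const_of_fderivWithin_eq_zero (𝕜 := ℝ) (f := f)
    (fun w hw => (hd w hw).differentiableAt.differentiableWithinAt)
    (fun w hw => by rw [fderivWithin_of_isOpen isOpen_Ioi hw, (hd w hw).fderiv])
    (x := (p : ℝ)) (y := (q : ℝ)) p.2 q.2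
  simp only [f] at hc
  rwa [hP p.2, hP q.2] at hc

/-- Smooth fields on the cone restrict to smooth fields on the link. -/
theorem smoothGen_link {W : Cone Y → GenVec E₆} (y : Y) (h : SmoothGen coneI W (unitPoint y)) :
    SmoothGen (𝓡 5) (fun y => ((W (unitPoint y)).1.2,
      (W (unitPoint y)).2.comp (ContinuousLinearMap.inr ℝ ℝ E₅))) y := by
  let L : GenVec E₆ →L[ℝ] GenVec E₅ :=
    ((ContinuousLinearMap.snd ℝ ℝ E₅).comp (ContinuousLinearMap.fst ℝ _ _)).prod
      (((ContinuousLinearMap.compL ℝ E₅ E₆ ℝ).flip (ContinuousLinearMap.inr ℝ ℝ E₅)).comp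
        (ContinuousLinearMap.snd ℝ _ _))
  have h1 : ContDiffAt ℝ ∞ (fun e : E₅ => ((1, e) : E₆)) (extChartAt (𝓡 5) y y) :=
    (contDiff_const.prodMk contDiff_id).contDiffAt
  have h2 : ContDiffAt ℝ ∞ (chartG coneI W (unitPoint y)) (1, extChartAt (𝓡 5) y y) := by
    have := h
    rw [SmoothGen, extChartAt_cone_self] at this
    exact this
  have h3 := (L.contDiff.contDiffAt.comp _ h2).comp _ h1
  refine ContDiffAt.congr_of_eventuallyEq h3 ?_
  filter_upwards [extChartAt_target_mem_nhds (I := 𝓡 5) y] with e he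
  have hz : ((1, e) : E₆) ∈ (extChartAt coneI (unitPoint y)).target :=
    mem_extChartAt_cone_target.mpr ⟨one_pos, he⟩
  have e1 : (extChartAt coneI (unitPoint y)).symm (1, e) = unitPoint ((extChartAt (𝓡 5) y).symm e) :=
    extChartAt_cone_symm (unitPoint y) (z := (1, e)) one_pos
  refine Prod.ext ?_ (ContinuousLinearMap.ext fun v => ?_)
  · change chartA (𝓡 5) y e _ = (chartA coneI (unitPoint y) (1, e)
      (W ((extChartAt coneI (unitPoint y)).symm (1, e))).1).2
    rw [chartA_cone hz, e1]
    rfl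
  · change (W (unitPoint ((extChartAt (𝓡 5) y).symm e))).2 (0, chartL (𝓡 5) y e v)
      = (W ((extChartAt coneI (unitPoint y)).symm (1, e))).2 (chartL coneI (unitPoint y) (1, e) (0, v))
    rw [chartL_cone hz, e1]
    rfl

/-- The exterior derivative commutes with the pull-back of one-forms to the cone. -/
theorem extD_pullback {σ : Cone Y → E₆ →L[ℝ] ℝ} {τ : Y → E₅ →L[ℝ] ℝ}
    (hσ : ∀ x, σ x = (τ x.2).comp (ContinuousLinearMap.snd ℝ ℝ E₅)) (x : Cone Y)
    (h1 : DifferentiableAt ℝ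
      (fun z => (σ ((extChartAt coneI x).symm z)).comp (chartL coneI x z)) (extChartAt coneI x x))
    (h2 : DifferentiableAt ℝ (fun z => (τ ((extChartAt (𝓡 5) x.2).symm z)).comp (chartL (𝓡 5) x.2 z))
      (extChartAt (𝓡 5) x.2 x.2)) (v w : E₆) :
    contract v (extD coneI (fun y => oneForm (σ y)) x) w
      = contract v.2 (extD (𝓡 5) (fun y => oneForm (τ y)) x.2) w.2 := by
  rw [contract_extD_oneForm (I := coneI) h1, contract_extD_oneForm (I := 𝓡 5) h2]
  set N : E₆ → E₆ →L[ℝ] ℝ :=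
    fun z => (σ ((extChartAt coneI x).symm z)).comp (chartL coneI x z) with hN
  set T : E₅ → E₅ →L[ℝ] ℝ :=
    fun z => (τ ((extChartAt (𝓡 5) x.2).symm z)).comp (chartL (𝓡 5) x.2 z) with hT
  have key : ∀ v w : E₆, fderiv ℝ N (extChartAt coneI x x) v w
      = fderiv ℝ T (extChartAt (𝓡 5) x.2 x.2) v.2 w.2 := by
    intro v w
    rw [fderiv_apply_const h1, fderiv_apply_const h2]
    have e : (fun z => N z w) =ᶠ[𝓝 (extChartAt coneI x x)] fun z => T z.2 w.2 := by
      filter_upwards [eventually_target (I := coneI) x] with z hz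
      change σ _ (chartL coneI x z w) = τ _ (chartL (𝓡 5) x.2 z.2 w.2)
      rw [chartL_cone hz, extChartAt_cone_symm x (mem_extChartAt_cone_target.mp hz).1, hσ]
      rfl
    rw [e.fderiv_eq]
    have h3 : DifferentiableAt ℝ (fun z => T z w.2) (extChartAt coneI x x).2 := by
      rw [extChartAt_cone_self]
      exact h2.clm_apply (differentiableAt_const _)
    have h4 := (h3.hasFDerivAt.comp (extChartAt coneI x x) hasFDerivAt_snd).fderiv
    refine (congrArg (fun L => L v) h4).trans ?_
    rw [extChartAt_cone_self]
    rfl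
  exact congrArg₂ (· - ·) (key v w) (key w v)

variable {Ωm Ωp : Cone Y → Polyform E₆} {α : Cone Y → ℂ} {b om : Cone Y → Form E₆ ℝ 2}
  {A Δ : Cone Y → ℝ} {f₅ : ℝ}

namespace IsConeStructure

variable (hX : IsConeStructure Ωm Ωp α b om A Δ f₅) (hA : ∀ x, A x = Real.log (rad x) + Δ x)
include hX hA

theorem smooth_pair (x : Cone Y) :
    SmoothGen coneI (fun x => ((xi Ωm x).1, sigma Ωm (basicB b) x)) x :=
  smoothGen_iff.mpr ⟨(smoothGen_iff.mp (hX.smooth_xi x)).1, hX.smooth_sigma hA x⟩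

theorem diff_sigma (x : Cone Y) : DifferentiableAt ℝ
    (fun z => (sigma Ωm (basicB b) ((extChartAt coneI x).symm z)).comp (chartL coneI x z))
    (extChartAt coneI x x) :=
  (ContDiffAt.snd (hX.smooth_pair hA x)).differentiableAt (by simp)

theorem contract_dsigma [Nonempty Y] (x : Cone Y) (v : E₆) :
    contract v (extD coneI (fun y => oneForm (sigma Ωm (basicB b) y)) x)
      = (2 : ℝ) • contract v (omegaT (sigma Ωm (basicB b)) x) := by
  rw [omegaT, contract_smul, smul_smul]
  norm_num

/-- The one-form `σ` is the pull-back of a contact form on the link, whose Reeb field is the vector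
part of `ξ`. -/
theorem exists_contact [Nonempty Y] : ∃ (σY : Y → E₅ →L[ℝ] ℝ) (R : Y → E₅),
    IsContactWithReeb σY R ∧
      (∀ x, sigma Ωm (basicB b) x = (σY x.2).comp (ContinuousLinearMap.snd ℝ ℝ E₅)) ∧
      (∀ x, (xi Ωm x).1 = (0, R x.2)) := by
  set σ := sigma Ωm (basicB b) with hσ
  let τ : Y → E₅ →L[ℝ] ℝ := fun y => (σ (unitPoint y)).comp (ContinuousLinearMap.inr ℝ ℝ E₅)
  let R : Y → E₅ := fun y => (xi Ωm (unitPoint y)).1.2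
  have pull : ∀ x, σ x = (τ x.2).comp (ContinuousLinearMap.snd ℝ ℝ E₅) := by
    intro x
    have h1 : σ x = σ (unitPoint x.2) := radial_const (hX.diff_sigma hA) hX.sigma_euler
      (fun x => by rw [hX.contract_dsigma hA, hX.omegaT_euler hA, smul_zero]) x.1 _ x.2
    rw [h1]
    refine ContinuousLinearMap.ext fun v => ?_
    exact apply_radial (rad_pos (unitPoint x.2)).ne' (hX.sigma_euler (unitPoint x.2)) v
  have smooth : ∀ y, SmoothGen (𝓡 5) (fun y => (R y, τ y)) y := fun y =>
    smoothGen_link y (hX.smooth_pair hA (unitPoint y))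
  have diff : ∀ y : Y, DifferentiableAt ℝ
      (fun z => (τ ((extChartAt (𝓡 5) y).symm z)).comp (chartL (𝓡 5) y z)) (extChartAt (𝓡 5) y y) :=
    fun y => (ContDiffAt.snd (smooth y)).differentiableAt (by simp)
  have ext : ∀ (x : Cone Y) (v w : E₆), (2 : ℝ) * contract v (omegaT σ x) w
      = contract v.2 (extD (𝓡 5) (fun y => oneForm (τ y)) x.2) w.2 := by
    intro x v w
    rw [← extD_pullback pull x (hX.diff_sigma hA x) (diff x.2), hX.contract_dsigma hA]
    rfl
  have first : ∀ x, (xi Ωm x).1.1 = 0 := fun x =>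
    (mul_eq_zero.mp (hX.dlogr_xi x)).resolve_left (inv_ne_zero (rad_pos x).ne')
  have one : ∀ x, τ x.2 (xi Ωm x).1.2 = 1 := by
    intro x
    have h := hX.sigma_xi x
    rw [← hσ, pull x] at h
    exact h
  have ker : ∀ x : Cone Y, contract (xi Ωm x).1.2 (extD (𝓡 5) (fun y => oneForm (τ y)) x.2) = 0 := by
    intro x
    refine ContinuousLinearMap.ext fun w => ?_
    have h := ext x (xi Ωm x).1 (0, w)
    rw [hX.omegaT_xi hA] at h
    exact h.symm.trans (mul_zero 2)
  have nondeg : ∀ y v, τ y v = 0 → (∀ w, τ y w = 0 →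
      extD (𝓡 5) (fun y => oneForm (τ y)) y ![v, w] = 0) → v = 0 := by
    intro y v hv hw
    have h1 : contract ((0, v) : E₆) (omegaT σ (unitPoint y)) = 0 := by
      refine ContinuousLinearMap.ext fun W => ?_
      have h2 := ext (unitPoint y) (0, v) W
      -- every vector of the link is the sum of a multiple of the Reeb vector and a vector of `ker σ`
      have h3 := hw (W.2 - τ y W.2 • R y) (by
        have h0 : τ y (R y) = 1 := one (unitPoint y)
        rw [map_sub, map_smul, h0, smul_eq_mul, mul_one, sub_self])
      rw [← contract_apply, map_sub, map_smul, contract_skew _ v (R y)] at h3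
      have h4 := congrArg (fun L => L v) (ker (unitPoint y))
      have h5 : contract (R y) (extD (𝓡 5) (fun y => oneForm (τ y)) y) v = 0 := h4
      rw [h5, neg_zero, smul_zero, sub_zero] at h3
      have h6 : (2 : ℝ) * contract ((0, v) : E₆) (omegaT σ (unitPoint y)) W = 0 := h2.trans h3
      exact (mul_eq_zero.mp h6).resolve_left two_ne_zero
    have h7 : σ (unitPoint y) (0, v) = 0 := hv
    have h8 : dlogr (unitPoint y) ((0, v) : E₆) = 0 := by simp [dlogr]
    rw [hσ, hX.omegaT_eq hA, contract_sub, contract_smul, contract_wedgeReal, ← hσ, h7, h8, zero_smul,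
      zero_smul, sub_zero, sub_zero] at h1
    have h9 := (smul_eq_zero.mp h1).resolve_left (Real.exp_pos _).ne'
    have h10 := (hX.typeZero (unitPoint y)).injective (a₁ := (0, v)) (a₂ := 0)
      (by rw [contractHom_apply, h9, map_zero])
    exact congrArg Prod.snd h10
  refine ⟨τ, R, ⟨fun y => (smoothGen_iff.mp (smooth y)).2, fun y => (smoothGen_iff.mp (smooth y)).1,
    nondeg, fun y => one (unitPoint y), fun y => ker (unitPoint y)⟩, pull, fun x => ?_⟩
  refine Prod.ext (first x) (sub_eq_zero.mp (nondeg x.2 _ ?_ fun w _ => ?_))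
  · rw [map_sub, one x]
    exact sub_eq_zero.mpr (one (unitPoint x.2)).symm
  · rw [← contract_apply]
    have h1 := ker x
    have h2 := ker (unitPoint x.2)
    have h3 : contractHom (extD (𝓡 5) (fun y => oneForm (τ y)) x.2) ((xi Ωm x).1.2 - R x.2) = 0 := by
      rw [map_sub, contractHom_apply, contractHom_apply, h1]
      exact (congrArg (fun L => 0 - L) h2).trans (sub_zero 0)
    exact congrArg (fun L => L w) h3

end IsConeStructure

end Descent

/-! ### Generalized Darboux coordinates -/

section Darboux

open Filter

variable {Y : Type*} [TopologicalSpace Y] [ChartedSpace (EuclideanSpace ℝ (Fin 5)) Y]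
  [IsManifold (𝓡 5) ∞ Y]

variable {Ωm Ωp : Cone Y → Polyform E₆} {α : Cone Y → ℂ} {b om : Cone Y → Form E₆ ℝ 2}
  {A Δ : Cone Y → ℝ} {f₅ : ℝ}
  {U : Set (Cone Y)} {z : Cone Y → ℂ} {p q : Fin 2 → Cone Y → ℝ} {b₀ : Cone Y → Form E₆ ℝ 2}
  {h ψ : Cone Y → ℝ} {Hh : Cone Y → E₆} {x : Cone Y}

namespace IsDarbouxFrame

variable (hD : IsDarbouxFrame Ωm U z p q b₀ h ψ Hh) (hx : x ∈ U)
include hD hx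

theorem smoothAt_h : ContMDiffAt coneI 𝓘(ℝ, ℝ) ∞ h x :=
  (hD.smooth_h x hx).contMDiffAt (hD.isOpen.mem_nhds hx)

theorem smoothAt_ψ : ContMDiffAt coneI 𝓘(ℝ, ℝ) ∞ ψ x :=
  (hD.smooth_ψ x hx).contMDiffAt (hD.isOpen.mem_nhds hx)

theorem z_eq_exp : z x = Complex.exp
    (3 * (((Real.log (rad x) + h x : ℝ) : ℂ) + Complex.I * (ψ x : ℂ))) := by
  have e : (rad x : ℂ) ^ 3 = Complex.exp (3 * (Real.log (rad x) : ℂ)) := by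
    rw [show (3 : ℂ) = (3 : ℕ) by norm_num, Complex.exp_nat_mul, ← Complex.ofReal_exp,
      Real.exp_log (rad_pos x)]
  rw [hD.z_eq x hx, e, Complex.ofReal_exp, ← Complex.exp_add, ← Complex.exp_add]
  congr 1
  push_cast
  ring

theorem z_ne_zero : z x ≠ 0 := by
  rw [hD.z_eq_exp hx]
  exact Complex.exp_ne_zero _

/-- `dz = 3 z (d log r + dh + i dψ)`. -/
theorem dz_eq (v : E₆) : dFun coneI z x v = 3 * z x *
    (((dlogr x + dFun coneI h x) v : ℝ) + Complex.I * (dFun coneI ψ x v : ℝ)) := by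
  have hl := ((contDiffAt_chart (contMDiff_log_rad x)).differentiableAt (by simp)).hasFDerivAt
  have hh := ((contDiffAt_chart (hD.smoothAt_h hx)).differentiableAt (by simp)).hasFDerivAt
  have hψ := ((contDiffAt_chart (hD.smoothAt_ψ hx)).differentiableAt (by simp)).hasFDerivAt
  have h1 := Complex.ofRealCLM.hasFDerivAt.comp (extChartAt coneI x x) (hl.add hh)
  have h2 := Complex.ofRealCLM.hasFDerivAt.comp (extChartAt coneI x x) hψ
  have h3 := ((h1.add (h2.const_mul Complex.I)).const_mul 3).cexp
  have hc := (continuousAt_extChartAt_symm (I := coneI) x).preimage_mem_nhds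
    (by rw [extChartAt_to_inv]; exact hD.isOpen.mem_nhds hx)
  have h4 : HasFDerivAt (fun y => z ((extChartAt coneI x).symm y)) _ (extChartAt coneI x x) :=
    h3.congr_of_eventuallyEq (by filter_upwards [hc] with y hy using hD.z_eq_exp hy)
  simp only [Pi.add_apply, Function.comp_apply, extChartAt_to_inv] at h4
  rw [dFun_eq, h4.fderiv, ← dFun_eq h, ← dFun_eq ψ, ← dFun_eq (fun x => Real.log (rad x)),
    dFun_log_rad, hD.z_eq_exp hx]
  simp
  ring

theorem minus_exp : Ωm x =
    wedOp ((Complex.conjCLE : ℂ →L[ℝ] ℂ).comp (dFun coneI z x))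
      (expP (b₀ x) (omegaZero p q x)) := by
  rw [hD.minus_eq x hx, expWedge_eq]
  rfl

end IsDarbouxFrame

namespace IsConeStructure

variable (hX : IsConeStructure Ωm Ωp α b om A Δ f₅)
  (hD : IsDarbouxFrame Ωm U z p q b₀ h ψ Hh) (hx : x ∈ U)
include hX hD hx

/-- `J₋(d log r + dh) = dψ`, since `dz̄` is proportional to `d log r + dh - i dψ` and annihilates
`Ω₋`. -/
theorem minus_dlogr_add_dh : genStruct (Ωm x) (0, dlogr x + dFun coneI h x)
    = (0, dFun coneI ψ x) := by
  have e : (Complex.conjCLE : ℂ →L[ℝ] ℂ).comp (dFun coneI z x)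
      = (3 * (starRingEnd ℂ) (z x)) • (Complex.ofRealCLM.comp (dlogr x + dFun coneI h x)
        + Complex.I • Complex.ofRealCLM.comp (-dFun coneI ψ x)) := by
    refine ContinuousLinearMap.ext fun v => ?_
    change (starRingEnd ℂ) (dFun coneI z x v) = _
    have h3 : (starRingEnd ℂ) 3 = 3 := map_ofNat _ 3
    rw [hD.dz_eq hx]
    simp [h3]
    ring
  have h1 : wedOp ((Complex.conjCLE : ℂ →L[ℝ] ℂ).comp (dFun coneI z x)) (Ωm x) = 0 := by
    rw [hD.minus_exp hx, ← Module.End.mul_apply, wed_wed, LinearMap.zero_apply]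
  rw [e, map_smul, LinearMap.smul_apply, map_add, map_smul, LinearMap.add_apply,
    LinearMap.smul_apply, ← cl_form, ← cl_form] at h1
  have hz : 3 * (starRingEnd ℂ) (z x) ≠ 0 :=
    mul_ne_zero three_ne_zero ((map_ne_zero _).mpr (hD.z_ne_zero hx))
  have h2 := ((hX.assoc_m x).cl_iff _ _).mp ((smul_eq_zero.mp h1).resolve_left hz)
  rw [← neg_eq_iff_eq_neg] at h2
  rw [← h2]
  simp

/-- `J₋(dh) = H + H ⌟ b₀` for the Hamiltonian vector field `H` of `h`. -/
theorem minus_dh : genStruct (Ωm x) (0, dFun coneI h x) = (Hh x, contract (Hh x) (b₀ x)) := by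
  set W : GenVec E₆ := (Hh x, contract (Hh x) (b₀ x)) with hW
  set μ := (Complex.conjCLE : ℂ →L[ℝ] ℂ).comp (dFun coneI z x) with hμ
  have hμH : μ (Hh x) = 0 := by
    change (starRingEnd ℂ) (dFun coneI z x (Hh x)) = 0
    rw [hD.ham_tangent x hx, map_zero]
  have anti : ∀ Φ, cl W (wedOp μ Φ) = -wedOp μ (cl W Φ) := by
    intro Φ
    have h1 := int_wed' (Hh x) μ Φ
    have h2 := congrArg (fun L => L Φ) (wed_anticomm (Complex.ofRealCLM.comp W.2) μ)
    simp only [LinearMap.smul_apply, Module.End.mul_apply] at h2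
    rw [hμH, zero_smul] at h1
    rw [cl_eq, LinearMap.add_apply, LinearMap.add_apply, map_add, h1, h2]
    module
  have h3 : cl W (Ωm x) + Complex.I • cl ((0, dFun coneI h x) : GenVec E₆) (Ωm x) = 0 := by
    have h4 := congrArg (fun L => L (expP (b₀ x) (omegaZero p q x)))
      (wed_anticomm (Complex.ofRealCLM.comp (dFun coneI h x)) μ)
    simp only [LinearMap.smul_apply, Module.End.mul_apply] at h4
    rw [hD.minus_exp hx, anti, cl_expP, hD.ham_eq x hx, cl_form, cl_form, h4,
      ContinuousLinearMap.comp_neg, map_neg, LinearMap.neg_apply, map_smul, map_neg]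
    module
  have h5 := ((hX.assoc_m x).cl_iff _ _).mp h3
  rw [h5, map_neg, (hX.assoc_m x).1, neg_neg]

/-- `η = dψ - H - H ⌟ b₀`. -/
theorem eta_darboux : eta Ωm x
    = (-Hh x, dFun coneI ψ x - contract (Hh x) (b₀ x)) := by
  have e : ((0, dlogr x) : GenVec E₆)
      = (0, dlogr x + dFun coneI h x) - (0, dFun coneI h x) := by simp
  rw [eta, e, map_sub, hX.minus_dlogr_add_dh hD hx, hX.minus_dh hD hx, Prod.mk_sub_mk, zero_sub]

theorem sigma_darboux (b₂ : Cone Y → Form E₆ ℝ 2) :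
    sigma Ωm b₂ x = dFun coneI ψ x + contract (Hh x) (b₂ x - b₀ x) := by
  have hn : contract (-Hh x) (b₂ x) = -contract (Hh x) (b₂ x) :=
    map_neg (contractHom (b₂ x)) (Hh x)
  rw [sigma, hX.eta_darboux hD hx, hn, contract_sub]
  have e : ∀ ν β γ : E₆ →L[ℝ] ℝ, ν - β - -γ = ν + (γ - β) := fun ν β γ => by abel
  exact e _ _ _

theorem b_darboux [Nonempty Y] (hA : ∀ x, A x = Real.log (rad x) + Δ x) :
    b x - b₀ x = -(Real.exp (4 * Δ x) •
      wedgeReal (dlogr x) (contract (Hh x) (omegaT (sigma Ωm (basicB b)) x)))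
      + (basicB b x - b₀ x) := by
  have hη := congrArg Prod.fst (hX.eta_darboux hD hx)
  have hH : dlogr x (Hh x) = 0 := by
    have h1 := hX.dlogr_eta x
    rw [hη, map_neg] at h1
    exact neg_eq_zero.mp h1
  have hn : contract (-Hh x) (om x) = -contract (Hh x) (om x) := map_neg (contractHom (om x)) (Hh x)
  have hb := hX.b_eq x
  rw [hη, hn] at hb
  have e : Real.exp (4 * Δ x) * Real.exp (-2 * Δ x) = Real.exp (2 * Δ x) := by
    rw [← Real.exp_add]; congr 1; ring
  have h2 : Real.exp (2 * Δ x) • wedgeReal (dlogr x) (-contract (Hh x) (om x))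
      = -(Real.exp (4 * Δ x) •
        wedgeReal (dlogr x) (contract (Hh x) (omegaT (sigma Ωm (basicB b)) x))) := by
    rw [hX.omegaT_eq hA, contract_sub, contract_smul, contract_wedgeReal, hH]
    ext v
    rw [vec_eq_cons v]
    simp only [ContinuousAlternatingMap.smul_apply, ContinuousAlternatingMap.neg_apply,
      wedgeReal_apply, smul_eq_mul, neg_apply, sub_apply, smul_apply]
    linear_combination (dlogr x (v 0) * contract (Hh x) (om x) (v 1)
      - dlogr x (v 1) * contract (Hh x) (om x) (v 0)) * e
  rw [hb, h2]
  abel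

end IsConeStructure

end Darboux

end GenGeom

end

theorem mainTheorem3 {Y : Type*} [TopologicalSpace Y]
    [ChartedSpace (EuclideanSpace ℝ (Fin 5)) Y] [IsManifold (𝓡 5) ∞ Y]
    [CompactSpace Y] [T2Space Y] [ConnectedSpace Y]
    (Ωm Ωp : Cone Y → Polyform E₆) (α : Cone Y → ℂ) (b om : Cone Y → Form E₆ ℝ 2)
    (A₀ Δ : Cone Y → ℝ) (f₀ : ℝ)
    (hX : IsConeStructure Ωm Ωp α b om A₀ Δ f₀) :
    -- the normalisation of `A` by an additive constant, under which `F` and `f₅` are rescaled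
    ∃ (c f₅ : ℝ) (A : Cone Y → ℝ), (∀ x, A x = A₀ x + c) ∧ f₅ = Real.exp (-3 * c) * f₀ ∧
      IsConeStructure Ωm Ωp α b om A Δ f₅ ∧
      -- a)
      (∀ x, Real.exp (A x) = rad x * Real.exp (Δ x)) ∧
      -- b)
      Preserves coneI (xi Ωm) (metricG Ωm Ωp) ∧
      (∀ x, lieP coneI (xi Ωm) (twistedFlux Ωm Ωp A) x = 0) ∧
      -- c) and d)
      f₅ ≠ 0 ∧
      ∃ b₂ : Cone Y → Form E₆ ℝ 2,
        (∀ x, SmoothFormAt coneI b₂ x) ∧ (∀ x, extD coneI b₂ x = 0) ∧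
        IsSymplectic (coneOmega (sigma Ωm b₂)) ∧
        (∃ (σY : Y → E₅ →L[ℝ] ℝ) (R : Y → E₅), IsContactWithReeb σY R ∧
          (∀ x, sigma Ωm b₂ x = (σY x.2).comp (ContinuousLinearMap.snd ℝ ℝ E₅)) ∧
          (∀ x, (xi Ωm x).1 = (0, R x.2))) ∧
        (∀ x, α x = -Complex.I * (f₅ / 32 : ℝ) * (rad x ^ 3 * Real.exp (-Δ x) : ℝ)) ∧
        (∀ x, om x = (Real.exp (2 * Δ x) / rad x ^ 2) • coneOmega (sigma Ωm b₂) x) ∧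
        (∀ x, b x = Real.exp (2 * Δ x) • wedgeReal (dlogr x) (contract (eta Ωm x).1 (om x))
          + b₂ x) ∧
        -- the expressions in generalized Darboux coordinates for `Ω₋`; after the closed
        -- `B`-transform by `b₀` the forms `b₊` and `b₂` become `b₊ - b₀` and `b₂ - b₀`
        ∀ (U : Set (Cone Y)) (z : Cone Y → ℂ) (p q : Fin 2 → Cone Y → ℝ)
          (b₀ : Cone Y → Form E₆ ℝ 2) (h ψ : Cone Y → ℝ) (Hh : Cone Y → E₆),
          IsDarbouxFrame Ωm U z p q b₀ h ψ Hh → ∀ x ∈ U,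
            sigma Ωm b₂ x = dFun coneI ψ x + contract (Hh x) (b₂ x - b₀ x) ∧
            b x - b₀ x = -(Real.exp (4 * Δ x) •
              wedgeReal (dlogr x) (contract (Hh x) (omegaT (sigma Ωm b₂) x))) + (b₂ x - b₀ x) := by
  obtain ⟨c, hc⟩ := hX.exists_shift
  have hS := hX.shift c
  refine ⟨c, Real.exp (-3 * c) * f₀, fun x => A₀ x + c, fun _ => rfl, rfl, hS, hS.exp_A hc,
    hS.preserves_metric hc, hS.lie_xi_flux hc, hS.f₅_ne, basicB b,
    fun x => (hS.smooth_closed_basicB x).1, fun x => (hS.smooth_closed_basicB x).2,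
    hS.isSymplectic hc, hS.exists_contact hc, fun x => ?_, hS.om_eq hc, hS.b_eq, ?_⟩
  · rw [hS.α_eq x, hS.im_α_eq hc x]
    push_cast
    ring
  · intro U z p q b₀ h ψ Hh hD x hx
    exact ⟨hS.sigma_darboux hD hx (basicB b), hS.b_darboux hD hx hc⟩
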